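/- Let $G=(V,E,w)$ be an undirected graph with edge weights $w:E\to\mathbb{R}_{\ge 0}$ and let $r\in V$ be a root. For a set of terminals $X\subseteq V$, a *Steiner tree* for $X$ is a minimal subgraph of $G$ that connects the vertices of $X$ to $r$ (that is, a minimal connected subgraph containing $X\cup\{r\}$), and $\mathrm{Opt}(X)$ is the minimum cost of a Steiner tree for $X$, where the cost $\mathrm{cost}(H)$ of a subgraph $H$ is the sum of the weights of its edges. For a spanning tree $T$ of $G$, let $T_X$ be the minimal subtree of $T$ that contains $X\cup\{r\}$. The *stretch* of $T$ is $$\max_{X\subseteq V}\ \frac{\mathrm{cost}(T_X)}{\mathrm{Opt}(X)},$$ with the conventions $0/0=0$ and $c/0=\infty$ for $c>0$. There are an absolute constant $C$ and a polynomial-time algorithm that, given any connected undirected weighted graph $G$ on $n$ vertices and any root $r$, outputs a spanning tree of $G$ of stretch at most $2^{C\sqrt{\log_2 n}}$. Here a polynomial-time algorithm is a single program for a random access machine which halts on every input on $n$ vertices after at most $p(n)$ steps, for a fixed polynomial $p$. The program can copy, add, subtract (with truncation at $0$) and compare natural numbers and use them as addresses; the weights are real numbers that it can only copy, add and compare. Each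 such operation takes one step. Input and output graphs are given by adjacency matrices, together with the matrix of edge weights and the root for the input. -/

import Mathlib

open scoped NNReal ENNReal

namespace UST

/-! ### Steiner trees, spanning trees and stretch -/

section Steiner

variable {V : Type*}

/-- A Steiner tree for the terminal set `X` and the root `r`: a minimal subgraph of `G` that
connects the vertices of `X` to `r`. -/
def IsSteinerTree (G : SimpleGraph V) (r : V) (X : Set V) (H : G.Subgraph) : Prop :=
  Minimal (fun K : G.Subgraph => K.Connected ∧ r ∈ K.verts ∧ X ⊆ K.verts) H

open Classical in
/-- The cost of a subgraph: the sum of the weights of its edges. -/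
noncomputable def cost [Fintype V] {G : SimpleGraph V} (w : Sym2 V → ℝ≥0) (H : G.Subgraph) :
    ℝ≥0 :=
  ∑ e : Sym2 V with e ∈ H.edgeSet, w e

/-- The minimum cost of a Steiner tree connecting `X` to `r` in `G`
(it is `∞` if `G` has no such tree, which does not happen in a connected graph). -/
noncomputable def opt [Fintype V] (G : SimpleGraph V) (w : Sym2 V → ℝ≥0) (r : V) (X : Set V) :
    ℝ≥0∞ :=
  ⨅ (H : G.Subgraph) (_ : IsSteinerTree G r X H), (cost w H : ℝ≥0∞)

/-- `T` is a spanning tree of `G`. -/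
def IsSpanningTree (G T : SimpleGraph V) : Prop :=
  T ≤ G ∧ T.IsTree

/-- The stretch of a spanning tree `T` of `G`: the maximum over all `X` of the cost of the minimal
subtree `S` of `T` that contains `X` and the root (in a tree, `S` is unique), divided by the cost of
an optimal Steiner tree of `G`. In `ℝ≥0∞` we have `0 / 0 = 0` and `c / 0 = ∞` for `c > 0`, so
terminal sets with `0 / 0` (such as `X = {r}`) are ignored. -/
noncomputable def stretch [Fintype V] (G : SimpleGraph V) (w : Sym2 V → ℝ≥0) (r : V)
    (T : SimpleGraph V) : ℝ≥0∞ :=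
  ⨆ (X : Set V) (S : T.Subgraph) (_ : IsSteinerTree T r X S), (cost w S : ℝ≥0∞) / opt G w r X

end Steiner

/-! ### The machine model

Programs for a random access machine with two kinds of memory: natural numbers (which can be added,
subtracted with truncation, compared, and used as addresses) and nonnegative real weights (which can
only be copied, added and compared). There is no multiplication, and the only weight constant is
`0`. The number of steps is the number of elementary operations executed. -/

/-- Memory contents: scalar registers and two-dimensional arrays (named by natural numbers) of
natural numbers and of weights. -/
structure State where
  natReg : ℕ → ℕ
  natArr : ℕ → ℕ → ℕ → ℕ
  wtReg : ℕ → ℝ≥0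
  wtArr : ℕ → ℕ → ℕ → ℝ≥0

/-- Expressions with natural number values. -/
inductive NExpr where
  /-- a constant -/
  | const (k : ℕ)
  /-- the contents of register `x` -/
  | reg (x : ℕ)
  /-- entry `(i, j)` of array `a` -/
  | arr (a : ℕ) (i j : NExpr)
  | add (e₁ e₂ : NExpr)
  | sub (e₁ e₂ : NExpr)

/-- Expressions with weight values. -/
inductive WExpr where
  | zero
  /-- the contents of register `x` -/
  | reg (x : ℕ)
  /-- entry `(i, j)` of array `a` -/
  | arr (a : ℕ) (i j : NExpr)
  | add (e₁ e₂ : WExpr)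

/-- Tests. -/
inductive Test where
  | natLE (e₁ e₂ : NExpr)
  | wtLE (e₁ e₂ : WExpr)
  | not (b : Test)
  | and (b₁ b₂ : Test)

/-- Programs. -/
inductive Program where
  | skip
  | setNat (x : ℕ) (e : NExpr)
  | setWt (x : ℕ) (e : WExpr)
  | storeNat (a : ℕ) (i j e : NExpr)
  | storeWt (a : ℕ) (i j : NExpr) (e : WExpr)
  | seq (P Q : Program)
  | ite (b : Test) (P Q : Program)
  | while (b : Test) (P : Program)

def NExpr.eval (σ : State) : NExpr → ℕ
  | .const k => k
  | .reg x => σ.natReg x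
  | .arr a i j => σ.natArr a (i.eval σ) (j.eval σ)
  | .add e₁ e₂ => e₁.eval σ + e₂.eval σ
  | .sub e₁ e₂ => e₁.eval σ - e₂.eval σ

/-- The number of steps that the evaluation takes. -/
def NExpr.steps : NExpr → ℕ
  | .const _ => 1
  | .reg _ => 1
  | .arr _ i j => i.steps + j.steps + 1
  | .add e₁ e₂ => e₁.steps + e₂.steps + 1
  | .sub e₁ e₂ => e₁.steps + e₂.steps + 1

noncomputable def WExpr.eval (σ : State) : WExpr → ℝ≥0
  | .zero => 0
  | .reg x => σ.wtReg x
  | .arr a i j => σ.wtArr a (i.eval σ) (j.eval σ)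
  | .add e₁ e₂ => e₁.eval σ + e₂.eval σ

/-- The number of steps that the evaluation takes. -/
def WExpr.steps : WExpr → ℕ
  | .zero => 1
  | .reg _ => 1
  | .arr _ i j => i.steps + j.steps + 1
  | .add e₁ e₂ => e₁.steps + e₂.steps + 1

/-- The test succeeds in the state `σ`. -/
def Test.Holds (σ : State) : Test → Prop
  | .natLE e₁ e₂ => e₁.eval σ ≤ e₂.eval σ
  | .wtLE e₁ e₂ => e₁.eval σ ≤ e₂.eval σ
  | .not b => ¬ b.Holds σ
  | .and b₁ b₂ => b₁.Holds σ ∧ b₂.Holds σ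

/-- The number of steps that the test takes. -/
def Test.steps : Test → ℕ
  | .natLE e₁ e₂ => e₁.steps + e₂.steps + 1
  | .wtLE e₁ e₂ => e₁.steps + e₂.steps + 1
  | .not b => b.steps + 1
  | .and b₁ b₂ => b₁.steps + b₂.steps + 1

/-- Replace entry `(i, j)` of array `a` by `v`. -/
def updateArr {α : Type*} (A : ℕ → ℕ → ℕ → α) (a i j : ℕ) (v : α) : ℕ → ℕ → ℕ → α :=
  Function.update A a (Function.update (A a) i (Function.update (A a i) j v))

/-- `Runs P σ t τ`: started in the state `σ`, the program `P` halts after exactly `t` steps in the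
state `τ`. -/
inductive Runs : Program → State → ℕ → State → Prop
  | skip (σ : State) : Runs .skip σ 1 σ
  | setNat (σ : State) (x : ℕ) (e : NExpr) :
      Runs (.setNat x e) σ (e.steps + 1)
        { σ with natReg := Function.update σ.natReg x (e.eval σ) }
  | setWt (σ : State) (x : ℕ) (e : WExpr) :
      Runs (.setWt x e) σ (e.steps + 1)
        { σ with wtReg := Function.update σ.wtReg x (e.eval σ) }
  | storeNat (σ : State) (a : ℕ) (i j e : NExpr) :
      Runs (.storeNat a i j e) σ (i.steps + j.steps + e.steps + 1)
        { σ with natArr := updateArr σ.natArr a (i.eval σ) (j.eval σ) (e.eval σ) }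
  | storeWt (σ : State) (a : ℕ) (i j : NExpr) (e : WExpr) :
      Runs (.storeWt a i j e) σ (i.steps + j.steps + e.steps + 1)
        { σ with wtArr := updateArr σ.wtArr a (i.eval σ) (j.eval σ) (e.eval σ) }
  | seq {P Q : Program} {σ τ υ : State} {s t : ℕ} :
      Runs P σ s τ → Runs Q τ t υ → Runs (.seq P Q) σ (s + t) υ
  | ite_true {b : Test} {P Q : Program} {σ τ : State} {t : ℕ} :
      b.Holds σ → Runs P σ t τ → Runs (.ite b P Q) σ (b.steps + t) τ
  | ite_false {b : Test} {P Q : Program} {σ τ : State} {t : ℕ} :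
      ¬ b.Holds σ → Runs Q σ t τ → Runs (.ite b P Q) σ (b.steps + t) τ
  | while_true {b : Test} {P : Program} {σ τ υ : State} {s t : ℕ} :
      b.Holds σ → Runs P σ s τ → Runs (.while b P) τ t υ →
        Runs (.while b P) σ (b.steps + s + t) υ
  | while_false {b : Test} {P : Program} {σ : State} :
      ¬ b.Holds σ → Runs (.while b P) σ b.steps σ

/-- Programs are deterministic: the final state and the number of steps are determined by the
program and the initial state. -/
theorem Runs.deterministic {P : Program} {σ τ τ' : State} {t t' : ℕ}
    (h : Runs P σ t τ) (h' : Runs P σ t' τ') : t = t' ∧ τ = τ' := by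
  induction h generalizing t' τ' with
  | skip => cases h'; exact ⟨rfl, rfl⟩
  | setNat => cases h'; exact ⟨rfl, rfl⟩
  | setWt => cases h'; exact ⟨rfl, rfl⟩
  | storeNat => cases h'; exact ⟨rfl, rfl⟩
  | storeWt => cases h'; exact ⟨rfl, rfl⟩
  | seq _ _ ih₁ ih₂ =>
    cases h' with
    | seq g₁ g₂ =>
      obtain ⟨rfl, rfl⟩ := ih₁ g₁
      obtain ⟨rfl, rfl⟩ := ih₂ g₂
      exact ⟨rfl, rfl⟩
  | ite_true hb _ ih =>
    cases h' with
    | ite_true _ g => obtain ⟨rfl, rfl⟩ := ih g; exact ⟨rfl, rfl⟩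
    | ite_false hn _ => exact absurd hb hn
  | ite_false hb _ ih =>
    cases h' with
    | ite_true hn _ => exact absurd hn hb
    | ite_false _ g => obtain ⟨rfl, rfl⟩ := ih g; exact ⟨rfl, rfl⟩
  | while_true hb _ _ ih₁ ih₂ =>
    cases h' with
    | while_true _ g₁ g₂ =>
      obtain ⟨rfl, rfl⟩ := ih₁ g₁
      obtain ⟨rfl, rfl⟩ := ih₂ g₂
      exact ⟨rfl, rfl⟩
    | while_false hn => exact absurd hb hn
  | while_false hb =>
    cases h' with
    | while_true hn _ _ => exact absurd hn hb
    | while_false _ => exact ⟨rfl, rfl⟩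

open Classical in
/-- The initial memory for a weighted graph on `n` vertices with root `r`: register `0` holds `n`,
register `1` holds `r`, and the arrays `0` hold the adjacency matrix and the matrix of edge weights;
all other cells are zero. -/
noncomputable def input {n : ℕ} (G : SimpleGraph (Fin n)) (w : Sym2 (Fin n) → ℝ≥0) (r : Fin n) :
    State where
  natReg x := if x = 0 then n else if x = 1 then r else 0
  natArr a i j :=
    if a = 0 ∧ ∃ u v : Fin n, (u : ℕ) = i ∧ (v : ℕ) = j ∧ G.Adj u v then 1 else 0
  wtReg _ := 0
  wtArr a i j :=
    if h : i < n ∧ j < n then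
      if a = 0 ∧ G.Adj ⟨i, h.1⟩ ⟨j, h.2⟩ then w s(⟨i, h.1⟩, ⟨j, h.2⟩) else 0
    else 0

/-- The final memory `σ` represents the graph `T` on `n` vertices: the array `1` of natural numbers
holds the adjacency matrix of `T`. -/
def Outputs {n : ℕ} (σ : State) (T : SimpleGraph (Fin n)) : Prop :=
  ∀ u v : Fin n, σ.natArr 1 u v ≠ 0 ↔ T.Adj u v

end UST

/-! The tree is built along a hierarchy of nested partitions (`Levels`). The classes of level `i`
have strong diameter at most `Δ i`, a ball of radius `ρ (i + 1)` meets at most `β` of them, such a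
ball about the root stays in the class of the root, and `ρ` grows by a factor of at least `g` per
level. Level `0` consists of single vertices; the top level is one class.

Lower bound. If the terminals occupy `k` classes of level `i` besides that of the root, then a
maximal `ρ (i + 1)`-separated set of those terminals has at least `k / β` points, and a connected
graph through separated points is costly (`card_mul_le_cost`). So `k * ρ (i + 1) ≤ 4 * β * cost` for
every Steiner tree (`Levels.classCount_le`). Because the scales grow geometrically and a terminal
outside the root's class forces `ρ (i + 1) ≤ cost`, only about `log n` levels matter in the sum over
all levels (`Levels.sum_classCount_le`).

Upper bound. Going down the levels, a set `R i` of vertices is extended from `{r}` to everything,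
and each new vertex gets a parent (`TreeStep`). From any vertex the parents lead to `R i` inside its
class of level `i` (up to the end points of the path) at cost `O(linkConst * ρ i)`
(`TreeSteps.parPath`). Inside a class the new vertices of `R i` form a chain, so all terminals of
the class together pay for one path to `R (i + 1)`, and the class of the root pays nothing
(`TreeSteps.parPaths`). Comparison with the lower bound gives `TreeSteps.stretch_le`.

The links of one level come from a shortest path forest in which the finer classes are contracted.
If each class used only its exit, a path entering at another vertex would have to make a detour
along finer levels. As in heavy path decompositions, the link with most descendants into a class is
continued directly to the exit; each remaining link at least doubles the number of descendants, so
there are only about `log n` detours (`LinkData.treeStep`), and `g` absorbs their number.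

The partitions. Level `N + 1` assigns every class of level `N` to a portal that is almost nearest
with respect to distance plus offset. The offsets come from nets `Z 0, …, Z t` at the scales `8 ^ j
* b 0`: a point of `Z (j + 1)` has at least `s` points of `Z j` nearby, and higher levels get
smaller offsets. A vertex sees points of only the levels from its highest nearby net point on, and
few of each, so at most `1 + (t + 1) * s` portals are almost nearest (`IsNet.card_portals_le`).
Whole classes are assigned, with connected preimages, in about `log n` phases of ball growing, each
of which disposes of at least half of the remaining vertices (`AggInv.step`, `AggInv.next_phase`);
the accumulated error, a polylogarithmic multiple of `Δ N`, is below `b 0` by the choice of `g`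
(`LevelsUpTo.next`).

With `t` the square root of `log₂ n`, rounded up, and `s = 2 ^ t`, all of `β`, `g` and the diameter
factor are `2 ^ O(t)`, hence so is the stretch. The scale of a new level is the smallest distance
not yet covered, so there are at most `n ^ 2 + 1` levels whatever the weights are, and classes at
distance `0` take care of zero weights.

The algorithm is written in a small language whose tests are formulas with bounded quantifiers and
whose loops run over the vertices. `Cmd.comp_runs` compiles it to the machine with a polynomial
bound on the time, once and for all; what remains is to follow its semantics `Cmd.den` through
Dijkstra's algorithm (`dijkstra_spec`), the hierarchy (`levelBlock_spec`) and the tree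
(`treeBlock_spec`). -/

namespace UST

/-! ### A structured language compiled to machine programs -/

section Language

/-- Set a register of natural numbers. -/
def State.setN (σ : State) (x k : ℕ) : State :=
  { σ with natReg := Function.update σ.natReg x k }

/-- Set a weight register. -/
noncomputable def State.setW (σ : State) (x : ℕ) (k : ℝ≥0) : State :=
  { σ with wtReg := Function.update σ.wtReg x k }

@[simp] theorem State.setN_natReg (σ : State) (x k y : ℕ) :
    (σ.setN x k).natReg y = if y = x then k else σ.natReg y := by
  simp [State.setN, Function.update_apply]

@[simp] theorem State.setN_natArr (σ : State) (x k : ℕ) : (σ.setN x k).natArr = σ.natArr := rfl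
@[simp] theorem State.setN_wtReg (σ : State) (x k : ℕ) : (σ.setN x k).wtReg = σ.wtReg := rfl
@[simp] theorem State.setN_wtArr (σ : State) (x k : ℕ) : (σ.setN x k).wtArr = σ.wtArr := rfl

@[simp] theorem State.setW_wtReg (σ : State) (x : ℕ) (k : ℝ≥0) (y : ℕ) :
    (σ.setW x k).wtReg y = if y = x then k else σ.wtReg y := by
  simp [State.setW, Function.update_apply]

@[simp] theorem State.setW_natArr (σ : State) (x : ℕ) (k : ℝ≥0) :
    (σ.setW x k).natArr = σ.natArr := rfl
@[simp] theorem State.setW_natReg (σ : State) (x : ℕ) (k : ℝ≥0) :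
    (σ.setW x k).natReg = σ.natReg := rfl
@[simp] theorem State.setW_wtArr (σ : State) (x : ℕ) (k : ℝ≥0) :
    (σ.setW x k).wtArr = σ.wtArr := rfl

theorem updateArr_apply {α : Type*} (A : ℕ → ℕ → ℕ → α) (a i j : ℕ) (v : α) (a' i' j' : ℕ) :
    updateArr A a i j v a' i' j' = if a' = a ∧ i' = i ∧ j' = j then v else A a' i' j' := by
  unfold updateArr
  by_cases h1 : a' = a
  · subst h1
    by_cases h2 : i' = i
    · subst h2
      by_cases h3 : j' = j
      · subst h3; simp
      · simp [h3]
    · simp [h2]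
  · simp [h1]

/-- First-order formulas whose quantifiers range over the numbers below register `0`. -/
inductive Fm where
  | nle (e₁ e₂ : NExpr)
  | wle (e₁ e₂ : WExpr)
  | not (b : Fm)
  | and (b₁ b₂ : Fm)
  | ex (x : ℕ) (b : Fm)

def Fm.Holds (σ : State) : Fm → Prop
  | .nle e₁ e₂ => e₁.eval σ ≤ e₂.eval σ
  | .wle e₁ e₂ => e₁.eval σ ≤ e₂.eval σ
  | .not b => ¬ b.Holds σ
  | .and b₁ b₂ => b₁.Holds σ ∧ b₂.Holds σ
  | .ex x b => ∃ i < σ.natReg 0, b.Holds (σ.setN x i)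

/-- Indices of registers and arrays that a user of the language may mention are below `64`. -/
def NExpr.ok : NExpr → Bool
  | .const _ => true
  | .reg x => decide (x < 64)
  | .arr a i j => decide (a < 64) && i.ok && j.ok
  | .add e₁ e₂ => e₁.ok && e₂.ok
  | .sub e₁ e₂ => e₁.ok && e₂.ok

def WExpr.ok : WExpr → Bool
  | .zero => true
  | .reg x => decide (x < 64)
  | .arr a i j => decide (a < 64) && i.ok && j.ok
  | .add e₁ e₂ => e₁.ok && e₂.ok

/-- Register `0` must not be bound, since it holds the range of the quantifiers. -/
def Fm.ok : Fm → Bool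
  | .nle e₁ e₂ => e₁.ok && e₂.ok
  | .wle e₁ e₂ => e₁.ok && e₂.ok
  | .not b => b.ok
  | .and b₁ b₂ => b₁.ok && b₂.ok
  | .ex x b => decide (x < 64) && decide (x ≠ 0) && b.ok

/-- Two states agree on the memory that a user of the language may mention. -/
structure Eqv (σ τ : State) : Prop where
  natReg : ∀ x < 64, σ.natReg x = τ.natReg x
  natArr : ∀ a < 64, σ.natArr a = τ.natArr a
  wtReg : ∀ x < 64, σ.wtReg x = τ.wtReg x
  wtArr : ∀ a < 64, σ.wtArr a = τ.wtArr a

theorem Eqv.refl (σ : State) : Eqv σ σ := ⟨fun _ _ => rfl, fun _ _ => rfl, fun _ _ => rfl,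
  fun _ _ => rfl⟩

theorem Eqv.trans {σ τ υ : State} (h : Eqv σ τ) (h' : Eqv τ υ) : Eqv σ υ :=
  ⟨fun x hx => (h.1 x hx).trans (h'.1 x hx), fun x hx => (h.2 x hx).trans (h'.2 x hx),
    fun x hx => (h.3 x hx).trans (h'.3 x hx), fun x hx => (h.4 x hx).trans (h'.4 x hx)⟩

theorem Eqv.symm {σ τ : State} (h : Eqv σ τ) : Eqv τ σ :=
  ⟨fun x hx => (h.1 x hx).symm, fun x hx => (h.2 x hx).symm, fun x hx => (h.3 x hx).symm,
    fun x hx => (h.4 x hx).symm⟩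

theorem Eqv.setN {σ τ : State} (h : Eqv σ τ) (x k : ℕ) : Eqv (σ.setN x k) (τ.setN x k) :=
  ⟨fun y hy => by simp [h.1 y hy], h.2, h.3, h.4⟩

theorem Eqv.nexpr {σ τ : State} (h : Eqv σ τ) (e : NExpr) (he : e.ok = true) :
    e.eval σ = e.eval τ := by
  induction e with
  | const k => rfl
  | reg x => exact h.1 x (by simpa [NExpr.ok] using he)
  | arr a i j ih₁ ih₂ =>
    simp only [NExpr.ok, Bool.and_eq_true, decide_eq_true_eq] at he
    simp only [NExpr.eval, ih₁ he.1.2, ih₂ he.2, h.2 a he.1.1]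
  | add e₁ e₂ ih₁ ih₂ =>
    simp only [NExpr.ok, Bool.and_eq_true] at he
    simp only [NExpr.eval, ih₁ he.1, ih₂ he.2]
  | sub e₁ e₂ ih₁ ih₂ =>
    simp only [NExpr.ok, Bool.and_eq_true] at he
    simp only [NExpr.eval, ih₁ he.1, ih₂ he.2]

theorem Eqv.wexpr {σ τ : State} (h : Eqv σ τ) (e : WExpr) (he : e.ok = true) :
    e.eval σ = e.eval τ := by
  induction e with
  | zero => rfl
  | reg x => exact h.3 x (by simpa [WExpr.ok] using he)
  | arr a i j =>
    simp only [WExpr.ok, Bool.and_eq_true, decide_eq_true_eq] at he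
    simp only [WExpr.eval, h.nexpr i he.1.2, h.nexpr j he.2, h.4 a he.1.1]
  | add e₁ e₂ ih₁ ih₂ =>
    simp only [WExpr.ok, Bool.and_eq_true] at he
    simp only [WExpr.eval, ih₁ he.1, ih₂ he.2]

theorem Eqv.holds {σ τ : State} (h : Eqv σ τ) (b : Fm) (hb : b.ok = true) :
    b.Holds σ ↔ b.Holds τ := by
  induction b generalizing σ τ with
  | nle e₁ e₂ =>
    simp only [Fm.ok, Bool.and_eq_true] at hb
    simp only [Fm.Holds, h.nexpr _ hb.1, h.nexpr _ hb.2]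
  | wle e₁ e₂ =>
    simp only [Fm.ok, Bool.and_eq_true] at hb
    simp only [Fm.Holds, h.wexpr _ hb.1, h.wexpr _ hb.2]
  | not b ih => simp only [Fm.Holds, ih h hb]
  | and b₁ b₂ ih₁ ih₂ =>
    simp only [Fm.ok, Bool.and_eq_true] at hb
    simp only [Fm.Holds, ih₁ h hb.1, ih₂ h hb.2]
  | ex x b ih =>
    simp only [Fm.ok, Bool.and_eq_true] at hb
    simp only [Fm.Holds, h.1 0 (by norm_num), fun i => ih (h.setN x i) hb.2]

/-- `for x = 0, …, n - 1 do P`, where `n` is the contents of register `0`. -/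
def loop (x : ℕ) (P : Program) : Program :=
  .seq (.setNat x (.const 0))
    (.while (.natLE (.add (.reg x) (.const 1)) (.reg 0))
      (.seq P (.setNat x (.add (.reg x) (.const 1)))))

theorem setNat_runs (σ : State) (x : ℕ) (e : NExpr) :
    Runs (.setNat x e) σ (e.steps + 1) (σ.setN x (e.eval σ)) := Runs.setNat σ x e

theorem setNat_runs' {σ : State} {x t k : ℕ} {e : NExpr} (h : e.eval σ = k)
    (ht : e.steps + 1 = t) : Runs (.setNat x e) σ t (σ.setN x k) := by
  subst h ht; exact setNat_runs σ x e

/-- A Hoare rule with a time bound. The invariant is required in the state where the counter has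
already been advanced, so it can be used directly for the next test. -/
theorem loop_runs {x : ℕ} (hx : x ≠ 0) {P : Program} {n c : ℕ} (I : ℕ → State → Prop)
    (hI : ∀ i < n, ∀ τ, I i τ → τ.natReg x = i → τ.natReg 0 = n →
      ∃ t τ', Runs P τ t τ' ∧ t ≤ c ∧ τ'.natReg x = i ∧ τ'.natReg 0 = n ∧
        I (i + 1) (τ'.setN x (i + 1)))
    {σ : State} (hn : σ.natReg 0 = n) (h0 : I 0 (σ.setN x 0)) :
    ∃ t τ, Runs (loop x P) σ t τ ∧ t ≤ (c + 9) * n + 7 ∧ I n τ ∧ τ.natReg x = n ∧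
      τ.natReg 0 = n := by
  have key : ∀ k i, i + k = n → ∀ τ, I i τ → τ.natReg x = i → τ.natReg 0 = n →
      ∃ t τ', Runs (.while (.natLE (.add (.reg x) (.const 1)) (.reg 0))
        (.seq P (.setNat x (.add (.reg x) (.const 1))))) τ t τ' ∧ t ≤ (c + 9) * k + 5 ∧ I n τ' ∧
        τ'.natReg x = n ∧ τ'.natReg 0 = n := by
    intro k
    induction k with
    | zero =>
      intro i hi τ hτ h1 h2
      obtain rfl : i = n := by simpa using hi
      refine ⟨_, τ, .while_false ?_, ?_, hτ, h1, h2⟩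
      · simp [Test.Holds, NExpr.eval, h1, h2]
      · simp [Test.steps, NExpr.steps]
    | succ k ih =>
      intro i hi τ hτ h1 h2
      obtain ⟨t, τ', r, ht, h3, h4, h5⟩ := hI i (by omega) τ hτ h1 h2
      obtain ⟨t', τ'', r', ht', h6⟩ := ih (i + 1) (by omega) (τ'.setN x (i + 1)) h5 (by simp)
        (by simp [hx.symm, h4])
      refine ⟨_, τ'', .while_true ?_ (.seq r (setNat_runs' (by simp [NExpr.eval, h3]) rfl)) r', ?_, h6⟩
      · simp [Test.Holds, NExpr.eval, h1, h2]; omega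
      · simp only [Test.steps, NExpr.steps]
        nlinarith
  obtain ⟨t, τ, r, ht, h⟩ := key n 0 (by omega) (σ.setN x 0) h0 (by simp) (by simp [hx.symm, hn])
  refine ⟨_, τ, .seq (.setNat σ x (.const 0)) r, ?_, h⟩
  simp only [NExpr.steps]; omega

/-- Evaluate a formula; the truth value is left in register `m`, and only registers from `m` on
change. -/
def Fm.comp : Fm → ℕ → Program
  | .nle e₁ e₂, m => .ite (.natLE e₁ e₂) (.setNat m (.const 1)) (.setNat m (.const 0))
  | .wle e₁ e₂, m => .ite (.wtLE e₁ e₂) (.setNat m (.const 1)) (.setNat m (.const 0))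
  | .not b, m => .seq (b.comp m) (.setNat m (.sub (.const 1) (.reg m)))
  | .and b₁ b₂, m => .seq (b₁.comp m) (.seq (b₂.comp (m + 1))
      (.ite (.natLE (.const 2) (.add (.reg m) (.reg (m + 1))))
        (.setNat m (.const 1)) (.setNat m (.const 0))))
  | .ex x b, m => .seq (.setNat m (.const 0)) (.seq (.setNat (m + 1) (.reg x))
      (.seq (loop x (.seq (b.comp (m + 2))
        (.ite (.natLE (.const 1) (.reg (m + 2))) (.setNat m (.const 1)) .skip)))
        (.setNat x (.reg (m + 1)))))

open Polynomial in
/-- A bound on the number of steps of `Fm.comp`. -/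
noncomputable def Fm.cost : Fm → ℕ[X]
  | .nle e₁ e₂ => C (e₁.steps + e₂.steps + 5)
  | .wle e₁ e₂ => C (e₁.steps + e₂.steps + 5)
  | .not b => b.cost + C 4
  | .and b₁ b₂ => b₁.cost + b₂.cost + C 9
  | .ex _ b => (b.cost + C 20) * X + C 20

open Classical in
/-- Only registers from `m` on differ, and register `m` holds the truth value of `p`. -/
structure EvalRes (σ τ : State) (m : ℕ) (p : Prop) : Prop where
  low : ∀ x < m, τ.natReg x = σ.natReg x
  natArr : τ.natArr = σ.natArr
  wtReg : τ.wtReg = σ.wtReg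
  wtArr : τ.wtArr = σ.wtArr
  res : τ.natReg m = if p then 1 else 0

theorem EvalRes.eqv {σ τ : State} {m : ℕ} {p : Prop} (h : EvalRes σ τ m p) (hm : 64 ≤ m) :
    Eqv σ τ :=
  ⟨fun x hx => (h.low x (by omega)).symm, fun a _ => by rw [h.natArr],
    fun a _ => by rw [h.wtReg], fun a _ => by rw [h.wtArr]⟩

/-- Subformulas are evaluated in ever higher registers, and well-formed formulas mention only
registers below `64`. So evaluation changes neither the truth of other formulas nor the memory
visible to the user, which is what `EvalRes` records. -/
theorem Fm.comp_runs (b : Fm) (hb : b.ok = true) (m : ℕ) (hm : 64 ≤ m) (σ : State) :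
    ∃ t τ, Runs (b.comp m) σ t τ ∧ t ≤ b.cost.eval (σ.natReg 0) ∧ EvalRes σ τ m (b.Holds σ) := by
  classical
  induction b generalizing σ m with
  | nle e₁ e₂ =>
    by_cases h : e₁.eval σ ≤ e₂.eval σ
    · refine ⟨_, _, .ite_true h (setNat_runs _ _ _), ?_, ⟨fun x hx => ?_, rfl, rfl, rfl, ?_⟩⟩
      · simp [Fm.cost, Test.steps, NExpr.steps]
      · simp [hx.ne]
      · simp [Fm.Holds, h, NExpr.eval]
    · refine ⟨_, _, .ite_false h (setNat_runs _ _ _), ?_, ⟨fun x hx => ?_, rfl, rfl, rfl, ?_⟩⟩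
      · simp [Fm.cost, Test.steps, NExpr.steps]
      · simp [hx.ne]
      · simp [Fm.Holds, h, NExpr.eval]
  | wle e₁ e₂ =>
    by_cases h : e₁.eval σ ≤ e₂.eval σ
    · refine ⟨_, _, .ite_true h (setNat_runs _ _ _), ?_, ⟨fun x hx => ?_, rfl, rfl, rfl, ?_⟩⟩
      · simp [Fm.cost, Test.steps, NExpr.steps]
      · simp [hx.ne]
      · simp [Fm.Holds, h, NExpr.eval]
    · refine ⟨_, _, .ite_false h (setNat_runs _ _ _), ?_, ⟨fun x hx => ?_, rfl, rfl, rfl, ?_⟩⟩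
      · simp [Fm.cost, Test.steps, NExpr.steps]
      · simp [hx.ne]
      · simp [Fm.Holds, h, NExpr.eval]
  | not b ih =>
    obtain ⟨t, τ, r, ht, h⟩ := ih hb m hm σ
    refine ⟨_, _, .seq r (setNat_runs _ _ _), ?_, ⟨fun x hx => ?_, h.2, h.3, h.4, ?_⟩⟩
    · simp [Fm.cost, NExpr.steps]; omega
    · simp [hx.ne, h.1 x hx]
    · by_cases hh : b.Holds σ <;> simp [Fm.Holds, NExpr.eval, h.5, hh]
  | and b₁ b₂ ih₁ ih₂ =>
    simp only [Fm.ok, Bool.and_eq_true] at hb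
    obtain ⟨t, τ, r, ht, h⟩ := ih₁ hb.1 m hm σ
    obtain ⟨t', τ', r', ht', h'⟩ := ih₂ hb.2 (m + 1) (by omega) τ
    rw [h.1 0 (by omega)] at ht'
    have e : b₂.Holds τ ↔ b₂.Holds σ := ((h.eqv hm).holds b₂ hb.2).symm
    have h5 : τ'.natReg (m + 1) = if b₂.Holds σ then 1 else 0 := by rw [h'.5]; simp only [e]
    have h6 : τ'.natReg m = if b₁.Holds σ then 1 else 0 := by rw [h'.1 m (by omega), h.5]
    by_cases hh : b₁.Holds σ ∧ b₂.Holds σ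
    · refine ⟨_, _, .seq r (.seq r' (.ite_true ?_ (setNat_runs _ _ _))), ?_,
        ⟨fun x hx => ?_, h'.2.trans h.2, h'.3.trans h.3, h'.4.trans h.4, ?_⟩⟩
      · simp [Test.Holds, NExpr.eval, h5, h6, hh.1, hh.2]
      · simp [Fm.cost, NExpr.steps, Test.steps]; omega
      · simp [hx.ne, h'.1 x (by omega), h.1 x hx]
      · simp [Fm.Holds, NExpr.eval, hh]
    · refine ⟨_, _, .seq r (.seq r' (.ite_false ?_ (setNat_runs _ _ _))), ?_,
        ⟨fun x hx => ?_, h'.2.trans h.2, h'.3.trans h.3, h'.4.trans h.4, ?_⟩⟩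
      · simp only [Test.Holds, NExpr.eval, h5, h6]
        rw [not_and_or] at hh
        rcases hh with hh | hh <;> simp [hh] <;> split_ifs <;> norm_num
      · simp [Fm.cost, NExpr.steps, Test.steps]; omega
      · simp [hx.ne, h'.1 x (by omega), h.1 x hx]
      · simp [Fm.Holds, NExpr.eval, hh]
  | ex x b ih =>
    simp only [Fm.ok, Bool.and_eq_true, decide_eq_true_eq] at hb
    obtain ⟨⟨hx64, hx0⟩, hb⟩ := hb
    set n := σ.natReg 0 with hn
    -- Register `m` collects the disjunction over the values tried so far, and `m + 1` keeps the old
    -- content of the bound register, which is the only low register that the loop disturbs.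
    let I : ℕ → State → Prop := fun i τ =>
      (∀ y < m, y ≠ x → τ.natReg y = σ.natReg y) ∧ τ.natArr = σ.natArr ∧ τ.wtReg = σ.wtReg ∧
      τ.wtArr = σ.wtArr ∧ τ.natReg (m + 1) = σ.natReg x ∧
      τ.natReg m = if ∃ j < i, b.Holds (σ.setN x j) then 1 else 0
    have h1 : m ≠ x := by omega
    have h2 : m + 1 ≠ x := by omega
    obtain ⟨t, τ, r, ht, hI, hτx, hτ0⟩ := loop_runs (n := n) (c := b.cost.eval n + 7)
      (P := .seq (b.comp (m + 2))
        (.ite (.natLE (.const 1) (.reg (m + 2))) (.setNat m (.const 1)) .skip)) hx0 I (by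
        intro i hi τ hτ hτx hτ0
        obtain ⟨t, τ', r, ht, h⟩ := ih hb (m + 2) (by omega) τ
        rw [hτ0] at ht
        have e : b.Holds τ ↔ b.Holds (σ.setN x i) := by
          refine Eqv.holds ⟨fun y hy => ?_, fun a _ => by rw [hτ.2.1]; rfl,
            fun a _ => by rw [hτ.2.2.1]; rfl, fun a _ => by rw [hτ.2.2.2.1]; rfl⟩ b hb
          by_cases hyx : y = x
          · subst hyx; simp [hτx]
          · simp [hyx, hτ.1 y (by omega) hyx]
        have h5 := h.5
        by_cases hh : b.Holds (σ.setN x i)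
        · refine ⟨_, _, .seq r (.ite_true ?_ (setNat_runs _ _ _)), ?_, ?_, ?_, ?_⟩
          · simp [Test.Holds, NExpr.eval, h5, e, hh]
          · simp [NExpr.steps, Test.steps]; omega
          · simp [h1.symm, h.1 x (by omega), hτx]
          · simp [show (0 : ℕ) ≠ m by omega, h.1 0 (by omega), hτ0]
          · refine ⟨fun y hy hyx => ?_, h.2.trans hτ.2.1, h.3.trans hτ.2.2.1,
              h.4.trans hτ.2.2.2.1, ?_, ?_⟩
            · simp [hyx, hy.ne, h.1 y (by omega), hτ.1 y hy hyx]
            · simp [h2, h.1 (m + 1) (by omega), hτ.2.2.2.2.1]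
            · rw [if_pos ⟨i, by omega, hh⟩]; simp [h1, NExpr.eval]
        · refine ⟨_, _, .seq r (.ite_false ?_ (.skip _)), ?_, ?_, ?_, ?_⟩
          · simp [Test.Holds, NExpr.eval, h5, e, hh]
          · simp [NExpr.steps, Test.steps]; omega
          · simp [h.1 x (by omega), hτx]
          · simp [h.1 0 (by omega), hτ0]
          · refine ⟨fun y hy hyx => ?_, h.2.trans hτ.2.1, h.3.trans hτ.2.2.1,
              h.4.trans hτ.2.2.2.1, ?_, ?_⟩
            · simp [hyx, h.1 y (by omega), hτ.1 y hy hyx]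
            · simp [h2, h.1 (m + 1) (by omega), hτ.2.2.2.2.1]
            · have : (∃ j < i + 1, b.Holds (σ.setN x j)) ↔ ∃ j < i, b.Holds (σ.setN x j) := by
                constructor
                · rintro ⟨j, hj, hj'⟩
                  rcases Nat.lt_succ_iff_lt_or_eq.1 hj with hj | rfl
                  · exact ⟨j, hj, hj'⟩
                  · exact absurd hj' hh
                · rintro ⟨j, hj, hj'⟩; exact ⟨j, by omega, hj'⟩
              rw [if_congr this rfl rfl]; simp [h1, h.1 m (by omega), hτ.2.2.2.2.2])
      (σ := (σ.setN m 0).setN (m + 1) (σ.natReg x))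
      (by simp [show (0 : ℕ) ≠ m by omega, ← hn]) (by
        refine ⟨fun y hy hyx => ?_, rfl, rfl, rfl, ?_, ?_⟩
        · simp [hyx, hy.ne, show y ≠ m + 1 by omega]
        · simp [h2]
        · simp [h1])
    refine ⟨_, _, .seq (setNat_runs' rfl rfl) (.seq (setNat_runs' (k := σ.natReg x)
      (by simp [NExpr.eval, h1.symm]) rfl) (.seq r (setNat_runs _ _ _))), ?_,
      ⟨fun y hy => ?_, hI.2.1, hI.2.2.1, hI.2.2.2.1, ?_⟩⟩
    · simp [Fm.cost, NExpr.steps]; nlinarith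
    · by_cases hyx : y = x
      · subst hyx; simp [NExpr.eval, hI.2.2.2.2.1]
      · simp [hyx, hI.1 y hy hyx]
    · simp [h1, hI.2.2.2.2.2, Fm.Holds, ← hn]


/-! ### Bounded search and counting, and the command language. -/

open Classical in
/-- The least `i < n` with `p i`, or `n` if there is none. -/
noncomputable def leastLT (n : ℕ) (p : ℕ → Prop) : ℕ :=
  Nat.find (⟨n, Or.inl le_rfl⟩ : ∃ i, n ≤ i ∨ p i)

theorem leastLT_le (n : ℕ) (p : ℕ → Prop) : leastLT n p ≤ n := by
  classical
  exact Nat.find_min' (⟨n, Or.inl le_rfl⟩ : ∃ i, n ≤ i ∨ p i) (Or.inl le_rfl)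

theorem leastLT_spec {n : ℕ} {p : ℕ → Prop} (h : leastLT n p < n) : p (leastLT n p) := by
  classical
  have := Nat.find_spec (⟨n, Or.inl le_rfl⟩ : ∃ i, n ≤ i ∨ p i)
  exact this.resolve_left (not_le.2 h)

theorem leastLT_min {n : ℕ} {p : ℕ → Prop} {j : ℕ} (h : j < leastLT n p) : ¬ p j := by
  classical
  have := Nat.find_min (⟨n, Or.inl le_rfl⟩ : ∃ i, n ≤ i ∨ p i) h
  exact fun h' => this (Or.inr h')

theorem leastLT_lt {n : ℕ} {p : ℕ → Prop} {j : ℕ} (hj : j < n) (h : p j) : leastLT n p < n :=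
  lt_of_le_of_lt (not_lt.1 fun h' => leastLT_min h' h) hj

theorem leastLT_eq {n : ℕ} {p : ℕ → Prop} {j : ℕ} (hj : j ≤ n) (h : j < n → p j)
    (h' : ∀ i < j, ¬ p i) : leastLT n p = j := by
  apply le_antisymm
  · rcases hj.lt_or_eq with hj | rfl
    · exact not_lt.1 fun h'' => leastLT_min h'' (h hj)
    · exact leastLT_le _ _
  · refine not_lt.1 fun h'' => h' _ h'' (leastLT_spec (h''.trans_le hj))

theorem leastLT_congr {n : ℕ} {p q : ℕ → Prop} (h : ∀ i < n, p i ↔ q i) :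
    leastLT n p = leastLT n q :=
  leastLT_eq (leastLT_le _ _) (fun hl => (h _ hl).2 (leastLT_spec hl))
    fun i hi hp => leastLT_min hi ((h i (hi.trans_le (leastLT_le _ _))).1 hp)

open Classical in
/-- The number of `i < n` with `p i`. -/
noncomputable def countLT (n : ℕ) (p : ℕ → Prop) : ℕ := ((Finset.range n).filter p).card

/-- Commands. Loops run over the numbers below register `0`, and `allN`, `allW` update all entries
of a row of an array that satisfy a formula simultaneously. -/
inductive Cmd where
  | setN (x : ℕ) (e : NExpr)
  | setW (x : ℕ) (e : WExpr)
  /-- register `y` becomes the least `x` with `b` -/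
  | find (y x : ℕ) (b : Fm)
  /-- register `y` becomes the number of `x` with `b` -/
  | count (y x : ℕ) (b : Fm)
  /-- for all `x` with `b`, entry `(i, x)` of array `a` becomes `e` -/
  | allN (x a : ℕ) (i : NExpr) (b : Fm) (e : NExpr)
  | allW (x a : ℕ) (i : NExpr) (b : Fm) (e : WExpr)
  | seq (c₁ c₂ : Cmd)
  | ite (b : Fm) (c₁ c₂ : Cmd)
  | forN (x : ℕ) (c : Cmd)

open Classical in
/-- The state after the command. -/
noncomputable def Cmd.den : Cmd → State → State
  | .setN x e, σ => σ.setN x (e.eval σ)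
  | .setW x e, σ => σ.setW x (e.eval σ)
  | .find y x b, σ => σ.setN y (leastLT (σ.natReg 0) fun i => b.Holds (σ.setN x i))
  | .count y x b, σ => σ.setN y (countLT (σ.natReg 0) fun i => b.Holds (σ.setN x i))
  | .allN x a i b e, σ =>
    { σ with natArr := fun a' i' j => if a' = a ∧ i' = i.eval σ ∧ j < σ.natReg 0 ∧
        b.Holds (σ.setN x j) then e.eval (σ.setN x j) else σ.natArr a' i' j }
  | .allW x a i b e, σ =>
    { σ with wtArr := fun a' i' j => if a' = a ∧ i' = i.eval σ ∧ j < σ.natReg 0 ∧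
        b.Holds (σ.setN x j) then e.eval (σ.setN x j) else σ.wtArr a' i' j }
  | .seq c₁ c₂, σ => c₂.den (c₁.den σ)
  | .ite b c₁ c₂, σ => if b.Holds σ then c₁.den σ else c₂.den σ
  | .forN x c, σ =>
    (Nat.rec σ (fun i τ => c.den (τ.setN x i)) (σ.natReg 0) : State).setN x (σ.natReg 0)

/-- The registers of natural numbers to which the command writes. -/
def Cmd.regs : Cmd → List ℕ
  | .setN x _ => [x]
  | .find y _ _ => [y]
  | .count y _ _ => [y]
  | .seq c₁ c₂ => c₁.regs ++ c₂.regs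
  | .ite _ c₁ c₂ => c₁.regs ++ c₂.regs
  | .forN x c => x :: c.regs
  | _ => []

/-- The arrays of natural numbers to which the command writes. -/
def Cmd.arrs : Cmd → List ℕ
  | .allN _ a _ _ _ => [a]
  | .seq c₁ c₂ => c₁.arrs ++ c₂.arrs
  | .ite _ c₁ c₂ => c₁.arrs ++ c₂.arrs
  | .forN _ c => c.arrs
  | _ => []

/-- The weight registers to which the command writes. -/
def Cmd.wregs : Cmd → List ℕ
  | .setW x _ => [x]
  | .seq c₁ c₂ => c₁.wregs ++ c₂.wregs
  | .ite _ c₁ c₂ => c₁.wregs ++ c₂.wregs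
  | .forN _ c => c.wregs
  | _ => []

/-- The weight arrays to which the command writes. -/
def Cmd.warrs : Cmd → List ℕ
  | .allW _ a _ _ _ => [a]
  | .seq c₁ c₂ => c₁.warrs ++ c₂.warrs
  | .ite _ c₁ c₂ => c₁.warrs ++ c₂.warrs
  | .forN _ c => c.warrs
  | _ => []

/-- Well-formedness of commands. -/
def Cmd.ok : Cmd → Bool
  | .setN x e => decide (x < 64) && decide (x ≠ 0) && e.ok
  | .setW x e => decide (x < 64) && e.ok
  | .find y x b => decide (y < 64) && decide (y ≠ 0) && decide (x < 64) && decide (x ≠ 0) && b.ok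
  | .count y x b => decide (y < 64) && decide (y ≠ 0) && decide (x < 64) && decide (x ≠ 0) && b.ok
  | .allN x a i b e =>
    decide (x < 64) && decide (x ≠ 0) && decide (a < 64) && i.ok && b.ok && e.ok
  | .allW x a i b e =>
    decide (x < 64) && decide (x ≠ 0) && decide (a < 64) && i.ok && b.ok && e.ok
  | .seq c₁ c₂ => c₁.ok && c₂.ok
  | .ite b c₁ c₂ => b.ok && c₁.ok && c₂.ok
  | .forN x c => decide (x < 64) && decide (x ≠ 0) && decide (x ∉ c.regs) && c.ok

/-- A frame rule. The lists of written registers are computable, so for concrete commands `decide`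
settles what is left unchanged; the same holds for the three variants that follow. -/
theorem Cmd.den_natReg {x : ℕ} (c : Cmd) (h : x ∉ c.regs) (σ : State) :
    (c.den σ).natReg x = σ.natReg x := by
  classical
  induction c generalizing σ with
  | setN y e => simp only [regs, List.mem_singleton] at h; simp [den, h]
  | find y z b => simp only [regs, List.mem_singleton] at h; simp [den, h]
  | count y z b => simp only [regs, List.mem_singleton] at h; simp [den, h]
  | setW | allN | allW => rfl
  | seq c₁ c₂ ih₁ ih₂ =>
    simp only [regs, List.mem_append, not_or] at h
    simp only [den, ih₂ h.2, ih₁ h.1]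
  | ite b c₁ c₂ ih₁ ih₂ =>
    simp only [regs, List.mem_append, not_or] at h
    simp only [den]; split_ifs
    · exact ih₁ h.1 σ
    · exact ih₂ h.2 σ
  | forN y c ih =>
    simp only [regs, List.mem_cons, not_or] at h
    simp only [den, State.setN_natReg, h.1, if_false]
    generalize σ.natReg 0 = n
    induction n with
    | zero => rfl
    | succ n ihn => simp only [ih h.2, State.setN_natReg, h.1, if_false, ihn]

theorem Cmd.den_natArr {a : ℕ} (c : Cmd) (h : a ∉ c.arrs) (σ : State) :
    (c.den σ).natArr a = σ.natArr a := by
  classical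
  induction c generalizing σ with
  | allN x a' i b e => simp only [arrs, List.mem_singleton] at h; simp [den, h]
  | setN | find | count | setW | allW => rfl
  | seq c₁ c₂ ih₁ ih₂ =>
    simp only [arrs, List.mem_append, not_or] at h
    simp only [den, ih₂ h.2, ih₁ h.1]
  | ite b c₁ c₂ ih₁ ih₂ =>
    simp only [arrs, List.mem_append, not_or] at h
    simp only [den]; split_ifs
    · exact ih₁ h.1 σ
    · exact ih₂ h.2 σ
  | forN y c ih =>
    simp only [arrs] at h
    simp only [den, State.setN_natArr]
    generalize σ.natReg 0 = n
    induction n with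
    | zero => rfl
    | succ n ihn => simp only [ih h, State.setN_natArr, ihn]

theorem Cmd.den_wtReg {x : ℕ} (c : Cmd) (h : x ∉ c.wregs) (σ : State) :
    (c.den σ).wtReg x = σ.wtReg x := by
  classical
  induction c generalizing σ with
  | setW y e => simp only [wregs, List.mem_singleton] at h; simp [den, h]
  | setN | find | count | allN | allW => rfl
  | seq c₁ c₂ ih₁ ih₂ =>
    simp only [wregs, List.mem_append, not_or] at h
    simp only [den, ih₂ h.2, ih₁ h.1]
  | ite b c₁ c₂ ih₁ ih₂ =>
    simp only [wregs, List.mem_append, not_or] at h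
    simp only [den]; split_ifs
    · exact ih₁ h.1 σ
    · exact ih₂ h.2 σ
  | forN y c ih =>
    simp only [wregs] at h
    simp only [den, State.setN_wtReg]
    generalize σ.natReg 0 = n
    induction n with
    | zero => rfl
    | succ n ihn => simp only [ih h, State.setN_wtReg, ihn]

theorem Cmd.den_wtArr {a : ℕ} (c : Cmd) (h : a ∉ c.warrs) (σ : State) :
    (c.den σ).wtArr a = σ.wtArr a := by
  classical
  induction c generalizing σ with
  | allW x a' i b e => simp only [warrs, List.mem_singleton] at h; simp [den, h]
  | setN | find | count | setW | allN => rfl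
  | seq c₁ c₂ ih₁ ih₂ =>
    simp only [warrs, List.mem_append, not_or] at h
    simp only [den, ih₂ h.2, ih₁ h.1]
  | ite b c₁ c₂ ih₁ ih₂ =>
    simp only [warrs, List.mem_append, not_or] at h
    simp only [den]; split_ifs
    · exact ih₁ h.1 σ
    · exact ih₂ h.2 σ
  | forN y c ih =>
    simp only [warrs] at h
    simp only [den, State.setN_wtArr]
    generalize σ.natReg 0 = n
    induction n with
    | zero => rfl
    | succ n ihn => simp only [ih h, State.setN_wtArr, ihn]

theorem Cmd.zero_notMem_regs {c : Cmd} (h : c.ok = true) : 0 ∉ c.regs := by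
  induction c with
  | setN x e =>
    simp only [ok, Bool.and_eq_true, decide_eq_true_eq] at h
    simpa [regs] using h.1.2.symm
  | find y x b | count y x b =>
    simp only [ok, Bool.and_eq_true, decide_eq_true_eq] at h
    simpa [regs] using h.1.1.1.2.symm
  | setW | allN | allW => simp [regs]
  | seq c₁ c₂ ih₁ ih₂ =>
    simp only [ok, Bool.and_eq_true] at h
    simp [regs, ih₁ h.1, ih₂ h.2]
  | ite b c₁ c₂ ih₁ ih₂ =>
    simp only [ok, Bool.and_eq_true] at h
    simp [regs, ih₁ h.1.2, ih₂ h.2]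
  | forN x c ih =>
    simp only [ok, Bool.and_eq_true, decide_eq_true_eq] at h
    simp [regs, ih h.2, h.1.1.2.symm]

/-- Run through all `x` and evaluate `b` before each execution of `Q`. -/
def scan (x : ℕ) (b : Fm) (Q : Program) : Program := loop x (.seq (b.comp 66) Q)

/-- Register `64` saves the bound register, `65` holds the intermediate result or the row index, and
formulas are evaluated from `66` on. The row updates need two passes through the scratch array `64`,
since the formula and the expression may read the very row that is being changed. -/
def Cmd.comp : Cmd → Program
  | .setN x e => .setNat x e
  | .setW x e => .setWt x e
  | .find y x b => .seq (.setNat 64 (.reg x)) (.seq (.setNat 65 (.reg 0))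
      (.seq (scan x b (.ite (.and (.natLE (.const 1) (.reg 66)) (.natLE (.reg 0) (.reg 65)))
        (.setNat 65 (.reg x)) .skip))
      (.seq (.setNat x (.reg 64)) (.setNat y (.reg 65)))))
  | .count y x b => .seq (.setNat 64 (.reg x)) (.seq (.setNat 65 (.const 0))
      (.seq (scan x b (.setNat 65 (.add (.reg 65) (.reg 66))))
      (.seq (.setNat x (.reg 64)) (.setNat y (.reg 65)))))
  | .allN x a i b e => .seq (.setNat 64 (.reg x)) (.seq (.setNat 65 i)
      (.seq (scan x b (.ite (.natLE (.const 1) (.reg 66))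
        (.storeNat 64 (.const 0) (.reg x) (.add e (.const 1)))
        (.storeNat 64 (.const 0) (.reg x) (.const 0))))
      (.seq (loop x (.ite (.natLE (.const 1) (.arr 64 (.const 0) (.reg x)))
        (.storeNat a (.reg 65) (.reg x) (.sub (.arr 64 (.const 0) (.reg x)) (.const 1))) .skip))
      (.setNat x (.reg 64)))))
  | .allW x a i b e => .seq (.setNat 64 (.reg x)) (.seq (.setNat 65 i)
      (.seq (scan x b (.seq (.storeNat 64 (.const 0) (.reg x) (.reg 66))
        (.storeWt 64 (.const 0) (.reg x) e)))
      (.seq (loop x (.ite (.natLE (.const 1) (.arr 64 (.const 0) (.reg x)))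
        (.storeWt a (.reg 65) (.reg x) (.arr 64 (.const 0) (.reg x))) .skip))
      (.setNat x (.reg 64)))))
  | .seq c₁ c₂ => .seq c₁.comp c₂.comp
  | .ite b c₁ c₂ => .seq (b.comp 64) (.ite (.natLE (.const 1) (.reg 64)) c₁.comp c₂.comp)
  | .forN x c => loop x c.comp

open Polynomial in
/-- A bound on the number of steps of `Cmd.comp`. -/
noncomputable def Cmd.cost : Cmd → ℕ[X]
  | .setN _ e => C (e.steps + 1)
  | .setW _ e => C (e.steps + 1)
  | .find _ _ b => (b.cost + C 20) * X + C 20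
  | .count _ _ b => (b.cost + C 20) * X + C 20
  | .allN _ _ i b e => (b.cost + C (e.steps + 60)) * X + C (i.steps + 40)
  | .allW _ _ i b e => (b.cost + C (e.steps + 60)) * X + C (i.steps + 40)
  | .seq c₁ c₂ => c₁.cost + c₂.cost
  | .ite b c₁ c₂ => b.cost + c₁.cost + c₂.cost + C 3
  | .forN _ c => (c.cost + C 9) * X + C 7

-- The common part of the searches and row updates. The invariant `J` sees only scratch memory; all
-- visible memory stays that of `σ` with the bound register equal to the counter.
open Classical in
theorem scan_runs {x : ℕ} (hx0 : x ≠ 0) (hx : x < 64) {b : Fm} (hb : b.ok = true) {Q : Program}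
    {c : ℕ} (σ : State) (J : ℕ → ℕ → (ℕ → ℕ → ℕ) → (ℕ → ℕ → ℝ≥0) → Prop)
    (hJ : ∀ i < σ.natReg 0, ∀ τ, J i (τ.natReg 65) (τ.natArr 64) (τ.wtArr 64) →
      Eqv τ (σ.setN x i) → (τ.natReg 66 = if b.Holds (σ.setN x i) then 1 else 0) →
      ∃ t τ', Runs Q τ t τ' ∧ t ≤ c ∧ Eqv τ' (σ.setN x i) ∧
        J (i + 1) (τ'.natReg 65) (τ'.natArr 64) (τ'.wtArr 64) ∧ τ'.natReg 64 = τ.natReg 64)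
    {τ₀ : State} (h₀ : Eqv τ₀ σ) (hJ₀ : J 0 (τ₀.natReg 65) (τ₀.natArr 64) (τ₀.wtArr 64)) :
    ∃ t τ, Runs (scan x b Q) τ₀ t τ ∧ t ≤ (b.cost.eval (σ.natReg 0) + c + 9) * σ.natReg 0 + 7 ∧
      Eqv τ (σ.setN x (σ.natReg 0)) ∧
      J (σ.natReg 0) (τ.natReg 65) (τ.natArr 64) (τ.wtArr 64) ∧
      τ.natReg 64 = τ₀.natReg 64 := by
  set n := σ.natReg 0 with hn
  have x64 : (64 : ℕ) ≠ x := by omega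
  have x65 : (65 : ℕ) ≠ x := by omega
  let I : ℕ → State → Prop := fun i τ => Eqv τ (σ.setN x i) ∧
    J i (τ.natReg 65) (τ.natArr 64) (τ.wtArr 64) ∧ τ.natReg 64 = τ₀.natReg 64
  obtain ⟨t, τ, r, ht, ⟨hI, hI', hI''⟩, -, -⟩ := loop_runs (n := n) (c := b.cost.eval n + c)
    (P := .seq (b.comp 66) Q) hx0 I (by
      rintro i hi τ ⟨h1, h2, h3⟩ hτx hτ0
      obtain ⟨t, τ', r, ht, h⟩ := Fm.comp_runs b hb 66 (by norm_num) τ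
      rw [hτ0] at ht
      have e := h.eqv (by norm_num)
      obtain ⟨t', τ'', r', ht', h4, h5, h6⟩ := hJ i hi τ' (by
        rw [h.1 65 (by norm_num), h.2, h.4]; exact h2) (e.symm.trans h1) (by
        rw [h.5, if_congr (h1.holds b hb) rfl rfl])
      refine ⟨_, τ'', .seq r r', by omega, ?_, ?_, ?_, ?_, ?_⟩
      · simpa using h4.1 x hx
      · simpa [hx0.symm, ← hn] using h4.1 0 (by norm_num)
      · refine ⟨fun y hy => ?_, h4.2, h4.3, h4.4⟩
        have := h4.1 y hy
        by_cases hyx : y = x <;> simp_all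
      · simpa [x65] using h5
      · simpa [x64] using h6.trans ((h.1 64 (by norm_num)).trans h3))
    (σ := τ₀) (h₀.1 0 (by norm_num)) ⟨h₀.setN x 0, by simpa [x65] using hJ₀, by simp [x64]⟩
  exact ⟨t, τ, r, ht, hI, hI', hI''⟩

theorem storeNat_runs {σ : State} {a i j k t : ℕ} {ei ej e : NExpr} (hi : ei.eval σ = i)
    (hj : ej.eval σ = j) (hk : e.eval σ = k) (ht : ei.steps + ej.steps + e.steps + 1 = t) :
    Runs (.storeNat a ei ej e) σ t { σ with natArr := updateArr σ.natArr a i j k } := by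
  subst hi hj hk ht; exact Runs.storeNat σ a ei ej e

theorem storeWt_runs {σ : State} {a i j t : ℕ} {k : ℝ≥0} {ei ej : NExpr} {e : WExpr}
    (hi : ei.eval σ = i)
    (hj : ej.eval σ = j) (hk : e.eval σ = k) (ht : ei.steps + ej.steps + e.steps + 1 = t) :
    Runs (.storeWt a ei ej e) σ t { σ with wtArr := updateArr σ.wtArr a i j k } := by
  subst hi hj hk ht; exact Runs.storeWt σ a ei ej e

theorem updateArr_of_ne {α : Type*} (A : ℕ → ℕ → ℕ → α) {a a' : ℕ} (i j : ℕ) (v : α)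
    (h : a' ≠ a) : updateArr A a i j v a' = A a' := by
  unfold updateArr; simp [h]

theorem Eqv.storeNat {σ τ : State} (h : Eqv σ τ) (i j k : ℕ) :
    Eqv { σ with natArr := updateArr σ.natArr 64 i j k } τ :=
  ⟨h.1, fun a ha => by rw [← h.2 a ha]; exact updateArr_of_ne _ _ _ _ ha.ne, h.3, h.4⟩

theorem Eqv.storeWt {σ τ : State} (h : Eqv σ τ) (i j : ℕ) (k : ℝ≥0) :
    Eqv { σ with wtArr := updateArr σ.wtArr 64 i j k } τ :=
  ⟨h.1, h.2, h.3, fun a ha => by rw [← h.4 a ha]; exact updateArr_of_ne _ _ _ _ ha.ne⟩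

theorem Eqv.setN_left {σ τ : State} (h : Eqv σ τ) {x : ℕ} (hx : 64 ≤ x) (k : ℕ) :
    Eqv (σ.setN x k) τ :=
  ⟨fun y hy => by simp [show y ≠ x by omega, h.1 y hy], h.2, h.3, h.4⟩


theorem one_le_ite (q : Prop) [Decidable q] : (1 ≤ if q then 1 else 0) ↔ q := by
  split_ifs with h <;> simp [h]

theorem countLT_succ (i : ℕ) (p : ℕ → Prop) [Decidable (p i)] :
    countLT (i + 1) p = countLT i p + if p i then 1 else 0 := by
  classical
  unfold countLT
  rw [Finset.range_add_one, Finset.filter_insert]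
  split_ifs with h
  · rw [Finset.card_insert_of_notMem (by simp)]
  · simp

theorem Cmd.comp_find {y x : ℕ} {b : Fm} (hc : (Cmd.find y x b).ok = true) {σ τ : State}
    (h : Eqv σ τ) : ∃ t τ', Runs (Cmd.find y x b).comp τ t τ' ∧
      t ≤ (Cmd.find y x b).cost.eval (σ.natReg 0) ∧ Eqv ((Cmd.find y x b).den σ) τ' := by
  classical
  simp only [ok, Bool.and_eq_true, decide_eq_true_eq] at hc
  obtain ⟨⟨⟨⟨hy, hy0⟩, hx⟩, hx0⟩, hb⟩ := hc
  set n := σ.natReg 0 with hn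
  set p : ℕ → Prop := fun i => b.Holds (σ.setN x i) with hp
  have e0 : (τ.setN 64 (τ.natReg x)).natReg 0 = n := by simp [← h.1 0 (by norm_num), hn]
  obtain ⟨t, τ', r, ht, h1, h2, h3⟩ := scan_runs (c := 20 - 11) hx0 hx hb
    (Q := .ite (.and (.natLE (.const 1) (.reg 66)) (.natLE (.reg 0) (.reg 65)))
        (.setNat 65 (.reg x)) .skip) σ
    -- The value `n` means that nothing has been found yet, and it is also the right answer if
    -- nothing is ever found.
    (fun i k _ _ => (k = n ∧ ∀ j < i, ¬ p j) ∨ (k < i ∧ i ≤ n ∧ k = leastLT n p)) (by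
      intro i hi τ' hJ h1 h2
      have hτ0 : τ'.natReg 0 = n := by simpa [hx0.symm] using h1.1 0 (by norm_num)
      have hτx : τ'.natReg x = i := by simpa using h1.1 x hx
      by_cases hh : p i ∧ n ≤ τ'.natReg 65
      · refine ⟨_, _, .ite_true ?_ (setNat_runs' (k := i) (by simpa [NExpr.eval] using hτx) rfl),
          ?_, h1.setN_left (by norm_num) _, ?_, by simp⟩
        · simpa only [Test.Holds, NExpr.eval, h2, hτ0, one_le_ite] using hh
        · simp [Test.steps, NExpr.steps]
        · rcases hJ with hJ | hJ
          · right
            exact ⟨by simp, hi, by simpa using (leastLT_eq hi.le (fun _ => hh.1) hJ.2).symm⟩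
          · omega
      · refine ⟨_, _, .ite_false ?_ (.skip _), ?_, h1, ?_, rfl⟩
        · simpa only [Test.Holds, NExpr.eval, h2, hτ0, one_le_ite] using hh
        · simp [Test.steps, NExpr.steps]
        · rcases hJ with hJ | hJ
          · left
            refine ⟨hJ.1, fun j hj => ?_⟩
            rcases Nat.lt_succ_iff_lt_or_eq.1 hj with hj | rfl
            · exact hJ.2 j hj
            · exact fun h' => hh ⟨h', hJ.1.ge⟩
          · right; exact ⟨by omega, hi, hJ.2.2⟩)
    (τ₀ := (τ.setN 64 (τ.natReg x)).setN 65 n)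
    ((h.symm.setN_left (by norm_num) _).setN_left (by norm_num) _)
    (by left; simp)
  have h4 : τ'.natReg 65 = leastLT n p := by
    rcases h2 with h2 | h2
    · rw [h2.1]; exact (leastLT_eq le_rfl (fun h => absurd h (lt_irrefl _)) h2.2).symm
    · exact h2.2.2
  refine ⟨_, _, .seq (setNat_runs' rfl rfl) (.seq (setNat_runs' e0 rfl) (.seq r
    (.seq (setNat_runs' (k := σ.natReg x) ?_ rfl) (setNat_runs' (k := leastLT n p) ?_ rfl)))),
    ?_, ?_⟩
  · simp only [NExpr.eval, h3]; simp [h.1 x hx]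
  · simp [NExpr.eval, show (65 : ℕ) ≠ x by omega, h4]
  · simp [cost, NExpr.steps]; nlinarith
  · refine ⟨fun z hz => ?_, fun a ha => (h1.2 a ha).symm, fun a ha => (h1.3 a ha).symm,
      fun a ha => (h1.4 a ha).symm⟩
    have := h1.1 z hz
    by_cases hzy : z = y
    · simp [den, hzy, ← hn, hp]
    · by_cases hzx : z = x <;> simp_all [den]

theorem Cmd.comp_count {y x : ℕ} {b : Fm} (hc : (Cmd.count y x b).ok = true) {σ τ : State}
    (h : Eqv σ τ) : ∃ t τ', Runs (Cmd.count y x b).comp τ t τ' ∧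
      t ≤ (Cmd.count y x b).cost.eval (σ.natReg 0) ∧ Eqv ((Cmd.count y x b).den σ) τ' := by
  classical
  simp only [ok, Bool.and_eq_true, decide_eq_true_eq] at hc
  obtain ⟨⟨⟨⟨hy, hy0⟩, hx⟩, hx0⟩, hb⟩ := hc
  set n := σ.natReg 0 with hn
  set p : ℕ → Prop := fun i => b.Holds (σ.setN x i) with hp
  obtain ⟨t, τ', r, ht, h1, h2, h3⟩ := scan_runs (c := 4) hx0 hx hb
    (Q := .setNat 65 (.add (.reg 65) (.reg 66))) σ
    (fun i k _ _ => k = countLT i p) (by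
      intro i hi τ' hJ h1 h2
      refine ⟨_, _, setNat_runs _ _ _, by simp [NExpr.steps], h1.setN_left (by norm_num) _, ?_,
        by simp⟩
      simp [NExpr.eval, hJ, h2, countLT_succ, hp])
    (τ₀ := (τ.setN 64 (τ.natReg x)).setN 65 0)
    ((h.symm.setN_left (by norm_num) _).setN_left (by norm_num) _)
    (by simp [countLT])
  refine ⟨_, _, .seq (setNat_runs' rfl rfl) (.seq (setNat_runs' rfl rfl) (.seq r
    (.seq (setNat_runs' (k := σ.natReg x) ?_ rfl) (setNat_runs' (k := countLT n p) ?_ rfl)))),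
    ?_, ?_⟩
  · simp only [NExpr.eval, h3]; simp [h.1 x hx]
  · simp [NExpr.eval, show (65 : ℕ) ≠ x by omega, h2, ← hn]
  · simp [cost, NExpr.steps]; nlinarith
  · refine ⟨fun z hz => ?_, fun a ha => (h1.2 a ha).symm, fun a ha => (h1.3 a ha).symm,
      fun a ha => (h1.4 a ha).symm⟩
    have := h1.1 z hz
    by_cases hzy : z = y
    · simp [den, hzy, ← hn, hp]
    · by_cases hzx : z = x <;> simp_all [den]

theorem Cmd.comp_allN {x a : ℕ} {i : NExpr} {b : Fm} {e : NExpr}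
    (hc : (Cmd.allN x a i b e).ok = true) {σ τ : State}
    (h : Eqv σ τ) : ∃ t τ', Runs (Cmd.allN x a i b e).comp τ t τ' ∧
      t ≤ (Cmd.allN x a i b e).cost.eval (σ.natReg 0) ∧ Eqv ((Cmd.allN x a i b e).den σ) τ' := by
  classical
  simp only [ok, Bool.and_eq_true, decide_eq_true_eq] at hc
  obtain ⟨⟨⟨⟨⟨hx, hx0⟩, ha⟩, hi⟩, hb⟩, he⟩ := hc
  set n := σ.natReg 0 with hn
  set p : ℕ → Prop := fun i => b.Holds (σ.setN x i) with hp
  -- Values are stored shifted by one, so that `0` marks the entries to be left alone.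
  set f : ℕ → ℕ := fun j => if p j then e.eval (σ.setN x j) + 1 else 0 with hf
  set k := i.eval σ with hk
  obtain ⟨t, τ', r, ht, h1, h2, h3⟩ := scan_runs (c := e.steps + 20) hx0 hx hb
    (Q := .ite (.natLE (.const 1) (.reg 66))
        (.storeNat 64 (.const 0) (.reg x) (.add e (.const 1)))
        (.storeNat 64 (.const 0) (.reg x) (.const 0))) σ
    (fun i m A _ => m = k ∧ ∀ j < i, A 0 j = f j) (by
      intro i hi τ' hJ h1 h2
      have hτx : τ'.natReg x = i := by simpa using h1.1 x hx
      by_cases hh : p i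
      · refine ⟨_, _, .ite_true ?_ (storeNat_runs (k := f i) rfl rfl ?_ rfl), ?_,
          h1.storeNat _ _ _, ⟨hJ.1, fun j hj => ?_⟩, rfl⟩
        · simpa only [Test.Holds, NExpr.eval, h2, one_le_ite] using hh
        · simp only [NExpr.eval, hf, hh, if_true, h1.nexpr e he]
        · simp [Test.steps, NExpr.steps]; omega
        · simp only [updateArr_apply, NExpr.eval, hτx]
          split_ifs with h'
          · rw [h'.2.2]
          · exact hJ.2 j (by simp at h'; omega)
      · refine ⟨_, _, .ite_false ?_ (storeNat_runs (k := f i) rfl rfl ?_ rfl), ?_,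
          h1.storeNat _ _ _, ⟨hJ.1, fun j hj => ?_⟩, rfl⟩
        · simpa only [Test.Holds, NExpr.eval, h2, one_le_ite] using hh
        · simp only [NExpr.eval, hf, hh, if_false]
        · simp [Test.steps, NExpr.steps]
        · simp only [updateArr_apply, NExpr.eval, hτx]
          split_ifs with h'
          · rw [h'.2.2]
          · exact hJ.2 j (by simp at h'; omega))
    (τ₀ := (τ.setN 64 (τ.natReg x)).setN 65 k)
    ((h.symm.setN_left (by norm_num) _).setN_left (by norm_num) _)
    (by simp)
  rw [← hn] at h2 ht h1
  let I : ℕ → State → Prop := fun m τ'' => (∀ y < 64, y ≠ x → τ''.natReg y = σ.natReg y) ∧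
    τ''.natReg 64 = σ.natReg x ∧ τ''.natReg 65 = k ∧
    (∀ j < n, τ''.natArr 64 0 j = f j) ∧
    (∀ a' < 64, ∀ i' j, τ''.natArr a' i' j =
      if a' = a ∧ i' = k ∧ j < m ∧ p j then e.eval (σ.setN x j) else σ.natArr a' i' j) ∧
    (∀ y < 64, τ''.wtReg y = σ.wtReg y) ∧ (∀ y < 64, τ''.wtArr y = σ.wtArr y)
  have x64 : (64 : ℕ) ≠ x := by omega
  have x65 : (65 : ℕ) ≠ x := by omega
  have a64 : (64 : ℕ) ≠ a := by omega
  obtain ⟨t', υ, r', ht', hI, hυx, hυ0⟩ := loop_runs (n := n) (c := 16)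
    (P := .ite (.natLE (.const 1) (.arr 64 (.const 0) (.reg x)))
        (.storeNat a (.reg 65) (.reg x) (.sub (.arr 64 (.const 0) (.reg x)) (.const 1))) .skip)
    hx0 I (by
      rintro m hm υ ⟨g1, g2, g3, g4, g5, g6, g7⟩ hυx hυ0
      by_cases hh : p m
      · refine ⟨_, _, .ite_true ?_ (storeNat_runs (i := k) (j := m)
          (k := e.eval (σ.setN x m)) g3 hυx ?_ rfl), ?_, hυx, hυ0,
          ⟨fun y hy hyx => ?_, ?_, ?_, fun j hj => ?_, fun a' ha' i' j => ?_, g6, g7⟩⟩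
        · simp [Test.Holds, NExpr.eval, hυx, g4 m hm, hf, hh]
        · simp [NExpr.eval, hυx, g4 m hm, hf, hh]
        · simp [Test.steps, NExpr.steps]
        · simp [hyx, g1 y hy hyx]
        · simp [x64, g2]
        · simp [x65, g3]
        · simp [updateArr_apply, a64, g4 j hj]
        · simp only [State.setN_natArr, updateArr_apply, g5 a' ha']
          by_cases h1 : a' = a ∧ i' = k ∧ j = m
          · rw [if_pos h1, if_pos ⟨h1.1, h1.2.1, by omega, h1.2.2 ▸ hh⟩, h1.2.2]
          · rw [if_neg h1]
            refine if_congr ⟨fun h => ⟨h.1, h.2.1, by omega, h.2.2.2⟩, fun h => ⟨h.1, h.2.1, ?_,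
              h.2.2.2⟩⟩ rfl rfl
            have : j ≠ m := fun h' => h1 ⟨h.1, h.2.1, h'⟩
            omega
      · refine ⟨_, _, .ite_false ?_ (.skip _), ?_, hυx, hυ0,
          ⟨fun y hy hyx => ?_, ?_, ?_, g4, fun a' ha' i' j => ?_, g6, g7⟩⟩
        · simp [Test.Holds, NExpr.eval, hυx, g4 m hm, hf, hh]
        · simp [Test.steps, NExpr.steps]
        · simp [hyx, g1 y hy hyx]
        · simp [x64, g2]
        · simp [x65, g3]
        · simp only [State.setN_natArr, g5 a' ha']
          refine if_congr ⟨fun h => ⟨h.1, h.2.1, by omega, h.2.2.2⟩, fun h => ⟨h.1, h.2.1, ?_,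
              h.2.2.2⟩⟩ rfl rfl
          have : j ≠ m := fun h' => hh (h' ▸ h.2.2.2)
          omega)
    (σ := τ') (by simpa [hx0.symm] using h1.1 0 (by norm_num))
    (by
      refine ⟨fun y hy hyx => ?_, ?_, ?_, h2.2, fun a' ha' i' j => ?_, h1.3, h1.4⟩
      · simpa [hyx] using h1.1 y hy
      · simp only [State.setN_natReg, x64, if_false, h3]; simp [h.1 x hx]
      · simp [x65, h2.1]
      · simp [h1.2 a' ha'])
  obtain ⟨g1, g2, g3, g4, g5, g6, g7⟩ := hI
  refine ⟨_, _, .seq (setNat_runs' rfl rfl) (.seq (setNat_runs' (k := k) ?_ rfl) (.seq r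
    (.seq r' (setNat_runs' (k := σ.natReg x) g2 rfl)))), ?_, ?_⟩
  · exact ((h.symm.setN_left (by norm_num) _).nexpr i hi)
  · simp [cost, NExpr.steps]; nlinarith
  · refine ⟨fun z hz => ?_, fun a' ha' => ?_, fun y hy => (g6 y hy).symm,
      fun y hy => (g7 y hy).symm⟩
    · by_cases hzx : z = x
      · simp [den, hzx]
      · simp [den, hzx, g1 z hz hzx]
    · funext i' j
      simp only [den, State.setN_natArr, g5 a' ha']
      rfl

theorem Cmd.comp_allW {x a : ℕ} {i : NExpr} {b : Fm} {e : WExpr}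
    (hc : (Cmd.allW x a i b e).ok = true) {σ τ : State}
    (h : Eqv σ τ) : ∃ t τ', Runs (Cmd.allW x a i b e).comp τ t τ' ∧
      t ≤ (Cmd.allW x a i b e).cost.eval (σ.natReg 0) ∧ Eqv ((Cmd.allW x a i b e).den σ) τ' := by
  classical
  simp only [ok, Bool.and_eq_true, decide_eq_true_eq] at hc
  obtain ⟨⟨⟨⟨⟨hx, hx0⟩, ha⟩, hi⟩, hb⟩, he⟩ := hc
  set n := σ.natReg 0 with hn
  set p : ℕ → Prop := fun i => b.Holds (σ.setN x i) with hp
  set k := i.eval σ with hk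
  obtain ⟨t, τ', r, ht, h1, h2, h3⟩ := scan_runs (c := e.steps + 20) hx0 hx hb
    (Q := .seq (.storeNat 64 (.const 0) (.reg x) (.reg 66))
        (.storeWt 64 (.const 0) (.reg x) e)) σ
    -- A weight has no spare value to serve as a mark, so the truth values are kept in a separate
    -- scratch array of natural numbers.
    (fun i m A B => m = k ∧ ∀ j < i, (A 0 j = if p j then 1 else 0) ∧ B 0 j = e.eval (σ.setN x j))
    (by
      intro i hi τ' hJ h1 h2
      have hτx : τ'.natReg x = i := by simpa using h1.1 x hx
      have h1' := h1.storeNat 0 i (if p i then 1 else 0)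
      refine ⟨_, _, .seq (storeNat_runs (i := 0) (j := i) (k := if p i then 1 else 0) rfl hτx
        (by simpa [NExpr.eval] using h2) rfl)
        (storeWt_runs (i := 0) (j := i) (k := e.eval (σ.setN x i)) rfl hτx (h1'.wexpr e he) rfl),
        ?_, h1'.storeWt _ _ _, ⟨hJ.1, fun j hj => ⟨?_, ?_⟩⟩, rfl⟩
      · simp [NExpr.steps]; omega
      · simp only [updateArr_apply]
        by_cases h' : j = i
        · simp [h']
        · simp [h', (hJ.2 j (by omega)).1]
      · simp only [updateArr_apply]
        split_ifs with h'
        · rw [h'.2.2]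
        · rw [(hJ.2 j (by simp at h'; omega)).2])
    (τ₀ := (τ.setN 64 (τ.natReg x)).setN 65 k)
    ((h.symm.setN_left (by norm_num) _).setN_left (by norm_num) _)
    (by simp)
  rw [← hn] at h2 ht h1
  let I : ℕ → State → Prop := fun m τ'' => (∀ y < 64, y ≠ x → τ''.natReg y = σ.natReg y) ∧
    τ''.natReg 64 = σ.natReg x ∧ τ''.natReg 65 = k ∧
    (∀ j < n, (τ''.natArr 64 0 j = if p j then 1 else 0) ∧
      τ''.wtArr 64 0 j = e.eval (σ.setN x j)) ∧
    (∀ a' < 64, ∀ i' j, τ''.wtArr a' i' j =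
      if a' = a ∧ i' = k ∧ j < m ∧ p j then e.eval (σ.setN x j) else σ.wtArr a' i' j) ∧
    (∀ y < 64, τ''.wtReg y = σ.wtReg y) ∧ (∀ y < 64, τ''.natArr y = σ.natArr y)
  have x64 : (64 : ℕ) ≠ x := by omega
  have x65 : (65 : ℕ) ≠ x := by omega
  have a64 : (64 : ℕ) ≠ a := by omega
  obtain ⟨t', υ, r', ht', hI, hυx, hυ0⟩ := loop_runs (n := n) (c := 16)
    (P := .ite (.natLE (.const 1) (.arr 64 (.const 0) (.reg x)))
        (.storeWt a (.reg 65) (.reg x) (.arr 64 (.const 0) (.reg x))) .skip)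
    hx0 I (by
      rintro m hm υ ⟨g1, g2, g3, g4, g5, g6, g7⟩ hυx hυ0
      by_cases hh : p m
      · refine ⟨_, _, .ite_true ?_ (storeWt_runs (i := k) (j := m)
          (k := e.eval (σ.setN x m)) g3 hυx ?_ rfl), ?_, hυx, hυ0,
          ⟨fun y hy hyx => ?_, ?_, ?_, fun j hj => ?_, fun a' ha' i' j => ?_, g6, g7⟩⟩
        · simp [Test.Holds, NExpr.eval, hυx, (g4 m hm).1, hh]
        · simp [WExpr.eval, NExpr.eval, hυx, (g4 m hm).2]
        · simp [Test.steps, NExpr.steps, WExpr.steps]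
        · simp [hyx, g1 y hy hyx]
        · simp [x64, g2]
        · simp [x65, g3]
        · simp [updateArr_apply, a64, g4 j hj]
        · simp only [State.setN_wtArr, updateArr_apply, g5 a' ha']
          by_cases h1 : a' = a ∧ i' = k ∧ j = m
          · rw [if_pos h1, if_pos ⟨h1.1, h1.2.1, by omega, h1.2.2 ▸ hh⟩, h1.2.2]
          · rw [if_neg h1]
            refine if_congr ⟨fun h => ⟨h.1, h.2.1, by omega, h.2.2.2⟩, fun h => ⟨h.1, h.2.1, ?_,
              h.2.2.2⟩⟩ rfl rfl
            have : j ≠ m := fun h' => h1 ⟨h.1, h.2.1, h'⟩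
            omega
      · refine ⟨_, _, .ite_false ?_ (.skip _), ?_, hυx, hυ0,
          ⟨fun y hy hyx => ?_, ?_, ?_, g4, fun a' ha' i' j => ?_, g6, g7⟩⟩
        · simp [Test.Holds, NExpr.eval, hυx, (g4 m hm).1, hh]
        · simp [Test.steps, NExpr.steps]
        · simp [hyx, g1 y hy hyx]
        · simp [x64, g2]
        · simp [x65, g3]
        · simp only [State.setN_wtArr, g5 a' ha']
          refine if_congr ⟨fun h => ⟨h.1, h.2.1, by omega, h.2.2.2⟩, fun h => ⟨h.1, h.2.1, ?_,
              h.2.2.2⟩⟩ rfl rfl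
          have : j ≠ m := fun h' => hh (h' ▸ h.2.2.2)
          omega)
    (σ := τ') (by simpa [hx0.symm] using h1.1 0 (by norm_num))
    (by
      refine ⟨fun y hy hyx => ?_, ?_, ?_, h2.2, fun a' ha' i' j => ?_, h1.3, h1.2⟩
      · simpa [hyx] using h1.1 y hy
      · simp only [State.setN_natReg, x64, if_false, h3]; simp [h.1 x hx]
      · simp [x65, h2.1]
      · simp [h1.4 a' ha'])
  obtain ⟨g1, g2, g3, g4, g5, g6, g7⟩ := hI
  refine ⟨_, _, .seq (setNat_runs' rfl rfl) (.seq (setNat_runs' (k := k) ?_ rfl) (.seq r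
    (.seq r' (setNat_runs' (k := σ.natReg x) g2 rfl)))), ?_, ?_⟩
  · exact ((h.symm.setN_left (by norm_num) _).nexpr i hi)
  · simp [cost, NExpr.steps]; nlinarith
  · refine ⟨fun z hz => ?_, fun y hy => (g7 y hy).symm, fun y hy => (g6 y hy).symm,
      fun a' ha' => ?_⟩
    · by_cases hzx : z = x
      · simp [den, hzx]
      · simp [den, hzx, g1 z hz hzx]
    · funext i' j
      simp only [den, State.setN_wtArr, g5 a' ha']
      rfl

/-- The compiled program simulates the command in polynomial time. -/
theorem Cmd.comp_runs (c : Cmd) (hc : c.ok = true) {σ τ : State} (h : Eqv σ τ) :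
    ∃ t τ', Runs c.comp τ t τ' ∧ t ≤ c.cost.eval (σ.natReg 0) ∧ Eqv (c.den σ) τ' := by
  classical
  induction c generalizing σ τ with
  | setN x e =>
    simp only [ok, Bool.and_eq_true] at hc
    refine ⟨_, _, setNat_runs _ _ _, by simp [cost], ?_⟩
    rw [← h.nexpr e hc.2]; exact h.setN _ _
  | setW x e =>
    simp only [ok, Bool.and_eq_true] at hc
    refine ⟨_, _, .setWt _ _ _, by simp [cost], ?_⟩
    rw [← h.wexpr e hc.2]
    exact ⟨h.1, h.2, fun y hy => by simp [den, State.setW, Function.update_apply, h.3 y hy], h.4⟩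
  | find y x b => exact comp_find hc h
  | count y x b => exact comp_count hc h
  | allN x a i b e => exact comp_allN hc h
  | allW x a i b e => exact comp_allW hc h
  | seq c₁ c₂ ih₁ ih₂ =>
    simp only [ok, Bool.and_eq_true] at hc
    obtain ⟨t, τ', r, ht, h'⟩ := ih₁ hc.1 h
    obtain ⟨t', τ'', r', ht', h''⟩ := ih₂ hc.2 h'
    rw [den_natReg c₁ (zero_notMem_regs hc.1)] at ht'
    exact ⟨_, _, .seq r r', by simp [cost]; omega, h''⟩
  | ite b c₁ c₂ ih₁ ih₂ =>
    simp only [ok, Bool.and_eq_true] at hc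
    obtain ⟨t, τ', r, ht, h'⟩ := Fm.comp_runs b hc.1.1 64 le_rfl τ
    rw [← h.1 0 (by norm_num)] at ht
    have hh := h.holds b hc.1.1
    have h1 := h.trans (h'.eqv le_rfl)
    by_cases hb : b.Holds σ
    · obtain ⟨t', τ'', r', ht', h''⟩ := ih₁ hc.1.2 h1
      refine ⟨_, _, .seq r (.ite_true ?_ r'), ?_, by simpa [den, hb] using h''⟩
      · simp [Test.Holds, NExpr.eval, h'.5, ← hh, hb]
      · simp [cost, Test.steps, NExpr.steps]; omega
    · obtain ⟨t', τ'', r', ht', h''⟩ := ih₂ hc.2 h1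
      refine ⟨_, _, .seq r (.ite_false ?_ r'), ?_, by simpa [den, hb] using h''⟩
      · simp [Test.Holds, NExpr.eval, h'.5, ← hh, hb]
      · simp [cost, Test.steps, NExpr.steps]; omega
  | forN x c ih =>
    simp only [ok, Bool.and_eq_true, decide_eq_true_eq] at hc
    obtain ⟨⟨⟨hx, hx0⟩, hxc⟩, hc⟩ := hc
    set n := σ.natReg 0 with hn
    let F : ℕ → State := fun m => Nat.rec σ (fun i τ => c.den (τ.setN x i)) m
    have hF0 : ∀ m, (F m).natReg 0 = n := by
      intro m
      induction m with
      | zero => rfl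
      | succ m ihm =>
        change (c.den ((F m).setN x m)).natReg 0 = n
        rw [den_natReg c (zero_notMem_regs hc)]; simp [hx0.symm, ihm]
    obtain ⟨t, τ', r, ht, hI, -, -⟩ := loop_runs (n := n) (c := c.cost.eval n) (P := c.comp) hx0
      (fun i τ => Eqv ((F i).setN x i) τ) (by
        intro i hi τ hτ hτx hτ0
        obtain ⟨t, τ', r, ht, h'⟩ := ih hc hτ
        rw [show ((F i).setN x i).natReg 0 = n by simp [hx0.symm, hF0]] at ht
        refine ⟨t, τ', r, ht, ?_, ?_, ?_⟩
        · rw [← h'.1 x hx, den_natReg c hxc]; simp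
        · rw [← h'.1 0 (by norm_num), den_natReg c (zero_notMem_regs hc)]; simp [hx0.symm, hF0]
        · exact h'.setN _ _)
      (σ := τ) (by rw [hn, h.1 0 (by norm_num)]) (h.setN x 0)
    exact ⟨t, τ', r, by simpa [cost] using ht, hI⟩

end Language


/-! ### Derived connectives and the induction rule for loops. -/

section Sugar

set_option linter.unusedSimpArgs false

namespace Fm

def or (a b : Fm) : Fm := .not (.and (.not a) (.not b))
def imp (a b : Fm) : Fm := .not (.and a (.not b))
def all (x : ℕ) (b : Fm) : Fm := .not (.ex x (.not b))
/-- `e₁ < e₂` -/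
def nlt (e₁ e₂ : NExpr) : Fm := .not (.nle e₂ e₁)
/-- `e₁ = e₂` -/
def neq (e₁ e₂ : NExpr) : Fm := .and (.nle e₁ e₂) (.nle e₂ e₁)
/-- `e₁ < e₂` -/
def wlt (e₁ e₂ : WExpr) : Fm := .not (.wle e₂ e₁)
abbrev true : Fm := .nle (.const 0) (.const 0)

variable (σ : State)

@[simp] theorem holds_nle (a b : NExpr) : (nle a b).Holds σ ↔ a.eval σ ≤ b.eval σ := Iff.rfl
@[simp] theorem holds_wle (a b : WExpr) : (wle a b).Holds σ ↔ a.eval σ ≤ b.eval σ := Iff.rfl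
@[simp] theorem holds_and' (a b : Fm) : (and a b).Holds σ ↔ a.Holds σ ∧ b.Holds σ := Iff.rfl
@[simp] theorem holds_not' (a : Fm) : (not a).Holds σ ↔ ¬ a.Holds σ := Iff.rfl
@[simp] theorem holds_ex' (x : ℕ) (b : Fm) :
    (ex x b).Holds σ ↔ ∃ i < σ.natReg 0, b.Holds (σ.setN x i) := Iff.rfl
@[simp] theorem holds_or (a b : Fm) : (or a b).Holds σ ↔ a.Holds σ ∨ b.Holds σ := by
  unfold or; simp only [holds_not', holds_and']; tauto
@[simp] theorem holds_imp (a b : Fm) : (imp a b).Holds σ ↔ (a.Holds σ → b.Holds σ) := by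
  unfold imp; simp only [holds_not', holds_and']; tauto
@[simp] theorem holds_all (x : ℕ) (b : Fm) :
    (all x b).Holds σ ↔ ∀ i < σ.natReg 0, b.Holds (σ.setN x i) := by
  simp only [all, Holds]; push Not; rfl
@[simp] theorem holds_nlt (a b : NExpr) : (nlt a b).Holds σ ↔ a.eval σ < b.eval σ := by
  simp only [nlt, Holds, not_le]
@[simp] theorem holds_neq (a b : NExpr) : (neq a b).Holds σ ↔ a.eval σ = b.eval σ := by
  simp only [neq, Holds]; omega
@[simp] theorem holds_wlt (a b : WExpr) : (wlt a b).Holds σ ↔ a.eval σ < b.eval σ := by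
  simp only [wlt, Holds, not_le]

end Fm

attribute [simp] NExpr.eval WExpr.eval

/-- Sequential composition of a list of commands. -/
def Cmd.seqs : List Cmd → Cmd
  | [] => .setN 63 (.const 0)
  | [c] => c
  | c :: d :: l => .seq c (Cmd.seqs (d :: l))

/-- The loop rule on the level of the semantics. The exit value of the counter is split off, so that
invariants need not mention it. -/
theorem Cmd.forN_ind {x : ℕ} {c : Cmd} {σ : State} (hx : x ≠ 0) (hc : 0 ∉ c.regs)
    (I : ℕ → State → Prop) (h0 : I 0 σ)
    (hs : ∀ i < σ.natReg 0, ∀ τ, I i τ → τ.natReg 0 = σ.natReg 0 →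
      I (i + 1) (c.den (τ.setN x i))) :
    ∃ τ, I (σ.natReg 0) τ ∧ (Cmd.forN x c).den σ = τ.setN x (σ.natReg 0) := by
  have key : ∀ m ≤ σ.natReg 0, I m (Nat.rec σ (fun i τ => c.den (τ.setN x i)) m) ∧
      (Nat.rec σ (fun i τ => c.den (τ.setN x i)) m : State).natReg 0 = σ.natReg 0 := by
    intro m
    induction m with
    | zero => exact fun _ => ⟨h0, rfl⟩
    | succ m ih =>
      intro hm
      obtain ⟨h1, h2⟩ := ih (by omega)
      refine ⟨hs m (by omega) _ h1 h2, ?_⟩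
      change (c.den (State.setN _ x m)).natReg 0 = _
      rw [Cmd.den_natReg c hc, State.setN_natReg, if_neg hx.symm, h2]
  exact ⟨_, (key _ le_rfl).1, rfl⟩

end Sugar

/-! ### Shortest path trees -/

section Dijkstra

set_option linter.unusedSimpArgs false

/-- A forest of shortest paths on the set `P` of the vertices that can be reached: `val` is the
distance from the sources, `q` the pointer towards the sources, `rk` the order in which vertices are
reached and `anc` the ancestor relation. -/
structure IsSPT {V : Type*} (M : V → V → Prop) (W : V → V → ℝ≥0) (src : V → Prop) (init : V → ℝ≥0)
    (P : V → Prop) (val : V → ℝ≥0) (q : V → V) (rk : V → ℕ) (anc : V → V → Prop) : Prop where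
  src_mem : ∀ v, src v → P v ∧ val v ≤ init v
  edge : ∀ u v, P u → M u v → P v ∧ val v ≤ val u + W u v
  ptr : ∀ v, P v → (q v = v ∧ src v ∧ val v = init v) ∨
    (P (q v) ∧ M (q v) v ∧ val v = val (q v) + W (q v) v ∧ rk (q v) < rk v)
  rk_inj : ∀ u v, P u → P v → rk u = rk v → u = v
  anc_iff : ∀ v, P v → ∀ u, anc v u ↔ u = v ∨ (q v ≠ v ∧ anc (q v) u)

/-- The status `st` is `0` for vertices not reached, `1` for those on the frontier and `2` for
settled ones. By `count`, each of the `k` rounds settles a vertex unless the frontier is empty, so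
`n` rounds suffice. -/
structure DijkstraInv (n : ℕ) (M : ℕ → ℕ → Prop) (W : ℕ → ℕ → ℝ≥0) (src : ℕ → Prop)
    (init : ℕ → ℝ≥0) (k : ℕ) (st : ℕ → ℕ) (val : ℕ → ℝ≥0) (q rk : ℕ → ℕ)
    (anc : ℕ → ℕ → Prop) : Prop where
  src_mem : ∀ v < n, src v → st v ≠ 0 ∧ val v ≤ init v
  edge : ∀ u < n, ∀ v < n, st u = 2 → M u v → st v ≠ 0 ∧ val v ≤ val u + W u v
  ptr : ∀ v < n, st v ≠ 0 → (q v = v ∧ src v ∧ val v = init v) ∨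
    (q v < n ∧ st (q v) = 2 ∧ M (q v) v ∧ val v = val (q v) + W (q v) v ∧
      (st v = 2 → rk (q v) < rk v))
  mono : ∀ u < n, ∀ v < n, st u = 2 → st v = 1 → val u ≤ val v
  rk_lt : ∀ v < n, st v = 2 → rk v < k
  rk_inj : ∀ u < n, ∀ v < n, st u = 2 → st v = 2 → rk u = rk v → u = v
  anc_iff : ∀ v < n, st v = 2 → ∀ u < n, anc v u ↔ u = v ∨ (q v ≠ v ∧ anc (q v) u)
  le_two : ∀ v < n, st v ≤ 2
  count : (∀ v < n, st v ≠ 1) ∨ k ≤ countLT n (fun v => st v = 2)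

theorem countLT_lt {n : ℕ} {p q : ℕ → Prop} (h : ∀ i < n, p i → q i) {j : ℕ} (hj : j < n)
    (hp : ¬ p j) (hq : q j) : countLT n p < countLT n q := by
  classical
  unfold countLT
  apply Finset.card_lt_card
  rw [Finset.ssubset_iff_of_subset]
  · exact ⟨j, by simp [hj, hq], by simp [hp]⟩
  · intro i hi
    simp only [Finset.mem_filter, Finset.mem_range] at hi ⊢
    exact ⟨hi.1, h i hi.1 hi.2⟩

theorem countLT_le (n : ℕ) (p : ℕ → Prop) : countLT n p ≤ n := by
  classical
  unfold countLT
  exact (Finset.card_filter_le _ _).trans (by simp)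

/-- The vertex `v` has the least value on the frontier, and `fl` are the vertices that it reaches or
improves. By `mono` every settled value is at most that of `v`, so edges into settled vertices need
no relaxation; values and pointers of settled vertices are final. The new rank `k` is larger than
all earlier ones. -/
theorem DijkstraInv.step {n : ℕ} {M : ℕ → ℕ → Prop} {W : ℕ → ℕ → ℝ≥0} {src : ℕ → Prop}
    {init : ℕ → ℝ≥0} {k : ℕ} {st : ℕ → ℕ} {val : ℕ → ℝ≥0} {q rk : ℕ → ℕ} {anc : ℕ → ℕ → Prop}
    (h : DijkstraInv n M W src init k st val q rk anc) {v : ℕ} (hv : v < n) (hv1 : st v = 1)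
    (hmin : ∀ u < n, st u = 1 → val v ≤ val u) {fl : ℕ → Prop}
    (hfl : ∀ u < n, fl u ↔ M v u ∧ u ≠ v ∧ st u ≠ 2 ∧ (st u = 0 ∨ val v + W v u < val u))
    {st' : ℕ → ℕ} {val' : ℕ → ℝ≥0} {q' rk' : ℕ → ℕ} {anc' : ℕ → ℕ → Prop}
    (hst₁ : ∀ u < n, fl u → st' u = 1) (hst₂ : ∀ u < n, ¬ fl u → u ≠ v → st' u = st u)
    (hst₃ : ¬ fl v → st' v = 2)
    (hval₁ : ∀ u < n, fl u → val' u = val v + W v u) (hval₂ : ∀ u < n, ¬ fl u → val' u = val u)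
    (hq₁ : ∀ u < n, fl u → q' u = v) (hq₂ : ∀ u < n, ¬ fl u → q' u = q u)
    (hrk₁ : rk' v = k) (hrk₂ : ∀ u < n, u ≠ v → rk' u = rk u)
    (hanc₁ : ∀ u < n, anc' v u ↔ u = v ∨ (q v ≠ v ∧ anc (q v) u))
    (hanc₂ : ∀ w < n, w ≠ v → ∀ u < n, anc' w u ↔ anc w u) :
    DijkstraInv n M W src init (k + 1) st' val' q' rk' anc' := by
  have hnv : ¬ fl v := fun h' => ((hfl v hv).1 h').2.1 rfl
  have hsv : st' v = 2 := hst₃ hnv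
  have h2 : ∀ u < n, st' u = 2 ↔ u = v ∨ st u = 2 := by
    intro u hu
    by_cases hf : fl u
    · have := (hfl u hu).1 hf
      simp [hst₁ u hu hf, this.2.1, this.2.2.1]
    · by_cases huv : u = v
      · subst huv; simp [hsv]
      · simp [hst₂ u hu hf huv, huv]
  have h0 : ∀ u < n, st u ≠ 0 → st' u ≠ 0 := by
    intro u hu hu0
    by_cases hf : fl u
    · simp [hst₁ u hu hf]
    · by_cases huv : u = v
      · subst huv; simp [hsv]
      · simpa [hst₂ u hu hf huv]
  have hdec : ∀ u < n, st u ≠ 0 → val' u ≤ val u := by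
    intro u hu hu0
    by_cases hf : fl u
    · rw [hval₁ u hu hf]
      rcases ((hfl u hu).1 hf).2.2.2 with h' | h'
      · exact absurd h' hu0
      · exact h'.le
    · rw [hval₂ u hu hf]
  have hsame : ∀ u < n, st' u = 2 → val' u = val u ∧ q' u = q u := by
    intro u hu hu2
    have : ¬ fl u := fun hf => by simp [hst₁ u hu hf] at hu2
    exact ⟨hval₂ u hu this, hq₂ u hu this⟩
  refine ⟨?_, ?_, ?_, ?_, ?_, ?_, ?_, ?_, ?_⟩
  · intro u hu hs
    obtain ⟨h1, h3⟩ := h.src_mem u hu hs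
    exact ⟨h0 u hu h1, (hdec u hu h1).trans h3⟩
  · intro u hu x hx hu2 hM
    rw [(hsame u hu hu2).1]
    rcases (h2 u hu).1 hu2 with rfl | hu2'
    · by_cases hf : fl x
      · exact ⟨by simp [hst₁ x hx hf], (hval₁ x hx hf).le⟩
      · by_cases hxu : x = u
        · subst hxu
          exact ⟨by simp [hsv], (hdec x hx (by simp [hv1])).trans le_self_add⟩
        · rw [hst₂ x hx hf hxu, hval₂ x hx hf]
          have h3 : ¬ (st x ≠ 2 ∧ (st x = 0 ∨ val u + W u x < val x)) :=
            fun h' => hf ((hfl x hx).2 ⟨hM, hxu, h'⟩)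
          by_cases hx2 : st x = 2
          · exact ⟨by simp [hx2], (h.mono x hx u hu hx2 hv1).trans le_self_add⟩
          · rw [not_and, not_or, not_lt] at h3
            exact h3 hx2
    · obtain ⟨h1, h3⟩ := h.edge u hu x hx hu2' hM
      exact ⟨h0 x hx h1, (hdec x hx h1).trans h3⟩
  · intro u hu hu0
    by_cases hf : fl u
    · right
      rw [hq₁ u hu hf, hval₁ u hu hf]
      refine ⟨hv, hsv, ((hfl u hu).1 hf).1, by rw [(hsame v hv hsv).1], fun h' => ?_⟩
      simp [hst₁ u hu hf] at h'
    · rw [hq₂ u hu hf, hval₂ u hu hf]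
      have hu0' : st u ≠ 0 := by
        by_cases huv : u = v
        · subst huv; simp [hv1]
        · rwa [hst₂ u hu hf huv] at hu0
      rcases h.ptr u hu hu0' with h' | ⟨h1, h3, h4, h5, h6⟩
      · exact Or.inl h'
      · right
        have h7 : st' (q u) = 2 := (h2 _ h1).2 (Or.inr h3)
        have h8 : q u ≠ v := fun h' => by rw [h', hv1] at h3; norm_num at h3
        refine ⟨h1, h7, h4, by rw [(hsame _ h1 h7).1, h5], fun hu2 => ?_⟩
        rw [hrk₂ _ h1 h8]
        rcases (h2 u hu).1 hu2 with rfl | hu2'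
        · rw [hrk₁]; exact h.rk_lt _ h1 h3
        · rw [hrk₂ u hu (fun h' => by rw [h', hv1] at hu2'; norm_num at hu2')]
          exact h6 hu2'
  · intro u hu x hx hu2 hx1
    rw [(hsame u hu hu2).1]
    have huv : val u ≤ val v := by
      rcases (h2 u hu).1 hu2 with rfl | hu2'
      · exact le_rfl
      · exact h.mono u hu v hv hu2' hv1
    by_cases hf : fl x
    · rw [hval₁ x hx hf]; exact huv.trans le_self_add
    · have hxv : x ≠ v := fun h' => by rw [h', hsv] at hx1; norm_num at hx1
      rw [hst₂ x hx hf hxv] at hx1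
      rw [hval₂ x hx hf]
      exact huv.trans (hmin x hx hx1)
  · intro u hu hu2
    by_cases huv : u = v
    · rw [huv, hrk₁]; omega
    · rw [hrk₂ u hu huv]
      have := h.rk_lt u hu (((h2 u hu).1 hu2).resolve_left huv)
      omega
  · intro u hu x hx hu2 hx2 he
    by_cases huv : u = v <;> by_cases hxv : x = v
    · rw [huv, hxv]
    · rw [huv, hrk₁, hrk₂ x hx hxv] at he
      have := h.rk_lt x hx (((h2 x hx).1 hx2).resolve_left hxv)
      omega
    · rw [hxv, hrk₁, hrk₂ u hu huv] at he
      have := h.rk_lt u hu (((h2 u hu).1 hu2).resolve_left huv)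
      omega
    · rw [hrk₂ u hu huv, hrk₂ x hx hxv] at he
      exact h.rk_inj u hu x hx (((h2 u hu).1 hu2).resolve_left huv)
        (((h2 x hx).1 hx2).resolve_left hxv) he
  · intro x hx hx2 u hu
    rw [(hsame x hx hx2).2]
    have hne : q x ≠ x → q x ≠ v ∧ q x < n := by
      intro hq
      have hx0 : st x ≠ 0 := by
        rcases (h2 x hx).1 hx2 with rfl | h'
        · simp [hv1]
        · simp [h']
      rcases h.ptr x hx hx0 with h' | ⟨h1, h3, -⟩
      · exact absurd h'.1 hq
      · exact ⟨fun h' => by rw [h', hv1] at h3; norm_num at h3, h1⟩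
    by_cases hxv : x = v
    · subst hxv
      rw [hanc₁ u hu]
      refine or_congr Iff.rfl (and_congr_right fun hq => ?_)
      exact (hanc₂ _ (hne hq).2 (hne hq).1 u hu).symm
    · rw [hanc₂ x hx hxv u hu, h.anc_iff x hx (((h2 x hx).1 hx2).resolve_left hxv) u hu]
      refine or_congr Iff.rfl (and_congr_right fun hq => ?_)
      exact (hanc₂ _ (hne hq).2 (hne hq).1 u hu).symm
  · intro u hu
    by_cases hf : fl u
    · simp [hst₁ u hu hf]
    · by_cases huv : u = v
      · subst huv; simp [hsv]
      · rw [hst₂ u hu hf huv]; exact h.le_two u hu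
  · rcases h.count with h' | h'
    · exact absurd hv1 (h' v hv)
    · right
      refine lt_of_le_of_lt h' (countLT_lt (fun u hu hu2 => (h2 u hu).2 (Or.inr hu2)) hv ?_ hsv)
      simp [hv1]

def dijkstraInit : Cmd := .seqs [
  .allN 30 4 (.const 0) .true (.const 0),
  .allN 30 4 (.const 0) (.nle (.const 1) (.arr 3 (.const 0) (.reg 30))) (.const 1),
  .allW 30 4 (.const 0) .true (.arr 3 (.const 0) (.reg 30)),
  .allN 30 5 (.const 0) .true (.reg 30)]

def dijkstraFind : Cmd :=
  .find 11 30 (.and (.neq (.arr 4 (.const 0) (.reg 30)) (.const 1))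
    (.all 31 (.imp (.neq (.arr 4 (.const 0) (.reg 31)) (.const 1))
      (.wle (.arr 4 (.const 0) (.reg 30)) (.arr 4 (.const 0) (.reg 31))))))

/-- The flags of the vertices to be improved go to row `0` of array `8` before any value changes,
the new ancestor row is prepared in row `1`, and weight register `1` keeps the value of the settled
vertex during the update. -/
def dijkstraRelax : Cmd := .seqs [
  .allN 30 8 (.const 0) .true (.const 0),
  .allN 30 8 (.const 0) (.and (.nle (.const 1) (.arr 2 (.reg 11) (.reg 30)))
    (.and (.not (.neq (.reg 30) (.reg 11)))
    (.and (.not (.neq (.arr 4 (.const 0) (.reg 30)) (.const 2)))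
    (.or (.neq (.arr 4 (.const 0) (.reg 30)) (.const 0))
      (.wlt (.add (.arr 4 (.const 0) (.reg 11)) (.arr 2 (.reg 11) (.reg 30)))
        (.arr 4 (.const 0) (.reg 30))))))) (.const 1),
  .allN 30 4 (.const 0) (.neq (.reg 30) (.reg 11)) (.const 2),
  .allN 30 6 (.const 0) (.neq (.reg 30) (.reg 11)) (.reg 10),
  .allN 30 8 (.const 1) .true (.const 0),
  .allN 30 8 (.const 1) (.and (.not (.neq (.arr 5 (.const 0) (.reg 11)) (.reg 11)))
    (.nle (.const 1) (.arr 7 (.arr 5 (.const 0) (.reg 11)) (.reg 30)))) (.const 1),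
  .allN 30 7 (.reg 11) .true (.arr 8 (.const 1) (.reg 30)),
  .allN 30 7 (.reg 11) (.neq (.reg 30) (.reg 11)) (.const 1),
  .setW 1 (.arr 4 (.const 0) (.reg 11)),
  .allW 30 4 (.const 0) (.nle (.const 1) (.arr 8 (.const 0) (.reg 30)))
    (.add (.reg 1) (.arr 2 (.reg 11) (.reg 30))),
  .allN 30 5 (.const 0) (.nle (.const 1) (.arr 8 (.const 0) (.reg 30))) (.reg 11),
  .allN 30 4 (.const 0) (.nle (.const 1) (.arr 8 (.const 0) (.reg 30))) (.const 1)]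

/-- Dijkstra's algorithm. Input: the edges (array `2`) with weights (weight array `2`), the sources
(array `3`) with initial values (weight array `3`). Output: array `4` is `2` at the reached
vertices, weight array `4` holds the distances, array `5` the pointers, array `6` the ranks,
array `7` the ancestor relation. -/
def dijkstra : Cmd := .seq dijkstraInit
  (.forN 10 (.seq dijkstraFind
    (.ite (.nlt (.reg 11) (.reg 0)) dijkstraRelax (.setN 12 (.const 0)))))

/-- A row of vertices held in memory, as a function on `Fin n`. -/
def toFin (n : ℕ) (f : ℕ → ℕ) (v : Fin n) : Fin n := if h : f v < n then ⟨f v, h⟩ else v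

theorem toFin_coe {n : ℕ} {f : ℕ → ℕ} {v : Fin n} (h : f v < n) : (toFin n f v : ℕ) = f v := by
  simp [toFin, h]

theorem dijkstraRelax_inv {n k : ℕ} {M : ℕ → ℕ → Prop} {W : ℕ → ℕ → ℝ≥0} {src : ℕ → Prop}
    {init : ℕ → ℝ≥0} {τ : State} (h0 : τ.natReg 0 = n) (hk : τ.natReg 10 = k)
    (hM : ∀ u v, M u v ↔ 1 ≤ τ.natArr 2 u v) (hW : τ.wtArr 2 = W) (hv : τ.natReg 11 < n)
    (hv1 : τ.natArr 4 0 (τ.natReg 11) = 1)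
    (hmin : ∀ u < n, τ.natArr 4 0 u = 1 → τ.wtArr 4 0 (τ.natReg 11) ≤ τ.wtArr 4 0 u)
    (h : DijkstraInv n M W src init k (τ.natArr 4 0) (τ.wtArr 4 0) (τ.natArr 5 0) (τ.natArr 6 0)
      (fun v u => 1 ≤ τ.natArr 7 v u))
    (hq : ∀ v < n, τ.natArr 5 0 v < n) :
    DijkstraInv n M W src init (k + 1) ((dijkstraRelax.den τ).natArr 4 0)
      ((dijkstraRelax.den τ).wtArr 4 0) ((dijkstraRelax.den τ).natArr 5 0)
      ((dijkstraRelax.den τ).natArr 6 0) (fun v u => 1 ≤ (dijkstraRelax.den τ).natArr 7 v u) ∧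
    ∀ v < n, (dijkstraRelax.den τ).natArr 5 0 v < n := by
  classical
  subst hW h0
  set v := τ.natReg 11 with hvd
  have key := h.step hv hv1 hmin (fl := fun u => M v u ∧ u ≠ v ∧ τ.natArr 4 0 u ≠ 2 ∧
    (τ.natArr 4 0 u = 0 ∨ τ.wtArr 4 0 v + τ.wtArr 2 v u < τ.wtArr 4 0 u)) (fun u hu => Iff.rfl)
    (st' := (dijkstraRelax.den τ).natArr 4 0) (val' := (dijkstraRelax.den τ).wtArr 4 0)
    (q' := (dijkstraRelax.den τ).natArr 5 0) (rk' := (dijkstraRelax.den τ).natArr 6 0)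
    (anc' := fun v u => 1 ≤ (dijkstraRelax.den τ).natArr 7 v u)
    (by intro u hu hf; rw [hM] at hf; simp [dijkstraRelax, Cmd.seqs, Cmd.den, hu, ← hvd, hf])
    (by
      intro u hu hf huv; rw [hM] at hf
      simp [dijkstraRelax, Cmd.seqs, Cmd.den, hu, ← hvd, one_le_ite, huv]
      intro h1 h2 h3
      exact absurd ⟨h1, huv, h2, h3⟩ hf)
    (by
      intro hf
      simp [dijkstraRelax, Cmd.seqs, Cmd.den, ← hvd, hv])
    (by intro u hu hf; rw [hM] at hf; simp [dijkstraRelax, Cmd.seqs, Cmd.den, hu, ← hvd, hf])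
    (by
      intro u hu hf; rw [hM] at hf
      simp [dijkstraRelax, Cmd.seqs, Cmd.den, hu, ← hvd, hf, one_le_ite])
    (by intro u hu hf; rw [hM] at hf; simp [dijkstraRelax, Cmd.seqs, Cmd.den, hu, ← hvd, hf])
    (by
      intro u hu hf; rw [hM] at hf
      simp [dijkstraRelax, Cmd.seqs, Cmd.den, hu, ← hvd, hf, one_le_ite])
    (by simp [dijkstraRelax, Cmd.seqs, Cmd.den, ← hvd, hv, hk])
    (by intro u hu huv; simp [dijkstraRelax, Cmd.seqs, Cmd.den, ← hvd, huv])
    (by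
      intro u hu
      by_cases huv : u = v <;>
      simp [dijkstraRelax, Cmd.seqs, Cmd.den, hu, ← hvd, huv, one_le_ite, hv])
    (by intro x hx hxv u hu; simp [dijkstraRelax, Cmd.seqs, Cmd.den, ← hvd, hxv])
  refine ⟨key, fun u hu => ?_⟩
  simp only [dijkstraRelax, Cmd.seqs, Cmd.den]
  simp [hu, ← hvd]
  split_ifs
  all_goals first | exact hv | exact hq u hu

theorem dijkstra_spec {n : ℕ} (σ : State) (hn : σ.natReg 0 = n) :
    IsSPT (V := Fin n) (fun u v => 1 ≤ σ.natArr 2 u v) (fun u v => σ.wtArr 2 u v)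
      (fun v => 1 ≤ σ.natArr 3 0 v) (fun v => σ.wtArr 3 0 v)
      (fun v => (dijkstra.den σ).natArr 4 0 v = 2) (fun v => (dijkstra.den σ).wtArr 4 0 v)
      (toFin n ((dijkstra.den σ).natArr 5 0)) (fun v => (dijkstra.den σ).natArr 6 0 v)
      (fun v u => 1 ≤ (dijkstra.den σ).natArr 7 v u) ∧
    ∀ v < n, (dijkstra.den σ).natArr 5 0 v < n := by
  classical
  subst hn
  set n := σ.natReg 0 with hn
  obtain ⟨τ, ⟨hI0, hI2, hIW, hI, hIq⟩, hτ⟩ := Cmd.forN_ind (x := 10) (c := (.seq dijkstraFind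
    (.ite (.nlt (.reg 11) (.reg 0)) dijkstraRelax (.setN 12 (.const 0)))))
    (σ := dijkstraInit.den σ) (by norm_num) (by decide)
    (fun k τ => τ.natReg 0 = n ∧ τ.natArr 2 = σ.natArr 2 ∧ τ.wtArr 2 = σ.wtArr 2 ∧
      DijkstraInv n (fun u v => 1 ≤ σ.natArr 2 u v)
      (σ.wtArr 2) (fun v => 1 ≤ σ.natArr 3 0 v) (σ.wtArr 3 0) k
      (τ.natArr 4 0) (τ.wtArr 4 0) (τ.natArr 5 0) (τ.natArr 6 0) (fun v u => 1 ≤ τ.natArr 7 v u) ∧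
      ∀ v < n, τ.natArr 5 0 v < n)
    (by
      refine ⟨rfl, by simp [dijkstraInit, Cmd.seqs, Cmd.den],
        by simp [dijkstraInit, Cmd.seqs, Cmd.den], ?_, ?_⟩
      · have h4 : ∀ v < n, (dijkstraInit.den σ).natArr 4 0 v =
            if 1 ≤ σ.natArr 3 0 v then 1 else 0 := by
          intro v hv; simp [dijkstraInit, Cmd.seqs, Cmd.den, hv, ← hn]
        have hw : ∀ v < n, (dijkstraInit.den σ).wtArr 4 0 v = σ.wtArr 3 0 v := by
          intro v hv; simp [dijkstraInit, Cmd.seqs, Cmd.den, hv, ← hn]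
        have h5 : ∀ v < n, (dijkstraInit.den σ).natArr 5 0 v = v := by
          intro v hv; simp [dijkstraInit, Cmd.seqs, Cmd.den, hv, ← hn]
        have hne : ∀ v < n, (dijkstraInit.den σ).natArr 4 0 v ≠ 2 := by
          intro v hv; rw [h4 v hv]; split_ifs <;> simp
        refine ⟨fun v hv hs => by simp [h4 v hv, hs, hw v hv], fun u hu v hv h2 => absurd h2 (hne u hu),
          fun v hv h => Or.inl ⟨h5 v hv, ?_, hw v hv⟩, fun u hu v hv h2 => absurd h2 (hne u hu),
          fun u hu h2 => absurd h2 (hne u hu), fun u hu v hv h2 => absurd h2 (hne u hu),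
          fun u hu h2 => absurd h2 (hne u hu), fun v hv => ?_, Or.inr (Nat.zero_le _)⟩
        · rw [h4 v hv] at h
          by_contra h'; simp [h'] at h
        · rw [h4 v hv]; split_ifs <;> simp
      · intro v hv; simp [dijkstraInit, Cmd.seqs, Cmd.den, hv, ← hn])
    (by
      rintro k hk τ ⟨h0, h2, h3, hI, hq⟩ -
      set υ := dijkstraFind.den (τ.setN 10 k) with hυ
      have e0 : υ.natReg 0 = n := by simp [hυ, dijkstraFind, Cmd.den, h0]
      have e10 : υ.natReg 10 = k := by simp [hυ, dijkstraFind, Cmd.den]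
      have eA : υ.natArr = τ.natArr := rfl
      have eW : υ.wtArr = τ.wtArr := rfl
      have e11 : υ.natReg 11 = leastLT n (fun i => τ.natArr 4 0 i = 1 ∧
          ∀ u < n, τ.natArr 4 0 u = 1 → τ.wtArr 4 0 i ≤ τ.wtArr 4 0 u) := by
        simp [hυ, dijkstraFind, Cmd.den, h0]
      change (fun k τ => τ.natReg 0 = n ∧ τ.natArr 2 = σ.natArr 2 ∧ τ.wtArr 2 = σ.wtArr 2 ∧
        DijkstraInv n (fun u v => 1 ≤ σ.natArr 2 u v)
        (σ.wtArr 2) (fun v => 1 ≤ σ.natArr 3 0 v) (σ.wtArr 3 0) k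
        (τ.natArr 4 0) (τ.wtArr 4 0) (τ.natArr 5 0) (τ.natArr 6 0)
        (fun v u => 1 ≤ τ.natArr 7 v u) ∧
        ∀ v < n, τ.natArr 5 0 v < n) (k + 1) ((Cmd.ite (.nlt (.reg 11) (.reg 0)) dijkstraRelax
          (.setN 12 (.const 0))).den υ)
      rw [Cmd.den]
      by_cases hlt : υ.natReg 11 < n
      · rw [if_pos (by simpa [e0] using hlt)]
        have hsp := hlt
        rw [e11] at hsp
        obtain ⟨hs1, hs2⟩ := leastLT_spec hsp
        rw [← e11] at hs1 hs2
        have := dijkstraRelax_inv (τ := υ) (k := k) e0 e10 (M := fun u v => 1 ≤ σ.natArr 2 u v)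
          (fun u v => by rw [eA, h2]) (by rw [eW, h3]) hlt hs1 hs2 hI hq
        refine ⟨?_, ?_, ?_, this⟩
        · rw [Cmd.den_natReg _ (by decide), e0]
        · rw [Cmd.den_natArr _ (by decide), eA, h2]
        · rw [Cmd.den_wtArr _ (by decide), eW, h3]
      · rw [if_neg (by simpa [e0] using hlt)]
        refine ⟨by simp [Cmd.den, e0], h2, h3, ⟨hI.src_mem, hI.edge, hI.ptr, hI.mono, ?_,
          hI.rk_inj, hI.anc_iff, hI.le_two, Or.inl ?_⟩, hq⟩
        · intro v hv h; exact (hI.rk_lt v hv h).trans (Nat.lt_succ_self _)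
        · intro v hv h1
          apply hlt
          obtain ⟨v', hv', hmin⟩ := Finset.exists_min_image
            ((Finset.range n).filter (fun i => τ.natArr 4 0 i = 1)) (τ.wtArr 4 0)
            ⟨v, by simpa using ⟨hv, h1⟩⟩
          simp only [Finset.mem_filter, Finset.mem_range] at hv' hmin
          rw [e11]
          exact leastLT_lt hv'.1 ⟨hv'.2, fun u hu h => hmin u ⟨hu, h⟩⟩)
  have hd : dijkstra.den σ = τ.setN 10 n := hτ
  rw [hd]
  simp only [State.setN_natArr, State.setN_wtArr]
  change DijkstraInv n _ _ _ _ n _ _ _ _ _ at hI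
  refine ⟨?_, hIq⟩
  -- After `n` rounds a frontier vertex would leave fewer than `n` settled ones, against `count`.
  have h1 : ∀ v < n, τ.natArr 4 0 v ≠ 1 := by
    rcases hI.count with h | h
    · exact h
    · intro v hv h'
      have := countLT_lt (p := fun v => τ.natArr 4 0 v = 2) (q := fun _ => True) (n := n)
        (fun _ _ _ => trivial) hv (by simp [h']) trivial
      have := countLT_le n (fun _ => True)
      omega
  have h2 : ∀ v < n, τ.natArr 4 0 v ≠ 0 → τ.natArr 4 0 v = 2 := by
    intro v hv h
    have := h1 v hv
    have := hI.le_two v hv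
    omega
  have hqc : ∀ v : Fin n, (toFin n (τ.natArr 5 0) v : ℕ) = τ.natArr 5 0 v :=
    fun v => toFin_coe (hIq v v.2)
  refine ⟨fun v hs => ?_, fun u v hu huv => ?_, fun v hv => ?_, fun u v hu hv h => ?_,
    fun v hv u => ?_⟩
  · obtain ⟨a, b⟩ := hI.src_mem v v.2 hs
    exact ⟨h2 v v.2 a, b⟩
  · obtain ⟨a, b⟩ := hI.edge u u.2 v v.2 hu huv
    exact ⟨h2 v v.2 a, b⟩
  · rcases hI.ptr v v.2 (by omega) with ⟨a, b, c⟩ | ⟨a, b, c, d, e⟩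
    · exact Or.inl ⟨Fin.ext (by rw [hqc, a]), b, c⟩
    · right
      simp only [hqc]
      exact ⟨b, c, d, e hv⟩
  · exact Fin.ext (hI.rk_inj u u.2 v v.2 hu hv h)
  · rw [hI.anc_iff v v.2 hv u u.2]
    simp only [Fin.ext_iff, ne_eq, hqc]

end Dijkstra


/-! ### Lengths of walks and distances -/

section Walks

variable {V : Type*} {G : SimpleGraph V}

/-- The length of a walk with respect to edge weights. -/
noncomputable def wl (w : Sym2 V → ℝ≥0) : ∀ {u v : V}, G.Walk u v → ℝ≥0
  | _, _, .nil => 0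
  | u, _, .cons (v := x) _ p => w s(u, x) + wl w p

variable (w : Sym2 V → ℝ≥0)

@[simp] theorem wl_nil (u : V) : wl w (.nil : G.Walk u u) = 0 := rfl

@[simp] theorem wl_cons {u x v : V} (h : G.Adj u x) (p : G.Walk x v) :
    wl w (.cons h p) = w s(u, x) + wl w p := rfl

@[simp] theorem wl_append {u x v : V} (p : G.Walk u x) (q : G.Walk x v) :
    wl w (p.append q) = wl w p + wl w q := by
  induction p with
  | nil => simp
  | cons h p ih => simp [ih, add_assoc]

@[simp] theorem wl_reverse {u v : V} (p : G.Walk u v) : wl w p.reverse = wl w p := by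
  induction p with
  | nil => simp
  | cons h p ih => simp [ih, Sym2.eq_swap, add_comm]

/-- `D` is the distance function of the weighted graph `(G, w)`. -/
structure IsDist (G : SimpleGraph V) (w : Sym2 V → ℝ≥0) (D : V → V → ℝ≥0) : Prop where
  le : ∀ {u v : V} (p : G.Walk u v), D u v ≤ wl w p
  exists_walk : ∀ u v : V, ∃ p : G.Walk u v, wl w p = D u v

variable {w} {D : V → V → ℝ≥0}

theorem IsDist.self (h : IsDist G w D) (u : V) : D u u = 0 :=
  le_antisymm (h.le (.nil : G.Walk u u)) zero_le

theorem IsDist.symm (h : IsDist G w D) (u v : V) : D u v = D v u := by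
  have key : ∀ u v, D u v ≤ D v u := by
    intro u v
    obtain ⟨p, hp⟩ := h.exists_walk v u
    rw [← hp, ← wl_reverse]
    exact h.le _
  exact le_antisymm (key _ _) (key _ _)

theorem IsDist.triangle (h : IsDist G w D) (u v x : V) : D u x ≤ D u v + D v x := by
  obtain ⟨p, hp⟩ := h.exists_walk u v
  obtain ⟨q, hq⟩ := h.exists_walk v x
  rw [← hp, ← hq, ← wl_append]
  exact h.le _

theorem IsDist.edge (h : IsDist G w D) {u v : V} (huv : G.Adj u v) : D u v ≤ w s(u, v) := by
  simpa using h.le (SimpleGraph.Walk.cons huv .nil)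

theorem IsDist.mem_support_le (h : IsDist G w D) {u v x : V} (p : G.Walk u v)
    (hx : x ∈ p.support) : D u x ≤ wl w p := by
  induction p with
  | nil =>
    simp only [SimpleGraph.Walk.support_nil, List.mem_singleton] at hx
    subst hx
    simp [h.self]
  | @cons a b c hab p ih =>
    rw [SimpleGraph.Walk.support_cons, List.mem_cons] at hx
    rcases hx with rfl | hx
    · simp [h.self]
    · rw [wl_cons]
      exact (h.triangle a b x).trans (add_le_add (h.edge hab) (ih hx))

end Walks

/-! ### Properties of shortest path forests. -/

section SPT

variable {V : Type*} {M : V → V → Prop} {W : V → V → ℝ≥0} {src : V → Prop} {init : V → ℝ≥0}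
  {P : V → Prop} {val : V → ℝ≥0} {q : V → V} {rk : V → ℕ} {anc : V → V → Prop}
  {G : SimpleGraph V} {w : Sym2 V → ℝ≥0}

/-- Sum the edge inequality along the walk. Only edges between vertices of the walk have to be
present, which allows walks confined to a class. -/
theorem IsSPT.walk_le (h : IsSPT M W src init P val q rk anc) {u v : V} (p : G.Walk u v)
    (hp : ∀ a b, G.Adj a b → a ∈ p.support → b ∈ p.support → M a b ∧ W a b ≤ w s(a, b))
    (hu : P u) : P v ∧ val v ≤ val u + wl w p := by
  induction p with
  | nil => simpa using hu
  | @cons a b c hab p ih =>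
    obtain ⟨h1, h2⟩ := hp a b hab (by simp) (by simp)
    obtain ⟨h3, h4⟩ := h.edge a b hu h1
    obtain ⟨h5, h6⟩ := ih (fun x y hxy hx hy => hp x y hxy (by simp [hx]) (by simp [hy])) h3
    refine ⟨h5, h6.trans ?_⟩
    rw [wl_cons, ← add_assoc]
    gcongr
    exact h4.trans (by gcongr)

/-- Ranks drop along pointers, so properties can be propagated from the sources outwards. -/
theorem IsSPT.induction (h : IsSPT M W src init P val q rk anc) {Q : V → Prop}
    (h0 : ∀ v, P v → q v = v → src v → val v = init v → Q v)
    (h1 : ∀ v, P v → q v ≠ v → P (q v) → M (q v) v → val v = val (q v) + W (q v) v →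
      rk (q v) < rk v → Q (q v) → Q v) (v : V) (hv : P v) : Q v := by
  induction hr : rk v using Nat.strong_induction_on generalizing v with
  | _ k ih =>
    rcases h.ptr v hv with ⟨a, b, c⟩ | ⟨a, b, c, d⟩
    · exact h0 v hv a b c
    · exact h1 v hv (fun h' => by rw [h'] at d; exact lt_irrefl _ d) a b c d
        (ih _ (hr ▸ d) _ a rfl)

theorem IsSPT.anc_self (h : IsSPT M W src init P val q rk anc) {v : V} (hv : P v) : anc v v :=
  (h.anc_iff v hv v).2 (Or.inl rfl)

theorem IsSPT.anc_rk (h : IsSPT M W src init P val q rk anc) {v : V} (hv : P v) :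
    ∀ u, anc v u → rk u ≤ rk v := by
  refine h.induction (Q := fun v => ∀ u, anc v u → rk u ≤ rk v) ?_ ?_ v hv
  · intro v hv hq _ _ u hu
    rcases (h.anc_iff v hv u).1 hu with rfl | h'
    · exact le_rfl
    · exact absurd hq h'.1
  · intro v hv _ _ _ _ hlt ih u hu
    rcases (h.anc_iff v hv u).1 hu with rfl | h'
    · exact le_rfl
    · exact (ih u h'.2).trans hlt.le

theorem IsSPT.anc_trans (h : IsSPT M W src init P val q rk anc) {v : V} (hv : P v) :
    ∀ u x, anc v u → anc u x → anc v x := by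
  refine h.induction (Q := fun v => ∀ u x, anc v u → anc u x → anc v x) ?_ ?_ v hv
  · intro v hv hq _ _ u x hu hx
    rcases (h.anc_iff v hv u).1 hu with rfl | h'
    · exact hx
    · exact absurd hq h'.1
  · intro v hv hne _ _ _ hlt ih u x hu hx
    rcases (h.anc_iff v hv u).1 hu with rfl | h'
    · exact hx
    · exact (h.anc_iff v hv x).2 (Or.inr ⟨hne, ih u x h'.2 hx⟩)

/-- Two ancestors of a vertex are comparable. -/
theorem IsSPT.anc_total (h : IsSPT M W src init P val q rk anc) {v : V} (hv : P v) :
    ∀ u x, anc v u → anc v x → anc u x ∨ anc x u := by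
  refine h.induction (Q := fun v => ∀ u x, anc v u → anc v x → anc u x ∨ anc x u) ?_ ?_ v hv
  · intro v hv hq _ _ u x hu hx
    rcases (h.anc_iff v hv u).1 hu with rfl | h'
    · exact Or.inl hx
    · exact absurd hq h'.1
  · intro v hv hne _ _ _ hlt ih u x hu hx
    rcases (h.anc_iff v hv u).1 hu with rfl | h'
    · exact Or.inl hx
    · rcases (h.anc_iff v hv x).1 hx with rfl | h''
      · exact Or.inr hu
      · exact ih u x h'.2 h''.2

/-- Following the pointers leads to a source, along a shortest path. -/
theorem IsSPT.exists_walk (h : IsSPT M W src init P val q rk anc)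
    (hM : ∀ a b, M a b → G.Adj a b ∧ W a b = w s(a, b)) (v : V) (hv : P v) :
    ∃ z, src z ∧ ∃ p : G.Walk v z, val v = wl w p + init z := by
  refine h.induction (Q := fun v => ∃ z, src z ∧ ∃ p : G.Walk v z, val v = wl w p + init z)
    ?_ ?_ v hv
  · intro v _ _ hs hi
    exact ⟨v, hs, .nil, by simp [hi]⟩
  · rintro v _ _ _ hm hval _ ⟨z, hz, p, hp⟩
    refine ⟨z, hz, .cons (hM _ _ hm).1.symm p, ?_⟩
    have := (hM _ _ hm).2
    rw [wl_cons, Sym2.eq_swap, ← this, hval, hp]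
    ring

end SPT

/-! ### Numbers of classes met by walks. -/

section Labels

variable {V : Type*} [DecidableEq V] {G : SimpleGraph V} {w : Sym2 V → ℝ≥0}
  {D : V → V → ℝ≥0}

/-- A walk visits few classes of a partition such that small balls meet few classes. -/
theorem card_labels_sdiff_mul_le [Fintype V] (hD : IsDist G w D) {c : V → V} {ρ : ℝ≥0} {β : ℕ} (hβ : 1 ≤ β)
    (hball : ∀ v, ((Finset.univ.filter fun x => D v x < ρ).image c).card ≤ β) {u v : V}
    (p : G.Walk u v) (a : V) (x : ℝ≥0) (hx : D a u ≤ x) :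
    ((p.support.toFinset.image c \ (Finset.univ.filter fun x => D a x < ρ).image c).card : ℝ≥0) * ρ
      ≤ β * (wl w p + x) := by
  have hβ' : (1 : ℝ≥0) ≤ β := by exact_mod_cast hβ
  induction p generalizing a x with
  | @nil u =>
    by_cases h : D a u < ρ
    · have : ((SimpleGraph.Walk.nil : G.Walk u u).support.toFinset.image c \
          (Finset.univ.filter fun x => D a x < ρ).image c) = ∅ := by
        simp only [SimpleGraph.Walk.support_nil, List.toFinset_cons, List.toFinset_nil,
          insert_empty_eq, Finset.image_singleton, Finset.sdiff_eq_empty_iff_subset,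
          Finset.singleton_subset_iff, Finset.mem_image, Finset.mem_filter, Finset.mem_univ,
          true_and]
        exact ⟨u, h, rfl⟩
      rw [this]; simp
    · have h1 : ((SimpleGraph.Walk.nil : G.Walk u u).support.toFinset.image c \
          (Finset.univ.filter fun x => D a x < ρ).image c).card ≤ 1 :=
        (Finset.card_le_card Finset.sdiff_subset).trans (by simp)
      have h2 : (((SimpleGraph.Walk.nil : G.Walk u u).support.toFinset.image c \
          (Finset.univ.filter fun x => D a x < ρ).image c).card : ℝ≥0) ≤ 1 := by exact_mod_cast h1
      calc _ ≤ 1 * ρ := by gcongr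
        _ ≤ 1 * x := by gcongr; exact (not_lt.1 h).trans hx
        _ ≤ β * (wl w (SimpleGraph.Walk.nil : G.Walk u u) + x) := by simp only [wl_nil, zero_add]; gcongr
  | @cons u y v huy p ih =>
    have hsub : ∀ S : Finset V, c u ∈ S →
        (SimpleGraph.Walk.cons huy p).support.toFinset.image c \ S =
          p.support.toFinset.image c \ S := by
      intro S hS
      ext z
      simp only [SimpleGraph.Walk.support_cons, List.toFinset_cons, Finset.image_insert,
        Finset.mem_sdiff, Finset.mem_insert]
      constructor
      · rintro ⟨rfl | h, h'⟩
        · exact absurd hS h'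
        · exact ⟨h, h'⟩
      · rintro ⟨h, h'⟩; exact ⟨Or.inr h, h'⟩
    -- The vertex `a` is the centre of the current ball, and `x` bounds the length walked since.
    -- Inside the ball no new class is counted; once outside, `x ≥ ρ` pays for the at most `β`
    -- classes of the ball about `u`, which becomes the new centre.
    by_cases h : D a u < ρ
    · rw [hsub _ (Finset.mem_image_of_mem c (by simp [h]))]
      refine (ih a (x + w s(u, y)) ((hD.triangle a u y).trans
        (add_le_add hx (hD.edge huy)))).trans (le_of_eq ?_)
      rw [wl_cons]; ring
    · rcases eq_or_ne ρ 0 with rfl | hρ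
      · simp
      · have huu : c u ∈ (Finset.univ.filter fun x => D u x < ρ).image c :=
          Finset.mem_image_of_mem c (by simp [hD.self, pos_iff_ne_zero, hρ])
        have h1 := ih u (w s(u, y)) (hD.edge huy)
        rw [← hsub _ huu] at h1
        set A := (SimpleGraph.Walk.cons huy p).support.toFinset.image c
        set B := (Finset.univ.filter fun x => D u x < ρ).image c
        have h2 : (A \ (Finset.univ.filter fun x => D a x < ρ).image c).card ≤
            B.card + (A \ B).card := by
          refine (Finset.card_le_card (Finset.sdiff_subset.trans ?_)).trans
            (Finset.card_union_le _ _)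
          intro z hz; simp only [Finset.mem_union, Finset.mem_sdiff]; tauto
        have h3 : ((A \ (Finset.univ.filter fun x => D a x < ρ).image c).card : ℝ≥0) ≤
            β + (A \ B).card := by
          exact_mod_cast h2.trans (by gcongr; exact hball u)
        calc _ ≤ (β + (A \ B).card : ℝ≥0) * ρ := by gcongr
          _ = β * ρ + (A \ B).card * ρ := by ring
          _ ≤ β * x + β * (wl w p + w s(u, y)) := by
            gcongr
            exact (not_lt.1 h).trans hx
          _ = _ := by rw [wl_cons]; ring

/-- Start with the ball about the first vertex, whose at most `β` classes give the extra summand `β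
* ρ`. -/
theorem card_labels_mul_le [Fintype V] (hD : IsDist G w D) {c : V → V} {ρ : ℝ≥0} {β : ℕ} (hβ : 1 ≤ β)
    (hball : ∀ v, ((Finset.univ.filter fun x => D v x < ρ).image c).card ≤ β) {u v : V}
    (p : G.Walk u v) : ((p.support.toFinset.image c).card : ℝ≥0) * ρ ≤ β * (wl w p + ρ) := by
  have h1 := card_labels_sdiff_mul_le hD hβ hball p u 0 (by simp [hD.self])
  set A := p.support.toFinset.image c
  set B := (Finset.univ.filter fun x => D u x < ρ).image c
  have h2 : A.card ≤ B.card + (A \ B).card := by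
    refine (Finset.card_le_card ?_).trans (Finset.card_union_le _ _)
    intro z hz; simp only [Finset.mem_union, Finset.mem_sdiff]; tauto
  have h3 : (A.card : ℝ≥0) ≤ β + (A \ B).card := by
    exact_mod_cast h2.trans (by gcongr; exact hball u)
  calc _ ≤ (β + (A \ B).card : ℝ≥0) * ρ := by gcongr
    _ = β * ρ + (A \ B).card * ρ := by ring
    _ ≤ β * ρ + β * (wl w p + 0) := by gcongr
    _ = _ := by ring

/-- Distances that charge `Δ` for each change of class. -/
theorem le_add_labels {c : V → V} {Δ : ℝ≥0} {val : V → ℝ≥0} {u s : V} (p : G.Walk u s)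
    (hc : ∀ x y, x ∈ p.support → y ∈ p.support → c x = c y → val x ≤ val y)
    (he : ∀ x y, G.Adj x y → x ∈ p.support → y ∈ p.support → val x ≤ val y + w s(x, y) + Δ) :
    ∀ x ∈ p.support, val x ≤ val s + wl w p + (p.support.toFinset.image c).card * Δ := by
  induction p with
  | nil => simp
  | @cons u y v huy p ih =>
    have ih' := ih (fun x y hx hy => hc x y (by simp [hx]) (by simp [hy]))
      (fun x y h hx hy => he x y h (by simp [hx]) (by simp [hy]))
    have hle : (p.support.toFinset.image c).card ≤
        ((SimpleGraph.Walk.cons huy p).support.toFinset.image c).card := by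
      apply Finset.card_le_card
      simp only [SimpleGraph.Walk.support_cons, List.toFinset_cons, Finset.image_insert]
      exact Finset.subset_insert _ _
    have hp : ∀ x ∈ p.support, val x ≤ val v + wl w (.cons huy p) +
        ((SimpleGraph.Walk.cons huy p).support.toFinset.image c).card * Δ := by
      intro x hx
      refine (ih' x hx).trans ?_
      rw [wl_cons]
      gcongr
      exact le_add_self
    intro x hx
    rw [SimpleGraph.Walk.support_cons, List.mem_cons] at hx
    rcases hx with rfl | hx
    -- If the class of the first vertex occurs again, the value at the later vertex can be used free
    -- of charge; otherwise the edge pays `Δ` and the number of classes rises by one. Thus distinct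
    -- classes are charged, not crossings.
    · by_cases h : c x ∈ p.support.toFinset.image c
      · obtain ⟨z, hz, hzx⟩ := Finset.mem_image.1 h
        rw [List.mem_toFinset] at hz
        exact (hc x z (by simp) (by simp [hz]) hzx.symm).trans (hp z hz)
      · have hcard : ((SimpleGraph.Walk.cons huy p).support.toFinset.image c).card =
            (p.support.toFinset.image c).card + 1 := by
          simp only [SimpleGraph.Walk.support_cons, List.toFinset_cons, Finset.image_insert]
          exact Finset.card_insert_of_notMem h
        refine (he x y huy (by simp) (by simp)).trans ?_
        rw [hcard, wl_cons]
        push_cast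
        calc _ ≤ (val v + wl w p + (p.support.toFinset.image c).card * Δ) + w s(x, y) + Δ := by
              gcongr
              exact ih' y (by simp)
          _ = _ := by ring
    · exact hp x hx

end Labels


/-! ### Nets with offsets -/

section Net

variable {V : Type*} {G : SimpleGraph V} {w : Sym2 V → ℝ≥0} {D : V → V → ℝ≥0}

open Classical in
/-- A hierarchy of nets: a point of level `j + 1` has at least `s` points of level `j` nearby, the
points of level `j + 1` are far from each other, and maximal with these properties. -/
structure IsNet [Fintype V] (D : V → V → ℝ≥0) (b : ℕ → ℝ≥0) (s t : ℕ) (Z : ℕ → V → Prop) : Prop where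
  zero : ∀ v, Z 0 v
  big : ∀ j < t, ∀ v, Z (j + 1) v →
    s ≤ (Finset.univ.filter fun z => Z j z ∧ D v z ≤ b (j + 1)).card
  sep : ∀ j < t, ∀ u v, Z (j + 1) u → Z (j + 1) v → u ≠ v → 2 * b (j + 1) < D u v
  max : ∀ j < t, ∀ v, s ≤ (Finset.univ.filter fun z => Z j z ∧ D v z ≤ b (j + 1)).card →
    ∃ u, Z (j + 1) u ∧ D v u ≤ 2 * b (j + 1)

-- The balls of radius `b (j + 1)` about points of level `j + 1` are disjoint by separation, and
-- each contains `s` points of level `j`; so every level is smaller by a factor `s`.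
open Classical in
theorem IsNet.card_mul_le [Fintype V] {b : ℕ → ℝ≥0} {s t : ℕ} {Z : ℕ → V → Prop} (hZ : IsNet D b s t Z)
    (hD : IsDist G w D) : ∀ j ≤ t, (Finset.univ.filter (Z j)).card * s ^ j ≤ Fintype.card V := by
  intro j
  induction j with
  | zero => intro _; simpa using Finset.card_le_univ _
  | succ j ih =>
    intro hj
    refine le_trans ?_ (ih (by omega))
    rw [pow_succ, mul_comm (s ^ j), ← mul_assoc]
    gcongr
    calc (Finset.univ.filter (Z (j + 1))).card * s
        ≤ ∑ v ∈ Finset.univ.filter (Z (j + 1)),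
          (Finset.univ.filter fun z => Z j z ∧ D v z ≤ b (j + 1)).card := by
          rw [← smul_eq_mul]
          apply Finset.card_nsmul_le_sum
          intro v hv
          exact hZ.big j (by omega) v (by simpa using hv)
      _ = ((Finset.univ.filter (Z (j + 1))).biUnion fun v =>
          (Finset.univ.filter fun z => Z j z ∧ D v z ≤ b (j + 1))).card := by
          rw [Finset.card_biUnion]
          intro u hu v hv huv
          simp only [Function.onFun]
          rw [Finset.disjoint_left]
          intro z hz hz'
          simp only [Finset.mem_filter, Finset.mem_univ, true_and, Finset.coe_filter,
            Set.mem_ofPred_eq] at hu hv hz hz'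
          refine absurd (hZ.sep j (by omega) u v hu hv huv) (not_lt.2 ?_)
          refine (hD.triangle u z v).trans ?_
          rw [hD.symm z v, two_mul]
          exact add_le_add hz.2 hz'.2
      _ ≤ (Finset.univ.filter (Z j)).card := by
          apply Finset.card_le_card
          intro z hz
          simp only [Finset.mem_biUnion, Finset.mem_filter, Finset.mem_univ, true_and] at hz ⊢
          obtain ⟨v, -, h, -⟩ := hz
          exact h

/-- The offsets of the levels. -/
noncomputable def levelOffset (b : ℕ → ℝ≥0) (t : ℕ) : ℕ → ℝ≥0
  | 0 => 4 * b t
  | k + 1 => levelOffset b t k + 4 * b (t - k)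

/-- The offsets of the points of a net with root `r`: points of higher levels have smaller
offsets. -/
structure IsOffset (r : V) (b : ℕ → ℝ≥0) (t : ℕ) (Z : ℕ → V → Prop) (off : V → ℝ≥0) : Prop where
  root : off r = 0
  level : ∀ v ≠ r, ∃ j ≤ t, Z j v ∧ off v = levelOffset b t (t - j) ∧
    ∀ j' ≤ t, Z j' v → j' ≤ j

variable {b : ℕ → ℝ≥0} {t : ℕ}

/-- The offset of level `j` is `4 * b t` plus four times the sum of `b i` for `j < i ≤ t`. For the
ratio `8` this geometric sum makes `7 * offset + 32 * b j` the same for all levels. -/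
theorem levelOffset_add (hb : ∀ j, b (j + 1) = 8 * b j) {j j' : ℕ} (hj : j ≤ j') (hj' : j' ≤ t) :
    7 * levelOffset b t (t - j) + 32 * b j = 7 * levelOffset b t (t - j') + 32 * b j' := by
  induction j', hj using Nat.le_induction with
  | base => rfl
  | succ k hk ih =>
    rw [ih (by omega)]
    have h1 : t - k = (t - (k + 1)) + 1 := by omega
    rw [h1, levelOffset, hb, show t - (t - (k + 1)) = k + 1 by omega, hb]
    ring

/-- Descending to a level below `j'` costs at least `4 * b j'`, more than the distance `2 * b j'` at
which maximality of the net provides a point of level `j'`. -/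
theorem levelOffset_lt {j j' : ℕ} (hj : j < j') (hj' : j' ≤ t) :
    levelOffset b t (t - j') + 4 * b j' ≤ levelOffset b t (t - j) := by
  induction j', hj using Nat.le_induction with
  | base =>
    have h1 : t - j = (t - (j + 1)) + 1 := by omega
    rw [h1, levelOffset, show t - (t - (j + 1)) = j + 1 by omega]
  | succ k hk ih =>
    refine le_trans ?_ (ih (by omega))
    have h1 : t - k = (t - (k + 1)) + 1 := by omega
    rw [h1, levelOffset, show t - (t - (k + 1)) = k + 1 by omega]
    exact le_self_add

theorem le_levelOffset (k : ℕ) : 4 * b t ≤ levelOffset b t k := by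
  induction k with
  | zero => rfl
  | succ k ih => exact ih.trans le_self_add

variable {Z : ℕ → V → Prop} {off : V → ℝ≥0} {r : V}

/-- The common value of `levelOffset_add` is `60 * b t`, so no offset exceeds `60 / 7 * b t`. -/
theorem IsOffset.offset_le (ho : IsOffset r b t Z off)
    (hb : ∀ j, b (j + 1) = 8 * b j) (v : V) : off v ≤ 9 * b t := by
  by_cases hv : v = r
  · rw [hv, ho.root]; exact zero_le
  · obtain ⟨j, hj, -, h, -⟩ := ho.level v hv
    have h1 := levelOffset_add hb (Nat.zero_le t) le_rfl
    have h2 := levelOffset_add hb (Nat.zero_le j) hj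
    have h3 := levelOffset_add hb hj le_rfl
    rw [h]
    simp only [Nat.sub_self, levelOffset] at h1 h2 h3
    have h4 := congrArg NNReal.toReal h3
    rw [← NNReal.coe_le_coe]
    push_cast at h4 ⊢
    have : (0 : ℝ) ≤ b j := (b j).2
    have : (0 : ℝ) ≤ b t := (b t).2
    linarith

theorem IsOffset.le (ho : IsOffset r b t Z off) {v : V} (hv : v ≠ r) : 4 * b t ≤ off v := by
  obtain ⟨j, hj, -, h, -⟩ := ho.level v hv
  rw [h]
  exact le_levelOffset _

open Classical in
/-- Every vertex has few almost nearest portals. -/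
theorem IsNet.card_portals_le [Fintype V] {s : ℕ} (hs : 1 ≤ s) (hZ : IsNet D b s t Z)
    (ho : IsOffset r b t Z off) (hD : IsDist G w D) (hb : ∀ j, b (j + 1) = 8 * b j)
    (hb0 : 0 < b 0) (hn : Fintype.card V ≤ s ^ t) {v : V} {d : ℝ≥0} (hd : ∀ p, d ≤ D v p + off p) :
    (Finset.univ.filter fun p => D v p + off p ≤ d + 3 * b 0).card ≤ 1 + (t + 1) * s := by
  have hbm : ∀ i j, i ≤ j → b i ≤ b j := by
    intro i j hij
    induction j, hij using Nat.le_induction with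
    | base => rfl
    | succ k _ ih =>
      rw [hb]
      refine ih.trans (le_mul_of_one_le_left zero_le (by norm_num))
  have hbm' : ∀ i j, i < j → 8 * b i ≤ b j := fun i j hij => hb i ▸ hbm _ _ hij
  -- The level `m` is the highest one with a net point near `v`; that point bounds `d`.
  let near : ℕ → Prop := fun j => ∃ z, Z j z ∧ (j = 0 ∧ z = v ∨ 0 < j ∧ D v z ≤ 2 * b j)
  set m := Nat.findGreatest near t with hm
  have hnear : near m := Nat.findGreatest_spec (m := 0) (Nat.zero_le t)
    ⟨v, hZ.zero v, Or.inl ⟨rfl, rfl⟩⟩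
  have hmt : m ≤ t := Nat.findGreatest_le t
  have hmax : ∀ j, m < j → j ≤ t → ¬ near j := fun j h1 h2 => Nat.findGreatest_is_greatest h1 h2
  obtain ⟨z, hz, hzv⟩ := hnear
  have hoz : off z ≤ levelOffset b t (t - m) := by
    by_cases hzr : z = r
    · rw [hzr, ho.root]; exact zero_le
    · obtain ⟨j, hj, h1, h2, h3⟩ := ho.level z hzr
      rw [h2]
      rcases (h3 m hmt hz).eq_or_lt with h | h
      · rw [h]
      · exact le_self_add.trans (levelOffset_lt h hj)
  have hdm : d ≤ 2 * b m + levelOffset b t (t - m) := by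
    refine (hd z).trans (add_le_add ?_ hoz)
    rcases hzv with ⟨-, rfl⟩ | ⟨-, h⟩
    · rw [hD.self]; exact zero_le
    · exact h
  -- More than `s` points of level `j` in this ball would by maximality produce a point of level `j
  -- + 1` near `v`, against the choice of `m`. At level `t` the whole net has at most one point.
  have hlev : ∀ j ≤ t, (Finset.univ.filter fun p => Z j p ∧ m ≤ j ∧ D v p ≤ b (j + 1)).card ≤ s := by
    intro j hj
    by_cases hmj : m ≤ j
    · rcases hj.eq_or_lt with rfl | hjt
      · refine (Finset.card_le_card (t := Finset.univ.filter (Z j)) ?_).trans (le_trans ?_ hs)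
        · intro p; simp only [Finset.mem_filter]; tauto
        · have h1 := (hZ.card_mul_le hD j le_rfl).trans hn
          have h2 : 0 < s ^ j := pow_pos hs j
          by_contra hlt
          push Not at hlt
          nlinarith
      · by_contra hlt
        push Not at hlt
        obtain ⟨u, hu1, hu2⟩ := hZ.max j hjt v (hlt.le.trans (Finset.card_le_card (by
          intro p; simp only [Finset.mem_filter]; tauto)))
        exact hmax (j + 1) (by omega) (by omega) ⟨u, hu1, Or.inr ⟨by omega, hu2⟩⟩
    · rw [Finset.filter_false_of_mem (fun p _ h => hmj h.2.1)]; simp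
  have hsub : (Finset.univ.filter fun p => D v p + off p ≤ d + 3 * b 0) ⊆ {r} ∪
      (Finset.range (t + 1)).biUnion fun j =>
        Finset.univ.filter fun p => Z j p ∧ m ≤ j ∧ D v p ≤ b (j + 1) := by
    intro p hp
    simp only [Finset.mem_filter, Finset.mem_univ, true_and, Finset.mem_union,
      Finset.mem_singleton, Finset.mem_biUnion, Finset.mem_range] at hp ⊢
    by_cases hpr : p = r
    · exact Or.inl hpr
    · right
      obtain ⟨j, hj, h1, h2, h3⟩ := ho.level p hpr
      rw [h2] at hp
      -- A portal of a lower level has an offset at least `4 * b m` above that of level `m`, but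
      -- almost nearest portals allow only `2 * b m + 3 * b 0`, and `8 * b 0 ≤ b m`.
      have hmj : m ≤ j := by
        by_contra hlt
        push Not at hlt
        have h4 := levelOffset_lt (b := b) hlt hmt
        have h5 := hbm' 0 m (by omega)
        rw [← NNReal.coe_le_coe] at hp hdm h4 h5
        rw [← NNReal.coe_lt_coe] at hb0
        push_cast at hp hdm h4 h5 hb0
        have : (0 : ℝ) ≤ D v p := (D v p).2
        linarith
      refine ⟨j, by omega, h1, hmj, ?_⟩
      -- The offsets of levels `m` and `j` differ by `32 / 7 * (b j - b m)`, so the distance to `p`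
      -- is at most `2 * b m + 32 / 7 * (b j - b m) + 3 * b 0`, which is below `8 * b j = b (j +
      -- 1)`.
      have h4 := congrArg NNReal.toReal (levelOffset_add hb hmj hj)
      have h6 := hbm 0 m (Nat.zero_le m)
      rw [hb]
      have hbm0 : (0 : ℝ) ≤ b m := (b m).2
      have hbj0 : (0 : ℝ) ≤ b j := (b j).2
      rcases hmj.eq_or_lt with h | h
      · subst h
        rw [← NNReal.coe_le_coe] at hp hdm h6 ⊢
        push_cast at hp hdm h4 h6 ⊢
        linarith
      · have h5 := hbm' m j h
        rw [← NNReal.coe_le_coe] at hp hdm h5 h6 ⊢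
        push_cast at hp hdm h4 h5 h6 ⊢
        linarith
  calc _ ≤ _ := Finset.card_le_card hsub
    _ ≤ 1 + ∑ j ∈ Finset.range (t + 1), s := by
      refine (Finset.card_union_le _ _).trans (add_le_add (by simp) ?_)
      refine Finset.card_biUnion_le.trans (Finset.sum_le_sum fun j hj => hlev j ?_)
      rw [Finset.mem_range] at hj; omega
    _ = _ := by simp

end Net


/-! ### Aggregation of clusters -/

section Aggregation

variable {V : Type*} {G : SimpleGraph V} {w : Sym2 V → ℝ≥0} {c : V → V} {Δ : ℝ≥0}
  {off val : V → ℝ≥0} {q : V → V} {rk : V → ℕ} {anc : V → V → Prop}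

/-- Clusters (the fibres of `c`) of strong diameter at most `Δ`, and a shortest path forest with
offsets `off`. -/
structure IsClustering (G : SimpleGraph V) (w : Sym2 V → ℝ≥0) (c : V → V) (Δ : ℝ≥0)
    (off val : V → ℝ≥0) (q : V → V) (rk : V → ℕ) (anc : V → V → Prop) : Prop where
  spt : IsSPT G.Adj (fun u v => w s(u, v)) (fun _ => True) off (fun _ => True) val q rk anc
  walk : ∀ u v, c u = c v → ∃ p : G.Walk u v, (∀ x ∈ p.support, c x = c u) ∧ wl w p ≤ Δ

/-- The pointers lead from a vertex to the set `U`, and all the vertices on the way (up to the first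
one in `U`) satisfy `un`. -/
inductive Hit (q : V → V) (un U : V → Prop) : V → Prop
  | base {v : V} : U v → Hit q un U v
  | step {v : V} : un v → q v ≠ v → Hit q un U (q v) → Hit q un U v

theorem Hit.mono {un U un' U' : V → Prop} (h : ∀ v, un v → un' v) (h' : ∀ v, U v → U' v) {v : V}
    (hv : Hit q un U v) : Hit q un' U' v := by
  induction hv with
  | base hv => exact .base (h' _ hv)
  | step h1 h2 _ ih => exact .step (h _ h1) h2 ih

theorem Hit.or {un U U' : V → Prop} {v : V} (hv : Hit q un (fun x => U x ∨ U' x) v) :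
    Hit q un U v ∨ Hit q un U' v := by
  induction hv with
  | base hv => exact hv.imp .base .base
  | step h1 h2 _ ih => exact ih.imp (.step h1 h2) (.step h1 h2)

/-- This turns an inductive predicate into a formula in the ancestor relation with quantifiers over
vertices, which the program can evaluate. -/
theorem IsClustering.hit_iff (h : IsClustering G w c Δ off val q rk anc) {un U : V → Prop}
    (hU : ∀ v, U v → un v) (v : V) :
    Hit q un U v ↔ ∃ y, anc v y ∧ U y ∧ ∀ y', anc v y' → anc y' y → un y' := by
  constructor
  · intro hv
    induction hv with
    | @base v hv =>
      refine ⟨v, h.spt.anc_self trivial, hv, fun y' h1 h2 => ?_⟩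
      have : y' = v := h.spt.rk_inj _ _ trivial trivial
        (le_antisymm (h.spt.anc_rk trivial _ h1) (h.spt.anc_rk trivial _ h2))
      exact this ▸ hU v hv
    | @step v h1 h2 _ ih =>
      obtain ⟨y, hy, hUy, hall⟩ := ih
      refine ⟨y, (h.spt.anc_iff v trivial y).2 (Or.inr ⟨h2, hy⟩), hUy, fun y' h3 h4 => ?_⟩
      rcases (h.spt.anc_iff v trivial y').1 h3 with rfl | h5
      · exact h1
      · exact hall y' h5.2 h4
  · rintro ⟨y, hy, hUy, hall⟩
    refine h.spt.induction (Q := fun v => anc v y → (∀ y', anc v y' → anc y' y → un y') →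
      Hit q un U v) ?_ ?_ v trivial hy hall
    · intro v _ hq _ _ hv _
      rcases (h.spt.anc_iff v trivial y).1 hv with rfl | h'
      · exact .base hUy
      · exact absurd hq h'.1
    · intro v _ hq _ _ _ _ ih hv hall
      rcases (h.spt.anc_iff v trivial y).1 hv with rfl | h'
      · exact .base hUy
      · exact .step (hall v (h.spt.anc_self trivial) hv) hq (ih h'.2 fun y' h1 h2 =>
          hall y' ((h.spt.anc_iff v trivial y').2 (Or.inr ⟨hq, h1⟩)) h2)

theorem IsClustering.val_le (h : IsClustering G w c Δ off val q rk anc) {u v : V}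
    (p : G.Walk u v) : val v ≤ val u + wl w p :=
  (h.spt.walk_le p (fun _ _ hab _ _ => ⟨hab, le_rfl⟩) trivial).2

/-- Pointers follow shortest paths, so the walk to `U` loses nothing compared with `val`, and all
its vertices belong to the next layer or to `U`. -/
theorem IsClustering.exists_walk_of_hit (h : IsClustering G w c Δ off val q rk anc)
    {un U : V → Prop} {v : V} (hv : Hit q un U v) : ∃ y, U y ∧ ∃ p : G.Walk v y,
      (∀ x ∈ p.support, Hit q un U x ∧ (U x ∨ un x)) ∧ val v = wl w p + val y := by
  induction hv with
  | @base v hv =>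
    refine ⟨v, hv, .nil, fun x hx => ?_, by simp⟩
    simp only [SimpleGraph.Walk.support_nil, List.mem_singleton] at hx
    exact hx ▸ ⟨.base hv, Or.inl hv⟩
  | @step v h1 h2 h3 ih =>
    obtain ⟨y, hy, p, hp, hval⟩ := ih
    rcases h.spt.ptr v trivial with h' | ⟨-, hadj, hv, -⟩
    · exact absurd h'.1 h2
    · refine ⟨y, hy, .cons hadj.symm p, fun x hx => ?_, ?_⟩
      · rw [SimpleGraph.Walk.support_cons, List.mem_cons] at hx
        rcases hx with rfl | hx
        · exact ⟨.step h1 h2 h3, Or.inr h1⟩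
        · exact hp x hx
      · rw [hv, hval, wl_cons, Sym2.eq_swap]; ring

/-- A set `U` of unassigned vertices from which the portal `f` can be reached with additive
error `e`, through `U` and the vertices assigned to `f`. -/
structure IsLayer (G : SimpleGraph V) (w : Sym2 V → ℝ≥0) (c : V → V) (off val : V → ℝ≥0)
    (st : V → ℕ) (port : V → V) (f : V) (e : ℝ≥0) (U : V → Prop) : Prop where
  sub : ∀ u, U u → st u ≤ 1
  cls : ∀ u v, c u = c v → U u → U v
  walk : ∀ u, U u → ∃ p : G.Walk u f, (∀ x ∈ p.support, U x ∨ (2 ≤ st x ∧ port x = f)) ∧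
    wl w p + off f ≤ val u + e

/-- The next layer: the unassigned clusters with a vertex whose pointers lead to `U`. -/
def nextLayer (c : V → V) (q : V → V) (st : V → ℕ) (U : V → Prop) (u : V) : Prop :=
  st u ≤ 1 ∧ ∃ v, c v = c u ∧ Hit q (fun x => st x ≤ 1) U v

theorem IsLayer.subset_next {st : V → ℕ} {port : V → V} {f : V} {e : ℝ≥0} {U : V → Prop}
    (hU : IsLayer G w c off val st port f e U) {u : V} (hu : U u) : nextLayer c q st U u :=
  ⟨hU.sub u hu, u, rfl, .base hu⟩

/-- From a new vertex go inside its cluster to the vertex whose pointers lead to `U`, follow them,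
and continue from `U`. The walk in the cluster has length at most `Δ` and raises `val` by at most
`Δ`; the pointers cause no error. -/
theorem IsClustering.next (h : IsClustering G w c Δ off val q rk anc) {st : V → ℕ} {port : V → V}
    (hst : ∀ u v, c u = c v → st u = st v) {f : V} {e : ℝ≥0} {U : V → Prop}
    (hU : IsLayer G w c off val st port f e U) :
    IsLayer G w c off val st port f (e + 2 * Δ) (nextLayer c q st U) := by
  refine ⟨fun u hu => hu.1, fun u v huv hu => ⟨hst u v huv ▸ hu.1, ?_⟩, fun u hu => ?_⟩
  · obtain ⟨-, x, hx, hh⟩ := hu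
    exact ⟨x, hx.trans huv, hh⟩
  · obtain ⟨hu1, x, hx, hh⟩ := hu
    obtain ⟨p₁, hp₁, hl₁⟩ := h.walk u x hx.symm
    obtain ⟨y, hy, p₂, hp₂, hl₂⟩ := h.exists_walk_of_hit hh
    obtain ⟨p₃, hp₃, hl₃⟩ := hU.walk y hy
    refine ⟨p₁.append (p₂.append p₃), fun z hz => ?_, ?_⟩
    · simp only [SimpleGraph.Walk.mem_support_append_iff] at hz
      rcases hz with hz | hz | hz
      · exact Or.inl ⟨hst u z (hp₁ z hz).symm ▸ hu1, x, hx.trans (hp₁ z hz).symm, hh⟩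
      · obtain ⟨h1, h2⟩ := hp₂ z hz
        exact Or.inl ⟨h2.elim (hU.sub z) id, z, rfl, h1⟩
      · rcases hp₃ z hz with h' | h'
        · exact Or.inl (hU.subset_next h')
        · exact Or.inr h'
    · have h4 := h.val_le p₁
      rw [wl_append, wl_append]
      calc wl w p₁ + (wl w p₂ + wl w p₃) + off f = wl w p₁ + wl w p₂ + (wl w p₃ + off f) := by ring
        _ ≤ Δ + wl w p₂ + (val y + e) := by gcongr
        _ = Δ + val x + e := by rw [hl₂]; ring
        _ ≤ Δ + (val u + Δ) + e := by gcongr; exact h4.trans (by gcongr)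
        _ = val u + (e + 2 * Δ) := by ring

/-- The portal assigned to `v` can be reached from `v` with additive error `e`, through
vertices with the same portal. -/
def GoodPort (G : SimpleGraph V) (w : Sym2 V → ℝ≥0) (off val : V → ℝ≥0) (st : V → ℕ)
    (port : V → V) (e : ℝ≥0) (v : V) : Prop :=
  ∃ p : G.Walk v (port v), (∀ x ∈ p.support, 2 ≤ st x ∧ port x = port v) ∧
    wl w p + off (port v) ≤ val v + e

/-- The whole cluster of `v` is the first layer. Either `v` is a source of the forest and becomes
the portal itself, or its pointer leads to a vertex assigned in an earlier phase, whose portal is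
inherited. -/
theorem IsClustering.isLayer_seed (h : IsClustering G w c Δ off val q rk anc) {st : V → ℕ}
    {port : V → V} (hst : ∀ u v, c u = c v → st u = st v) {e : ℝ≥0} {v : V} (hv : st v ≤ 1)
    (hq : q v = v ∨ st (q v) = 3)
    (hg : st (q v) = 3 → GoodPort G w off val st port e (q v)) {f : V}
    (hf : q v = v → f = v) (hf' : q v ≠ v → f = port (q v)) :
    IsLayer G w c off val st port f (e + 2 * Δ) (fun u => c u = c v) := by
  refine ⟨fun u hu => (hst u v hu) ▸ hv, fun u x hux hu => hux.symm.trans hu, fun u hu => ?_⟩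
  obtain ⟨p, hp, hl⟩ := h.walk u v hu
  have h1 := h.val_le p
  by_cases hqv : q v = v
  · obtain rfl := hf hqv
    have h2 : val f = off f := by
      rcases h.spt.ptr f trivial with h' | ⟨-, -, -, h'⟩
      · exact h'.2.2
      · rw [hqv] at h'; exact absurd h' (lt_irrefl _)
    refine ⟨p, fun x hx => Or.inl ((hp x hx).trans hu), ?_⟩
    rw [← h2]
    calc wl w p + val f ≤ Δ + (val u + Δ) := by gcongr; exact h1.trans (by gcongr)
      _ ≤ Δ + (val u + Δ) + e := le_self_add
      _ = _ := by ring
  · have h3 := hq.resolve_left hqv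
    obtain ⟨p', hp', hl'⟩ := hg h3
    obtain rfl := hf' hqv
    rcases h.spt.ptr v trivial with h' | ⟨-, hadj, hval, -⟩
    · exact absurd h'.1 hqv
    · refine ⟨p.append (.cons hadj.symm p'), fun x hx => ?_, ?_⟩
      · rw [SimpleGraph.Walk.mem_support_append_iff, SimpleGraph.Walk.support_cons,
          List.mem_cons] at hx
        rcases hx with hx | rfl | hx
        · exact Or.inl ((hp x hx).trans hu)
        · exact Or.inl rfl
        · exact Or.inr (hp' x hx)
      · rw [wl_append, wl_cons, Sym2.eq_swap]
        calc wl w p + (w s(q v, v) + wl w p') + off (port (q v))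
            = wl w p + w s(q v, v) + (wl w p' + off (port (q v))) := by ring
          _ ≤ Δ + w s(q v, v) + (val (q v) + e) := by gcongr
          _ = Δ + val v + e := by rw [hval]; ring
          _ ≤ Δ + (val u + Δ) + e := by gcongr; exact h1.trans (by gcongr)
          _ = _ := by ring

open Classical in
/-- The invariant of the aggregation in phase `k`: `st` is `0` for active vertices, `1` for
deferred ones, `2` for those assigned in this phase and `3` for those assigned before. -/
structure AggInv [Fintype V] (G : SimpleGraph V) (w : Sym2 V → ℝ≥0) (c : V → V)
    (off val : V → ℝ≥0) (q : V → V) (k l : ℕ) (ε : ℝ≥0) (st : V → ℕ) (port : V → V)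
    (done : V → Prop) : Prop where
  cls : ∀ u v, c u = c v → st u = st v
  cls_port : ∀ u v, c u = c v → 2 ≤ st u → port u = port v
  old : ∀ v, st v = 3 → GoodPort G w off val st port (min k (l + 1) * ε) v
  new : ∀ v, st v = 2 → GoodPort G w off val st port (min (k + 1) (l + 1) * ε) v
  avoid : ∀ v, st v = 0 → ¬ Hit q (fun x => st x ≤ 1) (fun x => st x = 2) v
  count : (Finset.univ.filter fun v => st v = 1).card ≤ (Finset.univ.filter fun v => st v = 2).card
  total : (Finset.univ.filter fun v => st v ≤ 2).card * 2 ^ k ≤ Fintype.card V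
  le_three : ∀ v, st v ≤ 3
  seeds : ∀ v, done v → st v ≤ 1 → q v ≠ v ∧ st (q v) ≠ 3

-- A vertex that remains active is not in the next layer, so its pointers cannot run into `U`
-- through unassigned vertices; this keeps `avoid`. By `hgrow` the newly deferred vertices are at
-- most as many as the active ones in `U`, which are assigned now; this keeps `count`.
open Classical in
theorem AggInv.step [Fintype V] {k l : ℕ} {ε : ℝ≥0} {st : V → ℕ} {port : V → V} {done : V → Prop}
    (h : AggInv G w c off val q k l ε st port done) {f : V} {U : V → Prop}
    (hU : IsLayer G w c off val st port f (min (k + 1) (l + 1) * ε) U)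
    (hgrow : (Finset.univ.filter fun v => nextLayer c q st U v ∧ st v = 0).card ≤
      2 * (Finset.univ.filter fun v => U v ∧ st v = 0).card)
    {st' : V → ℕ} {port' : V → V} (h1 : ∀ v, U v → st' v = 2 ∧ port' v = f)
    (h2 : ∀ v, ¬ U v → nextLayer c q st U v → st v = 0 → st' v = 1)
    (h3 : ∀ v, ¬ U v → ¬ (nextLayer c q st U v ∧ st v = 0) → st' v = st v)
    (h4 : ∀ v, ¬ U v → port' v = port v) {done' : V → Prop}
    (hdone : ∀ v, done' v → done v ∨ U v) :
    AggInv G w c off val q k l ε st' port' done' := by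
  have hnl : ∀ u v, c u = c v → nextLayer c q st U u → nextLayer c q st U v := by
    rintro u v huv ⟨ha, x, hx, hh⟩
    exact ⟨h.cls u v huv ▸ ha, x, hx.trans huv, hh⟩
  have hUn : ∀ v, U v → st v ≤ 1 := hU.sub
  have hge : ∀ v, 2 ≤ st v → st' v = st v ∧ port' v = port v := by
    intro v hv
    have hnU : ¬ U v := fun h' => by have := hUn v h'; omega
    exact ⟨h3 v hnU (fun h' => by omega), h4 v hnU⟩
  have hle : ∀ v, st v ≤ 1 → st' v ≤ 2 := by
    intro v hv
    by_cases ha : U v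
    · rw [(h1 v ha).1]
    · by_cases hb : nextLayer c q st U v ∧ st v = 0
      · rw [h2 v ha hb.1 hb.2]; norm_num
      · rw [h3 v ha hb]; omega
  have hle1 : ∀ v, st' v ≤ 1 → ¬ U v ∧ st v ≤ 1 := by
    intro v hv
    refine ⟨fun ha => by rw [(h1 v ha).1] at hv; omega, ?_⟩
    by_contra hb
    push Not at hb
    have := (hge v hb).1
    omega
  have h2iff : ∀ v, st' v = 2 ↔ st v = 2 ∨ U v := by
    intro v
    by_cases ha : U v
    · simp [(h1 v ha).1, ha]
    · by_cases hb : nextLayer c q st U v ∧ st v = 0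
      · rw [h2 v ha hb.1 hb.2]; simp [ha, hb.2]
      · rw [h3 v ha hb]; simp [ha]
  have h3iff : ∀ v, st' v = 3 ↔ st v = 3 := by
    intro v
    by_cases ha : U v
    · have := hUn v ha
      rw [(h1 v ha).1]; omega
    · by_cases hb : nextLayer c q st U v ∧ st v = 0
      · rw [h2 v ha hb.1 hb.2]; omega
      · rw [h3 v ha hb]
  have hgood : ∀ e v, 2 ≤ st v → GoodPort G w off val st port e v →
      GoodPort G w off val st' port' e v := by
    rintro e v hv ⟨p, hp, hl⟩
    refine ⟨p.copy rfl (hge v hv).2.symm, fun x hx => ?_, ?_⟩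
    · rw [SimpleGraph.Walk.support_copy] at hx
      obtain ⟨ha, hb⟩ := hp x hx
      rw [(hge x ha).1, (hge x ha).2, (hge v hv).2]
      exact ⟨ha, hb⟩
    · have : wl w (p.copy rfl (hge v hv).2.symm) = wl w p := by
        generalize (hge v hv).2.symm = hh
        generalize port' v = z at hh
        subst hh; rfl
      rw [this, (hge v hv).2]
      exact hl
  refine ⟨?_, ?_, ?_, ?_, ?_, ?_, ?_, ?_, ?_⟩
  · intro u v huv
    by_cases ha : U u
    · rw [(h1 u ha).1, (h1 v (hU.cls u v huv ha)).1]
    · have ha' : ¬ U v := fun h' => ha (hU.cls v u huv.symm h')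
      by_cases hb : nextLayer c q st U u ∧ st u = 0
      · rw [h2 u ha hb.1 hb.2, h2 v ha' (hnl u v huv hb.1) (h.cls u v huv ▸ hb.2)]
      · rw [h3 u ha hb, h3 v ha' (fun h' => hb ⟨hnl v u huv.symm h'.1, (h.cls u v huv).trans h'.2⟩)]
        exact h.cls u v huv
  · intro u v huv hu
    by_cases ha : U u
    · rw [(h1 u ha).2, (h1 v (hU.cls u v huv ha)).2]
    · have ha' : ¬ U v := fun h' => ha (hU.cls v u huv.symm h')
      rw [h4 u ha, h4 v ha']
      refine h.cls_port u v huv ?_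
      by_contra hb
      by_cases hb' : nextLayer c q st U u ∧ st u = 0
      · rw [h2 u ha hb'.1 hb'.2] at hu; omega
      · rw [h3 u ha hb'] at hu; omega
  · intro v hv
    rw [h3iff] at hv
    exact hgood _ v (by omega) (h.old v hv)
  · intro v hv
    by_cases ha : U v
    · obtain ⟨p, hp, hl⟩ := hU.walk v ha
      have hf := (h1 v ha).2
      unfold GoodPort
      rw [hf]
      refine ⟨p, fun x hx => ?_, hl⟩
      rcases hp x hx with h' | h'
      · rw [(h1 x h').1, (h1 x h').2]
        exact ⟨le_rfl, rfl⟩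
      · rw [(hge x h'.1).1, (hge x h'.1).2]
        exact h'
    · have hv2 := ((h2iff v).1 hv).resolve_right ha
      exact hgood _ v (by omega) (h.new v hv2)
  · intro v hv hh
    obtain ⟨hv1, hv2⟩ := hle1 v (by omega)
    have hh' : Hit q (fun x => st x ≤ 1) (fun x => st x = 2 ∨ U x) v :=
      hh.mono (fun x hx => (hle1 x hx).2) (fun x hx => (h2iff x).1 hx)
    have hv0 : st v = 0 ∧ ¬ nextLayer c q st U v := by
      by_cases hb : nextLayer c q st U v ∧ st v = 0
      · rw [h2 v hv1 hb.1 hb.2] at hv; omega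
      · rw [h3 v hv1 hb] at hv
        exact ⟨hv, fun h' => hb ⟨h', hv⟩⟩
    rcases hh'.or with h' | h'
    · exact h.avoid v hv0.1 h'
    · exact hv0.2 ⟨hv2, v, rfl, h'⟩
  · have ha : (Finset.univ.filter fun v => st' v = 1) ⊆
        (Finset.univ.filter fun v => st v = 1 ∧ ¬ U v) ∪
        ((Finset.univ.filter fun v => nextLayer c q st U v ∧ st v = 0) \
          (Finset.univ.filter fun v => U v ∧ st v = 0)) := by
      intro v hv
      simp only [Finset.mem_filter, Finset.mem_univ, true_and, Finset.mem_union,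
        Finset.mem_sdiff] at hv ⊢
      obtain ⟨hv1, hv2⟩ := hle1 v (by omega)
      by_cases hb : nextLayer c q st U v ∧ st v = 0
      · exact Or.inr ⟨hb, fun h' => hv1 h'.1⟩
      · rw [h3 v hv1 hb] at hv
        exact Or.inl ⟨hv, hv1⟩
    have hb : (Finset.univ.filter fun v => U v ∧ st v = 0) ⊆
        (Finset.univ.filter fun v => nextLayer c q st U v ∧ st v = 0) := by
      intro v hv
      simp only [Finset.mem_filter, Finset.mem_univ, true_and] at hv ⊢
      exact ⟨hU.subset_next hv.1, hv.2⟩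
    have hc : (Finset.univ.filter fun v => st' v = 2) =
        (Finset.univ.filter fun v => st v = 2) ∪ (Finset.univ.filter fun v => U v) := by
      ext v; simp [h2iff]
    have hd : Disjoint (Finset.univ.filter fun v => st v = 2) (Finset.univ.filter fun v => U v) := by
      rw [Finset.disjoint_left]
      intro v hv hv'
      simp only [Finset.mem_filter, Finset.mem_univ, true_and] at hv hv'
      have := hUn v hv'
      omega
    rw [hc, Finset.card_union_of_disjoint hd]
    have e1 := (Finset.card_le_card ha).trans (Finset.card_union_le _ _)
    rw [Finset.card_sdiff_of_subset hb] at e1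
    have e2 : (Finset.univ.filter fun v => st v = 1 ∧ ¬ U v).card ≤
      (Finset.univ.filter fun v => st v = 1).card :=
      Finset.card_le_card (fun v hv => by
        simp only [Finset.mem_filter, Finset.mem_univ, true_and] at hv ⊢; exact hv.1)
    have e3 : (Finset.univ.filter fun v => U v ∧ st v = 0).card ≤
      (Finset.univ.filter fun v => U v).card :=
      Finset.card_le_card (fun v hv => by
        simp only [Finset.mem_filter, Finset.mem_univ, true_and] at hv ⊢; exact hv.1)
    have e4 := h.count
    omega
  · have : (Finset.univ.filter fun v => st' v ≤ 2) = (Finset.univ.filter fun v => st v ≤ 2) := by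
      ext v
      simp only [Finset.mem_filter, Finset.mem_univ, true_and]
      by_cases ha : st v ≤ 1
      · have := hle v ha; omega
      · rw [(hge v (by omega)).1]
    rw [this]
    exact h.total
  · intro v
    by_cases ha : st v ≤ 1
    · have := hle v ha; omega
    · rw [(hge v (by omega)).1]; exact h.le_three v
  · intro v hv hv1
    obtain ⟨hv2, hv3⟩ := hle1 v hv1
    rw [ne_eq, ne_eq, h3iff]
    exact h.seeds v ((hdone v hv).resolve_right hv2) hv3

-- When all seeds are used up, the pointers from an unassigned vertex can neither end at an
-- unassigned vertex nor enter a vertex of an earlier phase, so they reach one of the present phase.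
-- By `avoid` no vertex is then active: all the unassigned ones are deferred, at most as many as
-- were assigned, and their number has halved.
open Classical in
theorem AggInv.next_phase [Fintype V] {k l : ℕ} {ε : ℝ≥0} {st : V → ℕ} {port : V → V}
    (h : AggInv G w c off val q k l ε st port fun _ => True)
    (hc : IsClustering G w c Δ off val q rk anc) {st' : V → ℕ}
    (h0 : ∀ v, st v ≤ 1 → st' v = 0) (h1 : ∀ v, 2 ≤ st v → st' v = 3) :
    AggInv G w c off val q (k + 1) l ε st' port fun _ => False := by
  have hhit : ∀ v, st v ≤ 1 → Hit q (fun x => st x ≤ 1) (fun x => st x = 2) v := by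
    intro v
    refine hc.spt.induction (Q := fun v => st v ≤ 1 →
      Hit q (fun x => st x ≤ 1) (fun x => st x = 2) v) ?_ ?_ v trivial
    · intro v _ hq _ _ hv
      exact absurd hq (h.seeds v trivial hv).1
    · intro v _ hq _ _ _ _ ih hv
      have ha := (h.seeds v trivial hv).2
      have hb := h.le_three (q v)
      refine .step hv hq ?_
      by_cases hd : st (q v) ≤ 1
      · exact ih hd
      · exact .base (by omega)
  have hact : ∀ v, st v ≠ 0 := fun v hv => h.avoid v hv (hhit v (by omega))
  have h3 : ∀ v, st' v = 0 ∨ st' v = 3 := by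
    intro v
    by_cases hv : st v ≤ 1
    · exact Or.inl (h0 v hv)
    · exact Or.inr (h1 v (by omega))
  have h03 : ∀ v, st' v = 3 ↔ 2 ≤ st v := by
    intro v
    by_cases hv : st v ≤ 1
    · rw [h0 v hv]; omega
    · rw [h1 v (by omega)]; omega
  have hmono : (min k (l + 1) : ℕ) ≤ min (k + 1) (l + 1) := by omega
  have hgood : ∀ v, 2 ≤ st v → GoodPort G w off val st' port (min (k + 1) (l + 1) * ε) v := by
    intro v hv
    have : GoodPort G w off val st port (min (k + 1) (l + 1) * ε) v := by
      by_cases hv2 : st v = 2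
      · exact h.new v hv2
      · obtain ⟨p, hp, hl⟩ := h.old v (by have := h.le_three v; omega)
        refine ⟨p, hp, hl.trans ?_⟩
        gcongr
    obtain ⟨p, hp, hl⟩ := this
    exact ⟨p, fun x hx => ⟨by rw [(h03 x).2 (hp x hx).1]; norm_num, (hp x hx).2⟩, hl⟩
  refine ⟨?_, ?_, ?_, ?_, ?_, ?_, ?_, ?_, fun _ h => h.elim⟩
  · intro u v huv
    have := h.cls u v huv
    by_cases hv : st v ≤ 1
    · rw [h0 v hv, h0 u (by omega)]
    · rw [h1 v (by omega), h1 u (by omega)]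
  · intro u v huv hu
    refine h.cls_port u v huv ((h03 u).1 ?_)
    rcases h3 u with h' | h' <;> omega
  · intro v hv
    have := hgood v ((h03 v).1 hv)
    push_cast at this ⊢
    exact this
  · intro v hv
    rcases h3 v with h' | h' <;> omega
  · intro v _ hh
    have : ∀ x, Hit q (fun x => st' x ≤ 1) (fun x => st' x = 2) x → False := by
      intro x hx
      induction hx with
      | @base x hx => rcases h3 x with h' | h' <;> omega
      | step _ _ _ ih => exact ih
    exact this v hh
  · rw [Finset.filter_false_of_mem]
    · simp
    · intro v _
      rcases h3 v with h' | h' <;> omega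
  · have ha : (Finset.univ.filter fun v => st' v ≤ 2) = (Finset.univ.filter fun v => st v = 1) := by
      ext v
      simp only [Finset.mem_filter, Finset.mem_univ, true_and]
      have := hact v
      by_cases hv : st v ≤ 1
      · rw [h0 v hv]; omega
      · rw [h1 v (by omega)]; omega
    have hb : (Finset.univ.filter fun v => st v ≤ 2) = (Finset.univ.filter fun v => st v = 1) ∪
        (Finset.univ.filter fun v => st v = 2) := by
      ext v
      simp only [Finset.mem_filter, Finset.mem_univ, true_and, Finset.mem_union]
      have := hact v
      omega
    have hd : Disjoint (Finset.univ.filter fun v => st v = 1)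
        (Finset.univ.filter fun v => st v = 2) := by
      rw [Finset.disjoint_left]
      intro v hv hv'
      simp only [Finset.mem_filter, Finset.mem_univ, true_and] at hv hv'
      omega
    have e1 := h.total
    have e2 := h.count
    rw [hb, Finset.card_union_of_disjoint hd] at e1
    rw [ha, pow_succ]
    refine le_trans ?_ e1
    rw [mul_comm (2 ^ k), ← mul_assoc]
    gcongr
    omega
  · intro v
    rcases h3 v with h' | h' <;> omega

open Classical in
/-- The invariant of the construction of the layers. -/
structure LayerInv [Fintype V] (G : SimpleGraph V) (w : Sym2 V → ℝ≥0) (c : V → V) (Δ : ℝ≥0)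
    (off val : V → ℝ≥0) (q : V → V) (st : V → ℕ) (port : V → V) (f : V) (e : ℝ≥0) (v : V)
    (j : ℕ) (U : V → Prop) : Prop where
  seed : U v
  layer : ∃ m : ℕ, IsLayer G w c off val st port f (e + (m + 1) * (2 * Δ)) U ∧
    2 ^ m ≤ (Finset.univ.filter fun v => U v ∧ st v = 0).card + 1
  grow : (Finset.univ.filter fun v => nextLayer c q st U v ∧ st v = 0).card ≤
      2 * (Finset.univ.filter fun v => U v ∧ st v = 0).card ∨
    2 ^ j ≤ (Finset.univ.filter fun v => U v ∧ st v = 0).card + 1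

-- The set grows only if the number `a` of active vertices becomes at least `2 * a + 1`; hence `a +
-- 1` doubles each time the error grows by `2 * Δ`. The summand `1` covers a seed cluster without
-- active vertices.
open Classical in
theorem LayerInv.step [Fintype V] (h : IsClustering G w c Δ off val q rk anc) {st : V → ℕ}
    {port : V → V} (hst : ∀ u v, c u = c v → st u = st v) {f : V} {e : ℝ≥0} {v : V} {j : ℕ}
    {U U' : V → Prop} (hU : LayerInv G w c Δ off val q st port f e v j U)
    (hU' : U' = if 2 * (Finset.univ.filter fun v => U v ∧ st v = 0).card <
      (Finset.univ.filter fun v => nextLayer c q st U v ∧ st v = 0).card then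
      nextLayer c q st U else U) :
    LayerInv G w c Δ off val q st port f e v (j + 1) U' := by
  obtain ⟨m, hm, hm'⟩ := hU.layer
  split_ifs at hU' with hlt
  · subst hU'
    refine ⟨hm.subset_next hU.seed, ⟨m + 1, ?_, ?_⟩, ?_⟩
    · have := h.next hst hm
      push_cast
      rwa [add_mul (m + 1 : ℝ≥0), one_mul, ← add_assoc]
    · rw [pow_succ]; omega
    · rcases hU.grow with h' | h'
      · omega
      · right; rw [pow_succ]; omega
  · subst hU'
    exact ⟨hU.seed, ⟨m, hm, hm'⟩, Or.inl (not_lt.1 hlt)⟩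

-- The doubling cannot go on for `n` rounds, so the last set does not grow; at most `l + 1`
-- doublings have taken place, which bounds the error.
open Classical in
theorem LayerInv.finish [Fintype V] {st : V → ℕ} {port : V → V} {f : V} {e : ℝ≥0} {v : V} {l : ℕ}
    {U : V → Prop} (hl : Fintype.card V ≤ 2 ^ l)
    (hU : LayerInv G w c Δ off val q st port f e v (Fintype.card V) U) :
    IsLayer G w c off val st port f (e + (l + 2) * (2 * Δ)) U ∧
    (Finset.univ.filter fun v => nextLayer c q st U v ∧ st v = 0).card ≤
      2 * (Finset.univ.filter fun v => U v ∧ st v = 0).card := by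
  have hle : ∀ S : Finset V, S.card ≤ Fintype.card V := fun S => Finset.card_le_univ S
  constructor
  · obtain ⟨m, hm, hm'⟩ := hU.layer
    refine ⟨hm.sub, hm.cls, fun u hu => ?_⟩
    obtain ⟨p, hp, hp'⟩ := hm.walk u hu
    refine ⟨p, hp, hp'.trans ?_⟩
    have h1 := hle (Finset.univ.filter fun v => U v ∧ st v = 0)
    have h2 : m ≤ l + 1 := by
      have : 2 ^ m ≤ 2 ^ (l + 1) := by
        have := Nat.one_le_two_pow (n := l)
        rw [pow_succ]; omega
      exact (Nat.pow_le_pow_iff_right (by norm_num)).1 this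
    have h3 : (m + 1 : ℝ≥0) ≤ l + 2 := by
      have : m + 1 ≤ l + 2 := by omega
      exact_mod_cast this
    gcongr
  · rcases hU.grow with h' | h'
    · exact h'
    · have h1 := hle (Finset.univ.filter fun v => nextLayer c q st U v ∧ st v = 0)
      have h2 := Nat.lt_two_pow_self (n := Fintype.card V)
      omega

open Classical in
/-- One seed: the cluster of an unassigned vertex `v` whose pointer leaves the unassigned part is
assigned, together with the layers around it. -/
theorem AggInv.seed_step [Fintype V] {k l : ℕ} {st : V → ℕ} {port : V → V} {done : V → Prop}
    (hl : Fintype.card V ≤ 2 ^ l)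
    (h : AggInv G w c off val q k l ((l + 2) * (2 * Δ)) st port done)
    {f v : V} {U : V → Prop} (hv : st v ≤ 1)
    (hU : LayerInv G w c Δ off val q st port f (min k (l + 1) * ((l + 2) * (2 * Δ))) v
      (Fintype.card V) U)
    {st' : V → ℕ} {port' : V → V} (h1 : ∀ v, U v → st' v = 2 ∧ port' v = f)
    (h2 : ∀ v, ¬ U v → nextLayer c q st U v → st v = 0 → st' v = 1)
    (h3 : ∀ v, ¬ U v → ¬ (nextLayer c q st U v ∧ st v = 0) → st' v = st v)
    (h4 : ∀ v, ¬ U v → port' v = port v) :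
    AggInv G w c off val q k l ((l + 2) * (2 * Δ)) st' port' (fun x => done x ∨ x = v) := by
  obtain ⟨ha, hb⟩ := hU.finish hl
  -- Some vertex is still unassigned although the remainder has halved `k` times, so `2 ^ k ≤ n ≤ 2
  -- ^ l`. Thus the cap `l + 1` on the number of charged phases is never exceeded.
  have hk : k ≤ l := by
    have h5 : 1 ≤ (Finset.univ.filter fun v => st v ≤ 2).card :=
      Finset.card_pos.2 ⟨v, by simp; omega⟩
    have h6 : 2 ^ k ≤ 2 ^ l := by
      refine le_trans ?_ (h.total.trans hl)
      exact Nat.le_mul_of_pos_left _ h5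
    exact (Nat.pow_le_pow_iff_right (by norm_num)).1 h6
  refine h.step ?_ hb h1 h2 h3 h4 ?_
  · rw [min_eq_left (Nat.succ_le_succ hk), Nat.cast_succ, add_mul (k : ℝ≥0) 1, one_mul]
    rwa [min_eq_left (by omega)] at ha
  · rintro x (hx | rfl)
    · exact Or.inl hx
    · exact Or.inr hU.seed

open Classical in
theorem AggInv.init [Fintype V] {l : ℕ} {ε : ℝ≥0} {st : V → ℕ} (port : V → V)
    (h0 : ∀ v, st v = 0) : AggInv G w c off val q 0 l ε st port fun _ => False := by
  refine ⟨fun u v _ => by rw [h0, h0], fun u v _ h => by rw [h0] at h; omega,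
    fun v h => by rw [h0] at h; omega, fun v h => by rw [h0] at h; omega, fun v _ hh => ?_,
    by simp [h0], by simp [h0], fun v => by simp [h0], fun _ h => h.elim⟩
  have : ∀ x, Hit q (fun x => st x ≤ 1) (fun x => st x = 2) x → False := by
    intro x hx
    induction hx with
    | @base x hx => rw [h0] at hx; omega
    | step _ _ _ ih => exact ih
  exact this v hh

/-- The result of the aggregation. -/
theorem AggInv.result [Fintype V] {l : ℕ} {ε : ℝ≥0} {st : V → ℕ} {port : V → V}
    {done : V → Prop} (h : AggInv G w c off val q (Fintype.card V) l ε st port done)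
    (v : V) : (∀ u, c u = c v → port u = port v) ∧
    ∃ p : G.Walk v (port v), (∀ x ∈ p.support, port x = port v) ∧
      wl w p + off (port v) ≤ val v + (l + 1) * ε := by
  classical
  -- After `n` phases fewer than one vertex remains, because `n < 2 ^ n`.
  have h3 : ∀ v, st v = 3 := by
    intro v
    by_contra hv
    have h1 : 1 ≤ (Finset.univ.filter fun v => st v ≤ 2).card :=
      Finset.card_pos.2 ⟨v, by have := h.le_three v; simp; omega⟩
    have h2 := h.total
    have h4 := Nat.lt_two_pow_self (n := Fintype.card V)
    have h5 := Nat.le_mul_of_pos_left (2 ^ Fintype.card V) h1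
    convert (lt_of_lt_of_le h4 (h5.trans h2)).false
  refine ⟨fun u hu => h.cls_port u v hu (by rw [h3]; norm_num), ?_⟩
  obtain ⟨p, hp, hl⟩ := h.old v (h3 v)
  refine ⟨p, fun x hx => (hp x hx).2, hl.trans ?_⟩
  gcongr
  exact_mod_cast min_le_right _ _

end Aggregation


/-! ### One level of the tree -/

section TreeStep

variable {V : Type*} {G : SimpleGraph V} {w : Sym2 V → ℝ≥0} {C c : V → V} {Δ : ℝ≥0}
  {R : V → Prop} {val₁ val₂ : V → ℝ≥0} {q₁ q₂ : V → V} {rk₁ rk₂ : V → ℕ} {anc₁ anc₂ : V → V → Prop}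
  {P₁ P₂ : V → Prop} {isx heavy : V → Prop} {sz : V → ℕ}

theorem IsSPT.reach {M : V → V → Prop} {W : V → V → ℝ≥0} {src : V → Prop} {init : V → ℝ≥0}
    {P : V → Prop} {val : V → ℝ≥0} {q : V → V} {rk : V → ℕ} {anc : V → V → Prop}
    (h : IsSPT M W src init P val q rk anc) {u v : V} (p : G.Walk u v)
    (hp : ∀ a b, G.Adj a b → a ∈ p.support → b ∈ p.support → M a b) (hu : P u) : P v := by
  induction p with
  | nil => exact hu
  | @cons a b c hab p ih =>
    exact ih (fun x y hxy hx hy => hp x y hxy (by simp [hx]) (by simp [hy]))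
      (h.edge a b hu (hp a b hab (by simp) (by simp))).1

/-- The class of `u` contains no vertex of `R`. -/
def Unhit (c : V → V) (R : V → Prop) (u : V) : Prop := ∀ z, R z → c z ≠ c u

theorem Unhit.congr {u v : V} (h : Unhit c R u) (huv : c u = c v) : Unhit c R v :=
  fun z hz => huv ▸ h z hz

/-- The computation of the links between the classes of `c` inside the classes of the coarser
partition `C`, towards the set `R`: the first shortest path forest contracts the classes of `c` and
determines for each class without vertices of `R` its exit `x`; the second one is made of paths
inside the classes and links from the exits. -/
structure LinkData (G : SimpleGraph V) (w : Sym2 V → ℝ≥0) (C c : V → V) (Δ : ℝ≥0) (R : V → Prop)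
    (P₁ : V → Prop) (val₁ : V → ℝ≥0) (q₁ : V → V) (rk₁ : V → ℕ) (anc₁ : V → V → Prop)
    (isx P₂ : V → Prop) (val₂ : V → ℝ≥0) (q₂ : V → V) (rk₂ : V → ℕ) (anc₂ : V → V → Prop) :
    Prop where
  nest : ∀ u v, c u = c v → C u = C v
  walk : ∀ u v, c u = c v → ∃ p : G.Walk u v, (∀ x ∈ p.support, c x = c u) ∧ wl w p ≤ Δ
  spt₁ : ∀ W : V → V → ℝ≥0, (∀ a b, c a = c b → W a b = 0) →
    (∀ a b, c a ≠ c b → W a b = w s(a, b) + Δ) →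
    IsSPT (fun a b => G.Adj a b ∧ C a = C b) W R (fun _ => 0) P₁ val₁ q₁ rk₁ anc₁
  exit : ∀ x, isx x ↔ Unhit c R x ∧ ∀ v, c v = c x → rk₁ x ≤ rk₁ v
  spt₂ : IsSPT (fun a b => (G.Adj a b ∧ c a = c b) ∨ (isx b ∧ a = q₁ b)) (fun a b => w s(a, b)) R
    (fun _ => 0) P₂ val₂ q₂ rk₂ anc₂
  reach : ∀ v, ∃ z, R z ∧ ∃ p : G.Walk v z, ∀ x ∈ p.support, C x = C v

namespace LinkData

variable (h : LinkData G w C c Δ R P₁ val₁ q₁ rk₁ anc₁ isx P₂ val₂ q₂ rk₂ anc₂)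
include h

/-- `LinkData` speaks of all weight functions with the prescribed values, so that no decision
procedure for equality of classes enters its statement; here one such function is picked. -/
theorem exists_spt₁ : ∃ W : V → V → ℝ≥0, (∀ a b, c a = c b → W a b = 0) ∧
    (∀ a b, c a ≠ c b → W a b = w s(a, b) + Δ) ∧
    IsSPT (fun a b => G.Adj a b ∧ C a = C b) W R (fun _ => 0) P₁ val₁ q₁ rk₁ anc₁ := by
  classical
  refine ⟨fun a b => if c a = c b then 0 else w s(a, b) + Δ, ?_, ?_, h.spt₁ _ ?_ ?_⟩ <;>
  simp +contextual

theorem mem₁ (v : V) : P₁ v := by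
  obtain ⟨W, -, -, hs⟩ := h.exists_spt₁
  obtain ⟨z, hz, p, hp⟩ := h.reach v
  refine hs.reach p.reverse (fun a b hab ha hb => ⟨hab, ?_⟩) (hs.src_mem z hz).1
  rw [SimpleGraph.Walk.support_reverse, List.mem_reverse] at ha hb
  rw [hp a ha, hp b hb]

/-- Moving inside a class costs nothing in the contracted graph, so the value depends only on the
class. -/
theorem val₁_le {u v : V} (huv : c u = c v) : val₁ v ≤ val₁ u := by
  obtain ⟨W, hW, -, hs⟩ := h.exists_spt₁
  obtain ⟨p, hp, -⟩ := h.walk u v huv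
  have := (hs.walk_le (w := fun _ => 0) p (fun a b hab ha hb => ⟨⟨hab, h.nest a b
    ((hp a ha).trans (hp b hb).symm)⟩, (hW a b ((hp a ha).trans (hp b hb).symm)).le⟩)
    (h.mem₁ u)).2
  have h0 : ∀ {a b : V} (p : G.Walk a b), wl (fun _ => 0) p = 0 := by
    intro a b p
    induction p with
    | nil => rfl
    | cons _ p ih => simp [ih]
  simpa [h0] using this

theorem val₁_eq {u v : V} (huv : c u = c v) : val₁ u = val₁ v :=
  le_antisymm (h.val₁_le huv.symm) (h.val₁_le huv)

/-- By `le_add_labels` the surcharge `Δ` is paid at most once for every class that the walk to `R`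
meets. -/
theorem val₁_bound {K L : ℝ≥0} [DecidableEq V] (v : V) {z : V} (hz : R z) (p : G.Walk v z)
    (hp : ∀ x ∈ p.support, C x = C v) (hl : wl w p ≤ K)
    (hL : (p.support.toFinset.image c).card * Δ ≤ L) : val₁ v ≤ K + L := by
  obtain ⟨W, hW, hW', hs⟩ := h.exists_spt₁
  have := le_add_labels (w := w) (c := c) (Δ := Δ) (val := val₁) p
    (fun x y _ _ hxy => h.val₁_le hxy.symm) (fun x y hxy hx hy => by
      have h1 := (hs.edge y x (h.mem₁ y) ⟨hxy.symm, by rw [hp x hx, hp y hy]⟩).2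
      refine h1.trans ?_
      rw [add_assoc]
      gcongr
      by_cases hc : c y = c x
      · rw [hW _ _ hc]; exact zero_le
      · rw [hW' _ _ hc, Sym2.eq_swap]) v (by simp)
  have h0 : val₁ z = 0 := le_antisymm (hs.src_mem z hz).2 zero_le
  rw [h0, zero_add] at this
  exact this.trans (add_le_add hl hL)

theorem exists_exit [Finite V] (u : V) (hu : Unhit c R u) : ∃ x, isx x ∧ c x = c u := by
  obtain ⟨x, hx, hmin⟩ := Set.exists_min_image {v | c v = c u} rk₁ (Set.toFinite _) ⟨u, rfl⟩
  exact ⟨x, (h.exit x).2 ⟨hu.congr hx.symm, fun v hv => hmin v (hv.trans hx)⟩, hx⟩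

theorem exit_unique {x y : V} (hx : isx x) (hy : isx y) (hxy : c x = c y) : x = y := by
  obtain ⟨W, -, -, hs⟩ := h.exists_spt₁
  exact hs.rk_inj x y (h.mem₁ x) (h.mem₁ y) (le_antisymm (((h.exit x).1 hx).2 y hxy.symm)
    (((h.exit y).1 hy).2 x hxy))

/-- The exit is the vertex of its class that the first forest reaches first, so its pointer, of
smaller rank, leaves the class; the link therefore carries the surcharge `Δ`. -/
theorem exit_ptr {x : V} (hx : isx x) : G.Adj (q₁ x) x ∧ C (q₁ x) = C x ∧ c (q₁ x) ≠ c x ∧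
    rk₁ (q₁ x) < rk₁ x ∧ val₁ x = val₁ (q₁ x) + w s(q₁ x, x) + Δ := by
  obtain ⟨W, -, hW, hs⟩ := h.exists_spt₁
  obtain ⟨h1, h2⟩ := (h.exit x).1 hx
  rcases hs.ptr x (h.mem₁ x) with ⟨-, h', -⟩ | ⟨-, h3, h4, h5⟩
  · exact absurd rfl (h1 x h')
  · have h6 : c (q₁ x) ≠ c x := fun h' => absurd (h2 _ h') (not_le.2 h5)
    exact ⟨h3.1, h3.2, h6, h5, by rw [h4, hW _ _ h6, add_assoc]⟩

/-- Induction on the rank in the first forest: the link from an exit leads to a class with a vertex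
of `R` or one whose exit has smaller rank, and within a class everything is connected. -/
theorem mem₂ [Finite V] (v : V) : P₂ v := by
  have hcls : ∀ u v, c u = c v → P₂ u → P₂ v := by
    intro u v huv hu
    obtain ⟨p, hp, -⟩ := h.walk u v huv
    exact h.spt₂.reach p (fun a b hab ha hb => Or.inl ⟨hab, (hp a ha).trans (hp b hb).symm⟩) hu
  have key : ∀ k x, isx x → rk₁ x = k → P₂ x := by
    intro k
    induction k using Nat.strong_induction_on with
    | _ k ih =>
      intro x hx hk
      obtain ⟨-, -, -, h1, -⟩ := h.exit_ptr hx
      refine (h.spt₂.edge (q₁ x) x ?_ (Or.inr ⟨hx, rfl⟩)).1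
      by_cases hu : Unhit c R (q₁ x)
      · obtain ⟨y, hy, hyc⟩ := h.exists_exit _ hu
        have h2 := ((h.exit y).1 hy).2 (q₁ x) hyc.symm
        exact hcls y _ hyc (ih _ (by omega) y hy rfl)
      · unfold Unhit at hu
        push Not at hu
        obtain ⟨z, hz, hzc⟩ := hu
        exact hcls z _ hzc (h.spt₂.src_mem z hz).1
  by_cases hu : Unhit c R v
  · obtain ⟨y, hy, hyc⟩ := h.exists_exit _ hu
    exact hcls y v hyc (key _ y hy rfl)
  · unfold Unhit at hu
    push Not at hu
    obtain ⟨z, hz, hzc⟩ := hu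
    exact hcls z v hzc (h.spt₂.src_mem z hz).1

theorem ptr₂ [Finite V] {u : V} (hu : Unhit c R u) : val₂ u = val₂ (q₂ u) + w s(q₂ u, u) ∧
    rk₂ (q₂ u) < rk₂ u ∧ ((G.Adj (q₂ u) u ∧ c (q₂ u) = c u) ∨ (isx u ∧ q₂ u = q₁ u)) := by
  rcases h.spt₂.ptr u (h.mem₂ u) with ⟨-, h', -⟩ | ⟨-, h1, h2, h3⟩
  · exact absurd rfl (hu u h')
  · exact ⟨h2, h3, h1⟩

/-- The pointers from a class without vertices of `R` pass through its exit. -/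
theorem anc_exit [Finite V] (u : V) (hu : Unhit c R u) :
    ∃ x, isx x ∧ c x = c u ∧ anc₂ u x ∧ q₂ x = q₁ x := by
  refine h.spt₂.induction (Q := fun u => Unhit c R u → ∃ x, isx x ∧ c x = c u ∧ anc₂ u x ∧
    q₂ x = q₁ x) ?_ ?_ u (h.mem₂ u) hu
  · intro v _ _ hs _ hv
    exact absurd rfl (hv v hs)
  · intro v _ hq _ _ _ _ ih hv
    rcases (h.ptr₂ hv).2.2 with ⟨-, h1⟩ | ⟨h1, h2⟩
    · obtain ⟨x, hx, hxc, hax, hqx⟩ := ih (hv.congr h1.symm)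
      exact ⟨x, hx, hxc.trans h1, (h.spt₂.anc_iff v (h.mem₂ v) x).2 (Or.inr ⟨hq, hax⟩), hqx⟩
    · exact ⟨v, h1, rfl, h.spt₂.anc_self (h.mem₂ v), h2⟩

theorem exit_q₂ [Finite V] {x : V} (hx : isx x) : q₂ x = q₁ x := by
  obtain ⟨y, hy, hyc, -, hq⟩ := h.anc_exit x ((h.exit x).1 hx).1
  rwa [h.exit_unique hy hx hyc] at hq

theorem anc_of_exit [Finite V] {u x : V} (hx : isx x) (hxc : c x = c u) : anc₂ u x := by
  obtain ⟨y, hy, hyc, ha, -⟩ := h.anc_exit u (((h.exit x).1 hx).1.congr hxc)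
  rwa [h.exit_unique hx hy (hxc.trans hyc.symm)]

theorem class_ptr [Finite V] {u : V} (hu : Unhit c R u) (hx : ¬ isx u) :
    G.Adj (q₂ u) u ∧ c (q₂ u) = c u := (h.ptr₂ hu).2.2.resolve_right fun h' => hx h'.1

/-- Ancestors outside of the class of a vertex are ancestors of the exit. -/
theorem exit_anc [Finite V] {u x v : V} (hx : isx x) (hxc : c x = c u) (ha : anc₂ u v)
    (hv : c v ≠ c u) : anc₂ x v := by
  refine h.spt₂.induction (Q := fun u => c x = c u → anc₂ u v → c v ≠ c u → anc₂ x v)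
    ?_ ?_ u (h.mem₂ u) hxc ha hv
  · intro u _ hq _ _ _ ha hv
    rcases (h.spt₂.anc_iff u (h.mem₂ u) v).1 ha with rfl | h'
    · exact absurd rfl hv
    · exact absurd hq h'.1
  · intro u _ _ _ _ _ _ ih hxc ha hv
    rcases (h.spt₂.anc_iff u (h.mem₂ u) v).1 ha with rfl | h'
    · exact absurd rfl hv
    · by_cases hxu : isx u
      · rwa [h.exit_unique hx hxu hxc]
      · have := (h.class_ptr (((h.exit x).1 hx).1.congr hxc) hxu).2
        exact ih (hxc.trans this.symm) h'.2 (this ▸ hv)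

theorem val₂_le [Finite V] {u v : V} (huv : c u = c v) : val₂ v ≤ val₂ u + Δ := by
  obtain ⟨p, hp, hl⟩ := h.walk u v huv
  exact ((h.spt₂.walk_le (w := w) p (fun a b hab ha hb => ⟨Or.inl ⟨hab, (hp a ha).trans
    (hp b hb).symm⟩, le_rfl⟩) (h.mem₂ u)).2).trans (by gcongr)

theorem val₂_anc [Finite V] {u v : V} (ha : anc₂ u v) : val₂ v ≤ val₂ u := by
  refine h.spt₂.induction (Q := fun u => anc₂ u v → val₂ v ≤ val₂ u) ?_ ?_ u (h.mem₂ u) ha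
  · intro u _ hq _ _ ha
    rcases (h.spt₂.anc_iff u (h.mem₂ u) v).1 ha with rfl | h'
    · exact le_rfl
    · exact absurd hq h'.1
  · intro u _ _ _ _ hval _ ih ha
    rcases (h.spt₂.anc_iff u (h.mem₂ u) v).1 ha with rfl | h'
    · exact le_rfl
    · rw [hval]; exact (ih h'.2).trans le_self_add

/-- The descendants of two exits that lead to the same class are disjoint. -/
theorem exit_disjoint [Finite V] {x y x' : V} (hx : isx x) (hy : isx y) (hxy : x ≠ y)
    (hx' : isx x') (h1 : c (q₂ x) = c x') (h2 : c (q₂ y) = c x') {d : V} (hdx : anc₂ d x)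
    (hdy : anc₂ d y) : False := by
  -- If `y` were an ancestor of `x`, the pointers from `x` would enter the class of `x'`, leave it
  -- at `x'` and reach `y`, whose own pointer leads back into that class and to `x'`: a cycle,
  -- against the ranks.
  have key : ∀ x y, isx x → isx y → x ≠ y → c (q₂ x) = c x' → c (q₂ y) = c x' →
      anc₂ x y → False := by
    intro x y hx hy hxy h1 h2 ha
    have h3 := ((h.spt₂.anc_iff x (h.mem₂ x) y).1 ha).resolve_left hxy.symm
    have hyc : c y ≠ c x' := by
      have := (h.exit_ptr hy).2.2.1
      rw [← h.exit_q₂ hy, h2] at this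
      exact this.symm
    have h4 := h.exit_anc hx' h1.symm h3.2 (by rwa [h1])
    have h5 := h.anc_of_exit hx' h2.symm
    have h6 := h.spt₂.anc_rk (h.mem₂ _) _ h4
    have h7 := h.spt₂.anc_rk (h.mem₂ _) _ h5
    have h8 := (h.ptr₂ ((h.exit y).1 hy).1).2.1
    omega
  rcases h.spt₂.anc_total (h.mem₂ d) x y hdx hdy with ha | ha
  · exact key x y hx hy hxy h1 h2 ha
  · exact key y x hy hx hxy.symm h2 h1 ha

end LinkData

/-- The extension of the set `R` at the next finer level: the exits of the classes without vertices
of `R`, and the paths to the exits that the heavy links use. -/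
def extend (c : V → V) (R isx heavy : V → Prop) (q₂ : V → V) (anc₂ : V → V → Prop) (u : V) : Prop :=
  R u ∨ (Unhit c R u ∧ (isx u ∨ ∃ x, heavy x ∧ c (q₂ x) = c u ∧ anc₂ (q₂ x) u))

/-- One step of the construction of the tree, from the set `R` of the coarser partition `C` to the
set `R'` of the finer partition `c`. -/
structure TreeStep (G : SimpleGraph V) (w : Sym2 V → ℝ≥0) (C c : V → V) (R R' : V → Prop)
    (par : V → V) (L : ℝ≥0) (m : ℕ) : Prop where
  sub : ∀ v, R v → R' v
  meets : ∀ v, ∃ z, R' z ∧ c z = c v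
  hit : ∀ u z, R' u → R z → c u = c z → R u
  chain : ∀ u v, R' u → ¬ R u → R' v → ¬ R v → c u = c v →
    Relation.ReflTransGen (fun a b => R' a ∧ ¬ R a ∧ b = par a) u v ∨
    Relation.ReflTransGen (fun a b => R' a ∧ ¬ R a ∧ b = par a) v u
  adj : ∀ u, R' u → ¬ R u → G.Adj u (par u)
  cls : ∀ u, R' u → ¬ R u → C (par u) = C u
  potential : ∃ (ψ : V → ℝ≥0) (ν : V → ℕ) (μ : V → ℕ ×ₗ ℕ), (∀ u, ψ u ≤ L ∧ ν u ≤ m) ∧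
    ∀ u, R' u → ¬ R u →
      (R' (par u) → ψ (par u) + w s(u, par u) ≤ ψ u ∧ ν (par u) ≤ ν u ∧ μ (par u) < μ u) ∧
      (¬ R' (par u) → ∀ z, R' z → c z = c (par u) →
        ψ z + w s(u, par u) ≤ ψ u ∧ ν z + 1 ≤ ν u ∧ μ z < μ u)

/-- Parents are fixed one level at a time; later changes concern vertices that do not matter here.
-/
theorem TreeStep.congr {R' : V → Prop} {par par' : V → V} {L : ℝ≥0} {m : ℕ}
    (h : TreeStep G w C c R R' par L m) (hp : ∀ u, R' u → ¬ R u → par' u = par u) :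
    TreeStep G w C c R R' par' L m := by
  have hrel : (fun a b => R' a ∧ ¬ R a ∧ b = par' a) = fun a b => R' a ∧ ¬ R a ∧ b = par a := by
    funext a b
    refine propext (and_congr_right fun h1 => and_congr_right fun h2 => ?_)
    rw [hp a h1 h2]
  refine ⟨h.sub, h.meets, h.hit, by rw [hrel]; exact h.chain,
    fun u h1 h2 => hp u h1 h2 ▸ h.adj u h1 h2, fun u h1 h2 => hp u h1 h2 ▸ h.cls u h1 h2, ?_⟩
  obtain ⟨ψ, ν, μ, h3, h4⟩ := h.potential
  exact ⟨ψ, ν, μ, h3, fun u h1 h2 => hp u h1 h2 ▸ h4 u h1 h2⟩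

-- The exits make sure that every class is met, and the heavy link into a class is continued along
-- the second forest to the exit, so the new vertices of a class lie on one path. Links that are not
-- heavy end outside of the new set, but each of them at least doubles the number of descendants.
open Classical in
theorem LinkData.treeStep [Fintype V]
    (h : LinkData G w C c Δ R P₁ val₁ q₁ rk₁ anc₁ isx P₂ val₂ q₂ rk₂ anc₂)
    (hsz : ∀ x, sz x = (Finset.univ.filter fun v => anc₂ v x).card)
    (hv₁ : ∀ x, heavy x → isx x)
    (hv₂ : ∀ x y, heavy x → heavy y → c (q₂ x) = c (q₂ y) → x = y)
    (hv₃ : ∀ x, isx x → ∃ y, heavy y ∧ c (q₂ y) = c (q₂ x) ∧ sz x ≤ sz y)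
    {L : ℝ≥0} (hL : ∀ v, val₁ v ≤ L) {par : V → V}
    (hpar : ∀ u, extend c R isx heavy q₂ anc₂ u → ¬ R u → par u = q₂ u) :
    TreeStep G w C c R (extend c R isx heavy q₂ anc₂) par (L + Δ)
      (Nat.log 2 (Fintype.card V) + 1) := by
  set R' := extend c R isx heavy q₂ anc₂ with hR'
  have hunhit : ∀ u, R' u → ¬ R u → Unhit c R u := by
    rintro u (hu | hu) hn
    · exact absurd hu hn
    · exact hu.1
  have hcl : ∀ u v, c u = c v → C u = C v := h.nest
  choose! X hX using h.exists_exit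
  have hXx : ∀ x, isx x → X x = x := fun x hx =>
    h.exit_unique (hX x ((h.exit x).1 hx).1).1 hx (hX x ((h.exit x).1 hx).1).2
  have hXc : ∀ u v, c u = c v → Unhit c R u → X u = X v := fun u v huv hu =>
    h.exit_unique (hX u hu).1 (hX v (hu.congr huv)).1
      ((hX u hu).2.trans (huv.trans (hX v (hu.congr huv)).2.symm))
  have hhit : ∀ u z, R' u → R z → c u = c z → R u := by
    rintro u z (hu | hu) hz huz
    · exact hu
    · exact absurd huz.symm (hu.1 z hz)
  refine ⟨fun v hv => Or.inl hv, ?_, hhit, ?_, ?_, ?_, ?_⟩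
  · intro v
    by_cases hu : Unhit c R v
    · obtain ⟨x, hx, hxc⟩ := h.exists_exit v hu
      exact ⟨x, Or.inr ⟨((h.exit x).1 hx).1, Or.inl hx⟩, hxc⟩
    · unfold Unhit at hu
      push Not at hu
      obtain ⟨z, hz, hzc⟩ := hu
      exact ⟨z, Or.inl hz, hzc⟩
  · have hpath : ∀ v u, R' u → ¬ R u → c u = c v → anc₂ u v →
        Relation.ReflTransGen (fun a b => R' a ∧ ¬ R a ∧ b = par a) u v := by
      intro v u
      refine h.spt₂.induction (Q := fun u => R' u → ¬ R u → c u = c v → anc₂ u v →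
        Relation.ReflTransGen (fun a b => R' a ∧ ¬ R a ∧ b = par a) u v) ?_ ?_ u (h.mem₂ u)
      · intro u _ _ hs _ _ hn
        exact absurd hs hn
      · intro u _ _ _ _ _ _ ih hu hn huv ha
        have hun := hunhit u hu hn
        rcases (h.spt₂.anc_iff u (h.mem₂ u) v).1 ha with rfl | ⟨-, ha'⟩
        · exact .refl
        · by_cases hx : isx u
          · have h1 := h.spt₂.anc_rk (h.mem₂ _) _ ha'
            have h2 := h.spt₂.anc_rk (h.mem₂ _) _ (h.anc_of_exit hx huv)
            have h3 := (h.ptr₂ hun).2.1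
            omega
          · have hq := (h.class_ptr hun hx).2
            have hq' : Unhit c R (q₂ u) := hun.congr hq.symm
            refine .head ⟨hu, hn, (hpar u hu hn).symm⟩ (ih ?_ (fun h' => hq' _ h' rfl)
              (hq.trans huv) ha')
            obtain ⟨x, hx1, hx2, hx3⟩ := ((hu.resolve_left hn).2).resolve_left hx
            refine Or.inr ⟨hq', Or.inr ⟨x, hx1, hx2.trans hq.symm, ?_⟩⟩
            refine h.spt₂.anc_trans (h.mem₂ _) _ _ hx3 ((h.spt₂.anc_iff u (h.mem₂ u) _).2
              (Or.inr ⟨fun h' => ?_, h.spt₂.anc_self (h.mem₂ _)⟩))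
            have h3 := (h.ptr₂ hun).2.1
            rw [h'] at h3
            exact lt_irrefl _ h3
    intro u v hu hun hv hvn huv
    obtain ⟨hu1, hu2⟩ := hu.resolve_left hun
    obtain ⟨hv1, hv2⟩ := hv.resolve_left hvn
    rcases hu2 with hu2 | ⟨x, hx1, hx2, hx3⟩
    · exact Or.inr (hpath u v hv hvn huv.symm (h.anc_of_exit hu2 huv))
    · rcases hv2 with hv2 | ⟨y, hy1, hy2, hy3⟩
      · exact Or.inl (hpath v u hu hun huv (h.anc_of_exit hv2 huv.symm))
      · obtain rfl := hv₂ x y hx1 hy1 (by rw [hx2, hy2, huv])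
        exact (h.spt₂.anc_total (h.mem₂ _) u v hx3 hy3).imp (hpath v u hu hun huv)
          (hpath u v hv hvn huv.symm)
  · intro u hu hn
    rw [hpar u hu hn]
    have hun := hunhit u hu hn
    by_cases hx : isx u
    · rw [h.exit_q₂ hx]; exact (h.exit_ptr hx).1.symm
    · exact (h.class_ptr hun hx).1.symm
  · intro u hu hn
    rw [hpar u hu hn]
    have hun := hunhit u hu hn
    by_cases hx : isx u
    · rw [h.exit_q₂ hx]; exact (h.exit_ptr hx).2.1
    · exact hcl _ _ (h.class_ptr hun hx).2
  · let n := Fintype.card V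
    have hszpos : ∀ x, 1 ≤ sz x := by
      intro x
      rw [hsz]
      exact Finset.card_pos.2 ⟨x, by simpa using h.spt₂.anc_self (h.mem₂ x)⟩
    -- With `X u` the exit of the class of `u`: the length potential is the value of the class plus
    -- the way to its exit, the second one bounds the number of light links still to come by a
    -- logarithm, and the lexicographic one (rank of the exit, rank of the vertex) ensures
    -- termination.
    refine ⟨fun u => if Unhit c R u then val₁ u + (val₂ u - val₂ (X u)) else 0,
      fun u => if Unhit c R u then Nat.log 2 n + 1 - Nat.log 2 (sz (X u)) else 0,
      fun u => if Unhit c R u then toLex (rk₁ (X u) + 1, rk₂ u) else toLex (0, 0), ?_, ?_⟩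
    · intro u
      by_cases hu : Unhit c R u
      · simp only [if_pos hu]
        refine ⟨add_le_add (hL u) ?_, Nat.sub_le _ _⟩
        rw [tsub_le_iff_left]
        exact h.val₂_le (hX u hu).2
      · simp only [if_neg hu]
        exact ⟨zero_le, Nat.zero_le _⟩
    · intro u hu hn
      have hun := hunhit u hu hn
      rw [hpar u hu hn]
      simp only [if_pos hun]
      have hrk := (h.ptr₂ hun).2.1
      have hval := (h.ptr₂ hun).1
      by_cases hx : isx u
      · -- the link leaves the class
        have hq := h.exit_q₂ hx
        obtain ⟨-, -, hne, hrk₁, hval₁⟩ := h.exit_ptr hx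
        rw [← hq] at hne hrk₁ hval₁
        rw [hXx u hx]
        have hνu : 1 ≤ Nat.log 2 n + 1 - Nat.log 2 (sz u) := by
          have : Nat.log 2 (sz u) ≤ Nat.log 2 n := Nat.log_mono_right (by
            rw [hsz]; exact Finset.card_le_univ _)
          omega
        -- The surcharge `Δ` of the link pays for the way from any vertex `z` of the next class to
        -- its exit.
        have hψ : ∀ z, Unhit c R z → c z = c (q₂ u) →
            val₁ z + (val₂ z - val₂ (X z)) + w s(u, q₂ u) ≤ val₁ u + (val₂ u - val₂ u) := by
          intro z hz hzc
          rw [tsub_self, add_zero, hval₁, h.val₁_eq hzc, Sym2.eq_swap (a := u), add_right_comm]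
          gcongr
          rw [tsub_le_iff_left]
          exact h.val₂_le (hX z hz).2
        have hμ : ∀ z, Unhit c R z → c z = c (q₂ u) →
            toLex (rk₁ (X z) + 1, rk₂ z) < toLex (rk₁ u + 1, rk₂ u) := by
          intro z hz hzc
          rw [Prod.Lex.toLex_lt_toLex]
          left
          have := ((h.exit (X z)).1 (hX z hz).1).2 (q₂ u) (hzc.symm.trans (hX z hz).2.symm)
          simp only
          omega
        have hdesc : ∀ z, Unhit c R z → c z = c (q₂ u) → ∀ d, anc₂ d u → anc₂ d (X z) := by
          intro z hz hzc d hd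
          refine h.spt₂.anc_trans (h.mem₂ d) _ _ hd ((h.spt₂.anc_iff u (h.mem₂ u) _).2
            (Or.inr ⟨fun h' => ?_, h.anc_of_exit (hX z hz).1 ((hX z hz).2.trans hzc)⟩))
          rw [h'] at hrk
          exact lt_irrefl _ hrk
        constructor
        · intro hy
          by_cases hyu : Unhit c R (q₂ u)
          · simp only [if_pos hyu]
            refine ⟨hψ _ hyu rfl, ?_, hμ _ hyu rfl⟩
            have : sz u ≤ sz (X (q₂ u)) := by
              rw [hsz, hsz]
              refine Finset.card_le_card fun d hd => ?_
              simp only [Finset.mem_filter, Finset.mem_univ, true_and] at hd ⊢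
              exact hdesc _ hyu rfl d hd
            have := Nat.log_mono_right (b := 2) this
            omega
          · simp only [if_neg hyu]
            refine ⟨?_, Nat.zero_le _, ?_⟩
            · rw [zero_add, hval₁, Sym2.eq_swap (a := u)]
              exact (le_add_self.trans le_self_add).trans le_self_add
            · rw [Prod.Lex.toLex_lt_toLex]
              left; simp
        · intro hy z hz hzc
          by_cases hzu : Unhit c R z
          · simp only [if_pos hzu]
            refine ⟨hψ z hzu hzc, ?_, hμ z hzu hzc⟩
            -- The link is light. The heavy link `y` into the same class has at least as many
            -- descendants, disjoint from those of `u`, and all of them pass through the exit of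
            -- that class; so the size doubles and its logarithm grows by one.
            obtain ⟨y, hy1, hy2, hy3⟩ := hv₃ u hx
            have hyu : u ≠ y := by
              rintro rfl
              exact hy (Or.inr ⟨hzu.congr hzc, Or.inr ⟨u, hy1, rfl, h.spt₂.anc_self (h.mem₂ _)⟩⟩)
            have h2 : 2 * sz u ≤ sz (X z) := by
              have : sz u + sz y ≤ sz (X z) := by
                rw [hsz, hsz, hsz, ← Finset.card_union_of_disjoint]
                · refine Finset.card_le_card fun d hd => ?_
                  simp only [Finset.mem_filter, Finset.mem_univ, true_and, Finset.mem_union]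
                    at hd ⊢
                  rcases hd with hd | hd
                  · exact hdesc z hzu hzc d hd
                  · refine h.spt₂.anc_trans (h.mem₂ d) _ _ hd
                      ((h.spt₂.anc_iff y (h.mem₂ y) _).2 (Or.inr ⟨fun h' => ?_,
                        h.anc_of_exit (hX z hzu).1 ((hX z hzu).2.trans (hzc.trans hy2.symm))⟩))
                    have := (h.ptr₂ ((h.exit y).1 (hv₁ y hy1)).1).2.1
                    rw [h'] at this
                    exact lt_irrefl _ this
                · rw [Finset.disjoint_left]
                  intro d hd hd'
                  simp only [Finset.mem_filter, Finset.mem_univ, true_and] at hd hd'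
                  exact h.exit_disjoint hx (hv₁ y hy1) hyu (hX z hzu).1
                    (hzc.symm.trans (hX z hzu).2.symm)
                    (hy2.trans (hzc.symm.trans (hX z hzu).2.symm)) hd hd'
              omega
            have h3 := Nat.log_mono_right (b := 2) h2
            rw [mul_comm, Nat.log_mul_base (by norm_num) (by have := hszpos u; omega)] at h3
            have h4 : Nat.log 2 (sz (X z)) ≤ Nat.log 2 n := Nat.log_mono_right (by
              rw [hsz]; exact Finset.card_le_univ _)
            omega
          · simp only [if_neg hzu]
            refine ⟨?_, by omega, ?_⟩
            · rw [zero_add, hval₁, Sym2.eq_swap (a := u)]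
              exact (le_add_self.trans le_self_add).trans le_self_add
            · rw [Prod.Lex.toLex_lt_toLex]
              left; simp
      · -- the link stays in the class
        obtain ⟨-, hq⟩ := h.class_ptr hun hx
        have hqu : Unhit c R (q₂ u) := hun.congr hq.symm
        have hqR : R' (q₂ u) := by
          obtain ⟨x, hx1, hx2, hx3⟩ := ((hu.resolve_left hn).2).resolve_left hx
          refine Or.inr ⟨hqu, Or.inr ⟨x, hx1, hx2.trans hq.symm, ?_⟩⟩
          refine h.spt₂.anc_trans (h.mem₂ _) _ _ hx3 ((h.spt₂.anc_iff u (h.mem₂ u) _).2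
            (Or.inr ⟨fun h' => ?_, h.spt₂.anc_self (h.mem₂ _)⟩))
          rw [h'] at hrk
          exact lt_irrefl _ hrk
        refine ⟨fun _ => ?_, fun h' => absurd hqR h'⟩
        simp only [if_pos hqu]
        rw [← hXc u (q₂ u) hq.symm hun]
        refine ⟨?_, le_rfl, ?_⟩
        · have h1 : val₂ (X u) ≤ val₂ (q₂ u) := h.val₂_anc
            (h.anc_of_exit (hX u hun).1 ((hX u hun).2.trans hq.symm))
          rw [hval, Sym2.eq_swap (a := u), ← tsub_add_eq_add_tsub h1, h.val₁_eq hq, add_assoc]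
        · rw [Prod.Lex.toLex_lt_toLex]
          right
          exact ⟨rfl, hrk⟩

end TreeStep


/-! ### Paths of the tree -/

section Paths

set_option linter.unusedSectionVars false

variable {V : Type*} [DecidableEq V] {G : SimpleGraph V} {w : Sym2 V → ℝ≥0} {par : V → V}

/-- Following the parents from `v`, one meets the vertices in `A` and then, for the first time, a
vertex `z` of `S`. -/
inductive ParPath (par : V → V) (S : V → Prop) : V → Finset V → V → Prop
  | base {v : V} : S v → ParPath par S v ∅ v
  | step {v z : V} {A : Finset V} : ¬ S v → ParPath par S (par v) A z →
      ParPath par S v (insert v A) z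

/-- The cost of the edges that join the vertices in `A` to their parents. -/
noncomputable def parCost (w : Sym2 V → ℝ≥0) (par : V → V) (A : Finset V) : ℝ≥0 :=
  ∑ a ∈ A, w s(a, par a)

theorem parCost_union_le (A B : Finset V) :
    parCost w par (A ∪ B) ≤ parCost w par A + parCost w par B := by
  unfold parCost
  rw [← Finset.sum_union_inter]
  exact le_self_add

theorem parCost_insert_le (a : V) (A : Finset V) :
    parCost w par (insert a A) ≤ w s(a, par a) + parCost w par A := by
  rw [Finset.insert_eq]
  exact (parCost_union_le _ _).trans (by simp [parCost])

theorem parCost_biUnion_le (S : Finset V) (f : V → Finset V) :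
    parCost w par (S.biUnion f) ≤ ∑ b ∈ S, parCost w par (f b) := by
  induction S using Finset.induction_on with
  | empty => simp [parCost]
  | insert a S ha ih =>
    rw [Finset.biUnion_insert, Finset.sum_insert ha]
    exact (parCost_union_le _ _).trans (by gcongr)

theorem ParPath.mem {S : V → Prop} {v z : V} {A : Finset V} (h : ParPath par S v A z) : S z := by
  induction h with
  | base h => exact h
  | step _ _ ih => exact ih

theorem ParPath.unique {S : V → Prop} {v z z' : V} {A A' : Finset V} (h : ParPath par S v A z)
    (h' : ParPath par S v A' z') : A = A' ∧ z = z' := by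
  induction h generalizing A' z' with
  | base h =>
    cases h' with
    | base => exact ⟨rfl, rfl⟩
    | step h1 _ => exact absurd h h1
  | step h _ ih =>
    cases h' with
    | base h1 => exact absurd h1 h
    | step _ h2 =>
      obtain ⟨rfl, rfl⟩ := ih h2
      exact ⟨rfl, rfl⟩

theorem ParPath.trans {S S' : V → Prop} (hS : ∀ v, S' v → S v) {v z z' : V} {A A' : Finset V}
    (h : ParPath par S v A z) (h' : ParPath par S' z A' z') : ParPath par S' v (A ∪ A') z' := by
  induction h with
  | base h => simpa using h'
  | step h1 _ ih =>
    rw [Finset.insert_union]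
    exact .step (fun h => h1 (hS _ h)) (ih h')

/-- Parent paths from comparable vertices. -/
theorem ParPath.subset_of_chain {S S' : V → Prop} {u v z : V} {A : Finset V}
    (h : Relation.ReflTransGen (fun a b => S' a ∧ ¬ S a ∧ b = par a) u v)
    (hu : ParPath par S u A z) : ∃ A' ⊆ A, ParPath par S v A' z := by
  induction h using Relation.ReflTransGen.head_induction_on generalizing A with
  | refl => exact ⟨A, subset_rfl, hu⟩
  | head hab _ ih =>
    obtain ⟨-, h1, rfl⟩ := hab
    cases hu with
    | base h2 => exact absurd h2 h1
    | step _ h2 =>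
      obtain ⟨A', hA', hp⟩ := ih h2
      exact ⟨A', hA'.trans (Finset.subset_insert _ _), hp⟩

/-- The parent paths of one level, assembled from those of the finer level. -/
theorem TreeStep.parPath {C c : V → V} {R R' : V → Prop} {L E : ℝ≥0} {m : ℕ}
    (h : TreeStep G w C c R R' par L m) (hc : ∀ u v, c u = c v → C u = C v)
    (hE : ∀ v, ∃ A z, ParPath par R' v A z ∧ c z = c v ∧ parCost w par A ≤ E) (v : V) :
    ∃ A z, ParPath par R v A z ∧ C z = C v ∧ parCost w par A ≤ L + (m + 1) * E := by
  obtain ⟨ψ, ν, μ, hb, hp⟩ := h.potential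
  have key : ∀ u, R' u → ∃ A z, ParPath par R u A z ∧ C z = C u ∧
      parCost w par A ≤ ψ u + ν u * E := by
    intro u
    induction hk : μ u using WellFoundedLT.induction generalizing u with
    | _ k ih =>
      intro hu
      by_cases hR : R u
      · exact ⟨∅, u, .base hR, rfl, by simp [parCost]⟩
      · obtain ⟨h1, h2⟩ := hp u hu hR
        -- If the parent belongs to the finer set, the path goes on directly. Otherwise a path of
        -- the finer level, of cost at most `E`, leads back to that set within the same class, and
        -- the bound on the number of detours drops.
        by_cases hy : R' (par u)
        · obtain ⟨h3, h4, h5⟩ := h1 hy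
          obtain ⟨A, z, h6, h7, h8⟩ := ih _ (hk ▸ h5) _ rfl hy
          refine ⟨_, z, .step hR h6, h7.trans (h.cls u hu hR), ?_⟩
          refine (parCost_insert_le _ _).trans ?_
          calc w s(u, par u) + parCost w par A ≤ w s(u, par u) + (ψ (par u) + ν (par u) * E) := by
                gcongr
            _ = (ψ (par u) + w s(u, par u)) + ν (par u) * E := by ring
            _ ≤ ψ u + ν u * E := by gcongr
        · obtain ⟨A, z, h6, h7, h8⟩ := hE (par u)
          obtain ⟨h3, h4, h5⟩ := h2 hy z h6.mem h7
          obtain ⟨A', z', h9, h10, h11⟩ := ih _ (hk ▸ h5) _ rfl h6.mem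
          refine ⟨_, z', .step hR (h6.trans h.sub h9), h10.trans ((hc _ _ h7).trans
            (h.cls u hu hR)), ?_⟩
          refine (parCost_insert_le _ _).trans ?_
          calc w s(u, par u) + parCost w par (A ∪ A')
              ≤ w s(u, par u) + (E + (ψ z + ν z * E)) := by
                gcongr
                exact (parCost_union_le _ _).trans (add_le_add h8 h11)
            _ = (ψ z + w s(u, par u)) + (ν z + 1) * E := by ring
            _ ≤ ψ u + ν u * E := by
              gcongr
              exact_mod_cast h4
  obtain ⟨A, z, h1, h2, h3⟩ := hE v
  obtain ⟨A', z', h4, h5, h6⟩ := key z h1.mem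
  refine ⟨_, z', h1.trans h.sub h4, h5.trans (hc _ _ h2), ?_⟩
  calc parCost w par (A ∪ A') ≤ E + (ψ z + ν z * E) :=
        (parCost_union_le _ _).trans (add_le_add h3 h6)
    _ ≤ E + (L + m * E) := by
      gcongr
      · exact (hb z).1
      · exact (hb z).2
    _ = _ := by ring

end Paths

/-! ### The hierarchy of partitions -/

section Levels

set_option linter.unusedSectionVars false

variable {V : Type*} [DecidableEq V] [Fintype V] {G : SimpleGraph V} {w : Sym2 V → ℝ≥0}
  {D : V → V → ℝ≥0} {r : V} {par : V → V}

/-- A hierarchy of partitions into the fibres of `c i`, with distance scales `ρ i` and strong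
diameters at most `Δ i`. -/
structure Levels (G : SimpleGraph V) (w : Sym2 V → ℝ≥0) (D : V → V → ℝ≥0) (r : V) (κ g : ℝ≥0)
    (β N : ℕ) (c : ℕ → V → V) (ρ Δ : ℕ → ℝ≥0) : Prop where
  bot : ∀ u v, c 0 u = c 0 v → u = v
  nest : ∀ i < N, ∀ u v, c i u = c i v → c (i + 1) u = c (i + 1) v
  walk : ∀ i ≤ N, ∀ u v, c i u = c i v →
    ∃ p : G.Walk u v, (∀ x ∈ p.support, c i x = c i u) ∧ wl w p ≤ Δ i
  ball : ∀ i < N, ∀ v, ((Finset.univ.filter fun x => D v x < ρ (i + 1)).image (c i)).card ≤ β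
  root : ∀ i < N, ∀ v, D r v < ρ (i + 1) → c i v = c i r
  growth : ∀ i < N, g * ρ i ≤ ρ (i + 1)
  diam : ∀ i ≤ N, Δ i ≤ κ * g * ρ i
  diam_next : ∀ i < N, Δ i ≤ κ * ρ (i + 1)
  bot_scale : ρ 0 = 0
  top : ∀ u v, c N u = c N v

/-- The constant in the lengths of the links. -/
noncomputable def linkConst (κ g : ℝ≥0) (β : ℕ) : ℝ≥0 := κ * g + κ * β * (κ * g + 1) + κ

/-- The tree built along a hierarchy of partitions. -/
structure TreeSteps (G : SimpleGraph V) (w : Sym2 V → ℝ≥0) (r : V) (κ g : ℝ≥0) (β m N : ℕ)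
    (c : ℕ → V → V) (ρ : ℕ → ℝ≥0) (R : ℕ → V → Prop) (par : V → V) : Prop where
  bot : ∀ v, R 0 v
  top : ∀ v, R N v ↔ v = r
  step : ∀ i < N, TreeStep G w (c (i + 1)) (c i) (R (i + 1)) (R i) par
    (linkConst κ g β * ρ (i + 1)) m

variable {κ g : ℝ≥0} {β m N : ℕ} {c : ℕ → V → V} {ρ Δ : ℕ → ℝ≥0} {R : ℕ → V → Prop}

/-- The labels that a short walk can meet. -/
theorem Levels.labels (hl : Levels G w D r κ g β N c ρ Δ) (hD : IsDist G w D) (hβ : 1 ≤ β)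
    {i : ℕ} (hi : i < N) {u v : V} (p : G.Walk u v) (hp : wl w p ≤ Δ (i + 1)) :
    ((p.support.toFinset.image (c i)).card : ℝ≥0) * Δ i ≤
      κ * β * (κ * g + 1) * ρ (i + 1) := by
  have h1 := card_labels_mul_le hD hβ (hl.ball i hi) p
  calc ((p.support.toFinset.image (c i)).card : ℝ≥0) * Δ i
      ≤ (p.support.toFinset.image (c i)).card * (κ * ρ (i + 1)) := by
        gcongr; exact hl.diam_next i hi
    _ = κ * ((p.support.toFinset.image (c i)).card * ρ (i + 1)) := by ring
    _ ≤ κ * (β * (κ * g * ρ (i + 1) + ρ (i + 1))) :=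
      mul_le_mul' le_rfl (h1.trans (by gcongr; exact hp.trans (hl.diam (i + 1) hi)))
    _ = _ := by ring

/-- One level uses links of total length `linkConst * ρ (i + 1)` and at most `m + 1` paths of the
finer level. Since `g ≥ 2 * (m + 1)`, the latter cost no more than the former, which explains the
factor `2`. -/
theorem TreeSteps.parPath (hl : Levels G w D r κ g β N c ρ Δ)
    (ht : TreeSteps G w r κ g β m N c ρ R par) (hg : 2 * (m + 1) ≤ g) :
    ∀ i ≤ N, ∀ v, ∃ A z, ParPath par (R i) v A z ∧ c i z = c i v ∧
      parCost w par A ≤ 2 * linkConst κ g β * ρ i := by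
  intro i
  induction i with
  | zero =>
    intro _ v
    exact ⟨∅, v, .base (ht.bot v), rfl, by simp [parCost]⟩
  | succ i ih =>
    intro hi v
    obtain ⟨A, z, h1, h2, h3⟩ := (ht.step i hi).parPath (hl.nest i hi) (ih (by omega)) v
    refine ⟨A, z, h1, h2, h3.trans ?_⟩
    calc linkConst κ g β * ρ (i + 1) + (m + 1) * (2 * linkConst κ g β * ρ i)
        = linkConst κ g β * ρ (i + 1) + linkConst κ g β * (2 * (m + 1) * ρ i) := by ring
      _ ≤ linkConst κ g β * ρ (i + 1) + linkConst κ g β * ρ (i + 1) := by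
        gcongr
        exact (by gcongr : _ ≤ g * ρ i).trans (hl.growth i hi)
      _ = _ := by ring

theorem TreeSteps.root_mem (ht : TreeSteps G w r κ g β m N c ρ R par) : ∀ i ≤ N, R i r := by
  intro i hi
  induction hi using Nat.decreasingInduction with
  | self => exact (ht.top r).2 rfl
  | of_succ i hi ih => exact (ht.step i hi).sub _ ih

/-- The number of classes of level `i` with vertices of `X`, apart from the one of the root. -/
noncomputable def classCount (c : ℕ → V → V) (r : V) (X : Finset V) (i : ℕ) : ℕ :=
  ((X.filter fun x => c i x ≠ c i r).image (c i)).card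

/-- The paths from `X` towards the root. -/
theorem TreeSteps.parPaths (hl : Levels G w D r κ g β N c ρ Δ)
    (ht : TreeSteps G w r κ g β m N c ρ R par) (hg : 2 * (m + 1) ≤ g) (X : Finset V) :
    ∀ i ≤ N, ∃ U : Finset V, (∀ x ∈ X, ∃ A z, A ⊆ U ∧ ParPath par (R i) x A z) ∧
      (∀ a ∈ U, ∃ x ∈ X, ∃ A z, ParPath par (R i) x A z ∧ a ∈ A) ∧
      parCost w par U ≤ ∑ j ∈ Finset.range i,
        classCount c r X j * (2 * linkConst κ g β * ρ (j + 1)) := by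
  intro i
  induction i with
  | zero =>
    intro _
    exact ⟨∅, fun x _ => ⟨∅, x, subset_rfl, .base (ht.bot x)⟩, by simp, by simp [parCost]⟩
  | succ i ih =>
    intro hi
    obtain ⟨U, hU, hU', hcost⟩ := ih (by omega)
    choose A₁ z₁ hp₁ hc₁ _ using ht.parPath hl hg i (by omega)
    choose A₂ z₂ hp₂ _ hb₂ using ht.parPath hl hg (i + 1) hi
    have hs := ht.step i hi
    set B := X.filter fun x => c i x ≠ c i r with hB
    -- The root belongs to every set, so by `hit` a vertex reached in its class already lies in the
    -- next set, and nothing more is paid.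
    have hemp : ∀ x ∈ X, x ∉ B → A₂ (z₁ x) = ∅ := by
      intro x hx hxB
      have h1 : c i x = c i r := by
        by_contra h'
        exact hxB (Finset.mem_filter.2 ⟨hx, h'⟩)
      have h2 : R (i + 1) (z₁ x) := hs.hit _ r (hp₁ x).mem (ht.root_mem _ hi)
        ((hc₁ x).trans h1)
      exact ((hp₂ (z₁ x)).unique (.base h2)).1
    -- By `chain` the vertices reached in one class are comparable along the parents, so the path
    -- with most vertices contains the others and the class pays only once.
    have hrep : ∀ b ∈ B.image (c i), ∃ y ∈ B, c i y = b ∧ ∀ x ∈ B, c i x = b →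
        A₂ (z₁ x) ⊆ A₂ (z₁ y) := by
      intro b hb
      obtain ⟨x₀, hx₀, hxb⟩ := Finset.mem_image.1 hb
      obtain ⟨y, hy, hmax⟩ := Finset.exists_max_image (B.filter fun x => c i x = b)
        (fun x => (A₂ (z₁ x)).card) ⟨x₀, Finset.mem_filter.2 ⟨hx₀, hxb⟩⟩
      obtain ⟨hyB, hyb⟩ := Finset.mem_filter.1 hy
      refine ⟨y, hyB, hyb, fun x hx hxb => ?_⟩
      by_cases h1 : R (i + 1) (z₁ x)
      · rw [((hp₂ (z₁ x)).unique (.base h1)).1]; simp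
      by_cases h2 : R (i + 1) (z₁ y)
      · exact absurd (hs.hit _ _ (hp₁ x).mem h2 ((hc₁ x).trans (hxb.trans (hyb.symm.trans
          (hc₁ y).symm)))) h1
      rcases hs.chain _ _ (hp₁ x).mem h1 (hp₁ y).mem h2
        ((hc₁ x).trans (hxb.trans (hyb.symm.trans (hc₁ y).symm))) with h3 | h3
      · obtain ⟨A', hA', hp'⟩ := (hp₂ (z₁ x)).subset_of_chain h3
        rw [((hp₂ (z₁ y)).unique hp').1]
        have : A' = A₂ (z₁ x) := Finset.eq_of_subset_of_card_le hA' (by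
          rw [← ((hp₂ (z₁ y)).unique hp').1]
          exact hmax x (Finset.mem_filter.2 ⟨hx, hxb⟩))
        rw [this]
      · obtain ⟨A', hA', hp'⟩ := (hp₂ (z₁ y)).subset_of_chain h3
        rw [((hp₂ (z₁ x)).unique hp').1]
        exact hA'
    choose! y hyB hyb hy using hrep
    refine ⟨U ∪ (B.image (c i)).biUnion (fun b => A₂ (z₁ (y b))), ?_, ?_, ?_⟩
    · intro x hx
      obtain ⟨A, z, hA, hp⟩ := hU x hx
      obtain ⟨rfl, rfl⟩ := hp.unique (hp₁ x)
      refine ⟨_, _, ?_, hp.trans hs.sub (hp₂ _)⟩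
      refine Finset.union_subset_union hA ?_
      by_cases hxB : x ∈ B
      · have hb := Finset.mem_image_of_mem (c i) hxB
        exact (hy _ hb x hxB rfl).trans
          (Finset.subset_biUnion_of_mem (fun b => A₂ (z₁ (y b))) hb)
      · rw [hemp x hx hxB]; simp
    · intro a ha
      rcases Finset.mem_union.1 ha with ha | ha
      · obtain ⟨x, hx, A, z, hp, haA⟩ := hU' a ha
        obtain ⟨rfl, rfl⟩ := hp.unique (hp₁ x)
        exact ⟨x, hx, _, _, hp.trans hs.sub (hp₂ _), Finset.mem_union_left _ haA⟩
      · obtain ⟨b, hb, hab⟩ := Finset.mem_biUnion.1 ha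
        exact ⟨y b, (Finset.mem_filter.1 (hyB b hb)).1, _, _, (hp₁ _).trans hs.sub (hp₂ _),
          Finset.mem_union_right _ hab⟩
    · rw [Finset.sum_range_succ]
      refine (parCost_union_le _ _).trans (add_le_add hcost ?_)
      calc parCost w par ((B.image (c i)).biUnion fun b => A₂ (z₁ (y b)))
          ≤ ∑ b ∈ B.image (c i), parCost w par (A₂ (z₁ (y b))) := by
            exact parCost_biUnion_le _ _
        _ ≤ ∑ b ∈ B.image (c i), 2 * linkConst κ g β * ρ (i + 1) :=
            Finset.sum_le_sum fun b _ => hb₂ _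
        _ = _ := by simp [classCount, ← hB]

end Levels


/-! ### Lower bounds for Steiner trees -/

section Steiner

set_option linter.unusedSectionVars false

variable {V : Type*} [DecidableEq V] [Fintype V] {G : SimpleGraph V} {w : Sym2 V → ℝ≥0}
  {D : V → V → ℝ≥0}

theorem wl_eq_sum {u v : V} (p : G.Walk u v) : wl w p = (p.edges.map w).sum := by
  induction p with
  | nil => rfl
  | cons h p ih => simp [ih]

theorem exists_path_of_connected {H : G.Subgraph} (hH : H.Connected) {u v : V} (hu : u ∈ H.verts)
    (hv : v ∈ H.verts) : ∃ p : G.Walk u v, p.IsPath ∧ ∀ e ∈ p.edges, e ∈ H.edgeSet := by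
  obtain ⟨p, hp⟩ := (SimpleGraph.Subgraph.connected_iff_forall_exists_walk_subgraph H).1 hH |>.2
    hu hv
  refine ⟨p.bypass, p.bypass_isPath, fun e he => ?_⟩
  have h1 := SimpleGraph.Walk.edges_bypass_subset_edges p he
  exact SimpleGraph.Subgraph.edgeSet_mono hp (by simpa using h1)

open Classical in
theorem sum_edges_le {H : G.Subgraph} {u v : V} {p : G.Walk u v} (hp : p.IsPath)
    (he : ∀ e ∈ p.edges, e ∈ H.edgeSet) (f : Sym2 V → ℝ≥0) :
    (p.edges.map f).sum ≤ ∑ e : Sym2 V with e ∈ H.edgeSet, f e := by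
  rw [← List.sum_toFinset f hp.isTrail.edges_nodup]
  refine Finset.sum_le_sum_of_subset fun e h => ?_
  simp only [Finset.mem_filter, Finset.mem_univ, true_and]
  exact he e (List.mem_toFinset.1 h)

theorem dist_le_cost (hD : IsDist G w D) {H : G.Subgraph} (hH : H.Connected) {u v : V}
    (hu : u ∈ H.verts) (hv : v ∈ H.verts) : D u v ≤ cost w H := by
  obtain ⟨p, hp, he⟩ := exists_path_of_connected hH hu hv
  refine (hD.le p).trans ?_
  rw [wl_eq_sum]
  exact sum_edges_le hp he w

/-- A connected subgraph that contains many distant vertices is costly. -/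
theorem card_mul_le_cost (hD : IsDist G w D) {H : G.Subgraph} (hH : H.Connected) {Y : Finset V}
    (hY : ∀ y ∈ Y, y ∈ H.verts) (h2 : 2 ≤ Y.card) {ρ : ℝ≥0}
    (hρ : ∀ y ∈ Y, ∀ y' ∈ Y, y ≠ y' → ρ ≤ D y y') : Y.card * ρ ≤ 4 * cost w H := by
  classical
  have h1 : ∀ y ∈ Y, ρ ≤ 2 * ∑ e : Sym2 V with e ∈ H.edgeSet,
      if ∃ x ∈ e, 2 * D y x < ρ then w e else 0 := by
    intro y hy
    obtain ⟨y', hy', hne⟩ := Finset.exists_mem_ne (s := Y) (by omega) y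
    obtain ⟨p, hp, he⟩ := exists_path_of_connected hH (hY y hy) (hY y' hy')
    -- As long as the walk stays in the open ball of radius `ρ / 2` about `y`, every edge starts in
    -- that ball and is counted; so the counted edges have total weight at least `ρ / 2`.
    have key : ∀ {u v : V} (p : G.Walk u v), ρ ≤ D y v → ρ ≤ 2 * (D y u +
        (p.edges.map fun e => if ∃ x ∈ e, 2 * D y x < ρ then w e else 0).sum) := by
      intro u v p hv
      induction p with
      | @nil u =>
        refine hv.trans ?_
        simp only [SimpleGraph.Walk.edges_nil, List.map_nil, List.sum_nil, add_zero, two_mul]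
        exact le_self_add
      | @cons u x v hux p ih =>
        by_cases hu : 2 * D y u < ρ
        · refine (ih hv).trans ?_
          rw [SimpleGraph.Walk.edges_cons, List.map_cons, List.sum_cons,
            if_pos ⟨u, by simp, hu⟩, ← add_assoc]
          gcongr
          exact (hD.triangle y u x).trans (by gcongr; exact hD.edge hux)
        · refine (not_lt.1 hu).trans ?_
          gcongr
          exact le_self_add
    have h3 := key p (hρ y hy y' hy' hne.symm)
    rw [hD.self, zero_add] at h3
    refine h3.trans ?_
    gcongr
    exact sum_edges_le hp he fun e => if ∃ x ∈ e, 2 * D y x < ρ then w e else 0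
  -- The open balls of radius `ρ / 2` about separated points are disjoint; hence an edge, with its
  -- two ends, is counted at most twice.
  have hone : ∀ x, (Y.filter fun y => 2 * D y x < ρ).card ≤ 1 := by
    intro x
    rw [Finset.card_le_one]
    intro a ha b hb
    rw [Finset.mem_filter] at ha hb
    by_contra hab
    have h3 := hρ a ha.1 b hb.1 hab
    have h4 := hD.triangle a x b
    rw [hD.symm x b] at h4
    have h5 : 2 * D a x + 2 * D b x < 2 * ρ := by rw [two_mul ρ]; exact add_lt_add ha.2 hb.2
    have h6 : 2 * ρ ≤ 2 * D a x + 2 * D b x := by rw [← mul_add]; gcongr; exact h3.trans h4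
    exact absurd h5 (not_lt.2 h6)
  have htwo : ∀ e : Sym2 V, (Y.filter fun y => ∃ x ∈ e, 2 * D y x < ρ).card ≤ 2 := by
    intro e
    induction e with
    | _ a b =>
      have : (Y.filter fun y => ∃ x ∈ s(a, b), 2 * D y x < ρ) ⊆
          (Y.filter fun y => 2 * D y a < ρ) ∪ (Y.filter fun y => 2 * D y b < ρ) := by
        intro y hy
        simp only [Finset.mem_filter, Sym2.mem_iff, Finset.mem_union] at hy ⊢
        obtain ⟨hy, x, rfl | rfl, hx⟩ := hy
        · exact Or.inl ⟨hy, hx⟩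
        · exact Or.inr ⟨hy, hx⟩
      have h3 := (Finset.card_le_card this).trans (Finset.card_union_le _ _)
      have h4 := hone a
      have h5 := hone b
      omega
  calc Y.card * ρ = ∑ y ∈ Y, ρ := by simp
    _ ≤ ∑ y ∈ Y, 2 * ∑ e : Sym2 V with e ∈ H.edgeSet,
        (if ∃ x ∈ e, 2 * D y x < ρ then w e else 0) := Finset.sum_le_sum h1
    _ = 2 * ∑ e : Sym2 V with e ∈ H.edgeSet, ∑ y ∈ Y,
        (if ∃ x ∈ e, 2 * D y x < ρ then w e else 0) := by
      rw [← Finset.mul_sum, Finset.sum_comm]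
    _ ≤ 2 * ∑ e : Sym2 V with e ∈ H.edgeSet, 2 * w e := by
      gcongr with e he
      rw [← Finset.sum_filter, Finset.sum_const, nsmul_eq_mul]
      gcongr
      exact_mod_cast htwo e
    _ = 4 * cost w H := by
      rw [← Finset.mul_sum, cost]; ring

end Steiner

/-! ### Lower bounds for Steiner trees in terms of the classes. -/

section Stretch

set_option linter.unusedSectionVars false

variable {V : Type*} [DecidableEq V] [Fintype V] {G : SimpleGraph V} {w : Sym2 V → ℝ≥0}
  {D : V → V → ℝ≥0} {r : V} {κ g : ℝ≥0} {β m N l : ℕ} {c : ℕ → V → V} {ρ Δ : ℕ → ℝ≥0}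
  {R : ℕ → V → Prop} {par : V → V}

/-- The classes that a Steiner tree has to reach. -/
theorem Levels.classCount_le (hl : Levels G w D r κ g β N c ρ Δ) (hD : IsDist G w D)
    {H : G.Subgraph} (hH : H.Connected) (hr : r ∈ H.verts) {X : Finset V}
    (hX : ∀ x ∈ X, x ∈ H.verts) {i : ℕ} (hi : i < N) :
    classCount c r X i * ρ (i + 1) ≤ 4 * β * cost w H := by
  classical
  rcases eq_or_ne (ρ (i + 1)) 0 with h0 | h0
  · rw [h0, mul_zero]; exact zero_le
  set B := X.filter fun x => c i x ≠ c i r with hB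
  have hBr : ∀ x ∈ B, ρ (i + 1) ≤ D r x := by
    intro x hx
    by_contra h'
    exact (Finset.mem_filter.1 hx).2 (hl.root i hi x (not_le.1 h'))
  rcases B.eq_empty_or_nonempty with hBe | hBne
  · have : classCount c r X i = 0 := by simp [classCount, ← hB, hBe]
    rw [this]; simp
  -- A maximal separated set `Y` of terminals outside the class of the root: by maximality its balls
  -- cover all these terminals, each ball meeting at most `β` classes. Adding the root keeps the set
  -- separated and provides the second point that the lower bound needs.
  let sep : Finset V → Prop := fun Y => ∀ y ∈ Y, ∀ y' ∈ Y, y ≠ y' → ρ (i + 1) ≤ D y y'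
  obtain ⟨Y, hY, hmax⟩ := Finset.exists_max_image (B.powerset.filter sep) Finset.card
    ⟨∅, by simp [sep]⟩
  obtain ⟨hYB, hYs⟩ := Finset.mem_filter.1 hY
  rw [Finset.mem_powerset] at hYB
  have hcov : ∀ x ∈ B, ∃ y ∈ Y, D y x < ρ (i + 1) := by
    intro x hx
    by_contra hno
    push Not at hno
    have hxY : x ∉ Y := fun h' => by
      have := hno x h'
      rw [hD.self] at this
      exact h0 (le_antisymm this zero_le)
    have h1 := hmax (insert x Y) (Finset.mem_filter.2 ⟨Finset.mem_powerset.2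
      (Finset.insert_subset hx hYB), ?_⟩)
    · rw [Finset.card_insert_of_notMem hxY] at h1; omega
    · intro y hy y' hy' hne
      rcases Finset.mem_insert.1 hy with rfl | h₁ <;> rcases Finset.mem_insert.1 hy' with rfl | h₂
      · exact absurd rfl hne
      · rw [hD.symm]; exact hno y' h₂
      · exact hno y h₁
      · exact hYs y h₁ y' h₂ hne
  have hYne : Y.Nonempty := by
    obtain ⟨x, hx⟩ := hBne
    obtain ⟨y, hy, -⟩ := hcov x hx
    exact ⟨y, hy⟩
  have hrY : r ∉ Y := fun h' => (Finset.mem_filter.1 (hYB h')).2 rfl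
  have h1 := card_mul_le_cost hD hH (Y := insert r Y) (ρ := ρ (i + 1)) (by
      intro y hy
      rcases Finset.mem_insert.1 hy with rfl | hy
      · exact hr
      · exact hX y (Finset.mem_filter.1 (hYB hy)).1)
    (by rw [Finset.card_insert_of_notMem hrY]; have := hYne.card_pos; omega) (by
      intro y hy y' hy' hne
      rcases Finset.mem_insert.1 hy with rfl | h₁ <;> rcases Finset.mem_insert.1 hy' with rfl | h₂
      · exact absurd rfl hne
      · exact hBr y' (hYB h₂)
      · rw [hD.symm]; exact hBr y (hYB h₁)
      · exact hYs y h₁ y' h₂ hne)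
  have h2 : classCount c r X i ≤ Y.card * β := by
    calc classCount c r X i ≤ (Y.biUnion fun y =>
          (Finset.univ.filter fun x => D y x < ρ (i + 1)).image (c i)).card := by
          refine Finset.card_le_card fun b hb => ?_
          obtain ⟨x, hx, rfl⟩ := Finset.mem_image.1 hb
          obtain ⟨y, hy, hyx⟩ := hcov x hx
          exact Finset.mem_biUnion.2 ⟨y, hy, Finset.mem_image_of_mem _ (by simpa using hyx)⟩
      _ ≤ Y.card * β := by
          refine Finset.card_biUnion_le.trans ?_
          rw [← smul_eq_mul]
          exact Finset.sum_le_card_nsmul _ _ _ fun y _ => hl.ball i hi y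
  calc (classCount c r X i : ℝ≥0) * ρ (i + 1) ≤ (Y.card * β : ℕ) * ρ (i + 1) := by
        gcongr
    _ = β * (Y.card * ρ (i + 1)) := by push_cast; ring
    _ ≤ β * ((insert r Y).card * ρ (i + 1)) := by
      gcongr
      exact Finset.subset_insert _ _
    _ ≤ β * (4 * cost w H) := by gcongr
    _ = _ := by ring

/-- The sum over all levels is dominated by few levels. -/
theorem Levels.sum_classCount_le (hl : Levels G w D r κ g β N c ρ Δ) (hD : IsDist G w D)
    (hg : 2 ≤ g) (hn : Fintype.card V ≤ 2 ^ l) {H : G.Subgraph} (hH : H.Connected)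
    (hr : r ∈ H.verts) {X : Finset V} (hX : ∀ x ∈ X, x ∈ H.verts) :
    ∀ i ≤ N, ∑ j ∈ Finset.range i, (classCount c r X j : ℝ≥0) * ρ (j + 1) ≤
      l * (4 * β * cost w H) + 2 * cost w H := by
  have hcount : ∀ i, (classCount c r X i : ℝ≥0) ≤ Fintype.card V := by
    intro i
    exact_mod_cast Finset.card_le_univ _
  have hgr : ∀ i < N, 2 * ρ i ≤ ρ (i + 1) := fun i hi =>
    (by gcongr : 2 * ρ i ≤ g * ρ i).trans (hl.growth i hi)
  -- The `k` highest levels pay `4 * β * cost` each. The levels below form a geometric sum of at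
  -- most `2 * n * ρ (i - k)`, and `2 ^ k * ρ (i - k) ≤ ρ i`; multiplying by `2 ^ k` avoids
  -- division.
  have h1 : ∀ k : ℕ, ∀ i ≤ N, 2 ^ k * ∑ j ∈ Finset.range i, (classCount c r X j : ℝ≥0) * ρ (j + 1) ≤
      2 ^ k * (k * (4 * β * cost w H)) + 2 * Fintype.card V * ρ i := by
    intro k
    induction k with
    | zero =>
      intro i
      induction i with
      | zero => simp
      | succ i ih =>
        intro hi
        have h2 := ih (by omega)
        have h3 := hgr i hi
        simp only [pow_zero, one_mul, Nat.cast_zero, zero_mul, zero_add] at h2 ⊢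
        rw [Finset.sum_range_succ]
        calc _ ≤ 2 * Fintype.card V * ρ i + Fintype.card V * ρ (i + 1) := by
              gcongr; exact_mod_cast hcount i
          _ = Fintype.card V * (2 * ρ i) + Fintype.card V * ρ (i + 1) := by ring
          _ ≤ Fintype.card V * ρ (i + 1) + Fintype.card V * ρ (i + 1) := by gcongr
          _ = _ := by ring
    | succ k ihk =>
      intro i hi
      rcases i with _ | i
      · simp
      · have h2 := ihk i (by omega)
        have h3 := hgr i hi
        have h4 := hl.classCount_le hD hH hr hX hi
        rw [Finset.sum_range_succ, pow_succ]
        calc (2 ^ k * 2 : ℝ≥0) * (∑ j ∈ Finset.range i, (classCount c r X j : ℝ≥0) * ρ (j + 1) +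
              classCount c r X i * ρ (i + 1))
            = 2 * (2 ^ k * ∑ j ∈ Finset.range i, (classCount c r X j : ℝ≥0) * ρ (j + 1)) +
              2 ^ k * 2 * (classCount c r X i * ρ (i + 1)) := by ring
          _ ≤ 2 * (2 ^ k * (k * (4 * β * cost w H)) + 2 * Fintype.card V * ρ i) +
              2 ^ k * 2 * (4 * β * cost w H) :=
              add_le_add (mul_le_mul' le_rfl h2) (mul_le_mul' le_rfl h4)
          _ = 2 ^ k * 2 * ((k + 1) * (4 * β * cost w H)) + 2 * Fintype.card V * (2 * ρ i) := by ring
          _ ≤ 2 ^ k * 2 * ((k + 1) * (4 * β * cost w H)) + 2 * Fintype.card V * ρ (i + 1) :=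
              add_le_add le_rfl (mul_le_mul' le_rfl h3)
          _ = _ := by push_cast; ring
  intro i
  induction i with
  | zero => simp
  | succ i ih =>
    intro hi
    -- At the highest level that contributes, a terminal outside the class of the root shows `ρ (i +
    -- 1) ≤ cost`. With `k = l` and `n ≤ 2 ^ l` the geometric part is then at most `2 * cost`.
    rcases Nat.eq_zero_or_pos (classCount c r X i) with h0 | hpos
    · rw [Finset.sum_range_succ, h0]
      simpa using ih (by omega)
    · obtain ⟨b, hb⟩ := Finset.card_pos.1 hpos
      obtain ⟨x, hx, -⟩ := Finset.mem_image.1 hb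
      obtain ⟨hx1, hx2⟩ := Finset.mem_filter.1 hx
      have h2 : ρ (i + 1) ≤ cost w H := by
        by_contra h'
        refine hx2 (hl.root i hi x (lt_of_le_of_lt ?_ (not_le.1 h')))
        exact dist_le_cost hD hH hr (hX x hx1)
      have h3 := h1 l (i + 1) hi
      have h4 : (Fintype.card V : ℝ≥0) ≤ 2 ^ l := by exact_mod_cast hn
      refine le_of_mul_le_mul_left (a := (2 ^ l : ℝ≥0)) ?_ (by positivity)
      refine h3.trans ?_
      rw [mul_add]
      refine add_le_add le_rfl ?_
      calc 2 * (Fintype.card V : ℝ≥0) * ρ (i + 1) ≤ 2 * 2 ^ l * cost w H := by gcongr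
        _ = _ := by ring

end Stretch


/-! ### The tree and its stretch -/

section ParentTree

set_option linter.unusedSectionVars false

variable {V : Type*} [DecidableEq V] [Fintype V] {G : SimpleGraph V} {w : Sym2 V → ℝ≥0}
  {r : V} {par : V → V}

/-- The graph in which all vertices but the root are joined to their parents. -/
def parentTree (r : V) (par : V → V) : SimpleGraph V where
  Adj u v := u ≠ v ∧ ((u ≠ r ∧ par u = v) ∨ (v ≠ r ∧ par v = u))
  symm := ⟨fun _ _ h => ⟨h.1.symm, h.2.symm⟩⟩
  loopless := ⟨fun _ h => h.1 rfl⟩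

theorem parentTree_adj_par (hadj : ∀ u, u ≠ r → G.Adj u (par u)) {u : V} (hu : u ≠ r) :
    (parentTree r par).Adj u (par u) := ⟨(hadj u hu).ne, Or.inl ⟨hu, rfl⟩⟩

theorem ParPath.reachable (hadj : ∀ u, u ≠ r → G.Adj u (par u)) {v z : V} {A : Finset V}
    (h : ParPath par (· = r) v A z) : (parentTree r par).Reachable v r := by
  induction h with
  | base h => rw [h]
  | step h _ ih => exact (parentTree_adj_par hadj h).reachable.trans ih

/-- Parent paths connect everything to `r`, and the edges are the images of the `n - 1` vertices
other than `r`; a connected graph with so few edges is a tree. -/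
theorem parentTree_isSpanningTree (hadj : ∀ u, u ≠ r → G.Adj u (par u))
    (hpath : ∀ v, ∃ A z, ParPath par (· = r) v A z) : IsSpanningTree G (parentTree r par) := by
  refine ⟨?_, ?_⟩
  · rintro u v ⟨-, ⟨h1, rfl⟩ | ⟨h1, rfl⟩⟩
    · exact hadj u h1
    · exact (hadj v h1).symm
  · have hconn : (parentTree r par).Connected := by
      have : Nonempty V := ⟨r⟩
      refine ⟨fun u v => ?_⟩
      obtain ⟨A, z, h⟩ := hpath u
      obtain ⟨A', z', h'⟩ := hpath v
      exact (h.reachable hadj).trans (h'.reachable hadj).symm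
    refine SimpleGraph.isTree_iff_connected_and_card.2 ⟨hconn, le_antisymm ?_
      hconn.card_vert_le_card_edgeSet_add_one⟩
    have h1 : Nat.card (parentTree r par).edgeSet ≤ Nat.card {v : V // v ≠ r} := by
      refine Nat.card_le_card_of_surjective (fun v => ⟨s(v.1, par v.1),
        parentTree_adj_par hadj v.2⟩) ?_
      rintro ⟨e, he⟩
      induction e with
      | _ a b =>
        change (parentTree r par).Adj a b at he
        rcases he with ⟨-, ⟨h1, rfl⟩ | ⟨h1, rfl⟩⟩
        · exact ⟨⟨a, h1⟩, rfl⟩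
        · exact ⟨⟨b, h1⟩, Subtype.ext Sym2.eq_swap⟩
    have h2 : Nat.card {v : V // v ≠ r} + 1 = Nat.card V := by
      rw [Nat.card_eq_fintype_card, Nat.card_eq_fintype_card, Fintype.card_subtype_compl]
      have : 0 < Fintype.card V := Fintype.card_pos_iff.2 ⟨r⟩
      simp only [Fintype.card_subtype_eq]
      omega
    omega

theorem ParPath.suffix {S : V → Prop} {v z a : V} {A : Finset V} (h : ParPath par S v A z)
    (ha : a ∈ A) : ¬ S a ∧ ∃ A' ⊆ A, a ∈ A' ∧ ParPath par S a A' z := by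
  induction h with
  | base => simp at ha
  | @step v z A h1 h2 ih =>
    rcases Finset.mem_insert.1 ha with rfl | ha
    · exact ⟨h1, _, subset_rfl, ha, .step h1 h2⟩
    · obtain ⟨h3, A', h4, h5, h6⟩ := ih ha
      exact ⟨h3, A', h4.trans (Finset.subset_insert _ _), h5, h6⟩

/-- A connected subgraph of the tree that contains the root contains the links of its vertices. -/
theorem adj_par_of_connected (hpath : ∀ v, ∃ A z, ParPath par (· = r) v A z)
    {S : (parentTree r par).Subgraph} (hS : S.Connected) (hr : r ∈ S.verts) {v : V}
    (hv : v ∈ S.verts) (hvr : v ≠ r) : S.Adj v (par v) := by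
  obtain ⟨p, -, hp⟩ := exists_path_of_connected hS hv hr
  -- The walk starts at a vertex whose parent path contains `v` and ends at one whose path does not;
  -- the only edge of the tree between these two kinds of vertices is that from `v` to its parent.
  have key : ∀ {x y : V} (p : (parentTree r par).Walk x y), (∀ e ∈ p.edges, e ∈ S.edgeSet) →
      (∃ A z, ParPath par (· = r) x A z ∧ v ∈ A) →
      (¬ ∃ A z, ParPath par (· = r) y A z ∧ v ∈ A) → S.Adj v (par v) := by
    intro x y p
    induction p with
    | nil => intro _ h1 h2; exact absurd h1 h2
    | @cons x x' y hxx p ih =>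
      intro he h1 h2
      by_cases hx' : ∃ A z, ParPath par (· = r) x' A z ∧ v ∈ A
      · exact ih (fun e h => he e (by simp [h])) hx' h2
      · have hadj : S.Adj x x' := he s(x, x') (by simp)
        obtain ⟨A, z, hA, hvA⟩ := h1
        rcases hxx.2 with ⟨hx, rfl⟩ | ⟨hx, rfl⟩
        · cases hA with
          | base h => exact absurd h hx
          | step _ h3 =>
            rcases Finset.mem_insert.1 hvA with rfl | h4
            · exact hadj
            · exact absurd ⟨_, _, h3, h4⟩ hx'
        · exact absurd ⟨_, _, .step hx hA, Finset.mem_insert_of_mem hvA⟩ hx'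
  refine key p hp ?_ ?_
  · obtain ⟨A, z, hA⟩ := hpath v
    cases hA with
    | base h => exact absurd h hvr
    | step h1 h2 => exact ⟨_, _, .step h1 h2, Finset.mem_insert_self _ _⟩
  · rintro ⟨A, z, hA, hvA⟩
    cases hA with
    | base => simp at hvA
    | step h1 _ => exact h1 rfl

/-- The union of the paths from the vertices of a set to the root. -/
theorem cost_le_parCost (hadj : ∀ u, u ≠ r → G.Adj u (par u))
    (hpath : ∀ v, ∃ A z, ParPath par (· = r) v A z)
    {X : Set V} {U : Finset V} (hU : ∀ x ∈ X, ∃ A z, A ⊆ U ∧ ParPath par (· = r) x A z)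
    (hU' : ∀ a ∈ U, ∃ x ∈ X, ∃ A z, ParPath par (· = r) x A z ∧ a ∈ A)
    {S : (parentTree r par).Subgraph} (hS : IsSteinerTree (parentTree r par) r X S) :
    cost w S ≤ parCost w par U := by
  classical
  have hUr : ∀ a ∈ U, a ≠ r ∧ ∃ A' ⊆ U, ∃ z, ParPath par (· = r) a A' z := by
    intro a ha
    obtain ⟨x, hx, A, z, hA, haA⟩ := hU' a ha
    obtain ⟨A', z', hA', hp⟩ := hU x hx
    obtain ⟨rfl, rfl⟩ := hA.unique hp
    obtain ⟨h1, B, hB, -, h2⟩ := hA.suffix haA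
    exact ⟨h1, B, hB.trans hA', _, h2⟩
  have hpar : ∀ a ∈ U, par a = r ∨ par a ∈ U := by
    intro a ha
    obtain ⟨h1, A, hA, z, hp⟩ := hUr a ha
    cases hp with
    | base h => exact absurd h h1
    | step _ h2 =>
      cases h2 with
      | base h3 => exact Or.inl h3
      | step _ _ =>
        exact Or.inr (hA (Finset.mem_insert_of_mem (Finset.mem_insert_self _ _)))
  -- The subgraph of the links of `U`; it is connected and contains the terminals and the root.
  let H : (parentTree r par).Subgraph :=
    { verts := {v | v = r ∨ v ∈ U}
      Adj := fun a b => (a ∈ U ∧ par a = b) ∨ (b ∈ U ∧ par b = a)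
      adj_sub := by
        rintro a b (⟨ha, rfl⟩ | ⟨hb, rfl⟩)
        · exact parentTree_adj_par hadj (hUr a ha).1
        · exact (parentTree_adj_par hadj (hUr b hb).1).symm
      edge_vert := by
        rintro a b (⟨ha, rfl⟩ | ⟨hb, rfl⟩)
        · exact Or.inr ha
        · exact hpar b hb
      symm := ⟨fun _ _ h => h.symm⟩ }
  have hwalk : ∀ {v z : V} {A : Finset V}, ParPath par (· = r) v A z → A ⊆ U → v ∈ H.verts →
      ∃ p : (parentTree r par).Walk v r, p.toSubgraph ≤ H := by
    intro v z A hp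
    induction hp with
    | @base v h =>
      intro _ hv
      subst h
      refine ⟨.nil, ?_⟩
      simpa using hv
    | @step v z A h1 h2 ih =>
      intro hA hv
      have hvU := hA (Finset.mem_insert_self _ _)
      obtain ⟨p, hp⟩ := ih ((Finset.subset_insert _ _).trans hA) (hpar v hvU)
      refine ⟨.cons (parentTree_adj_par hadj h1) p, ?_⟩
      rw [SimpleGraph.Walk.toSubgraph]
      exact sup_le (SimpleGraph.subgraphOfAdj_le_of_adj H (Or.inl ⟨hvU, rfl⟩)) hp
  have hwalk' : ∀ v ∈ H.verts, ∃ p : (parentTree r par).Walk v r, p.toSubgraph ≤ H := by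
    rintro v (rfl | hv)
    · exact hwalk (.base rfl) (by simp) (Or.inl rfl)
    · obtain ⟨-, A, hA, z, hp⟩ := hUr v hv
      exact hwalk hp hA (Or.inr hv)
  have hH : H.Connected := by
    rw [SimpleGraph.Subgraph.connected_iff_forall_exists_walk_subgraph]
    refine ⟨⟨r, Or.inl rfl⟩, fun {u v} hu hv => ?_⟩
    obtain ⟨p, hp⟩ := hwalk' u hu
    obtain ⟨q, hq⟩ := hwalk' v hv
    refine ⟨p.append q.reverse, ?_⟩
    rw [SimpleGraph.Walk.toSubgraph_append, SimpleGraph.Walk.toSubgraph_reverse]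
    exact sup_le hp hq
  have hXH : X ⊆ H.verts := by
    intro x hx
    obtain ⟨A, z, hA, hp⟩ := hU x hx
    cases hp with
    | base h => exact Or.inl h
    | step _ _ => exact Or.inr (hA (Finset.mem_insert_self _ _))
  obtain ⟨⟨hSc, hSr, hSX⟩, hmin⟩ := hS
  -- Every link of `H` is forced in a connected subgraph with these vertices; minimality of `S` then
  -- gives equality.
  have hHS : H ≤ S := by
    have hmem : ∀ {v z : V} {A : Finset V}, ParPath par (· = r) v A z → v ∈ S.verts →
        ∀ a ∈ A, a ∈ S.verts := by
      intro v z A hp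
      induction hp with
      | base => simp
      | @step v z A h1 h2 ih =>
        intro hv a ha
        rcases Finset.mem_insert.1 ha with rfl | ha
        · exact hv
        · exact ih ((adj_par_of_connected hpath hSc hSr hv h1).snd_mem) a ha
    have hUS : ∀ a ∈ U, a ∈ S.verts := by
      intro a ha
      obtain ⟨x, hx, A, z, hA, haA⟩ := hU' a ha
      exact hmem hA (hSX hx) a haA
    refine ⟨?_, ?_⟩
    · rintro v (rfl | hv)
      · exact hSr
      · exact hUS v hv
    · rintro a b (⟨ha, rfl⟩ | ⟨hb, rfl⟩)
      · exact adj_par_of_connected hpath hSc hSr (hUS a ha) (hUr a ha).1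
      · exact (adj_par_of_connected hpath hSc hSr (hUS b hb) (hUr b hb).1).symm
  have hSH : S ≤ H := hmin ⟨hH, Or.inl rfl, hXH⟩ hHS
  calc cost w S ≤ ∑ e ∈ U.image (fun a => s(a, par a)), w e := by
        refine Finset.sum_le_sum_of_subset fun e he => ?_
        simp only [Finset.mem_filter, Finset.mem_univ, true_and] at he
        have he' := SimpleGraph.Subgraph.edgeSet_mono hSH he
        induction e with
        | _ a b =>
          change H.Adj a b at he'
          rcases he' with ⟨ha, rfl⟩ | ⟨hb, rfl⟩
          · exact Finset.mem_image_of_mem (fun a => s(a, par a)) ha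
          · rw [Sym2.eq_swap]
            exact Finset.mem_image_of_mem (fun a => s(a, par a)) hb
    _ ≤ parCost w par U := by
        unfold parCost
        exact Finset.sum_image_le_of_nonneg fun _ _ => zero_le

end ParentTree

/-! ### The stretch of the tree. -/

section Main

variable {V : Type*} [DecidableEq V] [Fintype V] {G : SimpleGraph V} {w : Sym2 V → ℝ≥0}
  {D : V → V → ℝ≥0} {r : V} {κ g : ℝ≥0} {β m N l : ℕ} {c : ℕ → V → V} {ρ Δ : ℕ → ℝ≥0}
  {R : ℕ → V → Prop} {par : V → V}

/-- The tree built along a hierarchy of partitions has small stretch. -/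
theorem TreeSteps.stretch_le (hl : Levels G w D r κ g β N c ρ Δ) (hD : IsDist G w D)
    (ht : TreeSteps G w r κ g β m N c ρ R par) (hg : 2 * (m + 1) ≤ g)
    (hn : Fintype.card V ≤ 2 ^ l) (hκ : 0 < κ) :
    IsSpanningTree G (parentTree r par) ∧ stretch G w r (parentTree r par) ≤
      ((2 * linkConst κ g β * (l * (4 * β) + 2) : ℝ≥0) : ℝ≥0∞) := by
  classical
  have hRN : R N = (· = r) := by funext v; exact propext (ht.top v)
  have hadj : ∀ u, u ≠ r → G.Adj u (par u) := by
    intro u hu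
    by_contra hno
    have : ∀ i ≤ N, R i u := by
      intro i
      induction i with
      | zero => intro _; exact ht.bot u
      | succ i ih =>
        intro hi
        by_contra h'
        exact hno ((ht.step i hi).adj u (ih (by omega)) h')
    exact hu ((ht.top u).1 (this N le_rfl))
  have hpath : ∀ v, ∃ A z, ParPath par (· = r) v A z := by
    intro v
    obtain ⟨A, z, h, -⟩ := ht.parPath hl hg N le_rfl v
    exact ⟨A, z, hRN ▸ h⟩
  refine ⟨parentTree_isSpanningTree hadj hpath, ?_⟩
  have hg2 : 2 ≤ g := by
    refine le_trans ?_ hg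
    rw [mul_add, mul_one]
    exact le_add_self
  set K : ℝ≥0 := 2 * linkConst κ g β * (l * (4 * β) + 2) with hK
  refine iSup_le fun X => iSup_le fun S => iSup_le fun hS => ?_
  obtain ⟨U, hU, hU', hcost⟩ := ht.parPaths hl hg X.toFinset N le_rfl
  rw [hRN] at hU hU'
  have h1 : cost w S ≤ parCost w par U := cost_le_parCost hadj hpath
    (fun x hx => hU x (by simpa using hx)) (fun a ha => by simpa using hU' a ha) hS
  have h2 : ∀ H : G.Subgraph, IsSteinerTree G r X H → cost w S ≤ cost w H * K := by
    intro H hH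
    obtain ⟨⟨hHc, hHr, hHX⟩, -⟩ := hH
    have h3 := hl.sum_classCount_le hD hg2 hn hHc hHr (X := X.toFinset)
      (fun x hx => hHX (by simpa using hx)) N le_rfl
    calc cost w S ≤ _ := h1.trans hcost
      _ = 2 * linkConst κ g β * ∑ j ∈ Finset.range N,
          (classCount c r X.toFinset j : ℝ≥0) * ρ (j + 1) := by
        rw [Finset.mul_sum]
        refine Finset.sum_congr rfl fun j _ => ?_
        ring
      _ ≤ 2 * linkConst κ g β * (l * (4 * β * cost w H) + 2 * cost w H) :=
        mul_le_mul' le_rfl h3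
      _ = _ := by rw [hK]; ring
  refine ENNReal.div_le_of_le_mul' ?_
  rw [opt]
  -- The factor is divided out in order to compare with every Steiner tree before the infimum is
  -- taken; this covers the case that the optimum is `0`.
  have hK0 : (K : ℝ≥0∞) ≠ 0 := by
    rw [ENNReal.coe_ne_zero, hK, linkConst]
    positivity
  refine (ENNReal.div_le_iff hK0 ENNReal.coe_ne_top).1 ?_
  refine le_iInf fun H => le_iInf fun hH => ENNReal.div_le_of_le_mul ?_
  exact_mod_cast h2 H hH

end Main


/-! ### The construction of the hierarchy -/

section LevelStep

variable {V : Type*} [DecidableEq V] [Fintype V] {G : SimpleGraph V} {w : Sym2 V → ℝ≥0}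
  {D : V → V → ℝ≥0} {r : V} {κ g : ℝ≥0} {β N : ℕ} {c : ℕ → V → V} {ρ Δ : ℕ → ℝ≥0}

/-- The levels of a hierarchy up to level `N`, and the properties of level `N` that are needed for
the next one. -/
structure LevelsUpTo (G : SimpleGraph V) (w : Sym2 V → ℝ≥0) (D : V → V → ℝ≥0) (r : V) (κ g : ℝ≥0)
    (β N : ℕ) (c : ℕ → V → V) (ρ Δ : ℕ → ℝ≥0) : Prop where
  bot : ∀ u v, c 0 u = c 0 v → u = v
  nest : ∀ i < N, ∀ u v, c i u = c i v → c (i + 1) u = c (i + 1) v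
  walk : ∀ i ≤ N, ∀ u v, c i u = c i v →
    ∃ p : G.Walk u v, (∀ x ∈ p.support, c i x = c i u) ∧ wl w p ≤ Δ i
  ball : ∀ i < N, ∀ v, ((Finset.univ.filter fun x => D v x < ρ (i + 1)).image (c i)).card ≤ β
  root : ∀ i < N, ∀ v, D r v < ρ (i + 1) → c i v = c i r
  growth : ∀ i < N, g * ρ i ≤ ρ (i + 1)
  diam : ∀ i ≤ N, Δ i ≤ κ * g * ρ i
  diam_next : ∀ i < N, Δ i ≤ κ * ρ (i + 1)
  bot_scale : ρ 0 = 0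
  last_ball : ∀ v, ((Finset.univ.filter fun x => D v x < g * ρ N ∨ D v x = 0).image (c N)).card ≤ β
  last_root : ∀ v, (D r v < g * ρ N ∨ D r v = 0) → c N v = c N r

/-- Once `g * ρ N` exceeds all distances, the last ball about the root contains everything, so the
last level is one class. -/
theorem LevelsUpTo.levels (h : LevelsUpTo G w D r κ g β N c ρ Δ)
    (hmax : ∀ u v, D u v ≠ 0 → D u v < g * ρ N) : Levels G w D r κ g β N c ρ Δ := by
  have htop : ∀ v, c N v = c N r := fun v => h.last_root v (by
    by_cases h0 : D r v = 0
    · exact Or.inr h0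
    · exact Or.inl (hmax _ _ h0))
  exact ⟨h.bot, h.nest, h.walk, h.ball, h.root, h.growth, h.diam, h.diam_next, h.bot_scale,
    fun u v => (htop u).trans (htop v).symm⟩

/-- The first two levels: single vertices, and the classes of vertices at distance `0`. -/
theorem levelsUpTo_one (hD : IsDist G w D) (hβ : 1 ≤ β) (h0 : ∀ v, c 0 v = v)
    (h1 : ∀ u v, c 1 u = c 1 v ↔ D u v = 0) (hρ : ∀ i ≤ 1, ρ i = 0) (hΔ : ∀ i ≤ 1, Δ i = 0) :
    LevelsUpTo G w D r κ g β 1 c ρ Δ := by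
  refine ⟨fun u v h => by rwa [h0, h0] at h, fun i hi u v huv => ?_, fun i hi u v huv => ?_,
    fun i hi v => ?_, fun i hi v hv => ?_, fun i hi => ?_, fun i hi => ?_, fun i hi => ?_,
    hρ 0 (by omega), fun v => ?_, fun v hv => ?_⟩
  · obtain rfl : i = 0 := by omega
    rw [h0, h0] at huv
    rw [huv]
  · rw [hΔ i hi]
    rcases Nat.le_one_iff_eq_zero_or_eq_one.1 hi with rfl | rfl
    · rw [h0, h0] at huv
      subst huv
      exact ⟨.nil, by simp, by simp⟩
    · rw [h1] at huv
      obtain ⟨p, hp⟩ := hD.exists_walk u v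
      rw [huv] at hp
      refine ⟨p, fun x hx => ?_, hp.le⟩
      rw [eq_comm, h1]
      exact le_antisymm ((hD.mem_support_le p hx).trans hp.le) zero_le
  · rw [hρ _ (by omega)]; simp
  · rw [hρ _ (by omega)] at hv; exact absurd hv not_lt_zero
  · rw [hρ _ (by omega), mul_zero]; exact zero_le
  · rw [hΔ _ hi]; exact zero_le
  · rw [hΔ _ (by omega)]; exact zero_le
  · refine le_trans (Finset.card_le_one.2 ?_) hβ
    intro a ha b hb
    simp only [Finset.mem_image, Finset.mem_filter, Finset.mem_univ, true_and, hρ 1 le_rfl,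
      mul_zero, not_lt_zero, false_or] at ha hb
    obtain ⟨x, hx, rfl⟩ := ha
    obtain ⟨y, hy, rfl⟩ := hb
    exact ((h1 v x).2 hx).symm.trans ((h1 v y).2 hy)
  · rw [hρ 1 le_rfl, mul_zero] at hv
    exact ((h1 r v).2 (hv.resolve_left not_lt_zero)).symm

/-- The new classes are the fibres of the portal map. The base radius of the nets is `b 0 = g * ρ'`,
and `hg` makes the error of the aggregation at most `b 0`, so every vertex reaches its portal inside
its new class with error at most `b 0`. -/
theorem LevelsUpTo.next {t s l : ℕ} (h : LevelsUpTo G w D r κ g (1 + (t + 1) * s) N c ρ Δ)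
    (hD : IsDist G w D) (hs : 1 ≤ s) (hn : Fintype.card V ≤ s ^ t) (hκ : κ = 32 * 8 ^ t)
    (hg : 2 * (l + 1) * (l + 2) * κ ≤ g) {ρ' : ℝ≥0} (hρ0 : 0 < ρ') (hρ : g * ρ N ≤ ρ')
    (hmin : ∀ u v, D u v ≠ 0 → g * ρ N ≤ D u v → ρ' ≤ D u v)
    {b : ℕ → ℝ≥0} (hb0 : b 0 = g * ρ') (hb : ∀ j, b (j + 1) = 8 * b j) {Z : ℕ → V → Prop}
    (hZ : IsNet D b s t Z) {off val : V → ℝ≥0} (ho : IsOffset r b t Z off)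
    (hlip : ∀ u v, val u ≤ D v u + val v) (hoff : ∀ v, val v ≤ off v)
    {port : V → V} (hport : ∀ v, (∀ u, c N u = c N v → port u = port v) ∧
      ∃ p : G.Walk v (port v), (∀ x ∈ p.support, port x = port v) ∧
        wl w p + off (port v) ≤ val v + (l + 1) * ((l + 2) * (2 * Δ N)))
    {c' : ℕ → V → V} {ρ'' Δ' : ℕ → ℝ≥0} (hc : ∀ i ≤ N, c' i = c i) (hc' : c' (N + 1) = port)
    (hρ' : ∀ i ≤ N, ρ'' i = ρ i) (hρ'' : ρ'' (N + 1) = ρ')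
    (hΔ : ∀ i ≤ N, Δ' i = Δ i) (hΔ' : Δ' (N + 1) = κ * g * ρ') :
    LevelsUpTo G w D r κ g (1 + (t + 1) * s) (N + 1) c' ρ'' Δ' := by
  have hval : ∀ v p, val v ≤ D v p + off p := fun v p =>
    (hlip v p).trans (by rw [hD.symm]; gcongr; exact hoff p)
  have hκ0 : 0 < κ := by rw [hκ]; positivity
  have hg0 : 0 < g := lt_of_lt_of_le (by positivity) hg
  have hb0' : 0 < b 0 := by rw [hb0]; positivity
  have hbt : ∀ j, b j = 8 ^ j * b 0 := by
    intro j
    induction j with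
    | zero => simp
    | succ j ih => rw [hb, ih, pow_succ]; ring
  have herr : (l + 1) * ((l + 2) * (2 * Δ N)) ≤ b 0 := by
    calc ((l + 1) * ((l + 2) * (2 * Δ N)) : ℝ≥0)
        ≤ (l + 1) * ((l + 2) * (2 * (κ * g * ρ N))) := by gcongr; exact h.diam N le_rfl
      _ = 2 * (l + 1) * (l + 2) * κ * (g * ρ N) := by ring
      _ ≤ g * ρ' := by gcongr
      _ = b 0 := hb0.symm
  have hwalk : ∀ v, ∃ p : G.Walk v (port v), (∀ x ∈ p.support, port x = port v) ∧
      wl w p + off (port v) ≤ val v + b 0 := by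
    intro v
    obtain ⟨p, hp, hl⟩ := (hport v).2
    exact ⟨p, hp, hl.trans (by gcongr)⟩
  have hvaloff : ∀ v, val v ≤ 9 * b t := fun v => by
    have := hval v v
    rw [hD.self, zero_add] at this
    exact this.trans (ho.offset_le hb v)
  -- The portal of a vertex `x` in the ball is within `3 * b 0` of optimal for `v`: one `b 0` for
  -- going to `x`, one for the change of `val` and one for the error of the aggregation.
  have hlastball : ∀ v, ((Finset.univ.filter fun x => D v x ≤ b 0).image port).card ≤
      1 + (t + 1) * s := by
    intro v
    refine le_trans ?_ (hZ.card_portals_le hs ho hD hb hb0' hn (v := v) (d := val v) (hval v))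
    refine Finset.card_le_card fun p hp => ?_
    simp only [Finset.mem_image, Finset.mem_filter, Finset.mem_univ, true_and] at hp ⊢
    obtain ⟨x, hx, rfl⟩ := hp
    obtain ⟨p, -, hl⟩ := hwalk x
    calc D v (port x) + off (port x) ≤ (D v x + wl w p) + off (port x) := by
          gcongr
          exact (hD.triangle v x _).trans (by gcongr; exact hD.le p)
      _ = D v x + (wl w p + off (port x)) := by ring
      _ ≤ b 0 + ((b 0 + val v) + b 0) :=
        add_le_add hx (hl.trans (add_le_add ((hlip x v).trans (add_le_add hx le_rfl)) le_rfl))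
      _ = _ := by ring
  -- The root has offset `0`, so `val v ≤ b 0` and the portal is reached at cost at most `2 * b 0`;
  -- any other portal has an offset of at least `4 * b t`.
  have hlastroot : ∀ v, D r v ≤ b 0 → port v = r := by
    intro v hv
    by_contra hne
    obtain ⟨p, -, hl⟩ := hwalk v
    have h1 := ho.le hne
    have h2 : val v ≤ b 0 := by
      refine (hval v r).trans ?_
      rw [ho.root, add_zero, hD.symm]
      exact hv
    have h3 : b 0 ≤ b t := by
      rw [hbt t]
      exact le_mul_of_one_le_left zero_le (one_le_pow₀ (by norm_num))
    have h4 : 4 * b 0 ≤ b 0 + b 0 := by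
      calc 4 * b 0 ≤ 4 * b t := by gcongr
        _ ≤ off (port v) := h1
        _ ≤ val v + b 0 := le_add_self.trans hl
        _ ≤ _ := by gcongr
    rw [← NNReal.coe_le_coe] at h4
    rw [← NNReal.coe_lt_coe] at hb0'
    push_cast at h4 hb0'
    linarith
  -- No positive distance lies between `g * ρ N` and the new scale, so the properties of balls of
  -- radius `g * ρ N` extend to the new scale.
  have hsplit : ∀ u v, D u v < ρ' → D u v < g * ρ N ∨ D u v = 0 := by
    intro u v huv
    by_cases h0 : D u v = 0
    · exact Or.inr h0
    · left
      by_contra h'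
      exact absurd (hmin u v h0 (not_lt.1 h')) (not_le.2 huv)
  have hcase : ∀ i < N + 1, i < N ∨ i = N := fun i hi => by omega
  refine ⟨?_, ?_, ?_, ?_, ?_, ?_, ?_, ?_, ?_, ?_, ?_⟩
  · rw [hc 0 (by omega)]; exact h.bot
  · intro i hi u v huv
    rcases hcase i hi with h' | rfl
    · rw [hc i (by omega)] at huv
      rw [hc (i + 1) h']
      exact h.nest i h' u v huv
    · rw [hc i le_rfl] at huv
      rw [hc']
      exact (hport v).1 u huv
  · intro i hi u v huv
    rcases hi.lt_or_eq with h' | rfl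
    · rw [hc i (by omega)] at huv ⊢
      rw [hΔ i (by omega)]
      exact h.walk i (by omega) u v huv
    · rw [hc'] at huv ⊢
      obtain ⟨p, hp, hl⟩ := hwalk u
      obtain ⟨p', hp', hl'⟩ := hwalk v
      refine ⟨p.append (p'.reverse.copy huv.symm rfl), fun x hx => ?_, ?_⟩
      · rw [SimpleGraph.Walk.mem_support_append_iff, SimpleGraph.Walk.support_copy,
          SimpleGraph.Walk.support_reverse, List.mem_reverse] at hx
        rcases hx with hx | hx
        · exact hp x hx
        · rw [hp' x hx, huv]
      · have hcp : wl w (p'.reverse.copy huv.symm rfl) = wl w p' := by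
          rw [← wl_reverse w p']
          generalize port u = z at huv
          subst huv; rfl
        rw [wl_append, hcp, hΔ']
        -- Since `val` is at most `9 * b t`, two walks to the common portal have total length at
        -- most `20 * 8 ^ t * b 0`; this fits into the factor `32 * 8 ^ t`.
        have h1 : ∀ v, val v + b 0 ≤ 10 * (8 ^ t * b 0) := by
          intro v
          calc val v + b 0 ≤ 9 * b t + 1 * b 0 := by rw [one_mul]; gcongr; exact hvaloff v
            _ ≤ 9 * (8 ^ t * b 0) + 8 ^ t * b 0 := by
              rw [hbt t]
              gcongr
              exact one_le_pow₀ (by norm_num)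
            _ = _ := by ring
        calc wl w p + wl w p' ≤ 10 * (8 ^ t * b 0) + 10 * (8 ^ t * b 0) :=
              add_le_add ((le_self_add.trans hl).trans (h1 u)) ((le_self_add.trans hl').trans (h1 v))
          _ = 20 * (8 ^ t * b 0) := by ring
          _ ≤ 32 * (8 ^ t * b 0) := by gcongr; norm_num
          _ = _ := by rw [hb0, hκ]; ring
  · intro i hi v
    rcases hcase i hi with h' | rfl
    · rw [hc i (by omega), hρ' _ (by omega)]
      exact h.ball i h' v
    · rw [hc i le_rfl, hρ'']
      refine le_trans (Finset.card_le_card (Finset.image_subset_image fun x hx => ?_))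
        (h.last_ball v)
      simp only [Finset.mem_filter, Finset.mem_univ, true_and] at hx ⊢
      exact hsplit v x hx
  · intro i hi v hv
    rcases hcase i hi with h' | rfl
    · rw [hρ' _ (by omega)] at hv
      rw [hc i (by omega)]
      exact h.root i h' v hv
    · rw [hρ''] at hv
      rw [hc i le_rfl]
      exact h.last_root v (hsplit r v hv)
  · intro i hi
    rcases hcase i hi with h' | rfl
    · rw [hρ' i (by omega), hρ' _ (by omega)]
      exact h.growth i h'
    · rw [hρ' i le_rfl, hρ'']
      exact hρ
  · intro i hi
    rcases hi.lt_or_eq with h' | rfl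
    · rw [hΔ i (by omega), hρ' i (by omega)]
      exact h.diam i (by omega)
    · rw [hΔ', hρ'']
  · intro i hi
    rcases hcase i hi with h' | rfl
    · rw [hΔ i (by omega), hρ' _ (by omega)]
      exact h.diam_next i h'
    · rw [hΔ i le_rfl, hρ'']
      calc Δ i ≤ κ * g * ρ i := h.diam i le_rfl
        _ = κ * (g * ρ i) := by ring
        _ ≤ κ * ρ' := by gcongr
  · rw [hρ' 0 (by omega)]; exact h.bot_scale
  · intro v
    rw [hc', hρ'', ← hb0]
    refine le_trans (Finset.card_le_card (Finset.image_subset_image fun x hx => ?_))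
      (hlastball v)
    simp only [Finset.mem_filter, Finset.mem_univ, true_and] at hx ⊢
    rcases hx with hx | hx
    · exact hx.le
    · rw [hx]; exact zero_le
  · intro v hv
    rw [hρ'', ← hb0] at hv
    rw [hc', hlastroot v (by rcases hv with hv | hv; exacts [hv.le, by rw [hv]; exact zero_le]),
      hlastroot r (by rw [hD.self]; exact zero_le)]

end LevelStep


/-! ### Building blocks of the program -/

section Blocks

set_option linter.unusedSimpArgs false

theorem IsSPT.congr {V : Type*} {M M' : V → V → Prop} {W W' : V → V → ℝ≥0} {src src' : V → Prop}
    {init init' : V → ℝ≥0} {P P' : V → Prop} {val : V → ℝ≥0} {q : V → V} {rk : V → ℕ}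
    {anc : V → V → Prop} (h : IsSPT M W src init P val q rk anc) (hM : ∀ u v, M u v ↔ M' u v)
    (hW : ∀ u v, M' u v → W u v = W' u v) (hs : ∀ v, src v ↔ src' v)
    (hi : ∀ v, src' v → init v = init' v) (hP : ∀ v, P v ↔ P' v) :
    IsSPT M' W' src' init' P' val q rk anc := by
  obtain rfl : M = M' := by funext u v; exact propext (hM u v)
  obtain rfl : src = src' := by funext v; exact propext (hs v)
  obtain rfl : P = P' := by funext v; exact propext (hP v)
  refine ⟨fun v hv => hi v hv ▸ h.src_mem v hv, fun u v hu huv => hW u v huv ▸ h.edge u v hu huv,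
    fun v hv => ?_, h.rk_inj, h.anc_iff⟩
  rcases h.ptr v hv with ⟨a, b, c⟩ | ⟨a, b, c, d⟩
  · exact Or.inl ⟨a, b, hi v b ▸ c⟩
  · exact Or.inr ⟨a, b, hW _ _ b ▸ c, d⟩

theorem countLT_fin {n : ℕ} (p : ℕ → Prop) [DecidablePred fun v : Fin n => p v] :
    countLT n p = (Finset.univ.filter fun v : Fin n => p v).card := by
  classical
  unfold countLT
  rw [← Finset.card_map Fin.valEmbedding]
  congr 1
  ext i
  simp only [Finset.mem_filter, Finset.mem_range, Finset.mem_map, Finset.mem_univ, true_and,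
    Fin.valEmbedding_apply]
  constructor
  · rintro ⟨h, h'⟩; exact ⟨⟨i, h⟩, h', rfl⟩
  · rintro ⟨v, h, rfl⟩; exact ⟨v.2, h⟩

/-- The states agree up to register `x` and the array `a` of natural numbers. -/
structure AgreeN (a x : ℕ) (σ τ : State) : Prop where
  reg : ∀ y ≠ x, τ.natReg y = σ.natReg y
  arr : ∀ b ≠ a, τ.natArr b = σ.natArr b
  wreg : τ.wtReg = σ.wtReg
  warr : τ.wtArr = σ.wtArr

/-- Fill the array `a` with the truth values of a formula. -/
def fillMask (a : ℕ) (φ : Fm) : Cmd :=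
  .forN 13 (.seq (.allN 30 a (.reg 13) .true (.const 0)) (.allN 30 a (.reg 13) φ (.const 1)))

theorem fillMask_spec {a : ℕ} {φ : Fm} {σ : State} (p : ℕ → ℕ → Prop)
    (h : ∀ τ, AgreeN a 13 σ τ → τ.natReg 13 < σ.natReg 0 → ∀ v < σ.natReg 0,
      φ.Holds (τ.setN 30 v) ↔ p (τ.natReg 13) v) :
    ∀ u < σ.natReg 0, ∀ v < σ.natReg 0, 1 ≤ ((fillMask a φ).den σ).natArr a u v ↔ p u v := by
  obtain ⟨τ, ⟨hI, hI'⟩, hτ⟩ := Cmd.forN_ind (x := 13) (σ := σ) (c := (.seq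
    (.allN 30 a (.reg 13) .true (.const 0)) (.allN 30 a (.reg 13) φ (.const 1)))) (by norm_num)
    (by simp [Cmd.regs]) (fun k τ => AgreeN a 13 σ τ ∧
      ∀ u < k, ∀ v < σ.natReg 0, 1 ≤ τ.natArr a u v ↔ p u v)
    ⟨⟨fun _ _ => rfl, fun _ _ => rfl, rfl, rfl⟩, by simp⟩
    (by
      rintro k hk τ ⟨h1, h2⟩ h0
      have h3 : AgreeN a 13 σ ((Cmd.allN 30 a (.reg 13) .true (.const 0)).den (τ.setN 13 k)) := by
        refine ⟨fun y hy => ?_, fun b hb => ?_, h1.wreg, h1.warr⟩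
        · simp [Cmd.den, hy, h1.reg y hy]
        · simp [Cmd.den, hb, h1.arr b hb]
      have h4 : ((Cmd.allN 30 a (.reg 13) .true (.const 0)).den (τ.setN 13 k)).natReg 13 = k := by
        simp [Cmd.den]
      refine ⟨⟨fun y hy => ?_, fun b hb => ?_, h1.wreg, h1.warr⟩, fun u hu v hv => ?_⟩
      · rw [Cmd.den]; exact h3.reg y hy
      · rw [Cmd.den, Cmd.den_natArr _ (by simpa [Cmd.arrs] using hb)]; exact h3.arr b hb
      · have h5 := h _ h3 (by rw [h4]; exact hk) v hv
        rw [h4] at h5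
        rw [Cmd.den]
        generalize hυ : (Cmd.allN 30 a (.reg 13) .true (.const 0)).den (τ.setN 13 k) = υ at *
        have h6 : υ.natReg 0 = σ.natReg 0 := h3.reg 0 (by norm_num)
        rcases Nat.lt_succ_iff_lt_or_eq.1 hu with hu | rfl
        · rw [← h2 u hu v hv, ← hυ]
          simp [Cmd.den, hu.ne]
        · by_cases hp : p u v
          · simp [Cmd.den, h4, h6, h5, hv, hp]
          · have h7 : υ.natArr a u v = 0 := by rw [← hυ]; simp [Cmd.den, h0, hv]
            simp [Cmd.den, h4, h6, h5, hv, hp, h7])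
  intro u hu v hv
  have : (fillMask a φ).den σ = τ.setN 13 (σ.natReg 0) := hτ
  rw [this, State.setN_natArr]
  exact hI' u hu v hv

/-- The states agree up to register `x` and the array `a` of weights. -/
structure AgreeW (a x : ℕ) (σ τ : State) : Prop where
  reg : ∀ y ≠ x, τ.natReg y = σ.natReg y
  arr : τ.natArr = σ.natArr
  wreg : τ.wtReg = σ.wtReg
  warr : ∀ b ≠ a, τ.wtArr b = σ.wtArr b

/-- Fill the weight array `a` with the values of an expression, or `0` where `φ` fails. -/
def fillWt (a : ℕ) (φ : Fm) (e : WExpr) : Cmd :=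
  .forN 13 (.seq (.allW 30 a (.reg 13) .true .zero) (.allW 30 a (.reg 13) φ e))

theorem fillWt_spec {a : ℕ} {φ : Fm} {e : WExpr} {σ : State} (p : ℕ → ℕ → Prop)
    (f : ℕ → ℕ → ℝ≥0) [∀ u v, Decidable (p u v)]
    (h : ∀ τ, AgreeW a 13 σ τ → τ.natReg 13 < σ.natReg 0 → ∀ v < σ.natReg 0,
      (φ.Holds (τ.setN 30 v) ↔ p (τ.natReg 13) v) ∧
      (p (τ.natReg 13) v → e.eval (τ.setN 30 v) = f (τ.natReg 13) v)) :
    ∀ u < σ.natReg 0, ∀ v < σ.natReg 0,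
      ((fillWt a φ e).den σ).wtArr a u v = if p u v then f u v else 0 := by
  obtain ⟨τ, ⟨hI, hI'⟩, hτ⟩ := Cmd.forN_ind (x := 13) (σ := σ) (c := (.seq
    (.allW 30 a (.reg 13) .true .zero) (.allW 30 a (.reg 13) φ e))) (by norm_num)
    (by simp [Cmd.regs]) (fun k τ => AgreeW a 13 σ τ ∧
      ∀ u < k, ∀ v < σ.natReg 0, τ.wtArr a u v = if p u v then f u v else 0)
    ⟨⟨fun _ _ => rfl, rfl, rfl, fun _ _ => rfl⟩, by simp⟩
    (by
      rintro k hk τ ⟨h1, h2⟩ h0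
      have h3 : AgreeW a 13 σ ((Cmd.allW 30 a (.reg 13) .true .zero).den (τ.setN 13 k)) := by
        refine ⟨fun y hy => ?_, h1.arr, h1.wreg, fun b hb => ?_⟩
        · simp [Cmd.den, hy, h1.reg y hy]
        · simp [Cmd.den, hb, h1.warr b hb]
      have h4 : ((Cmd.allW 30 a (.reg 13) .true .zero).den (τ.setN 13 k)).natReg 13 = k := by
        simp [Cmd.den]
      refine ⟨⟨fun y hy => ?_, h1.arr, h1.wreg, fun b hb => ?_⟩, fun u hu v hv => ?_⟩
      · rw [Cmd.den]; exact h3.reg y hy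
      · rw [Cmd.den, Cmd.den_wtArr _ (by simpa [Cmd.warrs] using hb)]; exact h3.warr b hb
      · have h5 := h _ h3 (by rw [h4]; exact hk) v hv
        rw [h4] at h5
        rw [Cmd.den]
        generalize hυ : (Cmd.allW 30 a (.reg 13) .true .zero).den (τ.setN 13 k) = υ at *
        have h6 : υ.natReg 0 = σ.natReg 0 := h3.reg 0 (by norm_num)
        rcases Nat.lt_succ_iff_lt_or_eq.1 hu with hu | rfl
        · rw [← h2 u hu v hv, ← hυ]
          simp [Cmd.den, hu.ne]
        · by_cases hp : p u v
          · simp [Cmd.den, h4, h6, h5.1, hv, hp, h5.2 hp]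
          · have h7 : υ.wtArr a u v = 0 := by rw [← hυ]; simp [Cmd.den, h0, hv]
            simp [Cmd.den, h4, h6, h5.1, hv, hp, h7])
  intro u hu v hv
  have : (fillWt a φ e).den σ = τ.setN 13 (σ.natReg 0) := hτ
  rw [this, State.setN_wtArr]
  exact hI' u hu v hv

/-- The state holds the input graph. -/
structure Base {n : ℕ} (G : SimpleGraph (Fin n)) (w : Sym2 (Fin n) → ℝ≥0) (r : Fin n)
    (σ : State) : Prop where
  size : σ.natReg 0 = n
  root : σ.natReg 1 = r
  adj : ∀ u v : Fin n, 1 ≤ σ.natArr 0 u v ↔ G.Adj u v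
  wt : ∀ u v : Fin n, G.Adj u v → σ.wtArr 0 u v = w s(u, v)

variable {n : ℕ} {G : SimpleGraph (Fin n)} {w : Sym2 (Fin n) → ℝ≥0} {r : Fin n}

theorem Base.den {σ : State} (h : Base G w r σ) {c : Cmd}
    (hc : 0 ∉ c.regs ∧ 1 ∉ c.regs ∧ 0 ∉ c.arrs ∧ 0 ∉ c.warrs) : Base G w r (c.den σ) := by
  obtain ⟨h0, h1, h2, h3⟩ := hc
  refine ⟨?_, ?_, fun u v => ?_, fun u v huv => ?_⟩
  · rw [Cmd.den_natReg _ h0, h.size]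
  · rw [Cmd.den_natReg _ h1, h.root]
  · rw [Cmd.den_natArr _ h2, h.adj]
  · rw [Cmd.den_wtArr _ h3, h.wt u v huv]

theorem Base.setN {σ : State} (h : Base G w r σ) {x : ℕ} (hx : 2 ≤ x) (k : ℕ) :
    Base G w r (σ.setN x k) :=
  ⟨by rw [State.setN_natReg, if_neg (by omega), h.size],
    by rw [State.setN_natReg, if_neg (by omega), h.root], h.adj, h.wt⟩

/-- Load the graph into the arrays of Dijkstra's algorithm. -/
def loadGraph : Cmd := .seq (fillMask 2 (.nle (.const 1) (.arr 0 (.reg 13) (.reg 30))))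
  (fillWt 2 .true (.arr 0 (.reg 13) (.reg 30)))

theorem loadGraph_spec {σ : State} (h : Base G w r σ) :
    (∀ u v : Fin n, 1 ≤ (loadGraph.den σ).natArr 2 u v ↔ G.Adj u v) ∧
    ∀ u v : Fin n, G.Adj u v → (loadGraph.den σ).wtArr 2 u v = w s(u, v) := by
  have h1 := fillMask_spec (a := 2) (φ := .nle (.const 1) (.arr 0 (.reg 13) (.reg 30))) (σ := σ)
    (fun u v => 1 ≤ σ.natArr 0 u v) (fun τ hτ _ v _ => by simp [hτ.arr 0])
  have h2 := fillWt_spec (a := 2) (φ := .true) (e := .arr 0 (.reg 13) (.reg 30))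
    (σ := (fillMask 2 (.nle (.const 1) (.arr 0 (.reg 13) (.reg 30)))).den σ)
    (fun _ _ => True) (fun u v => σ.wtArr 0 u v) (fun τ hτ _ v _ => by
      simp [hτ.warr 0, Cmd.den_wtArr (fillMask 2 (.nle (.const 1) (.arr 0 (.reg 13) (.reg 30)))) (show 0 ∉ _ by decide)])
  have h0 : ((fillMask 2 (.nle (.const 1) (.arr 0 (.reg 13) (.reg 30)))).den σ).natReg 0 = n := by
    rw [Cmd.den_natReg _ (by decide), h.size]
  rw [h.size] at h1
  rw [h0] at h2
  refine ⟨fun u v => ?_, fun u v huv => ?_⟩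
  · rw [loadGraph, Cmd.den, Cmd.den_natArr _ (by decide), h1 u u.2 v v.2, h.adj]
  · rw [loadGraph, Cmd.den, h2 u u.2 v v.2, if_pos trivial, h.wt u v huv]

def apspSource : Cmd := .seqs [
  .allN 30 3 (.const 0) .true (.const 0),
  .allN 30 3 (.const 0) (.neq (.reg 30) (.reg 14)) (.const 1),
  .allW 30 3 (.const 0) .true .zero]

/-- All distances. -/
def apsp : Cmd := .seq loadGraph (.forN 14 (.seq apspSource (.seq dijkstra
  (.allW 30 1 (.reg 14) .true (.arr 4 (.const 0) (.reg 30))))))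

theorem apsp_spec {σ : State} (h : Base G w r σ) (hG : G.Connected) :
    IsDist G w fun u v => (apsp.den σ).wtArr 1 u v := by
  obtain ⟨hg1, hg2⟩ := loadGraph_spec h
  have hb : Base G w r (loadGraph.den σ) := h.den (by decide)
  set υ := loadGraph.den σ with hυ
  obtain ⟨τ, ⟨-, -, hI⟩, hτ⟩ := Cmd.forN_ind (x := 14) (σ := υ) (c := (.seq apspSource
    (.seq dijkstra (.allW 30 1 (.reg 14) .true (.arr 4 (.const 0) (.reg 30)))))) (by norm_num)
    (by decide) (fun k τ => τ.natArr 2 = υ.natArr 2 ∧ τ.wtArr 2 = υ.wtArr 2 ∧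
      ∀ u v : Fin n, (u : ℕ) < k → (∀ p : G.Walk u v, τ.wtArr 1 u v ≤ wl w p) ∧
        ∃ p : G.Walk u v, wl w p = τ.wtArr 1 u v)
    ⟨rfl, rfl, fun _ _ h => absurd h (Nat.not_lt_zero _)⟩
    (by
      rintro k hk τ ⟨h1, h2, h3⟩ h0
      rw [hb.size] at hk h0
      have e3 : ∀ v < n, (apspSource.den (τ.setN 14 k)).natArr 3 0 v = if v = k then 1 else 0 := by
        intro v hv; simp [apspSource, Cmd.seqs, Cmd.den, h0, hv]
      have e3w : ∀ v < n, (apspSource.den (τ.setN 14 k)).wtArr 3 0 v = 0 := by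
        intro v hv; simp [apspSource, Cmd.seqs, Cmd.den, h0, hv]
      have e0 : (apspSource.den (τ.setN 14 k)).natReg 0 = n := by
        rw [Cmd.den_natReg _ (by decide)]; simpa using h0
      have e14 : (apspSource.den (τ.setN 14 k)).natReg 14 = k := by
        rw [Cmd.den_natReg _ (by decide)]; simp
      have e2 : (apspSource.den (τ.setN 14 k)).natArr 2 = υ.natArr 2 := by
        rw [Cmd.den_natArr _ (by decide)]; exact h1
      have e2w : (apspSource.den (τ.setN 14 k)).wtArr 2 = υ.wtArr 2 := by
        rw [Cmd.den_wtArr _ (by decide)]; exact h2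
      have e1w : (apspSource.den (τ.setN 14 k)).wtArr 1 = τ.wtArr 1 := by
        rw [Cmd.den_wtArr _ (by decide)]; rfl
      rw [Cmd.den, Cmd.den]
      generalize apspSource.den (τ.setN 14 k) = τ₁ at *
      obtain ⟨hd, -⟩ := dijkstra_spec τ₁ e0
      have f0 : (dijkstra.den τ₁).natReg 0 = n := by rw [Cmd.den_natReg _ (by decide), e0]
      have f14 : (dijkstra.den τ₁).natReg 14 = k := by rw [Cmd.den_natReg _ (by decide), e14]
      have f2 : (dijkstra.den τ₁).natArr 2 = υ.natArr 2 := by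
        rw [Cmd.den_natArr _ (by decide), e2]
      have f2w : (dijkstra.den τ₁).wtArr 2 = υ.wtArr 2 := by
        rw [Cmd.den_wtArr _ (by decide), e2w]
      have f1w : (dijkstra.den τ₁).wtArr 1 = τ.wtArr 1 := by
        rw [Cmd.den_wtArr _ (by decide), e1w]
      generalize dijkstra.den τ₁ = τ₂ at *
      have hd' := hd.congr (M' := G.Adj) (W' := fun u v => w s(u, v))
        (src' := fun v : Fin n => (v : ℕ) = k) (init' := fun _ => 0) (P' := fun v => τ₂.natArr 4 0 v = 2)
        (fun u v => by rw [e2, hg1]) (fun u v huv => by rw [e2w, hg2 u v huv])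
        (fun v => by rw [e3 v v.2]; split_ifs <;> simp [*]) (fun v _ => e3w v v.2)
        (fun v => Iff.rfl)
      refine ⟨?_, ?_, fun u v hu => ?_⟩
      · rw [← f2]; rfl
      · rw [← f2w]; funext i j; simp [Cmd.den]
      · rcases Nat.lt_succ_iff_lt_or_eq.1 hu with hu | rfl
        · have := h3 u v hu
          simpa [Cmd.den, f14, hu.ne, f1w] using this
        · have hv : ((Cmd.allW 30 1 (.reg 14) .true (.arr 4 (.const 0) (.reg 30))).den τ₂).wtArr 1 u v
              = τ₂.wtArr 4 0 v := by simp [Cmd.den, f14, f0]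
          rw [hv]
          obtain ⟨hPu, hvu⟩ := hd'.src_mem u rfl
          have hle : ∀ p : G.Walk u v, τ₂.natArr 4 0 v = 2 ∧ τ₂.wtArr 4 0 v ≤ wl w p := by
            intro p
            obtain ⟨a, b⟩ := hd'.walk_le (w := w) p (fun _ _ hab _ _ => ⟨hab, le_rfl⟩) hPu
            refine ⟨a, b.trans ?_⟩
            rw [le_antisymm hvu zero_le, zero_add]
          refine ⟨fun p => (hle p).2, ?_⟩
          obtain ⟨p⟩ := hG.preconnected u v
          obtain ⟨z, hz, p', hp'⟩ := hd'.exists_walk (G := G) (w := w) (fun a b h => ⟨h, rfl⟩) v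
            (hle p).1
          obtain rfl : z = u := Fin.ext hz
          exact ⟨p'.reverse, by rw [wl_reverse, hp', add_zero]⟩)
  have hd : apsp.den σ = τ.setN 14 n := by
    rw [apsp, Cmd.den, ← hυ, hτ, hb.size]
  rw [hd]
  rw [hb.size] at hI
  exact ⟨fun {u v} p => (hI u v u.2).1 p, fun u v => (hI u v u.2).2⟩

end Blocks


/-! ### Computing a net and its offsets -/

section NetBlock

set_option linter.unusedSimpArgs false

variable {n : ℕ} {G : SimpleGraph (Fin n)} {w : Sym2 (Fin n) → ℝ≥0} {r : Fin n}

theorem Cmd.forN_natReg {x y m : ℕ} {c : Cmd} {σ τ : State}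
    (h : (Cmd.forN x c).den σ = τ.setN x m) (hy : y ∉ (Cmd.forN x c).regs) :
    τ.natReg y = σ.natReg y := by
  have e := Cmd.den_natReg _ hy σ
  rwa [h, State.setN_natReg, if_neg fun h' => hy (by simp [Cmd.regs, h'])] at e

/-- The net that consists of the vertices below `k` that a greedy algorithm selects. -/
structure GreedyInv (D : Fin n → Fin n → ℝ≥0) (B : ℝ≥0) (big : Fin n → Prop) (k : ℕ)
    (Z : Fin n → Prop) : Prop where
  big_of_mem : ∀ v, Z v → big v
  sep : ∀ u v, Z u → Z v → u ≠ v → 2 * B < D u v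
  max : ∀ v : Fin n, v < k → big v → ∃ u, Z u ∧ D v u ≤ 2 * B

/-- Vertices are tried in order, and one is added if it is far from those chosen before; a vertex
that is rejected is near a chosen one, which gives maximality. -/
theorem GreedyInv.step {D : Fin n → Fin n → ℝ≥0} {B : ℝ≥0} {big : Fin n → Prop} {k : ℕ}
    {Z Z' : Fin n → Prop} (hD : IsDist G w D) (h : GreedyInv D B big k Z)
    (hZ : ∀ v, Z' v ↔ Z v ∨ ((v : ℕ) = k ∧ big v ∧ ∀ u, Z u → 2 * B < D v u)) :
    GreedyInv D B big (k + 1) Z' := by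
  refine ⟨fun v hv => ?_, fun u v hu hv huv => ?_, fun v hv hb => ?_⟩
  · rcases (hZ v).1 hv with hv | hv
    · exact h.big_of_mem v hv
    · exact hv.2.1
  · rcases (hZ u).1 hu with hu | hu <;> rcases (hZ v).1 hv with hv | hv
    · exact h.sep u v hu hv huv
    · rw [hD.symm]; exact hv.2.2 u hu
    · exact hu.2.2 v hv
    · exact absurd (Fin.ext (hu.1.trans hv.1.symm)) huv
  · by_cases hex : ∃ u, Z u ∧ D v u ≤ 2 * B
    · obtain ⟨u, hu, hu'⟩ := hex
      exact ⟨u, (hZ u).2 (Or.inl hu), hu'⟩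
    · push Not at hex
      rcases Nat.lt_succ_iff_lt_or_eq.1 hv with hv | hv
      · obtain ⟨u, hu, hu'⟩ := h.max v hv hb
        exact absurd (hex u hu) (not_lt.2 hu')
      · exact ⟨v, (hZ v).2 (Or.inr ⟨hv, hb, hex⟩), by rw [hD.self]; exact zero_le⟩

/-- Register `15` is the level, `16` the candidate, and `17` counts the points of that level near
the candidate. Twice the radius is written as a sum, the machine having no products. -/
def netStep : Cmd := .seq
  (.count 17 30 (.and (.nle (.const 1) (.arr 10 (.reg 15) (.reg 30)))
    (.wle (.arr 1 (.reg 16) (.reg 30)) (.arr 5 (.const 0) (.add (.reg 15) (.const 1))))))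
  (.allN 30 10 (.add (.reg 15) (.const 1)) (.and (.neq (.reg 30) (.reg 16))
    (.and (.nle (.reg 3) (.reg 17))
      (.all 31 (.imp (.nle (.const 1) (.arr 10 (.add (.reg 15) (.const 1)) (.reg 31)))
        (.wlt (.add (.arr 5 (.const 0) (.add (.reg 15) (.const 1)))
          (.arr 5 (.const 0) (.add (.reg 15) (.const 1)))) (.arr 1 (.reg 16) (.reg 31))))))) (.const 1))

/-- Compute a hierarchy of nets in the array `10`. -/
def netBlock : Cmd := .seq (.allN 30 10 (.const 0) .true (.const 1))
  (.forN 15 (.seq (.allN 30 10 (.add (.reg 15) (.const 1)) .true (.const 0)) (.forN 16 netStep)))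

theorem netLoop_spec {σ : State} {D : Fin n → Fin n → ℝ≥0} (hD : IsDist G w D)
    (hn : σ.natReg 0 = n) (h1 : ∀ u v : Fin n, σ.wtArr 1 u v = D u v) {j : ℕ}
    (hj : σ.natReg 15 = j) (h0 : ∀ v : Fin n, σ.natArr 10 (j + 1) v = 0) {big : Fin n → Prop}
    (hbig : ∀ v : Fin n, big v ↔ σ.natReg 3 ≤ countLT n fun z => 1 ≤ σ.natArr 10 j z ∧
      σ.wtArr 1 v z ≤ σ.wtArr 5 0 (j + 1)) :
    GreedyInv D (σ.wtArr 5 0 (j + 1)) big n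
      (fun v => 1 ≤ ((Cmd.forN 16 netStep).den σ).natArr 10 (j + 1) v) ∧
    ∀ i ≤ j, ((Cmd.forN 16 netStep).den σ).natArr 10 i = σ.natArr 10 i := by
  obtain ⟨τ, ⟨-, -, -, -, hI⟩, hτ⟩ := Cmd.forN_ind (x := 16) (σ := σ) (c := netStep) (by norm_num)
    (by decide) (fun k τ => τ.natReg 15 = j ∧ τ.natReg 3 = σ.natReg 3 ∧ τ.wtArr 1 = σ.wtArr 1 ∧
      τ.wtArr 5 = σ.wtArr 5 ∧ GreedyInv D (σ.wtArr 5 0 (j + 1)) big k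
      (fun v => 1 ≤ τ.natArr 10 (j + 1) v) ∧ ∀ i ≤ j, τ.natArr 10 i = σ.natArr 10 i)
    ⟨hj, rfl, rfl, rfl, ⟨fun v hv => by simp [h0] at hv, fun v u hv => by simp [h0] at hv,
      fun v hv => absurd hv (Nat.not_lt_zero _)⟩, fun _ _ => rfl⟩
    (by
      rintro k hk τ ⟨t1, t2, t3, t4, t5, t6⟩ t0
      rw [hn] at hk t0
      refine ⟨?_, ?_, ?_, ?_, t5.step hD fun v => ?_, fun i hi => ?_⟩
      · rw [Cmd.den_natReg _ (by decide), State.setN_natReg, if_neg (by norm_num), t1]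
      · rw [Cmd.den_natReg _ (by decide), State.setN_natReg, if_neg (by norm_num), t2]
      · rw [Cmd.den_wtArr _ (by decide), ← t3]; rfl
      · rw [Cmd.den_wtArr _ (by decide), ← t4]; rfl
      · by_cases hv : (v : ℕ) = k
        · have hk : v = ⟨k, hk⟩ := Fin.ext hv
          subst hk
          rw [hbig]
          have e : (∀ u : Fin n, 1 ≤ τ.natArr 10 (j + 1) u →
              2 * σ.wtArr 5 0 (j + 1) < D ⟨k, hk⟩ u) ↔ ∀ u < n, 1 ≤ τ.natArr 10 (j + 1) u →
              σ.wtArr 5 0 (j + 1) + σ.wtArr 5 0 (j + 1) < σ.wtArr 1 k u :=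
            ⟨fun h u hu h' => by have := h ⟨u, hu⟩ h'; rwa [two_mul, ← h1] at this,
              fun h u h' => by rw [two_mul, ← h1]; exact h u u.2 h'⟩
          rw [e]
          simp [netStep, Cmd.den, t0, t1, t2, t3, t4, hk, t6]
          split_ifs with hc
          · exact ⟨fun _ => Or.inr hc, fun _ => le_rfl⟩
          · simp only [hc, or_false]
        · have hv' : ¬ ((v : ℕ) = k ∧ big v ∧ ∀ u : Fin n, 1 ≤ τ.natArr 10 (j + 1) u →
            2 * σ.wtArr 5 0 (j + 1) < D v u) := fun h => hv h.1
          simp [netStep, Cmd.den, t1, hv]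
      · rw [← t6 i hi]
        funext v
        simp [netStep, Cmd.den, t1, show i ≠ j + 1 by omega])
  have hτ' : ((Cmd.forN 16 netStep).den σ).natArr = τ.natArr := by rw [hτ]; rfl
  rw [hτ']
  rw [hn] at hI
  exact hI

theorem netBlock_spec {σ : State} {D : Fin n → Fin n → ℝ≥0} (hD : IsDist G w D)
    (hn : σ.natReg 0 = n) (h1 : ∀ u v : Fin n, σ.wtArr 1 u v = D u v) {t : ℕ} (ht : t ≤ n) :
    IsNet D (σ.wtArr 5 0) (σ.natReg 3) t fun j v => 1 ≤ (netBlock.den σ).natArr 10 j v := by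
  classical
  set υ := (Cmd.allN 30 10 (.const 0) .true (.const 1)).den σ with hυ
  obtain ⟨τ, ⟨-, -, -, hI⟩, hτ⟩ := Cmd.forN_ind (x := 15) (σ := υ) (c := (.seq
    (.allN 30 10 (.add (.reg 15) (.const 1)) .true (.const 0)) (.forN 16 netStep))) (by norm_num)
    (by decide) (fun k τ => τ.natReg 3 = σ.natReg 3 ∧ τ.wtArr 1 = σ.wtArr 1 ∧
      τ.wtArr 5 = σ.wtArr 5 ∧ IsNet D (σ.wtArr 5 0) (σ.natReg 3) k fun j v => 1 ≤ τ.natArr 10 j v)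
    ⟨rfl, rfl, rfl, fun v => by simp [hυ, Cmd.den, hn], fun j hj => absurd hj (Nat.not_lt_zero _),
      fun j hj => absurd hj (Nat.not_lt_zero _), fun j hj => absurd hj (Nat.not_lt_zero _)⟩
    (by
      rintro j hj τ ⟨t1, t2, t3, t4⟩ t0
      have hυ0 : υ.natReg 0 = n := hn
      rw [hυ0] at t0 hj
      rw [Cmd.den]
      set τ₁ := (Cmd.allN 30 10 (.add (.reg 15) (.const 1)) .true (.const 0)).den (τ.setN 15 j)
        with hτ₁
      have e0 : τ₁.natReg 0 = n := by simp [hτ₁, Cmd.den, t0]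
      have e15 : τ₁.natReg 15 = j := by simp [hτ₁, Cmd.den]
      have e3 : τ₁.natReg 3 = σ.natReg 3 := by simp [hτ₁, Cmd.den, t1]
      have e5 : τ₁.wtArr 5 = σ.wtArr 5 := by simp [hτ₁, Cmd.den, t3]
      have e1 : τ₁.wtArr 1 = σ.wtArr 1 := by simp [hτ₁, Cmd.den, t2]
      have ez : ∀ v : Fin n, τ₁.natArr 10 (j + 1) v = 0 := fun v => by simp [hτ₁, Cmd.den, t0]
      have ei : ∀ i ≤ j, τ₁.natArr 10 i = τ.natArr 10 i := fun i hi => by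
        funext v; simp [hτ₁, Cmd.den, show i ≠ j + 1 by omega]
      obtain ⟨g1, g2⟩ := netLoop_spec hD e0 (fun u v => by rw [e1, h1]) e15 ez
        (big := fun v => σ.natReg 3 ≤ (Finset.univ.filter fun z : Fin n => 1 ≤ τ.natArr 10 j z ∧
          D v z ≤ σ.wtArr 5 0 (j + 1)).card) (fun v => by
          rw [countLT_fin, e3, e1, e5, ei j le_rfl]
          simp only [h1])
      refine ⟨?_, ?_, ?_, ?_⟩
      · rw [Cmd.den_natReg _ (by decide), e3]
      · rw [Cmd.den_wtArr _ (by decide), e1]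
      · rw [Cmd.den_wtArr _ (by decide), e5]
      · rw [e5] at g1
        generalize (Cmd.forN 16 netStep).den τ₁ = τ₂ at *
        have g3 : ∀ i ≤ j, τ₂.natArr 10 i = τ.natArr 10 i := fun i hi => by rw [g2 i hi, ei i hi]
        refine ⟨fun v => by rw [g3 0 (Nat.zero_le _)]; exact t4.zero v, fun i hi v hv => ?_,
          fun i hi u v => ?_, fun i hi v hv => ?_⟩
        all_goals rcases Nat.lt_succ_iff_lt_or_eq.1 hi with hi | rfl
        · rw [g3 (i + 1) (by omega)] at hv
          simp only [g3 i (by omega)]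
          convert t4.big i hi v hv
        · simp only [g3 i le_rfl]
          convert g1.big_of_mem v hv
        · rw [g3 (i + 1) (by omega)]
          exact t4.sep i hi u v
        · exact g1.sep u v
        · simp only [g3 i (by omega)] at hv
          simp only [g3 (i + 1) (by omega)]
          exact t4.max i hi v (by convert hv)
        · simp only [g3 i le_rfl] at hv
          exact g1.max v v.2 (by convert hv))
  have hd : (netBlock.den σ).natArr = τ.natArr := by rw [netBlock, Cmd.den, ← hυ, hτ]; rfl
  rw [hd]
  have hυ0 : υ.natReg 0 = n := hn
  rw [hυ0] at hI
  exact ⟨hI.zero, fun j hj => hI.big j (by omega), fun j hj => hI.sep j (by omega),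
    fun j hj => hI.max j (by omega)⟩

/-- Levels are treated from the top, and array `11` marks the vertices whose offset is settled, so
that the highest level counts. Weight register `2` runs through the values of `levelOffset`. -/
def offsetStep : Cmd := .seqs [
  .allW 30 3 (.const 0) (.and (.neq (.arr 11 (.const 0) (.reg 30)) (.const 0))
    (.nle (.const 1) (.arr 10 (.sub (.reg 2) (.reg 15)) (.reg 30)))) (.reg 2),
  .allN 30 11 (.const 0) (.nle (.const 1) (.arr 10 (.sub (.reg 2) (.reg 15)) (.reg 30))) (.const 1),
  .setW 3 (.arr 5 (.const 0) (.sub (.reg 2) (.reg 15))),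
  .setW 2 (.add (.reg 2) (.add (.add (.reg 3) (.reg 3)) (.add (.reg 3) (.reg 3))))]

def offsetInit : Cmd := .seqs [
  .allN 30 11 (.const 0) .true (.const 0),
  .setW 3 (.arr 5 (.const 0) (.reg 2)),
  .setW 2 (.add (.add (.reg 3) (.reg 3)) (.add (.reg 3) (.reg 3)))]

/-- Compute the offsets in the weight array `3`. -/
def offsetBlock : Cmd := .seqs [offsetInit, .forN 15 offsetStep,
  .allW 30 3 (.const 0) (.neq (.reg 30) (.reg 1)) .zero]

theorem offsetBlock_spec {σ : State} (hn : σ.natReg 0 = n) (hr : σ.natReg 1 = r)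
    (hZ : ∀ v : Fin n, 1 ≤ σ.natArr 10 0 v) (ht : σ.natReg 2 < n) :
    IsOffset r (σ.wtArr 5 0) (σ.natReg 2) (fun j v => 1 ≤ σ.natArr 10 j v)
      fun v : Fin n => (offsetBlock.den σ).wtArr 3 0 v := by
  set t := σ.natReg 2 with htd
  set b := σ.wtArr 5 0 with hb
  have four : ∀ x : ℝ≥0, x + x + (x + x) = 4 * x := fun x => by ring
  obtain ⟨τ, ⟨-, -, -, -, -, hI⟩, hτ⟩ := Cmd.forN_ind (x := 15) (σ := offsetInit.den σ)
    (c := offsetStep) (by norm_num) (by decide) (fun k τ => τ.natReg 2 = t ∧ τ.natReg 1 = r ∧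
      τ.wtArr 5 = σ.wtArr 5 ∧ τ.natArr 10 = σ.natArr 10 ∧ τ.wtReg 2 = levelOffset b t k ∧
      ∀ v : Fin n, (τ.natArr 11 0 v = 0 ∧ ∀ i < k, ¬ 1 ≤ σ.natArr 10 (t - i) v) ∨
        (τ.natArr 11 0 v = 1 ∧ ∃ i < k, 1 ≤ σ.natArr 10 (t - i) v ∧
          τ.wtArr 3 0 v = levelOffset b t i ∧ ∀ i' < i, ¬ 1 ≤ σ.natArr 10 (t - i') v))
    (by
      refine ⟨rfl, hr, rfl, ?_, ?_, fun v => Or.inl ⟨?_, fun i hi => absurd hi (Nat.not_lt_zero _)⟩⟩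
      · rw [Cmd.den_natArr _ (by decide)]
      · simp [offsetInit, Cmd.seqs, Cmd.den, levelOffset, four, ← htd, ← hb]
      · simp [offsetInit, Cmd.seqs, Cmd.den, hn])
    (by
      rintro k hk τ ⟨t2, t1, t5, t10, tw, tI⟩ t0
      have h0 : (offsetInit.den σ).natReg 0 = n := hn
      rw [h0] at t0 hk
      refine ⟨?_, ?_, ?_, ?_, ?_, fun v => ?_⟩
      · rw [Cmd.den_natReg _ (by decide), State.setN_natReg, if_neg (by norm_num), t2]
      · rw [Cmd.den_natReg _ (by decide), State.setN_natReg, if_neg (by norm_num), t1]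
      · rw [Cmd.den_wtArr _ (by decide), ← t5]; rfl
      · rw [Cmd.den_natArr _ (by decide), ← t10]; rfl
      · simp [offsetStep, Cmd.seqs, Cmd.den, levelOffset, four, t2, tw, t5, ← hb]
      · have e1 : (offsetStep.den (τ.setN 15 k)).natArr 11 0 v =
            if 1 ≤ σ.natArr 10 (t - k) v then 1 else τ.natArr 11 0 v := by
          simp [offsetStep, Cmd.seqs, Cmd.den, t0, t2, t10]
        have e2 : (offsetStep.den (τ.setN 15 k)).wtArr 3 0 v =
            if τ.natArr 11 0 v = 0 ∧ 1 ≤ σ.natArr 10 (t - k) v then levelOffset b t k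
            else τ.wtArr 3 0 v := by
          simp [offsetStep, Cmd.seqs, Cmd.den, t0, t2, t10, tw]
        rw [e1, e2]
        rcases tI v with ⟨a, h⟩ | ⟨a, i, hi, h1, h2, h3⟩
        · by_cases hz : 1 ≤ σ.natArr 10 (t - k) v
          · right
            exact ⟨by simp [hz], k, by omega, hz, by simp [hz, a], h⟩
          · left
            refine ⟨by simp [hz, a], fun i hi => ?_⟩
            rcases Nat.lt_succ_iff_lt_or_eq.1 hi with hi | rfl
            · exact h i hi
            · exact hz
        · right
          exact ⟨by split_ifs <;> simp [a], i, by omega, h1, by simp [a, h2], h3⟩)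
  have h0 : (offsetInit.den σ).natReg 0 = n := hn
  have hd : ∀ v : Fin n, (offsetBlock.den σ).wtArr 3 0 v =
      if v = r then 0 else τ.wtArr 3 0 v := by
    intro v
    rw [offsetBlock, Cmd.seqs, Cmd.den, Cmd.seqs, Cmd.den, hτ, h0]
    have e1 : τ.natReg 1 = r := by
      rw [Cmd.forN_natReg hτ (by decide), Cmd.den_natReg _ (by decide), hr]
    have e0 : τ.natReg 0 = n := by rw [Cmd.forN_natReg hτ (by decide), h0]
    simp [Cmd.seqs, Cmd.den, e1, e0, Fin.ext_iff]
  rw [h0] at hI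
  refine ⟨by simp [hd], fun v hv => ?_⟩
  rw [hd, if_neg hv]
  -- Level `0` contains all vertices, so every vertex is marked by round `t`; the later rounds,
  -- where the subtraction is truncated and level `0` recurs, change nothing.
  rcases hI v with ⟨-, h⟩ | ⟨-, i, hi, h1, h2, h3⟩
  · exact absurd (by simpa using hZ v) (h t ht)
  · have hit : i ≤ t := by
      by_contra hit
      exact h3 t (by omega) (by simpa using hZ v)
    refine ⟨t - i, by omega, h1, by rw [h2]; congr 1; omega, fun j' hj' hz => ?_⟩
    by_contra hlt
    exact h3 (t - j') (by omega) (by rwa [Nat.sub_sub_self hj'])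

end NetBlock


/-! ### Computing the portals of the next level -/

section AggBlock

set_option linter.unusedSimpArgs false

variable {n : ℕ} {G : SimpleGraph (Fin n)} {w : Sym2 (Fin n) → ℝ≥0} {c q : Fin n → Fin n}
  {Δ : ℝ≥0} {off val : Fin n → ℝ≥0} {rk : Fin n → ℕ} {anc : Fin n → Fin n → Prop}

theorem exists_lt_iff {n : ℕ} {p : ℕ → Prop} : (∃ i < n, p i) ↔ ∃ v : Fin n, p v :=
  ⟨fun ⟨i, h, hp⟩ => ⟨⟨i, h⟩, hp⟩, fun ⟨v, h⟩ => ⟨v, v.2, h⟩⟩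

theorem forall_lt_iff {n : ℕ} {p : ℕ → Prop} : (∀ i < n, p i) ↔ ∀ v : Fin n, p v :=
  ⟨fun h v => h v v.2, fun h i hi => h ⟨i, hi⟩⟩

/-- The memory holds the clusters and the shortest path forest. -/
structure AggMem (c q : Fin n → Fin n) (anc : Fin n → Fin n → Prop) (σ : State) : Prop where
  size : σ.natReg 0 = n
  lab : ∀ v : Fin n, σ.natArr 9 (σ.natReg 4) v = c v
  ptr : ∀ v : Fin n, σ.natArr 5 0 v = q v
  anc : ∀ u v : Fin n, 1 ≤ σ.natArr 7 u v ↔ anc u v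

theorem AggMem.den {σ : State} (h : AggMem c q anc σ) {d : Cmd}
    (hd : (0 ∉ d.regs ∧ 4 ∉ d.regs) ∧ 5 ∉ d.arrs ∧ 7 ∉ d.arrs ∧ 9 ∉ d.arrs) :
    AggMem c q anc (d.den σ) := by
  obtain ⟨⟨h0, h4⟩, h5, h7, h9⟩ := hd
  refine ⟨?_, fun v => ?_, fun v => ?_, fun u v => ?_⟩
  · rw [Cmd.den_natReg _ h0, h.size]
  · rw [Cmd.den_natReg _ h4, Cmd.den_natArr _ h9, h.lab]
  · rw [Cmd.den_natArr _ h5, h.ptr]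
  · rw [Cmd.den_natArr _ h7, h.anc]

theorem AggMem.setN {σ : State} (h : AggMem c q anc σ) {x : ℕ} (hx : 5 ≤ x) (k : ℕ) :
    AggMem c q anc (σ.setN x k) :=
  ⟨by rw [State.setN_natReg, if_neg (by omega), h.size],
    fun v => by rw [State.setN_natReg, if_neg (by omega), State.setN_natArr, h.lab], h.ptr, h.anc⟩

theorem Cmd.den_seq (c d : Cmd) (σ : State) : (Cmd.seq c d).den σ = d.den (c.den σ) := rfl

/-- Fill row `0` of the array `a` with the truth values of a formula. -/
def flagRow (a : ℕ) (φ : Fm) : Cmd :=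
  .seq (.allN 30 a (.const 0) .true (.const 0)) (.allN 30 a (.const 0) φ (.const 1))

theorem flagRow_spec {a : ℕ} {φ : Fm} {σ : State} {v : ℕ} (hv : v < σ.natReg 0) :
    1 ≤ ((flagRow a φ).den σ).natArr a 0 v ↔
      φ.Holds (((Cmd.allN 30 a (.const 0) .true (.const 0)).den σ).setN 30 v) := by
  rw [flagRow, Cmd.den_seq]
  have h0 : ((Cmd.allN 30 a (.const 0) .true (.const 0)).den σ).natArr a 0 v = 0 := by
    simp [Cmd.den, hv]
  have h1 : ((Cmd.allN 30 a (.const 0) .true (.const 0)).den σ).natReg 0 = σ.natReg 0 := rfl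
  generalize (Cmd.allN 30 a (.const 0) .true (.const 0)).den σ = τ at *
  by_cases h : φ.Holds (τ.setN 30 v) <;> simp [Cmd.den, h, h0, h1, hv]

/-- The right-hand side of `IsClustering.hit_iff` as a formula. -/
def hitBlock : Cmd := flagRow 18 (.ex 31 (.and (.nle (.const 1) (.arr 7 (.reg 30) (.reg 31)))
    (.and (.nle (.const 1) (.arr 14 (.const 0) (.reg 31)))
    (.all 32 (.imp (.nle (.const 1) (.arr 7 (.reg 30) (.reg 32)))
      (.imp (.nle (.const 1) (.arr 7 (.reg 32) (.reg 31)))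
        (.nle (.arr 12 (.const 0) (.reg 32)) (.const 1))))))))

/-- Compute the next layer of the set in the array `14` in the array `15`. -/
def nextBlock : Cmd := .seq hitBlock (flagRow 15
  (.and (.nle (.arr 12 (.const 0) (.reg 30)) (.const 1))
    (.ex 31 (.and (.neq (.arr 9 (.reg 4) (.reg 31)) (.arr 9 (.reg 4) (.reg 30)))
      (.nle (.const 1) (.arr 18 (.const 0) (.reg 31)))))))

theorem nextBlock_spec (hc : IsClustering G w c Δ off val q rk anc) {σ : State}
    (h : AggMem c q anc σ) (hU : ∀ v : Fin n, 1 ≤ σ.natArr 14 0 v → σ.natArr 12 0 v ≤ 1)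
    (v : Fin n) : 1 ≤ (nextBlock.den σ).natArr 15 0 v ↔
      nextLayer c q (fun v => σ.natArr 12 0 v) (fun v => 1 ≤ σ.natArr 14 0 v) v := by
  have e : ∀ v : Fin n, 1 ≤ (hitBlock.den σ).natArr 18 0 v ↔
      Hit q (fun x => σ.natArr 12 0 x ≤ 1) (fun v => 1 ≤ σ.natArr 14 0 v) v := by
    intro v
    rw [hc.hit_iff hU]
    rw [hitBlock, flagRow_spec (by rw [h.size]; exact v.2)]
    simp [Cmd.den, h.size, h.anc, exists_lt_iff, forall_lt_iff]
  have m : AggMem c q anc (hitBlock.den σ) := h.den (by decide)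
  have e12 : (hitBlock.den σ).natArr 12 = σ.natArr 12 := Cmd.den_natArr _ (by decide) _
  unfold nextLayer
  rw [nextBlock, Cmd.den_seq]
  generalize hitBlock.den σ = τ at *
  rw [flagRow_spec (by rw [m.size]; exact v.2)]
  simp [Cmd.den, m.size, m.lab, e, e12, exists_lt_iff, Fin.ext_iff]

def layerStep : Cmd := .seq nextBlock (.seqs [
  .count 20 30 (.and (.nle (.const 1) (.arr 14 (.const 0) (.reg 30)))
    (.neq (.arr 12 (.const 0) (.reg 30)) (.const 0))),
  .count 21 30 (.and (.nle (.const 1) (.arr 15 (.const 0) (.reg 30)))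
    (.neq (.arr 12 (.const 0) (.reg 30)) (.const 0))),
  .allN 30 14 (.const 0) (.nlt (.add (.reg 20) (.reg 20)) (.reg 21))
    (.arr 15 (.const 0) (.reg 30))])

theorem layerLoop_spec (hc : IsClustering G w c Δ off val q rk anc) {σ : State}
    (h : AggMem c q anc σ) {port : Fin n → Fin n} {f : Fin n} {e : ℝ≥0} {v : Fin n}
    (hst : ∀ u v : Fin n, c u = c v → σ.natArr 12 0 u = σ.natArr 12 0 v)
    (hU : LayerInv G w c Δ off val q (fun v => σ.natArr 12 0 v) port f e v 0
      fun v => 1 ≤ σ.natArr 14 0 v) :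
    LayerInv G w c Δ off val q (fun v => σ.natArr 12 0 v) port f e v n
      fun v => 1 ≤ ((Cmd.forN 19 layerStep).den σ).natArr 14 0 v := by
  classical
  obtain ⟨τ, ⟨-, -, hI⟩, hτ⟩ := Cmd.forN_ind (x := 19) (σ := σ) (c := layerStep) (by norm_num)
    (by decide) (fun k τ => AggMem c q anc τ ∧ τ.natArr 12 = σ.natArr 12 ∧
      LayerInv G w c Δ off val q (fun v => σ.natArr 12 0 v) port f e v k
        fun v => 1 ≤ τ.natArr 14 0 v) ⟨h, rfl, hU⟩
    (by
      rintro k hk τ ⟨t1, t2, t3⟩ -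
      have m1 : AggMem c q anc (τ.setN 19 k) := t1.setN (by norm_num) _
      have m2 : AggMem c q anc (nextBlock.den (τ.setN 19 k)) := m1.den (by decide)
      refine ⟨m1.den (by decide), ?_, ?_⟩
      · rw [Cmd.den_natArr _ (by decide), ← t2]; rfl
      have hsub : ∀ v : Fin n, 1 ≤ (τ.setN 19 k).natArr 14 0 v → (τ.setN 19 k).natArr 12 0 v ≤ 1 := by
        intro v hv
        obtain ⟨m, hm, -⟩ := t3.layer
        rw [State.setN_natArr, t2]
        exact hm.sub v hv
      have hn := nextBlock_spec hc m1 hsub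
      have e12 : (nextBlock.den (τ.setN 19 k)).natArr 12 = σ.natArr 12 := by
        rw [Cmd.den_natArr _ (by decide), ← t2]; rfl
      have e14 : (nextBlock.den (τ.setN 19 k)).natArr 14 = τ.natArr 14 := by
        rw [Cmd.den_natArr _ (by decide)]; rfl
      simp only [State.setN_natArr, t2] at hn
      rw [layerStep, Cmd.den]
      generalize nextBlock.den (τ.setN 19 k) = υ at *
      refine t3.step hc hst ?_
      have e0 := m2.size
      have c1 := countLT_fin (n := n) (fun v => 1 ≤ τ.natArr 14 0 v ∧ σ.natArr 12 0 v = 0)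
      have c2 := countLT_fin (n := n) (fun v => 1 ≤ υ.natArr 15 0 v ∧ σ.natArr 12 0 v = 0)
      simp only [← hn]
      have hiff : 2 * (Finset.univ.filter fun v : Fin n => 1 ≤ τ.natArr 14 0 v ∧
          σ.natArr 12 0 v = 0).card < (Finset.univ.filter fun v : Fin n => 1 ≤ υ.natArr 15 0 v ∧
          σ.natArr 12 0 v = 0).card ↔
          countLT n (fun v => 1 ≤ τ.natArr 14 0 v ∧ σ.natArr 12 0 v = 0) +
          countLT n (fun v => 1 ≤ τ.natArr 14 0 v ∧ σ.natArr 12 0 v = 0) <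
          countLT n (fun v => 1 ≤ υ.natArr 15 0 v ∧ σ.natArr 12 0 v = 0) := by
        rw [c1, c2, ← two_mul]
      split_ifs with hlt
      · replace hlt := hiff.1 (by convert hlt)
        funext u
        simp [Cmd.seqs, Cmd.den, e0, e12, e14, hlt]
        exact hn u
      · replace hlt := hiff.not.1 (by convert hlt)
        funext u
        simp [Cmd.seqs, Cmd.den, e0, e12, e14, hlt])
  have hd : ((Cmd.forN 19 layerStep).den σ).natArr = τ.natArr := by rw [hτ]; rfl
  rw [hd]
  rw [h.size] at hI
  exact hI

/-- Register `17` becomes the portal, which is the seed itself or the portal of the vertex it points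
to, and array `14` its cluster, the first layer. -/
def seedInit : Cmd := .seqs [
  .ite (.neq (.arr 5 (.const 0) (.reg 16)) (.reg 16)) (.setN 17 (.reg 16))
    (.setN 17 (.arr 13 (.const 0) (.arr 5 (.const 0) (.reg 16)))),
  flagRow 14 (.neq (.arr 9 (.reg 4) (.reg 30)) (.arr 9 (.reg 4) (.reg 16)))]

def seedAssign : Cmd := .seqs [
  .allN 30 12 (.const 0) (.and (.nle (.const 1) (.arr 15 (.const 0) (.reg 30)))
    (.neq (.arr 12 (.const 0) (.reg 30)) (.const 0))) (.const 1),
  .allN 30 12 (.const 0) (.nle (.const 1) (.arr 14 (.const 0) (.reg 30))) (.const 2),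
  .allN 30 13 (.const 0) (.nle (.const 1) (.arr 14 (.const 0) (.reg 30))) (.reg 17)]

def seedBody : Cmd := .seq seedInit (.seq (.forN 19 layerStep) (.seq nextBlock seedAssign))

/-- The next layer is computed once more after the loop, since array `15` may still belong to the
set before its last enlargement; then `AggInv.seed_step` applies. -/
theorem seedBody_spec (hc : IsClustering G w c Δ off val q rk anc) {l : ℕ} (hl : n ≤ 2 ^ l)
    {σ : State} (h : AggMem c q anc σ) {v : Fin n} (hv : σ.natReg 16 = v)
    (hst : σ.natArr 12 0 v ≤ 1) (hq : q v = v ∨ σ.natArr 12 0 (q v) = 3) {k : ℕ}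
    {port : Fin n → Fin n} (hp : ∀ v : Fin n, σ.natArr 13 0 v = port v) {done : Fin n → Prop}
    (hA : AggInv G w c off val q k l ((l + 2) * (2 * Δ)) (fun v => σ.natArr 12 0 v) port done) :
    ∃ port' : Fin n → Fin n, (∀ v : Fin n, (seedBody.den σ).natArr 13 0 v = port' v) ∧
      AggInv G w c off val q k l ((l + 2) * (2 * Δ)) (fun v => (seedBody.den σ).natArr 12 0 v)
        port' (fun x => done x ∨ x = v) := by
  classical
  set f : Fin n := if q v = v then v else port (q v) with hf
  have m1 : AggMem c q anc (seedInit.den σ) := h.den (by decide)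
  have a12 : (seedInit.den σ).natArr 12 = σ.natArr 12 := Cmd.den_natArr _ (by decide) _
  have a13 : (seedInit.den σ).natArr 13 = σ.natArr 13 := Cmd.den_natArr _ (by decide) _
  have a17 : (seedInit.den σ).natReg 17 = f := by
    by_cases hqv : q v = v
    · simp [seedInit, flagRow, Cmd.seqs, Cmd.den, hv, h.ptr, hf, hqv]
    · have : ¬ ((q v : ℕ) = v) := fun h' => hqv (Fin.ext h')
      simp [seedInit, flagRow, Cmd.seqs, Cmd.den, hv, h.ptr, hf, hqv, this, hp]
  have a14 : ∀ u : Fin n, 1 ≤ (seedInit.den σ).natArr 14 0 u ↔ c u = c v := by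
    intro u
    rw [seedInit, Cmd.seqs, Cmd.den_seq, Cmd.seqs, flagRow_spec (by
      rw [Cmd.den_natReg _ (by decide), h.size]; exact u.2)]
    simp only [Fm.holds_neq, NExpr.eval, State.setN_natReg, State.setN_natArr]
    have e9 : ∀ τ : State,
        ((Cmd.allN 30 14 (.const 0) .true (.const 0)).den τ).natArr 9 = τ.natArr 9 := fun τ =>
      Cmd.den_natArr _ (by decide) _
    have e4 : ∀ τ : State,
        ((Cmd.allN 30 14 (.const 0) .true (.const 0)).den τ).natReg = τ.natReg := fun _ => rfl
    rw [e9, e4, Cmd.den_natArr _ (by decide)]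
    simp only [Nat.reduceEqDiff, if_false, if_true]
    rw [Cmd.den_natReg _ (by decide), Cmd.den_natReg _ (by decide), hv, h.lab, h.lab, Fin.ext_iff]
  have hd : seedBody.den σ = seedAssign.den (nextBlock.den
    ((Cmd.forN 19 layerStep).den (seedInit.den σ))) := rfl
  rw [hd]
  clear hd
  generalize seedInit.den σ = σ₁ at *
  have hL0 : LayerInv G w c Δ off val q (fun v => σ₁.natArr 12 0 v) port f
      (min k (l + 1) * ((l + 2) * (2 * Δ))) v 0 fun v => 1 ≤ σ₁.natArr 14 0 v := by
    refine ⟨(a14 v).2 rfl, ⟨0, ?_, by simp⟩, Or.inr (by simp)⟩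
    simp only [a14, a12, Nat.cast_zero, zero_add, one_mul]
    exact hc.isLayer_seed hA.cls hst hq (fun h3 => by exact_mod_cast hA.old (q v) h3)
      (fun h' => by simp [hf, h']) (fun h' => by simp [hf, h'])
  have hL := layerLoop_spec hc m1 (fun u v => by rw [a12]; exact hA.cls u v) hL0
  have m2 : AggMem c q anc ((Cmd.forN 19 layerStep).den σ₁) := m1.den (by decide)
  have b12 : ((Cmd.forN 19 layerStep).den σ₁).natArr 12 = σ.natArr 12 := by
    rw [Cmd.den_natArr _ (by decide), a12]
  have b13 : ((Cmd.forN 19 layerStep).den σ₁).natArr 13 = σ.natArr 13 := by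
    rw [Cmd.den_natArr _ (by decide), a13]
  have b17 : ((Cmd.forN 19 layerStep).den σ₁).natReg 17 = f := by
    rw [Cmd.den_natReg _ (by decide), a17]
  rw [a12] at hL
  generalize (Cmd.forN 19 layerStep).den σ₁ = σ₂ at *
  have hsub : ∀ v : Fin n, 1 ≤ σ₂.natArr 14 0 v → σ₂.natArr 12 0 v ≤ 1 := by
    intro v hv
    obtain ⟨m, hm, -⟩ := hL.layer
    rw [b12]
    exact hm.sub v hv
  have hn := nextBlock_spec hc m2 hsub
  have m3 : AggMem c q anc (nextBlock.den σ₂) := m2.den (by decide)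
  have c12 : (nextBlock.den σ₂).natArr 12 = σ.natArr 12 := by
    rw [Cmd.den_natArr _ (by decide), b12]
  have c13 : (nextBlock.den σ₂).natArr 13 = σ.natArr 13 := by
    rw [Cmd.den_natArr _ (by decide), b13]
  have c14 : (nextBlock.den σ₂).natArr 14 = σ₂.natArr 14 := Cmd.den_natArr _ (by decide) _
  have c17 : (nextBlock.den σ₂).natReg 17 = f := by rw [Cmd.den_natReg _ (by decide), b17]
  rw [b12] at hn
  generalize nextBlock.den σ₂ = σ₃ at *
  refine ⟨fun u => if 1 ≤ σ₂.natArr 14 0 u then f else port u, fun u => ?_, ?_⟩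
  · by_cases hu : 1 ≤ σ₂.natArr 14 0 u <;>
    simp [seedAssign, Cmd.seqs, Cmd.den, m3.size, c14, hu, c17, c13, hp]
  · refine hA.seed_step (by simpa using hl) hst (by simpa using hL) (fun u hu => ?_)
      (fun u hu hu' h0 => ?_) (fun u hu hu' => ?_) (fun u hu => by simp [hu])
    · simp [seedAssign, Cmd.seqs, Cmd.den, m3.size, c14, hu]
    · rw [← hn] at hu'
      simp [seedAssign, Cmd.seqs, Cmd.den, m3.size, c14, hu, c12, hu', h0]
    · rw [← hn] at hu'
      simp only [seedAssign, Cmd.seqs, Cmd.den]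
      simp [m3.size, c14, hu, c12]
      intro h1 h2; exact absurd ⟨h1, h2⟩ hu'

/-- Exactly the situation of `IsClustering.isLayer_seed`. Pointers to vertices assigned in the same
phase (status `2`) are not accepted, so that errors add up only once per phase. -/
def seedStep : Cmd := .ite (.and (.nle (.arr 12 (.const 0) (.reg 16)) (.const 1))
    (.or (.neq (.arr 5 (.const 0) (.reg 16)) (.reg 16))
      (.neq (.arr 12 (.const 0) (.arr 5 (.const 0) (.reg 16))) (.const 3))))
  seedBody (.setN 63 (.const 0))

def phaseStep : Cmd := .seq (.forN 16 seedStep) (.seq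
  (.allN 30 12 (.const 0) (.nle (.arr 12 (.const 0) (.reg 30)) (.const 1)) (.const 0))
  (.allN 30 12 (.const 0) (.nle (.const 2) (.arr 12 (.const 0) (.reg 30))) (.const 3)))

theorem phaseStep_spec (hc : IsClustering G w c Δ off val q rk anc) {l : ℕ} (hl : n ≤ 2 ^ l)
    {σ : State} (h : AggMem c q anc σ) {k : ℕ}
    (hA : ∃ port : Fin n → Fin n, (∀ v : Fin n, σ.natArr 13 0 v = port v) ∧
      AggInv G w c off val q k l ((l + 2) * (2 * Δ)) (fun v => σ.natArr 12 0 v) port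
        fun _ => False) :
    ∃ port : Fin n → Fin n, (∀ v : Fin n, (phaseStep.den σ).natArr 13 0 v = port v) ∧
      AggInv G w c off val q (k + 1) l ((l + 2) * (2 * Δ))
        (fun v => (phaseStep.den σ).natArr 12 0 v) port fun _ => False := by
  classical
  obtain ⟨τ, ⟨t1, port, t2, t3⟩, hτ⟩ := Cmd.forN_ind (x := 16) (σ := σ) (c := seedStep)
    (by norm_num) (by decide) (fun i τ => AggMem c q anc τ ∧ ∃ port : Fin n → Fin n,
      (∀ v : Fin n, τ.natArr 13 0 v = port v) ∧ AggInv G w c off val q k l ((l + 2) * (2 * Δ))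
        (fun v => τ.natArr 12 0 v) port fun v => v < i)
    ⟨h, by simpa using hA⟩
    (by
      rintro i hi τ ⟨t1, port, t2, t3⟩ -
      rw [h.size] at hi
      have m1 : AggMem c q anc (τ.setN 16 i) := t1.setN (by norm_num) _
      refine ⟨m1.den (by decide), ?_⟩
      have hdone : (fun v : Fin n => (v : ℕ) < i + 1) =
          fun x : Fin n => (x : ℕ) < i ∨ x = ⟨i, hi⟩ := by
        funext x
        simp only [eq_iff_iff, Fin.ext_iff]
        omega
      rw [hdone, seedStep, Cmd.den]
      split_ifs with hcond
      · simp at hcond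
        refine seedBody_spec hc hl m1 (v := ⟨i, hi⟩) (by simp) hcond.1 ?_ t2 t3
        have := t1.ptr ⟨i, hi⟩
        simp only at this
        rw [this] at hcond
        exact hcond.2.imp Fin.ext id
      · refine ⟨port, t2, t3.cls, t3.cls_port, t3.old, t3.new, t3.avoid, t3.count, t3.total,
          t3.le_three, ?_⟩
        rintro x (hx | rfl)
        · exact t3.seeds x hx
        · intro hx
          have := t1.ptr ⟨i, hi⟩
          simp only at this
          simp [this] at hcond
          obtain ⟨h1, h2⟩ := hcond hx
          exact ⟨fun h' => h1 (congrArg Fin.val h'), h2⟩)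
  rw [phaseStep, Cmd.den, hτ, Cmd.den]
  have e0 := t1.size
  refine ⟨port, fun v => by simp [Cmd.den, t2], ?_⟩
  refine AggInv.next_phase (st := fun v : Fin n => τ.natArr 12 0 v) ?_ hc (fun v hv => ?_) (fun v hv => ?_)
  · convert t3 with v
    simp [h.size]
  · simp [Cmd.den, e0, hv]
  · have : ¬ τ.natArr 12 0 v ≤ 1 := by omega
    simp [Cmd.den, e0, this, hv]

/-- Compute the portals of the vertices in the array `13`. -/
def aggBlock : Cmd := .seq (.allN 30 12 (.const 0) .true (.const 0))
  (.seq (.allN 30 13 (.const 0) .true (.reg 30)) (.forN 15 phaseStep))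

theorem aggBlock_spec (hc : IsClustering G w c Δ off val q rk anc) {l : ℕ} (hl : n ≤ 2 ^ l)
    {σ : State} (h : AggMem c q anc σ) :
    ∃ port : Fin n → Fin n, (∀ v : Fin n, (aggBlock.den σ).natArr 13 0 v = port v) ∧
      ∀ v, (∀ u, c u = c v → port u = port v) ∧
      ∃ p : G.Walk v (port v), (∀ x ∈ p.support, port x = port v) ∧
        wl w p + off (port v) ≤ val v + (l + 1) * ((l + 2) * (2 * Δ)) := by
  set υ := (Cmd.allN 30 13 (.const 0) .true (.reg 30)).den
    ((Cmd.allN 30 12 (.const 0) .true (.const 0)).den σ) with hυ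
  have hm : AggMem c q anc υ := (h.den (by decide)).den (by decide)
  obtain ⟨τ, ⟨-, port, t2, t3⟩, hτ⟩ := Cmd.forN_ind (x := 15) (σ := υ) (c := phaseStep)
    (by norm_num) (by decide) (fun i τ => AggMem c q anc τ ∧ ∃ port : Fin n → Fin n,
      (∀ v : Fin n, τ.natArr 13 0 v = port v) ∧ AggInv G w c off val q i l ((l + 2) * (2 * Δ))
        (fun v => τ.natArr 12 0 v) port fun _ => False)
    ⟨hm, id, fun v => by simp [hυ, Cmd.den, h.size],
      AggInv.init id fun v => by simp [hυ, Cmd.den, h.size]⟩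
    (by
      rintro i hi τ ⟨t1, t2⟩ -
      have m1 : AggMem c q anc (τ.setN 15 i) := t1.setN (by norm_num) _
      exact ⟨m1.den (by decide), phaseStep_spec hc hl m1 t2⟩)
  have hd : (aggBlock.den σ).natArr = τ.natArr := by
    rw [aggBlock, Cmd.den_seq, Cmd.den_seq, ← hυ, hτ]; rfl
  rw [hd]
  rw [hm.size] at t3
  refine ⟨port, t2, AggInv.result (by simpa using t3)⟩

end AggBlock


/-! ### Computing the hierarchy -/

section LevelBlock

set_option linter.unusedSimpArgs false

variable {n : ℕ} {G : SimpleGraph (Fin n)} {w : Sym2 (Fin n) → ℝ≥0} {r : Fin n}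
  {D : Fin n → Fin n → ℝ≥0}

/-- Two nested loops serve as one loop of `n ^ 2` rounds; the invariant must not depend on the two
counters. -/
theorem Cmd.forN_forN_ind {x y : ℕ} {c : Cmd} {σ : State} (hx : x ≠ 0) (hy : y ≠ 0)
    (hc : 0 ∉ c.regs) (I : ℕ → State → Prop) (h0 : I 0 σ)
    (hI : ∀ k τ i, I k τ → I k (τ.setN x i) ∧ I k (τ.setN y i))
    (hs : ∀ k τ, I k τ → τ.natReg 0 = σ.natReg 0 → I (k + 1) (c.den τ)) :
    I (σ.natReg 0 * σ.natReg 0) ((Cmd.forN x (.forN y c)).den σ) := by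
  set n := σ.natReg 0 with hn
  obtain ⟨τ, h1, h2⟩ := Cmd.forN_ind (x := x) (σ := σ) (c := .forN y c) hx
    (by simp [Cmd.regs, hc, hy.symm]) (fun i τ => I (i * n) τ) (by simpa using h0)
    (by
      intro i hi τ hτ h0
      have e0 : (τ.setN x i).natReg 0 = n := by simp [hx.symm, h0, hn]
      obtain ⟨υ, h1, h2⟩ := Cmd.forN_ind (x := y) (σ := τ.setN x i) (c := c) hy hc
        (fun j τ => I (i * n + j) τ) (hI _ _ _ hτ).1
        (fun j _ υ hυ h0 => hs _ _ (hI _ _ _ hυ).2 (by rw [State.setN_natReg, if_neg hy.symm, h0, e0]))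
      rw [h2, add_mul, one_mul]
      rw [e0] at h1
      exact (hI _ _ _ h1).2)
  rw [h2]
  exact (hI _ _ _ h1).1

/-- Double the weight register `x` repeatedly. -/
def double (x : ℕ) : ℕ → Cmd
  | 0 => .setN 63 (.const 0)
  | k + 1 => .seq (double x k) (.setW x (.add (.reg x) (.reg x)))

theorem double_spec (x : ℕ) : ∀ (k : ℕ) (σ : State),
    ((double x k).den σ).wtReg x = 2 ^ k * σ.wtReg x
  | 0, σ => by simp [double, Cmd.den]
  | k + 1, σ => by
    have := double_spec x k σ
    simp only [double, Cmd.den, State.setW_wtReg, if_true, WExpr.eval, this]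
    ring

/-- Multiply the weight register `x` by `2 ^ (a + b * t)`, where `t` is the register `2`. -/
def scaleUp (x a b : ℕ) : Cmd :=
  .seq (double x a) (.forN 26 (.ite (.nlt (.reg 26) (.reg 2)) (double x b) (.setN 63 (.const 0))))

theorem double_regs (x : ℕ) : ∀ k, (double x k).regs = [63]
  | 0 => rfl
  | k + 1 => by simp [double, Cmd.regs, double_regs x k]

theorem scaleUp_spec (x a b : ℕ) {σ : State} (ht : σ.natReg 2 ≤ σ.natReg 0) :
    ((scaleUp x a b).den σ).wtReg x = 2 ^ (a + b * σ.natReg 2) * σ.wtReg x := by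
  set υ := (double x a).den σ with hυ
  have e : ∀ y ≠ 63, υ.natReg y = σ.natReg y := fun y hy => by
    rw [hυ, Cmd.den_natReg _ (by simp [double_regs, hy])]
  obtain ⟨τ, ⟨-, hI⟩, hτ⟩ := Cmd.forN_ind (x := 26) (σ := υ)
    (c := .ite (.nlt (.reg 26) (.reg 2)) (double x b) (.setN 63 (.const 0))) (by norm_num)
    (by simp [Cmd.regs, double_regs])
    (fun k τ => τ.natReg 2 = σ.natReg 2 ∧
      τ.wtReg x = 2 ^ (a + b * min k (σ.natReg 2)) * σ.wtReg x)
    ⟨e 2 (by norm_num), by simp [hυ, double_spec]⟩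
    (by
      rintro k hk τ ⟨t1, t2⟩ -
      refine ⟨by rw [Cmd.den_natReg _ (by simp [Cmd.regs, double_regs])]; simpa using t1, ?_⟩
      have hc : (Fm.nlt (.reg 26) (.reg 2)).Holds (τ.setN 26 k) ↔ k < σ.natReg 2 := by simp [t1]
      rw [Cmd.den]
      split_ifs with h
      all_goals rw [hc] at h
      · rw [double_spec, State.setN_wtReg, t2, min_eq_left (by omega), min_eq_left (by omega)]
        ring
      · simp only [Cmd.den, State.setN_wtReg, t2]
        rw [min_eq_right (by omega), min_eq_right (by omega)])
  rw [scaleUp, Cmd.den_seq, ← hυ, hτ, State.setN_wtReg, hI, e 0 (by norm_num), min_eq_right ht]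

/-- The memory during the construction of the hierarchy. -/
structure LevelMem (G : SimpleGraph (Fin n)) (w : Sym2 (Fin n) → ℝ≥0) (r : Fin n)
    (D : Fin n → Fin n → ℝ≥0) (t s N : ℕ) (c : ℕ → Fin n → Fin n) (Δ : ℕ → ℝ≥0) (σ : State) :
    Prop where
  base : Base G w r σ
  dist : ∀ u v : Fin n, σ.wtArr 1 u v = D u v
  exponent : σ.natReg 2 = t
  branching : σ.natReg 3 = s
  level : σ.natReg 4 = N
  lab : ∀ i ≤ N, ∀ v : Fin n, σ.natArr 9 i v = c i v
  diam : ∀ i ≤ N, σ.wtArr 6 i 0 = Δ i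

variable {t s N : ℕ} {c : ℕ → Fin n → Fin n} {ρ Δ : ℕ → ℝ≥0}

theorem LevelMem.den {σ : State} (h : LevelMem G w r D t s N c Δ σ) {d : Cmd}
    (hd : (0 ∉ d.regs ∧ 1 ∉ d.regs ∧ 2 ∉ d.regs ∧ 3 ∉ d.regs ∧ 4 ∉ d.regs) ∧
      (0 ∉ d.arrs ∧ 9 ∉ d.arrs) ∧ 0 ∉ d.warrs ∧ 1 ∉ d.warrs ∧ 6 ∉ d.warrs) :
    LevelMem G w r D t s N c Δ (d.den σ) := by
  obtain ⟨⟨h0, h1, h2, h3, h4⟩, ⟨a0, a9⟩, w0, w1, w6⟩ := hd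
  refine ⟨h.base.den ⟨h0, h1, a0, w0⟩, fun u v => ?_, ?_, ?_, ?_, fun i hi v => ?_, fun i hi => ?_⟩
  · rw [Cmd.den_wtArr _ w1, h.dist]
  · rw [Cmd.den_natReg _ h2, h.exponent]
  · rw [Cmd.den_natReg _ h3, h.branching]
  · rw [Cmd.den_natReg _ h4, h.level]
  · rw [Cmd.den_natArr _ a9, h.lab i hi]
  · rw [Cmd.den_wtArr _ w6, h.diam i hi]

theorem LevelMem.setN {σ : State} (h : LevelMem G w r D t s N c Δ σ) {x : ℕ} (hx : 5 ≤ x) (k : ℕ) :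
    LevelMem G w r D t s N c Δ (σ.setN x k) := by
  refine ⟨h.base.setN (by omega) k, h.dist, ?_, ?_, ?_, h.lab, h.diam⟩
  · rw [State.setN_natReg, if_neg (by omega), h.exponent]
  · rw [State.setN_natReg, if_neg (by omega), h.branching]
  · rw [State.setN_natReg, if_neg (by omega), h.level]

/-- The powers of `8` times the weight register `6`, in the weight array `5`. -/
def powers : Cmd := .seq (.setW 8 (.reg 6)) (.forN 27
  (.seq (.allW 30 5 (.const 0) (.neq (.reg 30) (.reg 27)) (.reg 8)) (double 8 3)))

theorem powers_spec {σ : State} (hn : σ.natReg 0 = n) :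
    ∀ j < n, (powers.den σ).wtArr 5 0 j = 8 ^ j * σ.wtReg 6 := by
  obtain ⟨τ, ⟨-, hI⟩, hτ⟩ := Cmd.forN_ind (x := 27) (σ := (Cmd.setW 8 (.reg 6)).den σ)
    (c := (.seq (.allW 30 5 (.const 0) (.neq (.reg 30) (.reg 27)) (.reg 8)) (double 8 3)))
    (by norm_num) (by decide) (fun k τ => τ.wtReg 8 = 8 ^ k * σ.wtReg 6 ∧
      ∀ j < k, τ.wtArr 5 0 j = 8 ^ j * σ.wtReg 6)
    ⟨by simp [Cmd.den], fun j hj => absurd hj (Nat.not_lt_zero _)⟩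
    (by
      rintro k hk τ ⟨t1, t2⟩ t0
      have hk' : k < τ.natReg 0 := by rw [t0]; exact hk
      rw [Cmd.den_seq]
      refine ⟨?_, fun j hj => ?_⟩
      · rw [double_spec, Cmd.den_wtReg _ (by decide), State.setN_wtReg, t1, pow_succ]
        norm_num; ring
      · rw [Cmd.den_wtArr _ (by decide)]
        rcases Nat.lt_succ_iff_lt_or_eq.1 hj with hj | rfl
        · simp [Cmd.den, hj.ne, t2 j hj]
        · simp [Cmd.den, hk', t1])
  intro j hj
  rw [powers, Cmd.den_seq, hτ]
  exact hI j (by simpa [Cmd.den, hn] using hj)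

/-- Compute the portals of the next level. -/
def portBlock : Cmd := .seq netBlock (.seq offsetBlock (.seq loadGraph
  (.seq (flagRow 3 .true) (.seq dijkstra aggBlock))))

/-- Dijkstra's algorithm started from all vertices with the offsets as initial values yields the
distance plus offset of the nearest portal, and the aggregation follows its pointers. -/
theorem portBlock_spec (hD : IsDist G w D) (ht : t < n) {l : ℕ} (hl : n ≤ 2 ^ l) {σ : State}
    (h : LevelMem G w r D t s N c Δ σ)
    (hwalk : ∀ u v, c N u = c N v → ∃ p : G.Walk u v, (∀ x ∈ p.support, c N x = c N u) ∧
      wl w p ≤ Δ N) :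
    ∃ (Z : ℕ → Fin n → Prop) (off val : Fin n → ℝ≥0) (port : Fin n → Fin n),
      IsNet D (σ.wtArr 5 0) s t Z ∧ IsOffset r (σ.wtArr 5 0) t Z off ∧
      (∀ u v, val u ≤ D v u + val v) ∧ (∀ v, val v ≤ off v) ∧
      (∀ v, (∀ u, c N u = c N v → port u = port v) ∧
        ∃ p : G.Walk v (port v), (∀ x ∈ p.support, port x = port v) ∧
          wl w p + off (port v) ≤ val v + (l + 1) * ((l + 2) * (2 * Δ N))) ∧
      ∀ v : Fin n, (portBlock.den σ).natArr 13 0 v = port v := by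
  have hnet := netBlock_spec hD h.base.size h.dist ht.le
  rw [h.branching] at hnet
  have m1 : LevelMem G w r D t s N c Δ (netBlock.den σ) := h.den (by decide)
  have e5 : (netBlock.den σ).wtArr 5 = σ.wtArr 5 := Cmd.den_wtArr _ (by decide) _
  rw [portBlock, Cmd.den_seq]
  generalize netBlock.den σ = σ₁ at *
  have hoff := offsetBlock_spec m1.base.size m1.base.root hnet.zero (by rw [m1.exponent]; exact ht)
  rw [m1.exponent, e5] at hoff
  have m2 : LevelMem G w r D t s N c Δ (offsetBlock.den σ₁) := m1.den (by decide)
  rw [Cmd.den_seq]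
  generalize offsetBlock.den σ₁ = σ₂ at *
  obtain ⟨g1, g2⟩ := loadGraph_spec m2.base
  have m3 : LevelMem G w r D t s N c Δ (loadGraph.den σ₂) := m2.den (by decide)
  have f3 : (loadGraph.den σ₂).wtArr 3 = σ₂.wtArr 3 := Cmd.den_wtArr _ (by decide) _
  rw [Cmd.den_seq]
  generalize loadGraph.den σ₂ = σ₃ at *
  have m4 : LevelMem G w r D t s N c Δ ((flagRow 3 .true).den σ₃) := m3.den (by decide)
  have k3 : ((flagRow 3 .true).den σ₃).wtArr 3 = σ₂.wtArr 3 := by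
    rw [Cmd.den_wtArr _ (by decide), f3]
  have k2 : ((flagRow 3 .true).den σ₃).natArr 2 = σ₃.natArr 2 := Cmd.den_natArr _ (by decide) _
  have k2w : ((flagRow 3 .true).den σ₃).wtArr 2 = σ₃.wtArr 2 := Cmd.den_wtArr _ (by decide) _
  have ks : ∀ v : Fin n, 1 ≤ ((flagRow 3 .true).den σ₃).natArr 3 0 v := fun v =>
    (flagRow_spec (by rw [m3.base.size]; exact v.2)).2 (by simp)
  rw [Cmd.den_seq]
  generalize (flagRow 3 .true).den σ₃ = σ₄ at *
  obtain ⟨hd, hq⟩ := dijkstra_spec σ₄ m4.base.size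
  have m5 : LevelMem G w r D t s N c Δ (dijkstra.den σ₄) := m4.den (by decide)
  rw [Cmd.den_seq]
  generalize dijkstra.den σ₄ = σ₅ at *
  have hc : IsClustering G w (c N) (Δ N) (fun v => σ₂.wtArr 3 0 v) (fun v => σ₅.wtArr 4 0 v)
      (toFin n (σ₅.natArr 5 0)) (fun v => σ₅.natArr 6 0 v) (fun v u => 1 ≤ σ₅.natArr 7 v u) := by
    refine ⟨hd.congr (fun u v => by rw [k2, g1]) (fun u v huv => by rw [k2w, g2 u v huv])
      (fun v => iff_true_intro (ks v)) (fun v _ => by rw [k3])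
      (fun v => iff_true_intro (hd.src_mem v (ks v)).1), hwalk⟩
  have hm : AggMem (c N) (toFin n (σ₅.natArr 5 0)) (fun v u => 1 ≤ σ₅.natArr 7 v u) σ₅ :=
    ⟨m5.base.size, fun v => by rw [m5.level, m5.lab N le_rfl],
      fun v => (toFin_coe (hq v v.2)).symm, fun u v => Iff.rfl⟩
  obtain ⟨port, hp1, hp2⟩ := aggBlock_spec hc hl hm
  refine ⟨_, _, _, port, hnet, hoff, fun u v => ?_, fun v => (hc.spt.src_mem v trivial).2, hp2, hp1⟩
  obtain ⟨p, hp⟩ := hD.exists_walk v u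
  rw [← hp, add_comm]
  exact hc.val_le p

theorem IsNet.congr {b b' : ℕ → ℝ≥0} {Z : ℕ → Fin n → Prop} (h : IsNet D b s t Z)
    (hb : ∀ j ≤ t, b j = b' j) : IsNet D b' s t Z :=
  ⟨h.zero, fun j hj => by rw [← hb (j + 1) hj]; exact h.big j hj,
    fun j hj => by rw [← hb (j + 1) hj]; exact h.sep j hj,
    fun j hj => by rw [← hb (j + 1) hj]; exact h.max j hj⟩

theorem IsOffset.congr {b b' : ℕ → ℝ≥0} {Z : ℕ → Fin n → Prop} {off : Fin n → ℝ≥0}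
    (h : IsOffset r b t Z off) (hb : ∀ j ≤ t, b j = b' j) : IsOffset r b' t Z off := by
  have e : ∀ k, levelOffset b t k = levelOffset b' t k := by
    intro k
    induction k with
    | zero => simp [levelOffset, hb t le_rfl]
    | succ k ih => simp [levelOffset, ih, hb (t - k) (Nat.sub_le _ _)]
  refine ⟨h.root, fun v hv => ?_⟩
  obtain ⟨j, h1, h2, h3, h4⟩ := h.level v hv
  exact ⟨j, h1, h2, h3.trans (e _), h4⟩

end LevelBlock


/-! ### The loop that constructs the levels. -/

section LevelLoop

set_option linter.unusedSimpArgs false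

variable {n : ℕ} {G : SimpleGraph (Fin n)} {w : Sym2 (Fin n) → ℝ≥0} {r : Fin n}
  {D : Fin n → Fin n → ℝ≥0} {t s N l : ℕ} {c : ℕ → Fin n → Fin n} {ρ Δ : ℕ → ℝ≥0}

/-- The distance of `a` and `b` is positive and at least the weight register `4`. -/
def goodPair (a b : ℕ) : Fm :=
  .and (.wlt .zero (.arr 1 (.reg a) (.reg b))) (.wle (.reg 4) (.arr 1 (.reg a) (.reg b)))

def minPair (a b : ℕ) : Fm := .and (goodPair a b) (.all 32 (.all 33 (.imp (goodPair 32 33)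
  (.wle (.arr 1 (.reg a) (.reg b)) (.arr 1 (.reg 32) (.reg 33))))))

def levelFind : Cmd := .find 24 30 (.ex 31 (minPair 30 31))

def levelScale : Cmd := .seq (.find 25 31 (minPair 24 31)) (.seq
  (.setW 5 (.arr 1 (.reg 24) (.reg 25))) (.seq (.setW 6 (.reg 5)) (.seq (scaleUp 6 10 5)
  (.seq (.setW 7 (.reg 6)) (.seq (scaleUp 7 5 3) powers)))))

/-- The portals become the labels of the new level, register `7` its diameter bound, and weight
register `4` keeps the threshold `g * ρ` beyond which the next scale is sought. -/
def levelStore : Cmd := .seqs [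
  .allN 30 9 (.add (.reg 4) (.const 1)) .true (.arr 13 (.const 0) (.reg 30)),
  .allW 30 6 (.add (.reg 4) (.const 1)) .true (.reg 7),
  .setW 4 (.reg 6), .setN 4 (.add (.reg 4) (.const 1))]

/-- Construct the next level, if necessary. -/
def levelStep : Cmd := .seq levelFind (.ite (.nlt (.reg 24) (.reg 0))
  (.seq levelScale (.seq portBlock levelStore)) (.setN 63 (.const 0)))

/-- A pair at the smallest distance that the levels do not cover yet. -/
def IsMinPair (D : Fin n → Fin n → ℝ≥0) (H : ℝ≥0) (u v : Fin n) : Prop :=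
  (0 < D u v ∧ H ≤ D u v) ∧ ∀ a b, 0 < D a b → H ≤ D a b → D u v ≤ D a b

theorem minPair_holds {σ : State} (h : LevelMem G w r D t s N c Δ σ) {a b : ℕ} (ha : a < 32)
    (hb : b < 32) {u v : Fin n} (hu : σ.natReg a = u) (hv : σ.natReg b = v) :
    (minPair a b).Holds σ ↔ IsMinPair D (σ.wtReg 4) u v := by
  have h1 : a ≠ 32 ∧ a ≠ 33 ∧ b ≠ 32 ∧ b ≠ 33 := by omega
  obtain ⟨h1, h2, h3, h4⟩ := h1
  simp [minPair, goodPair, h.base.size, hu, hv, h1, h2, h3, h4, forall_lt_iff, h.dist, IsMinPair]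

theorem levelScale_spec {σ : State} (h : LevelMem G w r D t s N c Δ σ) (ht : t ≤ n) {u : Fin n}
    (hu : σ.natReg 24 = u) (hex : ∃ v, IsMinPair D (σ.wtReg 4) u v) :
    ∃ v, IsMinPair D (σ.wtReg 4) u v ∧
      (levelScale.den σ).wtReg 6 = 2 ^ (10 + 5 * t) * D u v ∧
      (levelScale.den σ).wtReg 7 = 32 * 8 ^ t * (2 ^ (10 + 5 * t) * D u v) ∧
      ∀ j < n, (levelScale.den σ).wtArr 5 0 j = 8 ^ j * (2 ^ (10 + 5 * t) * D u v) := by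
  set σ₁ := (Cmd.find 25 31 (minPair 24 31)).den σ with h₁
  have m1 : LevelMem G w r D t s N c Δ σ₁ := h.den (by decide)
  have e25 : σ₁.natReg 25 = leastLT n fun i => (minPair 24 31).Holds (σ.setN 31 i) := by
    simp [h₁, Cmd.den, h.base.size]
  have hm : ∀ v : Fin n, (minPair 24 31).Holds (σ.setN 31 v) ↔ IsMinPair D (σ.wtReg 4) u v :=
    fun v => minPair_holds (h.setN (by norm_num) _) (by norm_num) (by norm_num) (by simpa using hu)
      (by simp)
  have hlt : σ₁.natReg 25 < n := by
    obtain ⟨v, hv⟩ := hex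
    rw [e25]
    exact leastLT_lt v.2 ((hm v).2 hv)
  have hmin : IsMinPair D (σ.wtReg 4) u ⟨σ₁.natReg 25, hlt⟩ := by
    rw [← hm]
    simp only [e25] at hlt ⊢
    exact leastLT_spec hlt
  refine ⟨⟨σ₁.natReg 25, hlt⟩, hmin, ?_⟩
  have hd : D u ⟨σ₁.natReg 25, hlt⟩ = σ₁.wtArr 1 (σ₁.natReg 24) (σ₁.natReg 25) := by
    rw [← m1.dist]
    congr 1
    rw [h₁, Cmd.den_natReg _ (by decide), hu]
  rw [hd, levelScale, Cmd.den_seq, ← h₁]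
  clear hmin hd e25 hex hm
  clear_value σ₁
  set σ₂ := (Cmd.setW 6 (.reg 5)).den ((Cmd.setW 5 (.arr 1 (.reg 24) (.reg 25))).den σ₁) with h₂
  have m2 : LevelMem G w r D t s N c Δ σ₂ := (m1.den (by decide)).den (by decide)
  have e6 : σ₂.wtReg 6 = σ₁.wtArr 1 (σ₁.natReg 24) (σ₁.natReg 25) := by simp [h₂, Cmd.den]
  rw [Cmd.den_seq, Cmd.den_seq, ← h₂, ← e6]
  have e := fun x a b => scaleUp_spec x a b (σ := σ₂) (by rw [m2.exponent, m2.base.size]; exact ht)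
  rw [Cmd.den_seq]
  have m3 : LevelMem G w r D t s N c Δ ((scaleUp 6 10 5).den σ₂) := m2.den (by decide)
  have e6' := e 6 10 5
  rw [m2.exponent] at e6'
  generalize (scaleUp 6 10 5).den σ₂ = σ₃ at *
  rw [Cmd.den_seq, ← e6']
  set σ₄ := (Cmd.setW 7 (.reg 6)).den σ₃ with h₄
  have m4 : LevelMem G w r D t s N c Δ σ₄ := m3.den (by decide)
  have f6 : σ₄.wtReg 6 = σ₃.wtReg 6 := by simp [h₄, Cmd.den]
  have f7 : σ₄.wtReg 7 = σ₃.wtReg 6 := by simp [h₄, Cmd.den]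
  clear_value σ₄
  have e7 := scaleUp_spec 7 5 3 (σ := σ₄) (by rw [m4.exponent, m4.base.size]; exact ht)
  have f6' : ((scaleUp 7 5 3).den σ₄).wtReg 6 = σ₃.wtReg 6 := by
    rw [Cmd.den_wtReg _ (by decide), f6]
  have m5 : LevelMem G w r D t s N c Δ ((scaleUp 7 5 3).den σ₄) := m4.den (by decide)
  rw [m4.exponent, f7] at e7
  rw [Cmd.den_seq]
  generalize (scaleUp 7 5 3).den σ₄ = σ₅ at *
  refine ⟨?_, ?_, fun j hj => ?_⟩
  · rw [Cmd.den_wtReg _ (by decide), f6']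
  · rw [Cmd.den_wtReg _ (by decide), e7, pow_add, pow_mul]; norm_num
  · rw [powers_spec m5.base.size j hj, f6']

open Classical in
/-- The pairs at a distance that the levels cover. -/
noncomputable def coveredPairs (D : Fin n → Fin n → ℝ≥0) (H : ℝ≥0) : Finset (Fin n × Fin n) :=
  Finset.univ.filter fun p => D p.1 p.2 < H ∨ D p.1 p.2 = 0

/-- The invariant of the construction of the hierarchy after `k` steps. -/
def LevelLoopInv (G : SimpleGraph (Fin n)) (w : Sym2 (Fin n) → ℝ≥0) (r : Fin n)
    (D : Fin n → Fin n → ℝ≥0) (t s k : ℕ) (σ : State) : Prop :=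
  ∃ N c ρ Δ, LevelMem G w r D t s N c Δ σ ∧
    LevelsUpTo G w D r (32 * 8 ^ t) (2 ^ (10 + 5 * t)) (1 + (t + 1) * s) N c ρ Δ ∧
    σ.wtReg 4 = 2 ^ (10 + 5 * t) * ρ N ∧ N ≤ k + 1 ∧
    ((∀ u v, D u v ≠ 0 → D u v < 2 ^ (10 + 5 * t) * ρ N) ∨
      k ≤ (coveredPairs D (2 ^ (10 + 5 * t) * ρ N)).card)

theorem levelStep_spec (hD : IsDist G w D) (hs : 1 ≤ s) (hn : n ≤ s ^ t) (ht : t < n)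
    (hl : n ≤ 2 ^ l) (hg : (2 * (l + 1) * (l + 2) * (32 * 8 ^ t) : ℝ≥0) ≤ 2 ^ (10 + 5 * t)) {k : ℕ}
    {σ : State} (h : LevelLoopInv G w r D t s k σ) :
    LevelLoopInv G w r D t s (k + 1) (levelStep.den σ) := by
  classical
  obtain ⟨N, c, ρ, Δ, hm, hlev, h4, hN, hk⟩ := h
  have e24 : (levelFind.den σ).natReg 24 =
      leastLT n fun i => (Fm.ex 31 (minPair 30 31)).Holds (σ.setN 30 i) := by
    simp [levelFind, Cmd.den, hm.base.size]
  have hf : ∀ u : Fin n, (Fm.ex 31 (minPair 30 31)).Holds (σ.setN 30 u) ↔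
      ∃ v, IsMinPair D (σ.wtReg 4) u v := by
    intro u
    have m1 : LevelMem G w r D t s N c Δ (σ.setN 30 u) := hm.setN (by norm_num) _
    rw [Fm.holds_ex', m1.base.size, exists_lt_iff]
    exact exists_congr fun v => minPair_holds (m1.setN (by norm_num) _) (by norm_num)
      (by norm_num) (by simp) (by simp)
  have m1 : LevelMem G w r D t s N c Δ (levelFind.den σ) := hm.den (by decide)
  have f4 : (levelFind.den σ).wtReg 4 = σ.wtReg 4 := Cmd.den_wtReg _ (by decide) _
  rw [levelStep, Cmd.den_seq]
  generalize levelFind.den σ = σ₁ at *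
  rw [Cmd.den]
  have hcond : (Fm.nlt (.reg 24) (.reg 0)).Holds σ₁ ↔ σ₁.natReg 24 < n := by
    simp [m1.base.size]
  split_ifs with hlt
  · rw [hcond] at hlt
    have hu : ∃ v, IsMinPair D (σ₁.wtReg 4) ⟨σ₁.natReg 24, hlt⟩ v := by
      rw [f4, ← hf]
      simp only [e24] at hlt ⊢
      exact leastLT_spec hlt
    obtain ⟨v, hv, e6, e7, e5⟩ := levelScale_spec m1 ht.le rfl hu
    generalize (⟨σ₁.natReg 24, hlt⟩ : Fin n) = u at *
    set ρ' := D u v with hρ'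
    rw [f4, h4] at hv
    have m2 : LevelMem G w r D t s N c Δ (levelScale.den σ₁) := m1.den (by decide)
    rw [Cmd.den_seq]
    generalize levelScale.den σ₁ = σ₂ at *
    obtain ⟨Z, off, val, port, hZ, ho, hlip, hoff, hport, hp⟩ :=
      portBlock_spec hD ht hl m2 (hlev.walk N le_rfl)
    have m3 : LevelMem G w r D t s N c Δ (portBlock.den σ₂) := m2.den (by decide)
    have g6 : (portBlock.den σ₂).wtReg 6 = 2 ^ (10 + 5 * t) * ρ' := by
      rw [Cmd.den_wtReg _ (by decide), e6]
    have g7 : (portBlock.den σ₂).wtReg 7 = 32 * 8 ^ t * 2 ^ (10 + 5 * t) * ρ' := by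
      rw [Cmd.den_wtReg _ (by decide), e7]; ring
    rw [Cmd.den_seq]
    generalize portBlock.den σ₂ = σ₃ at *
    have hb : ∀ j ≤ t, σ₂.wtArr 5 0 j = 8 ^ j * (2 ^ (10 + 5 * t) * ρ') :=
      fun j hj => e5 j (by omega)
    have hlev' := hlev.next hD hs (by simpa using hn) rfl hg hv.1.1 hv.1.2
      (fun a b hab => hv.2 a b (pos_iff_ne_zero.2 hab)) (ρ' := ρ') (b := fun j => 8 ^ j *
        (2 ^ (10 + 5 * t) * ρ')) (by simp) (fun j => by rw [pow_succ]; ring) (hZ.congr hb)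
      (ho.congr hb) hlip hoff hport (c' := fun i => if i = N + 1 then port else c i)
      (ρ'' := fun i => if i = N + 1 then ρ' else ρ i)
      (Δ' := fun i => if i = N + 1 then 32 * 8 ^ t * 2 ^ (10 + 5 * t) * ρ' else Δ i)
      (fun i hi => if_neg (by omega)) (if_pos rfl) (fun i hi => if_neg (by omega)) (if_pos rfl)
      (fun i hi => if_neg (by omega)) (if_pos rfl)
    refine ⟨N + 1, _, _, _, ⟨?_, fun a b => ?_, ?_, ?_, ?_, fun i hi a => ?_, fun i hi => ?_⟩,
      hlev', ?_, by omega, ?_⟩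
    · exact m3.base.den (by decide)
    · rw [Cmd.den_wtArr _ (by decide), m3.dist]
    · rw [Cmd.den_natReg _ (by decide), m3.exponent]
    · rw [Cmd.den_natReg _ (by decide), m3.branching]
    · simp [levelStore, Cmd.seqs, Cmd.den, m3.level]
    · by_cases hi' : i = N + 1
      · simp [levelStore, Cmd.seqs, Cmd.den, m3.level, hi', m3.base.size, hp]
      · simp [levelStore, Cmd.seqs, Cmd.den, m3.level, hi', m3.lab i (by omega)]
    · by_cases hi' : i = N + 1
      · simp [levelStore, Cmd.seqs, Cmd.den, m3.level, hi', m3.base.size, g7]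
        omega
      · simp [levelStore, Cmd.seqs, Cmd.den, m3.level, hi', m3.diam i (by omega)]
    · simp [levelStore, Cmd.seqs, Cmd.den, g6]
    · rcases hk with hk | hk
      · exact absurd (hk u v hv.1.1.ne') (not_lt.2 hv.1.2)
      · right
        rw [if_pos rfl]
        -- The pair that defines the new scale was not covered before, and it is covered now because
        -- the new threshold is a proper multiple of its distance. So the number of rounds never
        -- depends on the size of the weights.
        refine hk.trans_lt (Finset.card_lt_card ?_)
        have h1 : ρ' ≤ 2 ^ (10 + 5 * t) * ρ' :=
          le_mul_of_one_le_left zero_le (one_le_pow₀ (by norm_num))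
        rw [Finset.ssubset_iff_of_subset]
        · refine ⟨(u, v), ?_, ?_⟩
          · simp only [coveredPairs, Finset.mem_filter, Finset.mem_univ, true_and]
            left
            refine lt_mul_of_one_lt_left hv.1.1 (one_lt_pow₀ (by norm_num) (by omega))
          · simp only [coveredPairs, Finset.mem_filter, Finset.mem_univ, true_and, not_or, not_lt]
            exact ⟨hv.1.2, hv.1.1.ne'⟩
        · intro p hp
          simp only [coveredPairs, Finset.mem_filter, Finset.mem_univ, true_and] at hp ⊢
          exact hp.imp (fun h' => h'.trans_le (hv.1.2.trans h1)) id
  · rw [hcond] at hlt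
    refine ⟨N, c, ρ, Δ, m1.den (by decide), hlev, f4.trans h4, by omega, Or.inl ?_⟩
    -- An uncovered pair of smallest distance would have been found by the search.
    by_contra hcon
    push Not at hcon
    obtain ⟨a, b, hab, hab'⟩ := hcon
    obtain ⟨p, hp, hmin⟩ := Finset.exists_min_image (Finset.univ.filter fun p : Fin n × Fin n =>
      0 < D p.1 p.2 ∧ 2 ^ (10 + 5 * t) * ρ N ≤ D p.1 p.2) (fun p => D p.1 p.2)
      ⟨(a, b), by simpa using ⟨pos_iff_ne_zero.2 hab, hab'⟩⟩
    simp only [Finset.mem_filter, Finset.mem_univ, true_and] at hp hmin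
    apply hlt
    rw [e24]
    refine leastLT_lt p.1.2 ((hf p.1).2 ⟨p.2, ?_⟩)
    rw [h4]
    exact ⟨hp, fun a b h1 h2 => hmin (a, b) ⟨h1, h2⟩⟩

/-- The label of a vertex at level `1` is the least vertex at distance `0` from it. -/
def classStep : Cmd := .seq (.find 24 30 (.wle (.arr 1 (.reg 22) (.reg 30)) .zero))
  (.allN 30 9 (.const 1) (.neq (.reg 30) (.reg 22)) (.reg 24))

def levelInit : Cmd := .seq (.allN 30 9 (.const 0) .true (.reg 30)) (.seq (.forN 22 classStep)
  (.seqs [.allW 30 6 (.const 0) .true .zero, .allW 30 6 (.const 1) .true .zero,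
    .setW 4 .zero, .setN 4 (.const 1)]))

theorem levelInit_spec (hD : IsDist G w D) {σ : State} (hb : Base G w r σ)
    (hd : ∀ u v : Fin n, σ.wtArr 1 u v = D u v) (h2 : σ.natReg 2 = t) (h3 : σ.natReg 3 = s) :
    LevelLoopInv G w r D t s 0 (levelInit.den σ) := by
  have hlt : ∀ v : Fin n, leastLT n (fun i => σ.wtArr 1 v i ≤ 0) < n := fun v =>
    leastLT_lt v.2 (by rw [hd, hD.self])
  set c₁ : Fin n → Fin n := fun v => ⟨_, hlt v⟩ with hc₁
  set υ := (Cmd.allN 30 9 (.const 0) .true (.reg 30)).den σ with hυ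
  have u0 : υ.natReg 0 = n := by rw [hυ, Cmd.den_natReg _ (by decide), hb.size]
  obtain ⟨τ, ⟨-, h0, h1⟩, hτ⟩ := Cmd.forN_ind (x := 22) (σ := υ) (c := classStep)
    (by norm_num) (by decide) (fun k τ => τ.wtArr 1 = σ.wtArr 1 ∧
      (∀ v : Fin n, τ.natArr 9 0 v = v) ∧ ∀ v : Fin n, v < k → τ.natArr 9 1 v = c₁ v)
    ⟨rfl, fun v => by simp [hυ, Cmd.den, hb.size], fun v hv => absurd hv (Nat.not_lt_zero _)⟩
    (by
      rintro k hk τ ⟨t1, t2, t3⟩ t0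
      rw [u0] at hk t0
      refine ⟨t1, fun v => ?_, fun v hv => ?_⟩
      · simp [classStep, Cmd.den, t2]
      · rcases Nat.lt_succ_iff_lt_or_eq.1 hv with hv | hv
        · simp [classStep, Cmd.den, hv.ne, t3 v hv]
        · simp [classStep, Cmd.den, hv, hk, t0, t1, hc₁])
  have e0 : τ.natReg 0 = n := by rw [Cmd.forN_natReg hτ (by decide), u0]
  rw [levelInit, Cmd.den_seq, Cmd.den_seq, ← hυ]
  refine ⟨1, fun i v => if i = 0 then v else c₁ v, fun _ => 0, fun _ => 0,
    ⟨?_, fun u v => ?_, ?_, ?_, ?_, fun i hi v => ?_, fun i hi => ?_⟩,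
    levelsUpTo_one hD (by omega) (fun v => if_pos rfl) (fun u v => ?_) (fun _ _ => rfl)
      (fun _ _ => rfl), ?_, le_rfl, Or.inr (Nat.zero_le _)⟩
  · exact ((hb.den (by decide)).den (c := .forN 22 classStep) (by decide)).den (by decide)
  · rw [Cmd.den_wtArr _ (by decide), Cmd.den_wtArr _ (by decide), ← hd]; rfl
  · rw [Cmd.den_natReg _ (by decide), Cmd.den_natReg _ (by decide), ← h2]; rfl
  · rw [Cmd.den_natReg _ (by decide), Cmd.den_natReg _ (by decide), ← h3]; rfl
  · simp [Cmd.seqs, Cmd.den]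
  · rw [Cmd.den_natArr _ (by decide), hτ, State.setN_natArr]
    rcases Nat.le_one_iff_eq_zero_or_eq_one.1 hi with rfl | rfl
    · simp [h0]
    · simp [h1 v (by rw [u0]; exact v.2)]
  · have hn : 0 < n := r.pos
    rw [hτ]
    rcases Nat.le_one_iff_eq_zero_or_eq_one.1 hi with rfl | rfl <;> simp [Cmd.seqs, Cmd.den, e0, hn]
  · have hz : ∀ v, D v (c₁ v) = 0 := fun v => by
      have := leastLT_spec (hlt v)
      rw [← hd]
      exact le_antisymm this zero_le
    simp only [one_ne_zero, if_false]
    constructor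
    · intro h
      refine le_antisymm ((hD.triangle u (c₁ u) v).trans ?_) zero_le
      rw [hz, h, hD.symm, hz, add_zero]
    · intro h
      have h' : D v u = 0 := by rw [hD.symm, h]
      refine Fin.ext (leastLT_congr fun i hi => ?_)
      have e1 := hd u ⟨i, hi⟩
      have e2 := hd v ⟨i, hi⟩
      simp only at e1 e2
      rw [e1, e2]
      constructor
      · intro hi
        refine (hD.triangle v u _).trans ?_
        rw [h', zero_add]; exact hi
      · intro hi
        refine (hD.triangle u v _).trans ?_
        rw [h, zero_add]; exact hi
  · simp [Cmd.seqs, Cmd.den]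

/-- Construct the hierarchy. -/
def levelBlock : Cmd := .seq levelInit (.forN 22 (.forN 23 levelStep))

/-- Each round covers another of the `n ^ 2` ordered pairs or finds all of them covered, so `n ^ 2`
rounds suffice. -/
theorem levelBlock_spec (hD : IsDist G w D) (hs : 1 ≤ s) (hn : n ≤ s ^ t) (ht : t < n)
    (hl : n ≤ 2 ^ l) (hg : (2 * (l + 1) * (l + 2) * (32 * 8 ^ t) : ℝ≥0) ≤ 2 ^ (10 + 5 * t))
    {σ : State} (hb : Base G w r σ) (hd : ∀ u v : Fin n, σ.wtArr 1 u v = D u v)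
    (h2 : σ.natReg 2 = t) (h3 : σ.natReg 3 = s) :
    ∃ N c ρ Δ, LevelMem G w r D t s N c Δ (levelBlock.den σ) ∧ N ≤ n * n + 1 ∧
      Levels G w D r (32 * 8 ^ t) (2 ^ (10 + 5 * t)) (1 + (t + 1) * s) N c ρ Δ := by
  classical
  have h0 := levelInit_spec hD hb hd h2 h3
  have e0 : (levelInit.den σ).natReg 0 = n := by rw [Cmd.den_natReg _ (by decide), hb.size]
  have key := Cmd.forN_forN_ind (x := 22) (y := 23) (c := levelStep) (by norm_num) (by norm_num)
    (by decide) (LevelLoopInv G w r D t s) h0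
    (fun k τ i ⟨N, c, ρ, Δ, hm, h⟩ => ⟨⟨N, c, ρ, Δ, hm.setN (by norm_num) _, h⟩,
      ⟨N, c, ρ, Δ, hm.setN (by norm_num) _, h⟩⟩)
    (fun k τ hτ _ => levelStep_spec hD hs hn ht hl hg hτ)
  rw [e0] at key
  obtain ⟨N, c, ρ, Δ, hm, hlev, -, hN, hk⟩ := key
  refine ⟨N, c, ρ, Δ, hm, hN, hlev.levels ?_⟩
  rcases hk with hk | hk
  · exact hk
  · intro u v huv
    have hall : coveredPairs D (2 ^ (10 + 5 * t) * ρ N) = Finset.univ := by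
      rw [← Finset.card_eq_iff_eq_univ]
      refine le_antisymm (Finset.card_le_univ _) ?_
      simpa using hk
    have := Finset.mem_univ (u, v)
    rw [← hall] at this
    simp only [coveredPairs, Finset.mem_filter, Finset.mem_univ, true_and] at this
    exact this.resolve_right huv

end LevelLoop


/-! ### Computing the tree -/

section TreeBlock

set_option linter.unusedSimpArgs false

variable {n : ℕ} {G : SimpleGraph (Fin n)} {w : Sym2 (Fin n) → ℝ≥0} {r : Fin n}
  {D : Fin n → Fin n → ℝ≥0} {t s N i : ℕ} {c : ℕ → Fin n → Fin n} {ρ Δ : ℕ → ℝ≥0}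
  {R : Fin n → Prop}

/-- Among the links into one class those with most descendants are compared, and ties are broken in
favour of the smallest vertex, so that the heavy link is unique. -/
theorem exists_heavy {c q : Fin n → Fin n} {isx heavy : Fin n → Prop} {sz : Fin n → ℕ}
    (hh : ∀ x, heavy x ↔ isx x ∧ ∀ y, isx y → c (q y) = c (q x) →
      sz y < sz x ∨ (sz y ≤ sz x ∧ x ≤ y)) :
    (∀ x y, heavy x → heavy y → c (q x) = c (q y) → x = y) ∧
    ∀ x, isx x → ∃ y, heavy y ∧ c (q y) = c (q x) ∧ sz x ≤ sz y := by
  classical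
  constructor
  · intro x y hx hy hxy
    have h1 := ((hh x).1 hx).2 y ((hh y).1 hy).1 hxy.symm
    have h2 := ((hh y).1 hy).2 x ((hh x).1 hx).1 hxy
    have h3 := Fin.le_def (a := x) (b := y)
    have h4 := Fin.le_def (a := y) (b := x)
    apply Fin.ext
    omega
  · intro x hx
    obtain ⟨y, hy, hmax⟩ := Finset.exists_max_image
      (Finset.univ.filter fun y => isx y ∧ c (q y) = c (q x))
      (fun y => toLex (sz y, OrderDual.toDual y)) ⟨x, by simp [hx]⟩
    simp only [Finset.mem_filter, Finset.mem_univ, true_and, Prod.Lex.toLex_le_toLex,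
      OrderDual.toDual_le_toDual] at hy hmax
    refine ⟨y, (hh y).2 ⟨hy.1, fun z hz hzy => ?_⟩, hy.2, ?_⟩
    · rcases hmax z ⟨hz, hzy.trans hy.2⟩ with h | h
      · exact Or.inl h
      · exact Or.inr ⟨h.1.le, h.2⟩
    · rcases hmax x ⟨hx, rfl⟩ with h | h
      · exact h.le
      · exact h.1.le

/-- The length of the links of level `i`. -/
theorem LinkData.treeStep_of_levels {κ g : ℝ≥0} {β : ℕ} (hl : Levels G w D r κ g β N c ρ Δ)
    (hD : IsDist G w D) (hβ : 1 ≤ β) (hi : i < N) {P₁ P₂ isx heavy : Fin n → Prop}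
    {val₁ val₂ : Fin n → ℝ≥0} {q₁ q₂ : Fin n → Fin n} {rk₁ rk₂ sz : Fin n → ℕ}
    {anc₁ anc₂ : Fin n → Fin n → Prop}
    (h : LinkData G w (c (i + 1)) (c i) (Δ i) R P₁ val₁ q₁ rk₁ anc₁ isx P₂ val₂ q₂ rk₂ anc₂)
    (hm : ∀ v, ∃ z, R z ∧ c (i + 1) z = c (i + 1) v)
    (hsz : ∀ x : Fin n, sz x = countLT n fun v => ∃ h : v < n, anc₂ ⟨v, h⟩ x)
    (hh : ∀ x, heavy x ↔ isx x ∧ ∀ y, isx y → c i (q₂ y) = c i (q₂ x) →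
      sz y < sz x ∨ (sz y ≤ sz x ∧ x ≤ y)) {par : Fin n → Fin n}
    (hpar : ∀ u, extend (c i) R isx heavy q₂ anc₂ u → ¬ R u → par u = q₂ u) :
    TreeStep G w (c (i + 1)) (c i) R (extend (c i) R isx heavy q₂ anc₂) par
      (linkConst κ g β * ρ (i + 1)) (Nat.log 2 n + 1) := by
  classical
  have hΔ : Δ i ≤ linkConst κ g β * ρ (i + 1) := by
    refine (hl.diam_next i hi).trans ?_
    gcongr
    exact le_add_self
  obtain ⟨h₂, h₃⟩ := exists_heavy hh
  have key := h.treeStep (sz := sz) (fun x => by rw [hsz, countLT_fin]; congr 1; ext v; simp)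
    (fun x hx => ((hh x).1 hx).1) h₂ h₃ (L := linkConst κ g β * ρ (i + 1) - Δ i) (fun v => ?_) hpar
  · rwa [tsub_add_cancel_of_le hΔ, Fintype.card_fin] at key
  · obtain ⟨z, hz, hzv⟩ := hm v
    obtain ⟨p, hp, hpl⟩ := hl.walk (i + 1) hi v z hzv.symm
    refine (h.val₁_bound v hz p hp (hpl.trans (hl.diam (i + 1) hi))
      (hl.labels hD hβ hi p hpl)).trans (le_tsub_of_add_le_right ?_)
    calc κ * g * ρ (i + 1) + κ * β * (κ * g + 1) * ρ (i + 1) + Δ i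
        ≤ κ * g * ρ (i + 1) + κ * β * (κ * g + 1) * ρ (i + 1) + κ * ρ (i + 1) := by
          gcongr; exact hl.diam_next i hi
      _ = _ := by unfold linkConst; ring

/-- The states agree up to the arrays `2` and register `13`. -/
structure AgreeGraph (σ τ : State) : Prop where
  reg : ∀ y ≠ 13, τ.natReg y = σ.natReg y
  arr : ∀ b ≠ 2, τ.natArr b = σ.natArr b
  warr : ∀ b ≠ 2, τ.wtArr b = σ.wtArr b

/-- A shortest path forest from the set in the array `16`. -/
def sptBlock (φ ψ : Fm) (e : WExpr) : Cmd := .seq (fillMask 2 φ) (.seq (fillWt 2 ψ e)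
  (.seq (flagRow 3 (.nle (.const 1) (.arr 16 (.const 0) (.reg 30))))
  (.seq (.allW 30 3 (.const 0) .true .zero) dijkstra)))

theorem sptBlock_spec {φ ψ : Fm} {e : WExpr} {σ : State} (hn : σ.natReg 0 = n)
    (M p : ℕ → ℕ → Prop) (f : ℕ → ℕ → ℝ≥0) [∀ u v, Decidable (p u v)]
    (h : ∀ τ, AgreeGraph σ τ → ∀ v < n, (φ.Holds (τ.setN 30 v) ↔ M (τ.natReg 13) v) ∧
      (ψ.Holds (τ.setN 30 v) ↔ p (τ.natReg 13) v) ∧ e.eval (τ.setN 30 v) = f (τ.natReg 13) v) :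
    IsSPT (V := Fin n) (fun u v => M u v) (fun u v => if p u v then f u v else 0)
      (fun v => 1 ≤ σ.natArr 16 0 v) (fun _ => 0)
      (fun v => ((sptBlock φ ψ e).den σ).natArr 4 0 v = 2)
      (fun v => ((sptBlock φ ψ e).den σ).wtArr 4 0 v)
      (toFin n (((sptBlock φ ψ e).den σ).natArr 5 0))
      (fun v => ((sptBlock φ ψ e).den σ).natArr 6 0 v)
      (fun v u => 1 ≤ ((sptBlock φ ψ e).den σ).natArr 7 v u) ∧
    ∀ v < n, ((sptBlock φ ψ e).den σ).natArr 5 0 v < n := by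
  have h1 := fillMask_spec (a := 2) (φ := φ) (σ := σ) M (fun τ hτ _ v hv =>
    (h τ ⟨hτ.reg, hτ.arr, fun b _ => by rw [hτ.warr]⟩ v (hn ▸ hv)).1)
  have a1 : AgreeGraph σ ((fillMask 2 φ).den σ) :=
    ⟨fun y hy => Cmd.den_natReg _ (by simp [fillMask, Cmd.regs, hy]) σ,
      fun b hb => Cmd.den_natArr _ (by simp [fillMask, Cmd.arrs, hb]) σ,
      fun b _ => Cmd.den_wtArr _ (by simp [fillMask, Cmd.warrs]) σ⟩
  rw [hn] at h1
  simp only [sptBlock]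
  rw [Cmd.den_seq]
  generalize (fillMask 2 φ).den σ = σ₁ at *
  have n1 : σ₁.natReg 0 = n := by rw [a1.reg 0 (by norm_num), hn]
  have h2 := fillWt_spec (a := 2) (φ := ψ) (e := e) (σ := σ₁) p f (fun τ hτ _ v hv => by
    have := h τ ⟨fun y hy => (hτ.reg y hy).trans (a1.reg y hy), fun b hb => by
      rw [hτ.arr, a1.arr b hb], fun b hb => (hτ.warr b hb).trans (a1.warr b hb)⟩ v (n1 ▸ hv)
    exact ⟨this.2.1, fun _ => this.2.2⟩)
  have a2 : AgreeGraph σ ((fillWt 2 ψ e).den σ₁) :=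
    ⟨fun y hy => by rw [Cmd.den_natReg _ (by simp [fillWt, Cmd.regs, hy]), a1.reg y hy],
      fun b hb => by rw [Cmd.den_natArr _ (by simp [fillWt, Cmd.arrs]), a1.arr b hb],
      fun b hb => by rw [Cmd.den_wtArr _ (by simp [fillWt, Cmd.warrs, hb]), a1.warr b hb]⟩
  have e2 : ((fillWt 2 ψ e).den σ₁).natArr 2 = σ₁.natArr 2 :=
    Cmd.den_natArr _ (by simp [fillWt, Cmd.arrs]) _
  rw [n1] at h2
  rw [Cmd.den_seq, Cmd.den_seq, Cmd.den_seq]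
  generalize (fillWt 2 ψ e).den σ₁ = σ₂ at *
  have n2 : σ₂.natReg 0 = n := by rw [a2.reg 0 (by norm_num), hn]
  set σ₃ := (flagRow 3 (.nle (.const 1) (.arr 16 (.const 0) (.reg 30)))).den σ₂ with h₃
  have n3 : σ₃.natReg 0 = n := by rw [h₃, Cmd.den_natReg _ (by decide), n2]
  have s3 : ∀ v : Fin n, 1 ≤ σ₃.natArr 3 0 v ↔ 1 ≤ σ.natArr 16 0 v := by
    intro v
    rw [h₃, flagRow_spec (by rw [n2]; exact v.2)]
    simp [Cmd.den, a2.arr 16]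
  set σ₄ := (Cmd.allW 30 3 (.const 0) .true .zero).den σ₃ with h₄
  have e4 : σ₄.natArr 2 = σ₁.natArr 2 := by
    rw [h₄, Cmd.den_natArr _ (by decide), h₃, Cmd.den_natArr _ (by decide), e2]
  have e4w : σ₄.wtArr 2 = σ₂.wtArr 2 := by
    rw [h₄, Cmd.den_wtArr _ (by decide), h₃, Cmd.den_wtArr _ (by decide)]
  have z4 : ∀ v : Fin n, σ₄.wtArr 3 0 v = 0 := fun v => by simp [h₄, Cmd.den, n3]
  have s4 : σ₄.natArr 3 = σ₃.natArr 3 := rfl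
  obtain ⟨hd, hq⟩ := dijkstra_spec σ₄ (n := n) n3
  exact ⟨hd.congr (fun u v => by rw [e4, h1 u u.2 v v.2])
    (fun u v _ => by rw [e4w, h2 u u.2 v v.2]) (fun v => by rw [s4, s3]) (fun v _ => z4 v)
    (fun v => Iff.rfl), hq⟩

/-- The memory before the step from level `i + 1` to level `i`. -/
structure TreeMem (G : SimpleGraph (Fin n)) (w : Sym2 (Fin n) → ℝ≥0) (r : Fin n)
    (D : Fin n → Fin n → ℝ≥0) (t s N : ℕ) (c : ℕ → Fin n → Fin n) (Δ : ℕ → ℝ≥0) (i : ℕ)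
    (R : Fin n → Prop) (σ : State) : Prop extends LevelMem G w r D t s N c Δ σ where
  le : i < N
  outer : σ.natReg 5 = i + 1
  inner : σ.natReg 6 = i
  mem : ∀ v : Fin n, 1 ≤ σ.natArr 16 0 v ↔ R v

theorem TreeMem.den {σ : State} (h : TreeMem G w r D t s N c Δ i R σ) {d : Cmd}
    (hd : ((0 ∉ d.regs ∧ 1 ∉ d.regs ∧ 2 ∉ d.regs ∧ 3 ∉ d.regs ∧ 4 ∉ d.regs) ∧
      (0 ∉ d.arrs ∧ 9 ∉ d.arrs) ∧ 0 ∉ d.warrs ∧ 1 ∉ d.warrs ∧ 6 ∉ d.warrs) ∧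
      5 ∉ d.regs ∧ 6 ∉ d.regs ∧ 16 ∉ d.arrs) : TreeMem G w r D t s N c Δ i R (d.den σ) := by
  refine ⟨h.toLevelMem.den hd.1, h.le, ?_, ?_, fun v => ?_⟩
  · rw [Cmd.den_natReg _ hd.2.1, h.outer]
  · rw [Cmd.den_natReg _ hd.2.2.1, h.inner]
  · rw [Cmd.den_natArr _ hd.2.2.2, h.mem]

theorem TreeMem.lab_inner {σ : State} (h : TreeMem G w r D t s N c Δ i R σ) (v : Fin n) :
    σ.natArr 9 i v = c i v := h.lab i h.le.le v

theorem TreeMem.lab_outer {σ : State} (h : TreeMem G w r D t s N c Δ i R σ) (v : Fin n) :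
    σ.natArr 9 (i + 1) v = c (i + 1) v := h.lab (i + 1) h.le v

/-- The vertices `a` and `b` have the same label of the level in register `x`. -/
def sameLab (x : ℕ) (a b : NExpr) : Fm := .neq (.arr 9 (.reg x) a) (.arr 9 (.reg x) b)

def unhitFm : Fm := .all 31 (.imp (.nle (.const 1) (.arr 16 (.const 0) (.reg 31)))
  (.not (sameLab 6 (.reg 31) (.reg 30))))

def contractBlock : Cmd := sptBlock
  (.and (.nle (.const 1) (.arr 0 (.reg 13) (.reg 30))) (sameLab 5 (.reg 13) (.reg 30)))
  (.not (sameLab 6 (.reg 13) (.reg 30)))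
  (.add (.arr 0 (.reg 13) (.reg 30)) (.arr 6 (.reg 6) (.const 0)))

theorem contractBlock_spec {σ : State} (h : TreeMem G w r D t s N c Δ i R σ) :
    (∀ W : Fin n → Fin n → ℝ≥0, (∀ a b, c i a = c i b → W a b = 0) →
      (∀ a b, c i a ≠ c i b → W a b = w s(a, b) + Δ i) →
      IsSPT (fun a b => G.Adj a b ∧ c (i + 1) a = c (i + 1) b) W R (fun _ => 0)
        (fun v => (contractBlock.den σ).natArr 4 0 v = 2)
        (fun v => (contractBlock.den σ).wtArr 4 0 v)
        (toFin n ((contractBlock.den σ).natArr 5 0))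
        (fun v => (contractBlock.den σ).natArr 6 0 v)
        (fun v u => 1 ≤ (contractBlock.den σ).natArr 7 v u)) ∧
    ∀ v < n, (contractBlock.den σ).natArr 5 0 v < n := by
  classical
  obtain ⟨hd, hq⟩ := sptBlock_spec (σ := σ) h.base.size
    (φ := .and (.nle (.const 1) (.arr 0 (.reg 13) (.reg 30))) (sameLab 5 (.reg 13) (.reg 30)))
    (ψ := .not (sameLab 6 (.reg 13) (.reg 30)))
    (e := .add (.arr 0 (.reg 13) (.reg 30)) (.arr 6 (.reg 6) (.const 0)))
    (fun u v => 1 ≤ σ.natArr 0 u v ∧ σ.natArr 9 (i + 1) u = σ.natArr 9 (i + 1) v)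
    (fun u v => ¬ σ.natArr 9 i u = σ.natArr 9 i v) (fun u v => σ.wtArr 0 u v + Δ i)
    (fun τ hτ v _ => by
      simp [sameLab, hτ.arr 0, hτ.arr 9, hτ.reg 5, hτ.reg 6, hτ.warr 0, hτ.warr 6, h.outer,
        h.inner, h.diam i h.le.le])
  refine ⟨fun W hW hW' => hd.congr (fun u v => ?_) (fun u v huv => ?_) h.mem (fun _ _ => rfl)
    (fun v => Iff.rfl), hq⟩
  · rw [h.base.adj, h.lab_outer, h.lab_outer, Fin.ext_iff]
  · rw [h.lab_inner, h.lab_inner, h.base.wt u v huv.1]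
    split_ifs with hc
    · exact (hW u v (Fin.ext hc)).symm
    · exact (hW' u v fun e => hc (by rw [e])).symm

/-- The pointers of the first forest are saved in array `23`, because the second run of Dijkstra's
algorithm overwrites array `5`. -/
def exitBlock : Cmd := .seq (.allN 30 23 (.const 0) .true (.arr 5 (.const 0) (.reg 30)))
  (flagRow 19 (.and unhitFm (.all 31 (.imp (sameLab 6 (.reg 31) (.reg 30))
    (.nle (.arr 6 (.const 0) (.reg 30)) (.arr 6 (.const 0) (.reg 31)))))))

theorem exitBlock_spec {σ : State} (h : TreeMem G w r D t s N c Δ i R σ) (x : Fin n) :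
    (1 ≤ (exitBlock.den σ).natArr 19 0 x ↔ Unhit (c i) R x ∧
      ∀ v : Fin n, c i v = c i x → σ.natArr 6 0 x ≤ σ.natArr 6 0 v) ∧
    (exitBlock.den σ).natArr 23 0 x = σ.natArr 5 0 x := by
  have h' : TreeMem G w r D t s N c Δ i R
    ((Cmd.allN 30 23 (.const 0) .true (.arr 5 (.const 0) (.reg 30))).den σ) := h.den (by decide)
  have e6 : ((Cmd.allN 30 23 (.const 0) .true (.arr 5 (.const 0) (.reg 30))).den σ).natArr 6 =
    σ.natArr 6 := Cmd.den_natArr _ (by decide) _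
  have e23 : ((Cmd.allN 30 23 (.const 0) .true (.arr 5 (.const 0) (.reg 30))).den σ).natArr 23 0 x =
    σ.natArr 5 0 x := by simp [Cmd.den, h.base.size]
  rw [exitBlock, Cmd.den_seq]
  generalize (Cmd.allN 30 23 (.const 0) .true (.arr 5 (.const 0) (.reg 30))).den σ = σ₁ at *
  refine ⟨?_, by rw [Cmd.den_natArr _ (by decide), e23]⟩
  rw [flagRow_spec (by rw [h'.base.size]; exact x.2)]
  simp [unhitFm, sameLab, Cmd.den, h'.base.size, h'.inner, forall_lt_iff, h'.mem, h'.lab_inner, e6,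
    Unhit, Fin.ext_iff]

def linkBlock : Cmd := sptBlock
  (.or (.and (.nle (.const 1) (.arr 0 (.reg 13) (.reg 30))) (sameLab 6 (.reg 13) (.reg 30)))
    (.and (.nle (.const 1) (.arr 19 (.const 0) (.reg 30)))
      (.neq (.reg 13) (.arr 23 (.const 0) (.reg 30)))))
  .true (.arr 0 (.reg 13) (.reg 30))

/-- The input array holds weights only at edges, so the links from the exits have to be known to be
edges. -/
theorem linkBlock_spec {σ : State} (h : TreeMem G w r D t s N c Δ i R σ) {isx : Fin n → Prop}
    {q₁ : Fin n → Fin n} (hx : ∀ v : Fin n, 1 ≤ σ.natArr 19 0 v ↔ isx v)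
    (hq₁ : ∀ v : Fin n, σ.natArr 23 0 v = q₁ v) (hadj : ∀ x, isx x → G.Adj (q₁ x) x) :
    IsSPT (fun a b => (G.Adj a b ∧ c i a = c i b) ∨ (isx b ∧ a = q₁ b)) (fun a b => w s(a, b)) R
      (fun _ => 0) (fun v => (linkBlock.den σ).natArr 4 0 v = 2)
      (fun v => (linkBlock.den σ).wtArr 4 0 v)
      (toFin n ((linkBlock.den σ).natArr 5 0))
      (fun v => (linkBlock.den σ).natArr 6 0 v)
      (fun v u => 1 ≤ (linkBlock.den σ).natArr 7 v u) ∧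
    ∀ v < n, (linkBlock.den σ).natArr 5 0 v < n := by
  classical
  obtain ⟨hd, hq⟩ := sptBlock_spec (σ := σ) h.base.size
    (φ := .or (.and (.nle (.const 1) (.arr 0 (.reg 13) (.reg 30)))
      (sameLab 6 (.reg 13) (.reg 30))) (.and (.nle (.const 1) (.arr 19 (.const 0) (.reg 30)))
      (.neq (.reg 13) (.arr 23 (.const 0) (.reg 30)))))
    (ψ := .true) (e := .arr 0 (.reg 13) (.reg 30))
    (fun u v => (1 ≤ σ.natArr 0 u v ∧ σ.natArr 9 i u = σ.natArr 9 i v) ∨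
      (1 ≤ σ.natArr 19 0 v ∧ u = σ.natArr 23 0 v))
    (fun u v => True) (fun u v => σ.wtArr 0 u v)
    (fun τ hτ v _ => by
      simp [sameLab, hτ.arr 0, hτ.arr 9, hτ.arr 19, hτ.arr 23, hτ.reg 6, hτ.warr 0, h.inner])
  refine ⟨hd.congr (fun u v => ?_) (fun u v huv => ?_) h.mem (fun _ _ => rfl)
    (fun v => Iff.rfl), hq⟩
  · rw [h.base.adj, h.lab_inner, h.lab_inner, hx, hq₁, Fin.ext_iff, Fin.ext_iff]
  · rw [if_pos trivial]
    rcases huv with huv | ⟨h1, rfl⟩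
    · exact h.base.wt u v huv.1
    · exact h.base.wt _ v (hadj v h1)

end TreeBlock


/-! ### The loop that constructs the tree, and its output. -/

section TreeLoop

set_option linter.unusedSimpArgs false

variable {n : ℕ} {G : SimpleGraph (Fin n)} {w : Sym2 (Fin n) → ℝ≥0} {r : Fin n}
  {D : Fin n → Fin n → ℝ≥0} {t s N i : ℕ} {c : ℕ → Fin n → Fin n} {ρ Δ : ℕ → ℝ≥0}
  {R : Fin n → Prop}

def sizeStep : Cmd := .seq (.count 20 30 (.nle (.const 1) (.arr 7 (.reg 30) (.reg 15))))
  (.allN 30 20 (.const 0) (.neq (.reg 30) (.reg 15)) (.reg 20))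

theorem sizeLoop_spec {σ : State} (hn : σ.natReg 0 = n) (v : Fin n) :
    ((Cmd.forN 15 sizeStep).den σ).natArr 20 0 v = countLT n fun u => 1 ≤ σ.natArr 7 u v := by
  obtain ⟨τ, ⟨-, h⟩, hτ⟩ := Cmd.forN_ind (x := 15) (σ := σ) (c := sizeStep)
    (by norm_num) (by decide) (fun k τ => τ.natArr 7 = σ.natArr 7 ∧
      ∀ v < k, τ.natArr 20 0 v = countLT n fun u => 1 ≤ σ.natArr 7 u v)
    ⟨rfl, fun v hv => absurd hv (Nat.not_lt_zero _)⟩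
    (by
      rintro k hk τ ⟨t1, t2⟩ t0
      rw [hn] at hk t0
      refine ⟨t1, fun v hv => ?_⟩
      rcases Nat.lt_succ_iff_lt_or_eq.1 hv with hv | rfl
      · simp [sizeStep, Cmd.den, hv.ne, t2 v hv]
      · simp [sizeStep, Cmd.den, hk, t0, t1])
  rw [hτ]
  exact h v (by rw [hn]; exact v.2)

def heavyFm : Fm := .and (.nle (.const 1) (.arr 19 (.const 0) (.reg 30)))
  (.all 31 (.imp (.nle (.const 1) (.arr 19 (.const 0) (.reg 31)))
    (.imp (sameLab 6 (.arr 5 (.const 0) (.reg 31)) (.arr 5 (.const 0) (.reg 30)))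
      (.or (.nlt (.arr 20 (.const 0) (.reg 31)) (.arr 20 (.const 0) (.reg 30)))
        (.and (.nle (.arr 20 (.const 0) (.reg 31)) (.arr 20 (.const 0) (.reg 30)))
          (.nle (.reg 30) (.reg 31)))))))

def extendFm : Fm := .or (.nle (.const 1) (.arr 16 (.const 0) (.reg 30)))
  (.and unhitFm (.or (.nle (.const 1) (.arr 19 (.const 0) (.reg 30)))
    (.ex 31 (.and (.nle (.const 1) (.arr 21 (.const 0) (.reg 31)))
      (.and (sameLab 6 (.arr 5 (.const 0) (.reg 31)) (.reg 30))
        (.nle (.const 1) (.arr 7 (.arr 5 (.const 0) (.reg 31)) (.reg 30))))))))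

def selectBlock : Cmd := .seq (.forN 15 sizeStep) (.seq (flagRow 21 heavyFm) (flagRow 22 extendFm))

theorem selectBlock_spec {σ : State} (h : TreeMem G w r D t s N c Δ i R σ) {isx : Fin n → Prop}
    {q₂ : Fin n → Fin n} {anc₂ : Fin n → Fin n → Prop}
    (hx : ∀ v : Fin n, 1 ≤ σ.natArr 19 0 v ↔ isx v) (hq : ∀ v : Fin n, σ.natArr 5 0 v = q₂ v)
    (ha : ∀ v u : Fin n, 1 ≤ σ.natArr 7 v u ↔ anc₂ v u) :
    ∃ (sz : Fin n → ℕ) (heavy : Fin n → Prop),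
      (∀ x : Fin n, sz x = countLT n fun v => ∃ h : v < n, anc₂ ⟨v, h⟩ x) ∧
      (∀ x, heavy x ↔ isx x ∧ ∀ y, isx y → c i (q₂ y) = c i (q₂ x) →
        sz y < sz x ∨ (sz y ≤ sz x ∧ x ≤ y)) ∧
      ∀ v : Fin n, 1 ≤ (selectBlock.den σ).natArr 22 0 v ↔
        extend (c i) R isx heavy q₂ anc₂ v := by
  classical
  have h20 := sizeLoop_spec h.base.size
  have m1 : TreeMem G w r D t s N c Δ i R ((Cmd.forN 15 sizeStep).den σ) := h.den (by decide)
  have e19 : ((Cmd.forN 15 sizeStep).den σ).natArr 19 = σ.natArr 19 := Cmd.den_natArr _ (by decide) _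
  have e5 : ((Cmd.forN 15 sizeStep).den σ).natArr 5 = σ.natArr 5 := Cmd.den_natArr _ (by decide) _
  have e7 : ((Cmd.forN 15 sizeStep).den σ).natArr 7 = σ.natArr 7 := Cmd.den_natArr _ (by decide) _
  rw [selectBlock, Cmd.den_seq, Cmd.den_seq]
  generalize (Cmd.forN 15 sizeStep).den σ = σ₁ at *
  have h21 : ∀ x : Fin n, 1 ≤ ((flagRow 21 heavyFm).den σ₁).natArr 21 0 x ↔
      isx x ∧ ∀ y, isx y → c i (q₂ y) = c i (q₂ x) → σ₁.natArr 20 0 y < σ₁.natArr 20 0 x ∨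
        (σ₁.natArr 20 0 y ≤ σ₁.natArr 20 0 x ∧ x ≤ y) := by
    intro x
    rw [flagRow_spec (by rw [m1.base.size]; exact x.2)]
    simp [heavyFm, sameLab, Cmd.den, m1.base.size, m1.inner, forall_lt_iff, m1.lab_inner, e19, e5,
      hx, hq, Fin.ext_iff]
  have m2 : TreeMem G w r D t s N c Δ i R ((flagRow 21 heavyFm).den σ₁) := m1.den (by decide)
  have f19 : ((flagRow 21 heavyFm).den σ₁).natArr 19 = σ.natArr 19 := by
    rw [Cmd.den_natArr _ (by decide), e19]
  have f5 : ((flagRow 21 heavyFm).den σ₁).natArr 5 = σ.natArr 5 := by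
    rw [Cmd.den_natArr _ (by decide), e5]
  have f7 : ((flagRow 21 heavyFm).den σ₁).natArr 7 = σ.natArr 7 := by
    rw [Cmd.den_natArr _ (by decide), e7]
  generalize (flagRow 21 heavyFm).den σ₁ = σ₂ at *
  refine ⟨fun x => σ₁.natArr 20 0 x, fun x => 1 ≤ σ₂.natArr 21 0 x, fun x => ?_, h21, fun v => ?_⟩
  · simp only [h20]
    rw [countLT_fin, countLT_fin]
    congr 1
    ext v
    simp [ha]
  · rw [flagRow_spec (by rw [m2.base.size]; exact v.2)]
    simp [extendFm, unhitFm, sameLab, Cmd.den, m2.base.size, m2.inner, forall_lt_iff,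
      exists_lt_iff, m2.lab_inner, m2.mem, f19, f5, f7, hx, hq, ha, extend, Unhit, Fin.ext_iff]

/-- Compute the links of one level, and the set of the next level in the array `22`. -/
def stepBlock : Cmd := .seq contractBlock (.seq exitBlock (.seq linkBlock selectBlock))

/-- Any parent function that agrees with the pointers at the new vertices will do, since the final
one is completed only at later levels. -/
theorem stepBlock_spec {κ g : ℝ≥0} {β : ℕ} (hl : Levels G w D r κ g β N c ρ Δ)
    (hD : IsDist G w D) (hβ : 1 ≤ β) (hm : ∀ v, ∃ z, R z ∧ c (i + 1) z = c (i + 1) v)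
    {σ : State} (h : TreeMem G w r D t s N c Δ i R σ) :
    ∃ (R' : Fin n → Prop) (q₂ : Fin n → Fin n),
      (∀ v : Fin n, 1 ≤ (stepBlock.den σ).natArr 22 0 v ↔ R' v) ∧
      (∀ v : Fin n, (stepBlock.den σ).natArr 5 0 v = q₂ v) ∧
      ∀ par : Fin n → Fin n, (∀ u, R' u → ¬ R u → par u = q₂ u) →
        TreeStep G w (c (i + 1)) (c i) R R' par (linkConst κ g β * ρ (i + 1))
          (Nat.log 2 n + 1) := by
  classical
  obtain ⟨hd₁, hq₁⟩ := contractBlock_spec h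
  have m1 : TreeMem G w r D t s N c Δ i R (contractBlock.den σ) := h.den (by decide)
  rw [stepBlock, Cmd.den_seq]
  generalize contractBlock.den σ = σ₁ at *
  have hx := exitBlock_spec m1
  have m2 : TreeMem G w r D t s N c Δ i R (exitBlock.den σ₁) := m1.den (by decide)
  rw [Cmd.den_seq]
  generalize exitBlock.den σ₁ = σ₂ at *
  set q₁ := toFin n (σ₁.natArr 5 0) with hq₁d
  have hreach : ∀ v, ∃ z, R z ∧ ∃ p : G.Walk v z, ∀ x ∈ p.support, c (i + 1) x = c (i + 1) v := by
    intro v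
    obtain ⟨z, hz, hzv⟩ := hm v
    obtain ⟨p, hp, -⟩ := hl.walk (i + 1) h.le v z hzv.symm
    exact ⟨z, hz, p, hp⟩
  -- `LinkData.exit_ptr` is not available yet, as the second forest is still to be computed;
  -- adjacency follows from the first one alone.
  have hadj : ∀ x : Fin n, 1 ≤ σ₂.natArr 19 0 x → G.Adj (q₁ x) x := by
    intro x hx'
    have hu := ((hx x).1.1 hx').1
    have hs := hd₁ (fun a b => if c i a = c i b then 0 else w s(a, b) + Δ i)
      (fun a b hab => if_pos hab) (fun a b hab => if_neg hab)
    obtain ⟨z, hz, p, hp⟩ := hreach x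
    have hP := hs.reach p.reverse (fun a b hab ha hb => ⟨hab, by
      rw [SimpleGraph.Walk.support_reverse, List.mem_reverse] at ha hb
      rw [hp a ha, hp b hb]⟩) (hs.src_mem z hz).1
    rcases hs.ptr x hP with ⟨-, h1, -⟩ | ⟨-, h1, -⟩
    · exact absurd rfl (hu x h1)
    · exact h1.1
  obtain ⟨hd₂, hq₂⟩ := linkBlock_spec m2 (isx := fun x => 1 ≤ σ₂.natArr 19 0 x) (q₁ := q₁)
    (fun v => Iff.rfl) (fun v => by rw [(hx v).2, hq₁d, toFin_coe (hq₁ v v.2)]) hadj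
  have m3 : TreeMem G w r D t s N c Δ i R (linkBlock.den σ₂) := m2.den (by decide)
  have e19 : (linkBlock.den σ₂).natArr 19 = σ₂.natArr 19 := Cmd.den_natArr _ (by decide) _
  rw [Cmd.den_seq]
  generalize linkBlock.den σ₂ = σ₃ at *
  obtain ⟨sz, heavy, hsz, hh, hR'⟩ := selectBlock_spec m3 (isx := fun x => 1 ≤ σ₂.natArr 19 0 x)
    (q₂ := toFin n (σ₃.natArr 5 0)) (anc₂ := fun v u => 1 ≤ σ₃.natArr 7 v u)
    (fun v => by rw [e19]) (fun v => (toFin_coe (hq₂ v v.2)).symm) (fun v u => Iff.rfl)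
  refine ⟨_, toFin n (σ₃.natArr 5 0), hR', fun v => ?_, fun par hpar => ?_⟩
  · rw [Cmd.den_natArr _ (by decide), toFin_coe (hq₂ v v.2)]
  · have hlink : LinkData G w (c (i + 1)) (c i) (Δ i) R _ _ q₁ _ _
        (fun x => 1 ≤ σ₂.natArr 19 0 x) _ _ _ _ _ :=
      ⟨hl.nest i h.le, hl.walk i h.le.le, hd₁, fun x => (hx x).1, hd₂, hreach⟩
    exact hlink.treeStep_of_levels hl hD hβ h.le hm hsz hh hpar

/-- The parents are written while array `16` still holds the old set, so that only the new vertices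
receive one. -/
def storeBlock : Cmd := .seqs [
  .allN 30 17 (.const 0) (.and (.nle (.const 1) (.arr 22 (.const 0) (.reg 30)))
    (.neq (.arr 16 (.const 0) (.reg 30)) (.const 0))) (.arr 5 (.const 0) (.reg 30)),
  .allN 30 16 (.const 0) .true (.arr 22 (.const 0) (.reg 30)),
  .setN 5 (.reg 6)]

def treeStep : Cmd := .ite (.nle (.const 1) (.reg 5))
  (.seq (.setN 6 (.sub (.reg 5) (.const 1))) (.seq stepBlock storeBlock)) (.setN 63 (.const 0))

/-- The invariant of the construction of the tree after `k` steps. -/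
def TreeLoopInv (G : SimpleGraph (Fin n)) (w : Sym2 (Fin n) → ℝ≥0) (r : Fin n)
    (D : Fin n → Fin n → ℝ≥0) (t s N : ℕ) (c : ℕ → Fin n → Fin n) (ρ Δ : ℕ → ℝ≥0) (κ g : ℝ≥0)
    (β k : ℕ) (σ : State) : Prop :=
  LevelMem G w r D t s N c Δ σ ∧ ∃ (R : ℕ → Fin n → Prop) (par : Fin n → Fin n),
    σ.natReg 5 = N - k ∧ (∀ v : Fin n, 1 ≤ σ.natArr 16 0 v ↔ R (N - k) v) ∧
    (∀ v : Fin n, σ.natArr 17 0 v = par v) ∧ (∀ v, R N v ↔ v = r) ∧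
    ∀ j, N - k ≤ j → j < N → TreeStep G w (c (j + 1)) (c j) (R (j + 1)) (R j) par
      (linkConst κ g β * ρ (j + 1)) (Nat.log 2 n + 1)

theorem treeStep_spec {κ g : ℝ≥0} {β k : ℕ} (hl : Levels G w D r κ g β N c ρ Δ)
    (hD : IsDist G w D) (hβ : 1 ≤ β) {σ : State}
    (h : TreeLoopInv G w r D t s N c ρ Δ κ g β k σ) :
    TreeLoopInv G w r D t s N c ρ Δ κ g β (k + 1) (treeStep.den σ) := by
  classical
  obtain ⟨hm, R, par, h5, h16, h17, htop, hstep⟩ := h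
  refine ⟨hm.den (by decide), ?_⟩
  rw [treeStep, Cmd.den]
  have hcond : (Fm.nle (.const 1) (.reg 5)).Holds σ ↔ 1 ≤ N - k := by simp [h5]
  split_ifs with hpos
  all_goals rw [hcond] at hpos
  · obtain ⟨i, hi⟩ : ∃ i, N - k = i + 1 := ⟨N - k - 1, by omega⟩
    have hi' : N - (k + 1) = i := by omega
    rw [hi] at h5 h16 hstep
    rw [hi']
    have m1 : TreeMem G w r D t s N c Δ i (R (i + 1))
        ((Cmd.setN 6 (.sub (.reg 5) (.const 1))).den σ) :=
      ⟨hm.den (by decide), by omega, by simp [Cmd.den, h5], by simp [Cmd.den, h5], h16⟩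
    have e17 : ((Cmd.setN 6 (.sub (.reg 5) (.const 1))).den σ).natArr 17 = σ.natArr 17 := rfl
    rw [Cmd.den_seq]
    generalize (Cmd.setN 6 (.sub (.reg 5) (.const 1))).den σ = σ₁ at *
    have hmeets : ∀ v, ∃ z, R (i + 1) z ∧ c (i + 1) z = c (i + 1) v := by
      intro v
      rcases (show i + 1 ≤ N by omega).lt_or_eq with h' | h'
      · exact (hstep (i + 1) le_rfl h').meets v
      · exact ⟨r, by rw [h', htop], by rw [h']; exact hl.top r v⟩
    -- The sets of the coarser levels lie in the old set, where no parent is changed; so the steps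
    -- already made remain valid by `TreeStep.congr`.
    have hmono : ∀ j, i + 1 ≤ j → j ≤ N → ∀ v, R j v → R (i + 1) v := by
      intro j hj
      induction j, hj using Nat.le_induction with
      | base => exact fun _ _ h => h
      | succ j hj ih => exact fun hN v hv => ih (by omega) v ((hstep j hj (by omega)).sub v hv)
    obtain ⟨R', q₂, hR', hq₂, hts⟩ := stepBlock_spec hl hD hβ hmeets m1
    have m2 : TreeMem G w r D t s N c Δ i (R (i + 1)) (stepBlock.den σ₁) := m1.den (by decide)
    have f17 : (stepBlock.den σ₁).natArr 17 = σ.natArr 17 := by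
      rw [Cmd.den_natArr _ (by decide), e17]
    rw [Cmd.den_seq]
    generalize stepBlock.den σ₁ = σ₂ at *
    have h0 : ∀ v : Fin n, σ₂.natArr 16 0 v = 0 ↔ ¬ R (i + 1) v := fun v => by
      rw [← m2.mem]; omega
    refine ⟨fun j => if j = i then R' else R j, fun v => if R' v ∧ ¬ R (i + 1) v then q₂ v else par v,
      ?_, fun v => ?_, fun v => ?_, fun v => ?_, fun j hj hjN => ?_⟩
    · simp [storeBlock, Cmd.seqs, Cmd.den, m2.inner]
    · simp [storeBlock, Cmd.seqs, Cmd.den, m2.base.size, hR']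
    · simp only [storeBlock, Cmd.seqs, Cmd.den]
      by_cases hc : R' v ∧ ¬ R (i + 1) v
      · simp [m2.base.size, hR', h0, hc, hq₂]
      · simp [m2.base.size, hR', h0, hc, hq₂, f17, h17]
    · beta_reduce
      rw [if_neg (by omega), htop]
    · beta_reduce
      rw [if_neg (show j + 1 ≠ i by omega)]
      split_ifs with hji
      · subst hji
        exact hts _ fun u h1 h2 => if_pos ⟨h1, h2⟩
      · refine (hstep j (by omega) hjN).congr fun u h1 h2 => if_neg fun h' => h'.2 ?_
        exact hmono j (by omega) hjN.le u h1
  · have hk : N - (k + 1) = N - k := by omega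
    rw [hk]
    refine ⟨R, par, ?_, h16, h17, htop, hstep⟩
    simp [Cmd.den, h5]

def treeInit : Cmd := .seq (.setN 5 (.reg 4)) (.seq (flagRow 16 (.neq (.reg 30) (.reg 1)))
  (.allN 30 17 (.const 0) .true (.reg 30)))

/-- Compute the parents of the vertices in the array `17`. -/
def treeBlock : Cmd := .seq treeInit (.seq (.forN 22 (.forN 23 treeStep)) treeStep)

/-- There can be `n ^ 2 + 1` levels, one more than the rounds of the double loop, hence the extra
call of `treeStep`. Classes of level `0` are single vertices and all are met, so every vertex has
been reached. -/
theorem treeBlock_spec {κ g : ℝ≥0} {β : ℕ} (hl : Levels G w D r κ g β N c ρ Δ)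
    (hD : IsDist G w D) (hβ : 1 ≤ β) (hN : N ≤ n * n + 1) {σ : State}
    (h : LevelMem G w r D t s N c Δ σ) :
    Base G w r (treeBlock.den σ) ∧ ∃ (R : ℕ → Fin n → Prop) (par : Fin n → Fin n),
      (∀ v : Fin n, (treeBlock.den σ).natArr 17 0 v = par v) ∧
      TreeSteps G w r κ g β (Nat.log 2 n + 1) N c ρ R par := by
  refine ⟨h.base.den (by decide), ?_⟩
  have h0 : TreeLoopInv G w r D t s N c ρ Δ κ g β 0 (treeInit.den σ) := by
    refine ⟨h.den (by decide), fun _ v => v = r, id, ?_, fun v => ?_, fun v => ?_, fun v => Iff.rfl,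
      fun j hj hj' => absurd hj' (by omega)⟩
    · simp [treeInit, flagRow, Cmd.den, h.level]
    · have m1 : LevelMem G w r D t s N c Δ ((Cmd.setN 5 (.reg 4)).den σ) := h.den (by decide)
      rw [treeInit, Cmd.den_seq, Cmd.den_seq, Cmd.den_natArr _ (by decide),
        flagRow_spec (by rw [m1.base.size]; exact v.2)]
      have := h.base.root
      simp [Cmd.den, Fin.ext_iff, this]
    · have m1 : LevelMem G w r D t s N c Δ ((flagRow 16 (.neq (.reg 30) (.reg 1))).den
        ((Cmd.setN 5 (.reg 4)).den σ)) := (h.den (by decide)).den (by decide)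
      rw [treeInit, Cmd.den_seq, Cmd.den_seq]
      generalize (flagRow 16 (.neq (.reg 30) (.reg 1))).den ((Cmd.setN 5 (.reg 4)).den σ) = σ₁ at *
      simp [Cmd.den, m1.base.size]
  have e0 : (treeInit.den σ).natReg 0 = n := by rw [Cmd.den_natReg _ (by decide), h.base.size]
  have key := Cmd.forN_forN_ind (x := 22) (y := 23) (c := treeStep) (by norm_num) (by norm_num)
    (by decide) (TreeLoopInv G w r D t s N c ρ Δ κ g β) h0
    (fun k τ i ⟨hm, h⟩ => ⟨⟨hm.setN (by norm_num) _, h⟩, ⟨hm.setN (by norm_num) _, h⟩⟩)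
    (fun k τ hτ _ => treeStep_spec hl hD hβ hτ)
  rw [e0] at key
  obtain ⟨-, R, par, -, -, h17, htop, hstep⟩ := treeStep_spec hl hD hβ key
  have hN0 : N - (n * n + 1) = 0 := by omega
  rw [hN0] at hstep
  refine ⟨R, par, h17, fun v => ?_, htop, fun i hi => hstep i (Nat.zero_le _) hi⟩
  rcases Nat.eq_zero_or_pos N with h' | h'
  · have : v = r := hl.bot v r (by have := hl.top v r; rwa [h'] at this)
    have h2 := htop v
    rw [h'] at h2
    exact h2.2 this
  · obtain ⟨z, hz, hzv⟩ := (hstep 0 le_rfl h').meets v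
    rwa [← hl.bot z v hzv]

/-- Write the adjacency matrix of the tree to the array `1`. -/
def outputBlock : Cmd := fillMask 1 (.and (.not (.neq (.reg 13) (.reg 30)))
  (.or (.and (.not (.neq (.reg 13) (.reg 1))) (.neq (.arr 17 (.const 0) (.reg 13)) (.reg 30)))
    (.and (.not (.neq (.reg 30) (.reg 1))) (.neq (.arr 17 (.const 0) (.reg 30)) (.reg 13)))))

theorem outputBlock_spec {σ : State} (h : Base G w r σ) {par : Fin n → Fin n}
    (hp : ∀ v : Fin n, σ.natArr 17 0 v = par v) : Outputs (outputBlock.den σ) (parentTree r par) := by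
  have h1 := fillMask_spec (a := 1) (φ := .and (.not (.neq (.reg 13) (.reg 30)))
    (.or (.and (.not (.neq (.reg 13) (.reg 1))) (.neq (.arr 17 (.const 0) (.reg 13)) (.reg 30)))
    (.and (.not (.neq (.reg 30) (.reg 1))) (.neq (.arr 17 (.const 0) (.reg 30)) (.reg 13)))))
    (σ := σ) (fun u v => u ≠ v ∧ ((u ≠ σ.natReg 1 ∧ σ.natArr 17 0 u = v) ∨
      (v ≠ σ.natReg 1 ∧ σ.natArr 17 0 v = u))) (fun τ hτ _ v _ => by
        simp [hτ.arr 17, hτ.reg 1])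
  intro u v
  have h2 := h1 u (by rw [h.size]; exact u.2) v (by rw [h.size]; exact v.2)
  rw [← Nat.one_le_iff_ne_zero]
  rw [outputBlock, h2, h.root, hp, hp]
  simp [parentTree, Fin.ext_iff]

end TreeLoop


/-! ### The parameters and the numerical bounds. -/

/-- One step of the computation of the parameters: the register `20` holds a power of two below
twice the size, and the register `2` the square root of its exponent, rounded up. -/
def paramStep : Cmd := .ite (.nlt (.reg 20) (.reg 0))
  (.seq (.setN 20 (.add (.reg 20) (.reg 20)))
    (.ite (.nle (.reg 21) (.const 0))
      (.seq (.setN 21 (.add (.reg 2) (.reg 2)))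
        (.seq (.setN 2 (.add (.reg 2) (.const 1))) (.setN 3 (.add (.reg 3) (.reg 3)))))
      (.setN 21 (.sub (.reg 21) (.const 1)))))
  (.setN 63 (.const 0))

/-- Compute the parameters of the construction in the registers `2` and `3`. -/
def paramBlock : Cmd :=
  .seq (.setN 20 (.const 1)) (.seq (.setN 21 (.const 0)) (.seq (.setN 2 (.const 0))
    (.seq (.setN 3 (.const 1)) (.forN 22 paramStep))))

/-- The numbers `l` and `t` are `log₂ n` and its square root, rounded up. -/
structure Params (n l t : ℕ) : Prop where
  le_sq : l ≤ t ^ 2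
  lt_of_ne : t ≠ 0 → (t - 1) ^ 2 < l
  le_pow : n ≤ 2 ^ l
  pow_lt : l ≠ 0 → 2 ^ (l - 1) < n

theorem paramBlock_spec {n : ℕ} {σ : State} (h : σ.natReg 0 = n) :
    ∃ l t, Params n l t ∧ (paramBlock.den σ).natReg 2 = t ∧
      (paramBlock.den σ).natReg 3 = 2 ^ t := by
  rw [paramBlock]
  simp only [Cmd.den_seq]
  set υ := (Cmd.setN 3 (.const 1)).den ((Cmd.setN 2 (.const 0)).den
    ((Cmd.setN 21 (.const 0)).den ((Cmd.setN 20 (.const 1)).den σ))) with hυ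
  have hn : υ.natReg 0 = n := by simp [hυ, Cmd.den, h]
  -- Register `21` counts how far the exponent `l` is from the next square: `l + reg21 = t ^ 2`. At
  -- `0` the root `t` is raised and the register is set to `2 * t`, since `t ^ 2 + 1 + 2 * t = (t +
  -- 1) ^ 2`.
  obtain ⟨τ, ⟨l, t, h20, h21, h2, h3, hsq, hpow, hk⟩, hτ⟩ := Cmd.forN_ind (x := 22) (σ := υ)
    (c := paramStep) (by norm_num) (by decide)
    (fun k τ => ∃ l t, τ.natReg 20 = 2 ^ l ∧ l + τ.natReg 21 = t ^ 2 ∧ τ.natReg 2 = t ∧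
      τ.natReg 3 = 2 ^ t ∧ (t ≠ 0 → (t - 1) ^ 2 < l) ∧ (l ≠ 0 → 2 ^ (l - 1) < n) ∧
      (n ≤ 2 ^ l ∨ k ≤ l))
    ⟨0, 0, by simp [hυ, Cmd.den]⟩
    (by
      rintro i hi τ ⟨l, t, h20, h21, h2, h3, hsq, hpow, hk⟩ h0
      rw [hn] at h0
      by_cases hlt : 2 ^ l < n
      · have hk' : i ≤ l := hk.resolve_left (by omega)
        by_cases hz : τ.natReg 21 = 0
        · refine ⟨l + 1, t + 1, ?_, ?_, ?_, ?_, fun _ => ?_, fun _ => by simpa using hlt,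
            Or.inr (by omega)⟩
          · simp [paramStep, Cmd.den, h20, h0, hlt, hz, h2, h3, pow_succ]; omega
          · simp [paramStep, Cmd.den, h20, h0, hlt, hz, h2, h3]
            rw [hz] at h21; nlinarith
          · simp [paramStep, Cmd.den, h20, h0, hlt, hz, h2, h3]
          · simp [paramStep, Cmd.den, h20, h0, hlt, hz, h2, h3, pow_succ]; omega
          · rw [hz] at h21; simp; omega
        · refine ⟨l + 1, t, ?_, ?_, ?_, ?_, fun h => ?_, fun _ => by simpa using hlt,
            Or.inr (by omega)⟩
          · simp [paramStep, Cmd.den, h20, h0, hlt, hz, pow_succ]; omega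
          · simp [paramStep, Cmd.den, h20, h0, hlt, hz]; omega
          · simp [paramStep, Cmd.den, h20, h0, hlt, hz, h2]
          · simp [paramStep, Cmd.den, h20, h0, hlt, hz, h3]
          · have := hsq h; omega
      · refine ⟨l, t, ?_, ?_, ?_, ?_, hsq, hpow, Or.inl (by omega)⟩ <;>
          simp [paramStep, Cmd.den, h20, h0, hlt, h2, h3, h21])
  rw [hn] at hτ hk
  have hle : n ≤ 2 ^ l := hk.elim id fun h => h.trans l.lt_two_pow_self.le
  exact ⟨l, t, ⟨by omega, hsq, hle, hpow⟩, by rw [hτ]; simp [h2], by rw [hτ]; simp [h3]⟩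

variable {n l t : ℕ}

/-- The chain is `t - 1 ≤ (t - 1) ^ 2 ≤ l - 1 < 2 ^ (l - 1) < n`. It is needed because nets and
powers are computed in loops of length `n`. -/
theorem Params.lt (h : Params n l t) (hn : 0 < n) : t < n := by
  rcases Nat.eq_zero_or_pos t with rfl | ht
  · exact hn
  · have h1 := h.lt_of_ne ht.ne'
    have h2 := h.pow_lt (by omega)
    have h3 := (l - 1).lt_two_pow_self
    have h4 : t - 1 ≤ (t - 1) ^ 2 := Nat.le_self_pow (by norm_num) _
    omega

theorem sq_add_two_le (t : ℕ) : t ^ 2 + 2 ≤ 2 ^ (2 + t) := by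
  induction t with
  | zero => norm_num
  | succ t ih =>
    have := t.lt_two_pow_self
    have e : 2 ^ (2 + (t + 1)) = 2 ^ (2 + t) + 4 * 2 ^ t := by ring
    rw [e]
    nlinarith

theorem Params.add_two_le (h : Params n l t) : l + 2 ≤ 2 ^ (2 + t) :=
  (Nat.add_le_add_right h.le_sq 2).trans (sq_add_two_le t)

theorem Params.le_branching_pow (h : Params n l t) : n ≤ (2 ^ t) ^ t := by
  rw [← pow_mul, ← sq]
  exact h.le_pow.trans (Nat.pow_le_pow_right (by norm_num) h.le_sq)

/-- This is where the exponent of `g` comes from: `(l + 1) * (l + 2) ≤ 2 ^ (4 + 2 * t)`, and the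
remaining factor is `64 * 8 ^ t = 2 ^ (6 + 3 * t)`. -/
theorem Params.gap (h : Params n l t) :
    (2 * (l + 1) * (l + 2) * (32 * 8 ^ t) : ℝ≥0) ≤ 2 ^ (10 + 5 * t) := by
  have h1 := h.add_two_le
  have h2 : (l + 1) * (l + 2) ≤ 2 ^ (2 + t) * 2 ^ (2 + t) := Nat.mul_le_mul (by omega) h1
  have h3 : 2 * (l + 1) * (l + 2) * (32 * 8 ^ t) ≤ 2 ^ (10 + 5 * t) := by
    calc 2 * (l + 1) * (l + 2) * (32 * 8 ^ t) = (l + 1) * (l + 2) * (64 * 8 ^ t) := by ring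
      _ ≤ 2 ^ (2 + t) * 2 ^ (2 + t) * (64 * 8 ^ t) := Nat.mul_le_mul_right _ h2
      _ = 2 ^ (10 + 5 * t) := by
        rw [show (8 : ℕ) ^ t = 2 ^ (3 * t) by rw [pow_mul]; norm_num]; ring
  exact_mod_cast h3

theorem Params.link_gap (h : Params n l t) :
    (2 * ((Nat.log 2 n + 1 : ℕ) + 1) : ℝ≥0) ≤ 2 ^ (10 + 5 * t) := by
  have h1 : Nat.log 2 n ≤ l := (Nat.log_mono_right h.le_pow).trans (by simp)
  have h2 := h.add_two_le
  have h3 : 2 * ((Nat.log 2 n + 1) + 1) ≤ 2 ^ (10 + 5 * t) := by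
    calc 2 * ((Nat.log 2 n + 1) + 1) ≤ 2 * 2 ^ (2 + t) := by omega
      _ = 2 ^ (3 + t) := by ring
      _ ≤ _ := Nat.pow_le_pow_right (by norm_num) (by omega)
  exact_mod_cast h3

/-- The dominant term is `κ ^ 2 * g * β`, of exponent `2 * (5 + 3 * t) + (10 + 5 * t) + (1 + 2 *
t)`; the other summands are absorbed generously. -/
theorem Params.linkConst_le (t : ℕ) :
    linkConst (32 * 8 ^ t) (2 ^ (10 + 5 * t)) (1 + (t + 1) * 2 ^ t) ≤ 2 ^ (24 + 13 * t) := by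
  have hκ : (32 * 8 ^ t : ℝ≥0) = 2 ^ (5 + 3 * t) := by
    rw [pow_add, pow_mul]; norm_num
  have hβ : ((1 + (t + 1) * 2 ^ t : ℕ) : ℝ≥0) ≤ 2 ^ (1 + 2 * t) := by
    have h1 : (t + 1) * 2 ^ t ≤ 2 ^ t * 2 ^ t := Nat.mul_le_mul_right _ t.lt_two_pow_self
    have h2 : 1 + (t + 1) * 2 ^ t ≤ 2 ^ (1 + 2 * t) := by
      have h3 : 1 ≤ 2 ^ t * 2 ^ t := Nat.mul_pos (by positivity) (by positivity)
      calc _ ≤ 2 * (2 ^ t * 2 ^ t) := by omega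
        _ = _ := by ring
    exact_mod_cast h2
  rw [linkConst, hκ]
  set b : ℝ≥0 := ((1 + (t + 1) * 2 ^ t : ℕ) : ℝ≥0)
  have one : ∀ k : ℕ, (1 : ℝ≥0) ≤ 2 ^ k := fun k => one_le_pow₀ (by norm_num)
  have mono : ∀ {a b : ℕ}, a ≤ b → (2 : ℝ≥0) ^ a ≤ 2 ^ b := fun h =>
    pow_le_pow_right₀ (by norm_num) h
  calc (2 : ℝ≥0) ^ (5 + 3 * t) * 2 ^ (10 + 5 * t) +
        2 ^ (5 + 3 * t) * b * (2 ^ (5 + 3 * t) * 2 ^ (10 + 5 * t) + 1) + 2 ^ (5 + 3 * t)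
      ≤ 2 ^ (5 + 3 * t) * 2 ^ (10 + 5 * t) + 2 ^ (5 + 3 * t) * 2 ^ (1 + 2 * t) *
        (2 ^ (5 + 3 * t) * 2 ^ (10 + 5 * t) + 2 ^ (15 + 8 * t)) + 2 ^ (5 + 3 * t) := by
        gcongr; exact one _
    _ = 2 ^ (15 + 8 * t) + 2 ^ (22 + 13 * t) + 2 ^ (5 + 3 * t) := by ring
    _ ≤ 2 ^ (22 + 13 * t) + 2 ^ (22 + 13 * t) + 2 * 2 ^ (22 + 13 * t) :=
        add_le_add (add_le_add (mono (by omega)) le_rfl)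
          ((mono (by omega)).trans (le_mul_of_one_le_left zero_le (by norm_num)))
    _ = 2 ^ (24 + 13 * t) := by ring

theorem Params.bound (h : Params n l t) :
    2 * linkConst (32 * 8 ^ t) (2 ^ (10 + 5 * t)) (1 + (t + 1) * 2 ^ t) *
      (l * (4 * (1 + (t + 1) * 2 ^ t : ℕ)) + 2) ≤ 2 ^ (32 + 16 * t) := by
  have h1 := h.add_two_le
  have h2 : l * (4 * (1 + (t + 1) * 2 ^ t)) + 2 ≤ 2 ^ (6 + 3 * t) := by
    have h3 : (t + 1) * 2 ^ t ≤ 2 ^ t * 2 ^ t := Nat.mul_le_mul_right _ t.lt_two_pow_self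
    have h4 : 1 ≤ 2 ^ t * 2 ^ t := Nat.mul_pos (by positivity) (by positivity)
    have h5 : 4 * (1 + (t + 1) * 2 ^ t) ≤ 8 * (2 ^ t * 2 ^ t) := by omega
    calc l * (4 * (1 + (t + 1) * 2 ^ t)) + 2 ≤ (l + 2) * (8 * (2 ^ t * 2 ^ t)) := by
          have := Nat.mul_le_mul_left l h5
          rw [add_mul l 2]; omega
      _ ≤ 2 ^ (2 + t) * (8 * (2 ^ t * 2 ^ t)) := Nat.mul_le_mul_right _ h1
      _ = 2 ^ (5 + 3 * t) := by ring
      _ ≤ _ := Nat.pow_le_pow_right (by norm_num) (by omega)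
  have h2' : (l * (4 * (1 + (t + 1) * 2 ^ t : ℕ)) + 2 : ℝ≥0) ≤ 2 ^ (6 + 3 * t) := by
    exact_mod_cast h2
  refine (mul_le_mul' (mul_le_mul' le_rfl (Params.linkConst_le t)) h2').trans ?_
  have e : (2 * 2 ^ (24 + 13 * t) * 2 ^ (6 + 3 * t) : ℝ≥0) = 2 ^ (31 + 16 * t) := by ring
  rw [e]
  exact pow_le_pow_right₀ (by norm_num) (by omega)

/-- Here `t ≤ 1 + √(log₂ n)`, and `√(log₂ n) ≥ 1` for `n ≥ 2`, so that `48 + 16 * √(log₂ n) ≤ 64 *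
√(log₂ n)`. -/
theorem Params.le_sqrt (h : Params n l t) (hn : 2 ≤ n) :
    (32 + 16 * t : ℝ) ≤ 64 * √(Real.logb 2 n) := by
  have h0 : (1 : ℝ) ≤ Real.logb 2 n := by
    rw [Real.le_logb_iff_rpow_le (by norm_num) (by positivity)]
    simpa using (by exact_mod_cast hn : (2 : ℝ) ≤ n)
  have h1 : 1 ≤ √(Real.logb 2 n) := Real.one_le_sqrt.2 h0
  have h2 : (t : ℝ) - 1 ≤ √(Real.logb 2 n) := by
    rcases Nat.eq_zero_or_pos t with rfl | ht
    · simp; linarith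
    · have h3 := h.lt_of_ne ht.ne'
      have h4 := h.pow_lt (by omega)
      refine Real.le_sqrt_of_sq_le ?_
      have h5 : ((l - 1 : ℕ) : ℝ) ≤ Real.logb 2 n := by
        rw [Real.le_logb_iff_rpow_le (by norm_num) (by positivity), Real.rpow_natCast]
        exact_mod_cast h4.le
      have h6 : (t - 1) ^ 2 ≤ l - 1 := by omega
      have h7 : (((t - 1) ^ 2 : ℕ) : ℝ) ≤ ((l - 1 : ℕ) : ℝ) := by exact_mod_cast h6
      rw [Nat.cast_pow, Nat.cast_sub ht, Nat.cast_one] at h7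
      exact h7.trans h5
  linarith


/-! ### The whole algorithm and its correctness. -/

variable {n : ℕ} {G : SimpleGraph (Fin n)} {w : Sym2 (Fin n) → ℝ≥0} {r : Fin n}

/-- The whole algorithm. -/
def steinerTreeCmd : Cmd :=
  .seq apsp (.seq paramBlock (.seq levelBlock (.seq treeBlock outputBlock)))

theorem base_input : Base G w r (input G w r) := by
  classical
  refine ⟨by simp [input], by simp [input], fun u v => ?_, fun u v huv => ?_⟩
  · have : (∃ u' v' : Fin n, (u' : ℕ) = u ∧ (v' : ℕ) = v ∧ G.Adj u' v') ↔ G.Adj u v :=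
      ⟨fun ⟨u', v', hu, hv, h⟩ => by rwa [← Fin.ext hu, ← Fin.ext hv],
        fun h => ⟨u, v, rfl, rfl, h⟩⟩
    by_cases h : G.Adj u v
    · exact iff_of_true (if_pos ⟨rfl, this.2 h⟩).ge h
    · exact iff_of_false (by
        rw [show (input G w r).natArr 0 u v = 0 from if_neg fun h' => h (this.1 h'.2)]
        norm_num) h
  · simp [input, huv]

theorem stretch_eq_zero_of_subsingleton [Subsingleton (Fin n)] (T : SimpleGraph (Fin n)) :
    stretch G w r T = 0 := by
  classical
  refine le_antisymm (iSup_le fun X => iSup_le fun S => iSup_le fun _ => ?_) zero_le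
  have : cost w S = 0 := by
    refine Finset.sum_eq_zero fun e he => ?_
    rw [Finset.mem_filter] at he
    induction e with
    | _ u v =>
      refine absurd (S.adj_sub he.2) ?_
      rw [Subsingleton.elim u v]
      exact T.loopless.irrefl v
  simp [this]

theorem steinerTreeCmd_spec (hG : G.Connected) : ∃ T : SimpleGraph (Fin n),
    Outputs (steinerTreeCmd.den (input G w r)) T ∧ IsSpanningTree G T ∧
    stretch G w r T ≤ ENNReal.ofReal (2 ^ (64 * √(Real.logb 2 n))) := by
  have hpos : 0 < n := r.pos
  have hb : Base G w r (input G w r) := base_input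
  have hD := apsp_spec hb hG
  have b1 : Base G w r (apsp.den (input G w r)) := hb.den (by decide)
  rw [steinerTreeCmd, Cmd.den_seq, Cmd.den_seq]
  generalize apsp.den (input G w r) = σ₁ at *
  obtain ⟨l, t, hp, h2, h3⟩ := paramBlock_spec b1.size
  have b2 : Base G w r (paramBlock.den σ₁) := b1.den (by decide)
  have e1 : (paramBlock.den σ₁).wtArr 1 = σ₁.wtArr 1 := Cmd.den_wtArr _ (by decide) _
  rw [← e1] at hD
  generalize paramBlock.den σ₁ = σ₂ at *
  rw [Cmd.den_seq, Cmd.den_seq]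
  obtain ⟨N, c, ρ, Δ, hm, hN, hl⟩ := levelBlock_spec hD Nat.one_le_two_pow hp.le_branching_pow
    (hp.lt hpos) hp.le_pow hp.gap b2 (fun _ _ => rfl) h2 h3
  obtain ⟨b3, R, par, h17, hts⟩ := treeBlock_spec hl hD (by omega) hN hm
  refine ⟨_, outputBlock_spec b3 h17, ?_⟩
  obtain ⟨hT, hS⟩ := hts.stretch_le hl hD hp.link_gap (by simpa using hp.le_pow) (by positivity)
  refine ⟨hT, ?_⟩
  -- For a single vertex the claimed bound is `1`, too small for the general estimate, but there are
  -- no edges at all.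
  rcases Nat.lt_or_ge 1 n with h1 | h1
  · refine hS.trans ?_
    rw [← ENNReal.ofReal_coe_nnreal]
    refine ENNReal.ofReal_le_ofReal ?_
    calc _ ≤ ((2 ^ (32 + 16 * t) : ℝ≥0) : ℝ) := NNReal.coe_le_coe.2 hp.bound
      _ = (2 : ℝ) ^ ((32 + 16 * t : ℕ) : ℝ) := by rw [Real.rpow_natCast]; push_cast; rfl
      _ ≤ _ := Real.rpow_le_rpow_of_exponent_le (by norm_num) (by
        push_cast; exact hp.le_sqrt h1)
  · have : Subsingleton (Fin n) := Fin.subsingleton_iff_le_one.2 h1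
    rw [stretch_eq_zero_of_subsingleton]
    exact zero_le

end UST

theorem mainTheorem1 :
    ∃ (P : UST.Program) (p : Polynomial ℕ) (C : ℝ),
      ∀ (n : ℕ) (G : SimpleGraph (Fin n)) (w : Sym2 (Fin n) → ℝ≥0) (r : Fin n), G.Connected →
        ∃ (t : ℕ) (σ : UST.State) (T : SimpleGraph (Fin n)),
          t ≤ p.eval n ∧ UST.Runs P (UST.input G w r) t σ ∧ UST.Outputs σ T ∧
          UST.IsSpanningTree G T ∧
          UST.stretch G w r T ≤ ENNReal.ofReal (2 ^ (C * √(Real.logb 2 n))) := by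
  refine ⟨UST.steinerTreeCmd.comp, UST.steinerTreeCmd.cost, 64, fun n G w r hG => ?_⟩
  obtain ⟨T, hO, hT, hS⟩ := UST.steinerTreeCmd_spec (w := w) (r := r) hG
  obtain ⟨t, σ, hr, ht, hσ⟩ := UST.Cmd.comp_runs UST.steinerTreeCmd (by decide)
    (UST.Eqv.refl (UST.input G w r))
  refine ⟨t, σ, T, ?_, hr, fun u v => ?_, hT, hS⟩
  · rwa [UST.base_input.size] at ht
  · rw [← hσ.natArr 1 (by norm_num)]
    exact hO u v
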